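/- Conventions. Manifolds are smooth. $L^w$ denotes the bundle of densities of weight $w$, $L=L^1$; a conformal structure $\mathsf c$ is an $L^2$-valued metric, and $\xi$ denotes a weightless unit vector field ($\xi\in L^{-1}TM$) as well as the dual weightless $1$-form. A Weyl derivative $D$ is a covariant derivative on $L$, with curvature (Faraday curvature) $F^D$; on a conformal manifold it induces a unique torsion-free connection $D$ on the tangent bundle with $D\mathsf c=0$. A Weyl structure $(\mathsf c_B,D^B)$ on a $3$-manifold $B$ is Einstein-Weyl if the symmetric tracefree part of the Ricci tensor of $D^B$ vanishes; $F^B$ is its Faraday curvature and $\mathrm{scal}^B\in L_B^{-2}$ its scalar curvature. Star operators are normalized by $*1=\mathrm{vol}$ and $\iota_X{*\alpha}=*(\langle X,\cdot\rangle\wedge\alpha)$, so $*(e_1\wedge e_2)=\mathrm{vol}(e_2,e_1,\cdots)$ for an oriented orthonormal frame. If $\pi\colon M\to B$ is a submersion of a $4$-manifold onto an open subset of an oriented $3$-manifold, with fibres oriented by $\xi$, then $M$ is oriented by $\pi^*\mathrm{vol}_B\wedge\xi$. For a conformal submersion with vertical unit field $\xi$ on an oriented conformal $4$-manifold, $D^0$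 denotes the minimal Weyl derivative, i.e. the unique Weyl derivative with $D^0_\xi\xi=0$ and $\mathrm{tr}\,D^0\xi=0$. The submersion is selfdual if $F^{D^0}$ is selfdual. If $g$ is a compatible Einstein metric with nonzero scalar curvature and Levi-Civita derivative $D^g$, the submersion is Legendrian if the skew part of $(D^0\otimes D^g)\xi$ ($D^0$ acting on $L^{-1}$, $D^g$ on $TM$) is selfdual. A metric is selfdual if the antiselfdual part of its Weyl curvature vanishes. Theorem. Let $B$ be an oriented $3$-manifold. (1) Let $(\mathsf c_B,D^B)$ be an Einstein-Weyl structure on $B$, let $M$ be a $4$-manifold with a submersion $\pi\colon M\to B$ onto an open subset, and let $\mu_t$ be a nowhere zero section of $\pi^*L_B$ whose derivative along the fibres is nowhere zero. Suppose that $\varepsilon(1-\tfrac16\mu_t^2\mathrm{scal}^B)>0$ on $M$, where $\varepsilon\in\{1,-1\}$, and set $$g=\bigl(1-\tfrac16\mu_t^2\mathrm{scal}^B\bigr)\mu_t^{-2}\pi^*\mathsf c_B+\bigl(1-\tfrac16\mu_t^2\mathrm{scal}^B\bigr)^{-1}\bigl(\mu_t^{-1}D^B\mu_t-\tfrac12\mu_t{*_B}F^B\bigr)^2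 .$$ Orient the fibres so that $\mu_t$ increases along them if $\varepsilon=1$ and decreases if $\varepsilon=-1$. Then $\varepsilon g$ is a selfdual Einstein Riemannian metric on $M$, its Ricci tensor is $-3\varepsilon$ times the metric $\varepsilon g$ (so its scalar curvature is $-12\varepsilon\neq0$), and $\pi$ is a Legendrian selfdual conformal submersion over $(B,\mathsf c_B)$. (2) $\mathsf c_B$ is the conformal infinity at $\mu_t=0$: if, on a $4$-manifold with a submersion $\pi$ to $B$, a section $\mu_t=t\mu_B$ of $\pi^*L_B$ (with $\mu_B$ any positive section of $L_B$) is allowed to vanish, its derivative along the fibres is nowhere zero, and $1-\tfrac16\mu_t^2\mathrm{scal}^B>0$, then the metric $t^2g$ on $\{t\neq0\}$ extends to a smooth Riemannian metric which induces $\mu_B^{-2}\pi^*\mathsf c_B$ on the hypersurface $\{t=0\}$. (3) Conversely, let $g$ be a selfdual Einstein metric with nonzero scalar curvature $s$ on a $4$-manifold $M$, and let $\pi\colon M\to B$ be a surjective Legendrian selfdual conformal submersion over a conformal manifold $(B,\mathsf c_B)$, with connected oriented fibres, $M$ being oriented as above. Then there are a Weyl derivative $D^B$ such that $(\mathsf c_B,D^B)$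 is Einstein-Weyl and a smooth section $\nu$ of $\pi^*L_B^{-1}$, strictly increasing along the fibres if $s>0$ and strictly decreasing if $s<0$, to first order everywhere, such that $\{\nu\neq0\}$ is dense and, with $\mu_t=\nu^{-1}$, on $\{\nu\ne0\}$ $$g=-\tfrac{12}{s}\Bigl(\bigl(1-\tfrac16\mu_t^2\mathrm{scal}^B\bigr)\mu_t^{-2}\pi^*\mathsf c_B+\bigl(1-\tfrac16\mu_t^2\mathrm{scal}^B\bigr)^{-1}\bigl(\mu_t^{-1}D^B\mu_t-\tfrac12\mu_t{*_B}F^B\bigr)^2\Bigr).$$ -/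

import Mathlib

open Bundle FiberBundle VectorField
open scoped Manifold ContDiff Topology

noncomputable section

namespace HitchinLeBrun

/-- Smooth Riemannian metrics on an `n`-manifold. -/
abbrev Metric (n : ℕ) (M : Type*) [TopologicalSpace M] [ChartedSpace (EuclideanSpace ℝ (Fin n)) M]
    [IsManifold (𝓡 n) ∞ M] :=
  ContMDiffRiemannianMetric (𝓡 n) ∞ (EuclideanSpace ℝ (Fin n))
    (fun x : M => TangentSpace (𝓡 n) x)

/-- Affine connections on an `n`-manifold. For a connection `D`, the vector `D Y x u` is the
covariant derivative `D_u Y` at `x`. -/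
abbrev Connection (n : ℕ) (M : Type*) [TopologicalSpace M]
    [ChartedSpace (EuclideanSpace ℝ (Fin n)) M] [IsManifold (𝓡 n) ∞ M] :=
  CovariantDerivative (𝓡 n) (EuclideanSpace ℝ (Fin n)) (fun x : M => TangentSpace (𝓡 n) x)

section General

variable {n : ℕ} {M : Type*} [TopologicalSpace M] [ChartedSpace (EuclideanSpace ℝ (Fin n)) M]
  [IsManifold (𝓡 n) ∞ M]

/-- Smoothness of a `1`-form. -/
def SmoothOneForm (α : ∀ x : M, TangentSpace (𝓡 n) x →L[ℝ] ℝ) : Prop :=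
  ContMDiff (𝓡 n) ((𝓡 n).prod 𝓘(ℝ, EuclideanSpace ℝ (Fin n) →L[ℝ] ℝ)) ∞
    (fun x => TotalSpace.mk' (EuclideanSpace ℝ (Fin n) →L[ℝ] ℝ)
      (E := fun x : M => TangentSpace (𝓡 n) x →L[ℝ] ℝ) x (α x))

/-- The exterior derivative of a `1`-form, through
`dα(U, V) = U(α(V)) - V(α(U)) - α([U, V])`. -/
def extDerivOne (α : ∀ x : M, TangentSpace (𝓡 n) x → ℝ) (x : M) (u v : TangentSpace (𝓡 n) x) : ℝ :=
  let U := extend (EuclideanSpace ℝ (Fin n)) u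
  let V := extend (EuclideanSpace ℝ (Fin n)) v
  mvfderiv (𝓡 n) (fun y => α y (V y)) x u - mvfderiv (𝓡 n) (fun y => α y (U y)) x v
    - α x (mlieBracket (𝓡 n) U V x)

/-- `D` is the Weyl connection determined by the metric `h` and the `1`-form `lee`: it is torsion
free and `D h = -2 lee ⊗ h`. -/
structure IsWeylConnection (h : Metric n M) (lee : ∀ x : M, TangentSpace (𝓡 n) x →L[ℝ] ℝ)
    (D : Connection n M) : Prop where
  torsion_free : D.torsion = 0
  compatible : ∀ (x : M) (u : TangentSpace (𝓡 n) x) (Y Z : ∀ y : M, TangentSpace (𝓡 n) y),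
    MDifferentiableAt (𝓡 n) (𝓡 n).tangent (fun y => (⟨y, Y y⟩ : TangentBundle (𝓡 n) M)) x →
    MDifferentiableAt (𝓡 n) (𝓡 n).tangent (fun y => (⟨y, Z y⟩ : TangentBundle (𝓡 n) M)) x →
    mvfderiv (𝓡 n) (fun y => h.inner y (Y y) (Z y)) x u =
      h.inner x (D Y x u) (Z x) + h.inner x (Y x) (D Z x u) - 2 * lee x u * h.inner x (Y x) (Z x)

/-- `D` is the Levi-Civita connection of `g`. -/
def IsLeviCivita (g : Metric n M) (D : Connection n M) : Prop :=
  IsWeylConnection g (fun _ => 0) D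

/-- The standard basis of `T_x M`, i.e. of the model space `ℝⁿ`. -/
def stdVec (x : M) (i : Fin n) : TangentSpace (𝓡 n) x :=
  (EuclideanSpace.single i (1 : ℝ) : EuclideanSpace ℝ (Fin n))

/-- Coordinates in the standard basis of `T_x M`. -/
def stdCoord (x : M) (i : Fin n) (u : TangentSpace (𝓡 n) x) : ℝ :=
  (show EuclideanSpace ℝ (Fin n) from u) i

/-- The curvature `R(u, v) w` of a connection. -/
def curvature (D : Connection n M) (x : M) (u v w : TangentSpace (𝓡 n) x) :
    TangentSpace (𝓡 n) x :=
  let U := extend (EuclideanSpace ℝ (Fin n)) u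
  let V := extend (EuclideanSpace ℝ (Fin n)) v
  let W := extend (EuclideanSpace ℝ (Fin n)) w
  D (fun y => D W y (V y)) x u - D (fun y => D W y (U y)) x v - D W x (mlieBracket (𝓡 n) U V x)

/-- The Ricci tensor `Ric(v, w) = tr (u ↦ R(u, v) w)`. -/
def ricci (D : Connection n M) (x : M) (v w : TangentSpace (𝓡 n) x) : ℝ :=
  ∑ i, stdCoord x i (curvature D x (stdVec x i) v w)

/-- The Gram matrix of a metric in the standard basis. -/
def gram (h : Metric n M) (x : M) : Matrix (Fin n) (Fin n) ℝ :=
  Matrix.of fun i j => h.inner x (stdVec x i) (stdVec x j)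

/-- The trace `∑ β(e_i, e_i)` of a bilinear form `β` with respect to a metric, where `e` is an
orthonormal basis; written in the standard basis. -/
def metricTrace (h : Metric n M) (x : M)
    (β : TangentSpace (𝓡 n) x → TangentSpace (𝓡 n) x → ℝ) : ℝ :=
  ∑ i, ∑ j, (gram h x)⁻¹ i j * β (stdVec x i) (stdVec x j)

/-- The scalar curvature of a connection, measured in the metric `h`. -/
def scalarCurv (h : Metric n M) (D : Connection n M) (x : M) : ℝ :=
  metricTrace h x (ricci D x)

/-- The divergence of a vector field. -/
def divergence (D : Connection n M) (X : ∀ y : M, TangentSpace (𝓡 n) y) (x : M) : ℝ :=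
  ∑ i, stdCoord x i (D X x (stdVec x i))

/-- Unit normalization of an `n`-form: `vol(v_1, …, v_n)² = det h(v_i, v_j)`. -/
def IsUnitForm (h : Metric n M)
    (vol : ∀ x : M, AlternatingMap ℝ (TangentSpace (𝓡 n) x) ℝ (Fin n)) : Prop :=
  ∀ (x : M) (v : Fin n → TangentSpace (𝓡 n) x),
    (vol x v) ^ 2 = Matrix.det (Matrix.of fun i j => h.inner x (v i) (v j))

/-- `vol` is the volume form of `h` for one of the orientations of `M`. -/
structure IsVolumeForm (h : Metric n M)
    (vol : ∀ x : M, AlternatingMap ℝ (TangentSpace (𝓡 n) x) ℝ (Fin n)) : Prop where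
  unit : IsUnitForm h vol
  continuous : ∀ (x : M) (X : Fin n → ∀ y : M, TangentSpace (𝓡 n) y),
    (∀ i, ContMDiffAt (𝓡 n) (𝓡 n).tangent ∞ (fun y => (⟨y, X i y⟩ : TangentBundle (𝓡 n) M)) x) →
    ContinuousAt (fun y => vol y (fun i => X i y)) x

end General

section Dim3

variable {B : Type*} [TopologicalSpace B] [ChartedSpace (EuclideanSpace ℝ (Fin 3)) B]
  [IsManifold (𝓡 3) ∞ B]

variable (B) in
/-- A Weyl structure on a `3`-manifold, in a gauge: `metric` is a representative of the conformal
class (equivalently a length scale `μ_B`), and the Weyl derivative on the bundle of lengths is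
`D μ_B = lee ⊗ μ_B`, inducing the Weyl connection `conn`. -/
structure WeylStructure where
  metric : Metric 3 B
  lee : ∀ x : B, TangentSpace (𝓡 3) x →L[ℝ] ℝ
  lee_smooth : SmoothOneForm lee
  conn : Connection 3 B
  isWeyl : IsWeylConnection metric lee conn

/-- The scalar curvature of the Weyl connection, in the gauge `metric`. -/
def WeylStructure.scal (W : WeylStructure B) (x : B) : ℝ := scalarCurv W.metric W.conn x

/-- The Faraday curvature: the curvature of the Weyl derivative. -/
def WeylStructure.faraday (W : WeylStructure B) (x : B) (u v : TangentSpace (𝓡 3) x) : ℝ :=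
  extDerivOne (fun y => W.lee y) x u v

/-- Einstein-Weyl: the symmetric tracefree part of the Ricci tensor vanishes. -/
def WeylStructure.IsEinsteinWeyl (W : WeylStructure B) : Prop :=
  ∀ (x : B) (u v : TangentSpace (𝓡 3) x),
    (ricci W.conn x u v + ricci W.conn x v u) / 2 = W.scal x / 3 * W.metric.inner x u v

/-- The star operator from `2`-forms to `1`-forms on an oriented `3`-manifold, with the sign
convention `*1 = vol`, `ι_X (*α) = *(X ∧ α)`: thus `*(e₁ ∧ e₂) = vol(e₂, e₁, ·)`. -/
def star3 (h : Metric 3 B) (vol : ∀ x : B, AlternatingMap ℝ (TangentSpace (𝓡 3) x) ℝ (Fin 3))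
    (x : B) (F : TangentSpace (𝓡 3) x → TangentSpace (𝓡 3) x → ℝ) (u : TangentSpace (𝓡 3) x) : ℝ :=
  1 / 2 * metricTrace h x fun a a' => metricTrace h x fun b b' => F a b * vol x ![b', a', u]

end Dim3

section Dim4

variable {M : Type*} [TopologicalSpace M] [ChartedSpace (EuclideanSpace ℝ (Fin 4)) M]
  [IsManifold (𝓡 4) ∞ M]

/-- The star operator on `2`-forms on an oriented `4`-manifold, with the same sign convention:
`*(e₁ ∧ e₂) = vol(e₂, e₁, ·, ·)`. -/
def star4 (g : Metric 4 M) (vol : ∀ x : M, AlternatingMap ℝ (TangentSpace (𝓡 4) x) ℝ (Fin 4))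
    (x : M) (F : TangentSpace (𝓡 4) x → TangentSpace (𝓡 4) x → ℝ)
    (u v : TangentSpace (𝓡 4) x) : ℝ :=
  1 / 2 * metricTrace g x fun a a' => metricTrace g x fun b b' => F a b * vol x ![b', a', u, v]

/-- Selfduality of a `2`-form at a point. -/
def IsSelfdualForm (g : Metric 4 M)
    (vol : ∀ x : M, AlternatingMap ℝ (TangentSpace (𝓡 4) x) ℝ (Fin 4))
    (x : M) (F : TangentSpace (𝓡 4) x → TangentSpace (𝓡 4) x → ℝ) : Prop :=
  ∀ u v : TangentSpace (𝓡 4) x, star4 g vol x F u v = F u v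

/-- The Schouten (normalized Ricci) tensor of a metric with Levi-Civita connection `D`. -/
def schouten (g : Metric 4 M) (D : Connection 4 M) (x : M) (u v : TangentSpace (𝓡 4) x) : ℝ :=
  1 / 2 * (ricci D x u v - scalarCurv g D x / 6 * g.inner x u v)

/-- The Weyl curvature of a metric with Levi-Civita connection `D`. -/
def weylTensor (g : Metric 4 M) (D : Connection 4 M) (x : M)
    (u v w z : TangentSpace (𝓡 4) x) : ℝ :=
  g.inner x (curvature D x u v w) z
    - (schouten g D x v w * g.inner x u z - schouten g D x u w * g.inner x v z
      + g.inner x v w * schouten g D x u z - g.inner x u w * schouten g D x v z)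

/-- The metric is selfdual: the antiselfdual part of its Weyl curvature vanishes. -/
def IsSelfdualMetric (g : Metric 4 M) (D : Connection 4 M)
    (vol : ∀ x : M, AlternatingMap ℝ (TangentSpace (𝓡 4) x) ℝ (Fin 4)) : Prop :=
  ∀ (x : M) (w z : TangentSpace (𝓡 4) x),
    IsSelfdualForm g vol x fun u v => weylTensor g D x u v w z

/-- The minimal Weyl derivative `D⁰` of the congruence spanned by the `g`-unit vector field `ξ`,
written `D⁰ = D^g + γ` on the bundle of lengths, where
`γ = g(∇_ξ ξ, ·) - (1/3) (div ξ) g(ξ, ·)`. This is the unique Weyl derivative whose Weyl connection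
satisfies `D⁰_ξ ξ = 0` and `tr D⁰ ξ = 0`. -/
def minimalForm (g : Metric 4 M) (D : Connection 4 M) (ξ : ∀ x : M, TangentSpace (𝓡 4) x)
    (x : M) (u : TangentSpace (𝓡 4) x) : ℝ :=
  g.inner x (D ξ x (ξ x)) u - 1 / 3 * divergence D ξ x * g.inner x (ξ x) u

/-- The congruence is selfdual: the Faraday curvature `F⁰ = dγ` of its minimal Weyl derivative is
selfdual. -/
def IsSelfdualCongruence (g : Metric 4 M) (D : Connection 4 M)
    (vol : ∀ x : M, AlternatingMap ℝ (TangentSpace (𝓡 4) x) ℝ (Fin 4))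
    (ξ : ∀ x : M, TangentSpace (𝓡 4) x) : Prop :=
  ∀ x : M, IsSelfdualForm g vol x fun u v => extDerivOne (minimalForm g D ξ) x u v

/-- The congruence is Legendrian: the skew part of `(D⁰ ⊗ D^g) ξ` is selfdual. Here the weightless
unit field `ξ ∈ L⁻¹ TM` is differentiated by `D⁰` on `L⁻¹` and by `D^g` on `TM`; in the gauge `g`,
`(D⁰ ⊗ D^g)_u ξ = D_u ξ - γ(u) ξ`. -/
def IsLegendrian (g : Metric 4 M) (D : Connection 4 M)
    (vol : ∀ x : M, AlternatingMap ℝ (TangentSpace (𝓡 4) x) ℝ (Fin 4))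
    (ξ : ∀ x : M, TangentSpace (𝓡 4) x) : Prop :=
  ∀ x : M, IsSelfdualForm g vol x fun u v =>
    ((g.inner x (D ξ x u) v - minimalForm g D ξ x u * g.inner x (ξ x) v)
      - (g.inner x (D ξ x v) u - minimalForm g D ξ x v * g.inner x (ξ x) u)) / 2

end Dim4

section Submersion

variable {B : Type*} [TopologicalSpace B] [ChartedSpace (EuclideanSpace ℝ (Fin 3)) B]
  [IsManifold (𝓡 3) ∞ B]
  {M : Type*} [TopologicalSpace M] [ChartedSpace (EuclideanSpace ℝ (Fin 4)) M]
  [IsManifold (𝓡 4) ∞ M]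

/-- `pr : M → B` is a smooth conformal submersion from `(M, [g])` to `(B, [h])`, with fibres oriented
by the smooth vertical `g`-unit vector field `ξ`. -/
structure IsConformalSubmersion (g : Metric 4 M) (h : Metric 3 B) (pr : M → B)
    (ξ : ∀ x : M, TangentSpace (𝓡 4) x) : Prop where
  smooth : ContMDiff (𝓡 4) (𝓡 3) ∞ pr
  submersion : ∀ x, Function.Surjective (mfderiv (𝓡 4) (𝓡 3) pr x)
  smooth_vertical : ContMDiff (𝓡 4) (𝓡 4).tangent ∞
    (fun x => (⟨x, ξ x⟩ : TangentBundle (𝓡 4) M))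
  vertical : ∀ x, mfderiv (𝓡 4) (𝓡 3) pr x (ξ x) = 0
  unit : ∀ x, g.inner x (ξ x) (ξ x) = 1
  conformal : ∀ x, ∃ c : ℝ, 0 < c ∧ ∀ u v : TangentSpace (𝓡 4) x,
    g.inner x u (ξ x) = 0 → g.inner x v (ξ x) = 0 →
      h.inner (pr x) (mfderiv (𝓡 4) (𝓡 3) pr x u) (mfderiv (𝓡 4) (𝓡 3) pr x v) = c * g.inner x u v

/-- `volM` is the volume form of `g` for the orientation `pr^* vol_B ∧ ξ` of `M`. -/
structure IsInducedVolume (g : Metric 4 M) (pr : M → B) (ξ : ∀ x : M, TangentSpace (𝓡 4) x)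
    (volB : ∀ x : B, AlternatingMap ℝ (TangentSpace (𝓡 3) x) ℝ (Fin 3))
    (volM : ∀ x : M, AlternatingMap ℝ (TangentSpace (𝓡 4) x) ℝ (Fin 4)) : Prop where
  unit : IsUnitForm g volM
  positive : ∀ (x : M) (a b c : TangentSpace (𝓡 4) x),
    0 < volB (pr x) ![mfderiv (𝓡 4) (𝓡 3) pr x a, mfderiv (𝓡 4) (𝓡 3) pr x b,
      mfderiv (𝓡 4) (𝓡 3) pr x c] →
    0 < volM x ![a, b, c, ξ x]

/-- The function `1 - (1/6) μ_t² scal^B`, where `μ_t = t μ_B`. -/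
def hlFactor (W : WeylStructure B) (pr : M → B) (t : M → ℝ) (x : M) : ℝ :=
  1 - 1 / 6 * t x ^ 2 * W.scal (pr x)

/-- The `1`-form `μ_t⁻¹ D^B μ_t - (1/2) μ_t *_B F^B`, where `μ_t = t μ_B`. -/
def hlOneForm (W : WeylStructure B)
    (volB : ∀ x : B, AlternatingMap ℝ (TangentSpace (𝓡 3) x) ℝ (Fin 3))
    (pr : M → B) (t : M → ℝ) (x : M) (u : TangentSpace (𝓡 4) x) : ℝ :=
  (t x)⁻¹ * mvfderiv (𝓡 4) t x u + W.lee (pr x) (mfderiv (𝓡 4) (𝓡 3) pr x u)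
    - 1 / 2 * t x * star3 W.metric volB (pr x) (W.faraday (pr x)) (mfderiv (𝓡 4) (𝓡 3) pr x u)

/-- The bilinear form `(1 - (1/6) μ_t² scal^B) μ_t⁻² pr^* c_B
+ (1 - (1/6) μ_t² scal^B)⁻¹ (μ_t⁻¹ D^B μ_t - (1/2) μ_t *_B F^B)²`, where `μ_t = t μ_B`. -/
def hlForm (W : WeylStructure B)
    (volB : ∀ x : B, AlternatingMap ℝ (TangentSpace (𝓡 3) x) ℝ (Fin 3))
    (pr : M → B) (t : M → ℝ) (x : M) (u v : TangentSpace (𝓡 4) x) : ℝ :=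
  hlFactor W pr t x * ((t x) ^ 2)⁻¹ *
      W.metric.inner (pr x) (mfderiv (𝓡 4) (𝓡 3) pr x u) (mfderiv (𝓡 4) (𝓡 3) pr x v)
    + (hlFactor W pr t x)⁻¹ * (hlOneForm W volB pr t x u * hlOneForm W volB pr t x v)

/-- `(pr, t) : M → B × ℝ` is smooth with injective differential: equivalently (by dimension), `pr` is
a submersion and `t` is a smooth function which is strictly monotone to first order along the
fibres, i.e. a fibre coordinate. -/
structure IsFibreCoordinate (pr : M → B) (t : M → ℝ) : Prop where
  smooth_proj : ContMDiff (𝓡 4) (𝓡 3) ∞ pr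
  smooth_coord : ContMDiff (𝓡 4) 𝓘(ℝ, ℝ) ∞ t
  injective : ∀ (x : M) (u : TangentSpace (𝓡 4) x),
    mfderiv (𝓡 4) (𝓡 3) pr x u = 0 → mvfderiv (𝓡 4) t x u = 0 → u = 0

end Submersion

end HitchinLeBrun

end

open HitchinLeBrun

set_option linter.unusedSectionVars false

/-! Everything is computed in local frames. Let e be an oriented orthonormal frame of the base, E_i
its horizontal lifts, which have a common length λ because the submersion is conformal, and T =
-λ⁻¹ξ; put Q = λ². With indices mod 3, [T, E_i] = κ_i T and [E_{p+1}, E_{p+2}] = Σ c_{pk} E_k + Ω_p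
T, where the c_{pk} come from the base. Put ν = ½T(Q) and pp_i = Q⁻¹E_i(Q) - 2κ_i; half of pp is the
horizontal part of the Lee form of the minimal Weyl derivative. The Legendrian condition becomes Ω_p
= Q pp_p (`isLegendrian_iff`). Granted this, selfduality of the minimal Weyl derivative becomes
T(κ_p) = 0 (`isSelfdual_iff_of_legendrian`), so that κ can be the Lee form ω of a Weyl derivative
D^B on the base.

A metric is Einstein with vanishing antiselfdual Weyl curvature exactly when the antiselfdual half
of its curvature operator is that of a space of constant curvature (`AsdEinstein`), and this half is
the curvature of the connection on antiselfdual 2-forms. For a Legendrian selfdual submersion that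
connection has no T-component, and along E_m it is the connection of D^B plus ν times the identity
(`asdForm_T`, `asdForm_E`). Its curvature is therefore R^B + ν² together with terms in dν - νω and
T(ν) (`asdCurv_E`, `asdCurv_T`).

The selfdual Einstein equation with Ric = c g now reads: T(ν) = -c/3; each diagonal component of R^B
equals -(c/3)Q - ν²; the off-diagonal components of R^B are, up to sign, those of dν - νω. The
equality of the diagonal components and the skewness of the others are the Einstein-Weyl equation.
By the first Bianchi identity the skew part is F/2, so dν - νω = F/2 on horizontal vectors, while
the diagonal gives -(c/3)Q = ν² - scal/6. These equations, with r = -c/3, form `IsHLCoordinate`.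
They determine Q, the horizontal distribution and the length of vertical vectors, hence g, and μ_t =
1/ν turns the result into the stated formula (`IsHLCoordinate.inner_eq`).

The converse part follows this reasoning once κ has been pushed down to B: functions without
vertical derivative descend because the fibres are connected (`exists_descend`, `exists_lee`).

For the direct part, the metric defined by the formula satisfies `IsHLCoordinate` with ν = 1/t and r
= ε. Commuting T with E_i on ν gives κ = ω, hence selfduality of the submersion. Commuting two of
the E_i gives the Legendrian condition, and here the second Bianchi identity of the Einstein-Weyl
structure is needed (`frame_einsteinWeyl_bianchi`). The curvature formula then gives the Einstein
and selfduality properties. For the conformal infinity, t²g is written without any negative power of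
t. -/

noncomputable section

namespace HitchinLeBrun

/-! ### Vector fields as derivations of the ring of smooth functions on an open set. -/

section Basic
variable {n : ℕ} {M : Type*} [TopologicalSpace M] [ChartedSpace (EuclideanSpace ℝ (Fin n)) M]
  [IsManifold (𝓡 n) ∞ M]

theorem mvfderiv_congr {f g : M → ℝ} {x : M} (h : f =ᶠ[𝓝 x] g) :
    mvfderiv (𝓡 n) f x = mvfderiv (𝓡 n) g x := by
  ext u
  exact congrArg (fun L : TangentSpace (𝓡 n) x →L[ℝ] ℝ => L u) h.mfderiv_eq

theorem contMDiffAt_mvfderiv_apply {f : M → ℝ} {X : ∀ y : M, TangentSpace (𝓡 n) y} {x : M}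
    (hf : ContMDiffAt (𝓡 n) 𝓘(ℝ, ℝ) ∞ f x)
    (hX : ContMDiffAt (𝓡 n) (𝓡 n).tangent ∞ (fun y => (⟨y, X y⟩ : TangentBundle (𝓡 n) M)) x) :
    ContMDiffAt (𝓡 n) 𝓘(ℝ, ℝ) ∞ (fun y => mvfderiv (𝓡 n) f y (X y)) x := by
  have h1 := hf.mfderiv_const (m := ∞) (by simp)
  have h2 := ContMDiffAt.clm_apply_of_inCoordinates (F₁ := EuclideanSpace ℝ (Fin n)) (F₂ := ℝ)
    (E₁ := fun x : M => TangentSpace (𝓡 n) x) (E₂ := fun x : ℝ => TangentSpace 𝓘(ℝ, ℝ) x)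
    (b₁ := id) (b₂ := f) (v := X) h1 hX hf
  rw [contMDiffAt_totalSpace] at h2
  refine h2.2.congr_of_eventuallyEq (Filter.Eventually.of_forall fun y => ?_)
  simp [mvfderiv]
  rfl

/-- A vector field read in the chart at `x`. -/
def chartField (x : M) (X : ∀ y : M, TangentSpace (𝓡 n) y) :
    EuclideanSpace ℝ (Fin n) → EuclideanSpace ℝ (Fin n) :=
  mpullbackWithin 𝓘(ℝ, EuclideanSpace ℝ (Fin n)) (𝓡 n) (extChartAt (𝓡 n) x).symm X
    (Set.range (𝓡 n))

theorem eventually_mfderiv_extChartAt_apply (x : M) (X : ∀ y : M, TangentSpace (𝓡 n) y) :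
    ∀ᶠ y in 𝓝 x, mfderiv (𝓡 n) 𝓘(ℝ, EuclideanSpace ℝ (Fin n)) (extChartAt (𝓡 n) x) y (X y) =
      chartField x X (extChartAt (𝓡 n) x y) := by
  have := eventuallyEq_mpullback_mpullbackWithin_extChartAt (I := 𝓡 n) (s := Set.univ) (x := x) X
  rw [nhdsWithin_univ] at this
  filter_upwards [this, extChartAt_source_mem_nhds (I := 𝓡 n) x] with y hy hys
  rw [hy, mpullback_apply]
  exact (isInvertible_mfderiv_extChartAt hys).self_apply_inverse _

theorem contMDiffAt_comp_extChartAt_symm {f : M → ℝ} {m : ℕ∞ω} (hm : m ≤ ∞) {x y : M}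
    (hys : y ∈ (extChartAt (𝓡 n) x).source) (hy : ContMDiffAt (𝓡 n) 𝓘(ℝ, ℝ) m f y) :
    ContDiffAt ℝ m (f ∘ (extChartAt (𝓡 n) x).symm) (extChartAt (𝓡 n) x y) := by
  have h : ContMDiffAt 𝓘(ℝ, EuclideanSpace ℝ (Fin n)) (𝓡 n) m (extChartAt (𝓡 n) x).symm
      (extChartAt (𝓡 n) x y) := by
    have := contMDiffWithinAt_extChartAt_symm_range (I := 𝓡 n) (n := ∞) x
      ((extChartAt (𝓡 n) x).map_source hys)
    simp only [modelWithCornersSelf_coe, Set.range_id, contMDiffWithinAt_univ] at this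
    exact this.of_le hm
  exact (ContMDiffAt.comp_of_eq (I' := 𝓡 n) hy h
    ((extChartAt (𝓡 n) x).left_inv hys)).contDiffAt

theorem eventually_mvfderiv_eq_fderiv {f : M → ℝ} {x : M}
    (hf : ContMDiffAt (𝓡 n) 𝓘(ℝ, ℝ) ∞ f x) (X : ∀ y : M, TangentSpace (𝓡 n) y) :
    ∀ᶠ y in 𝓝 x, mvfderiv (𝓡 n) f y (X y) =
      fderiv ℝ (f ∘ (extChartAt (𝓡 n) x).symm) (extChartAt (𝓡 n) x y)
        (chartField x X (extChartAt (𝓡 n) x y)) := by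
  have h1 : ∀ᶠ y in 𝓝 x, ContMDiffAt (𝓡 n) 𝓘(ℝ, ℝ) 1 f y :=
    (contMDiffAt_iff_contMDiffAt_nhds (by simp)).1 (hf.of_le (by simp))
  filter_upwards [h1, eventually_mfderiv_extChartAt_apply x X,
    extChartAt_source_mem_nhds (I := 𝓡 n) x,
    eventually_eventually_nhds.2 (extChartAt_source_mem_nhds (I := 𝓡 n) x)] with y hy hX hys hyss
  rw [← hX]
  have h2 : f =ᶠ[𝓝 y] (f ∘ (extChartAt (𝓡 n) x).symm) ∘ (extChartAt (𝓡 n) x) := by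
    filter_upwards [hyss] with z hz
    simp only [Function.comp_apply]
    rw [(extChartAt (𝓡 n) x).left_inv hz]
  rw [mvfderiv_congr h2]
  have h4 : MDifferentiableAt 𝓘(ℝ, EuclideanSpace ℝ (Fin n)) 𝓘(ℝ, ℝ)
      (f ∘ (extChartAt (𝓡 n) x).symm) (extChartAt (𝓡 n) x y) :=
    ((contMDiffAt_comp_extChartAt_symm (by simp) hys hy).differentiableAt
      one_ne_zero).mdifferentiableAt
  rw [mvfderiv_comp_apply y h4 (mdifferentiableAt_extChartAt (by simpa using hys))]
  simp only [mvfderiv, mfderiv_eq_fderiv]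
  rfl

/-- Stated on the model space itself, so that it applies by definitional unfolding to expressions
typed in tangent spaces. -/
theorem lieBracketWithin_univ_euclideanSpace
    (V W : EuclideanSpace ℝ (Fin n) → EuclideanSpace ℝ (Fin n)) (z : EuclideanSpace ℝ (Fin n)) :
    lieBracketWithin ℝ V W Set.univ z = lieBracket ℝ V W z := by
  rw [lieBracketWithin_univ]

/-- Read in the chart at `x`, the bracket of the manifold is the bracket of the chart fields, so
this is the symmetry of second derivatives in Euclidean space. All later bracket computations rest
on it. -/
theorem mvfderiv_mlieBracket {f : M → ℝ} {X Y : ∀ y : M, TangentSpace (𝓡 n) y} {x : M}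
    (hf : ContMDiffAt (𝓡 n) 𝓘(ℝ, ℝ) ∞ f x)
    (hX : ContMDiffAt (𝓡 n) (𝓡 n).tangent ∞ (fun y => (⟨y, X y⟩ : TangentBundle (𝓡 n) M)) x)
    (hY : ContMDiffAt (𝓡 n) (𝓡 n).tangent ∞ (fun y => (⟨y, Y y⟩ : TangentBundle (𝓡 n) M)) x) :
    mvfderiv (𝓡 n) f x (mlieBracket (𝓡 n) X Y x) =
      mvfderiv (𝓡 n) (fun y => mvfderiv (𝓡 n) f y (Y y)) x (X x) -
      mvfderiv (𝓡 n) (fun y => mvfderiv (𝓡 n) f y (X y)) x (Y x) := by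
  set φ := extChartAt (𝓡 n) x with hφ
  set f' := f ∘ φ.symm with hf'
  have hx : x ∈ φ.source := mem_extChartAt_source x
  have hfx : ContDiffAt ℝ ∞ f' (φ x) := contMDiffAt_comp_extChartAt_symm le_rfl hx hf
  have hd {Z : ∀ y : M, TangentSpace (𝓡 n) y}
      (hZ : ContMDiffAt (𝓡 n) (𝓡 n).tangent ∞
        (fun y => (⟨y, Z y⟩ : TangentBundle (𝓡 n) M)) x) :
      DifferentiableAt ℝ (chartField x Z) (φ x) := by
    have := MDifferentiableWithinAt.differentiableWithinAt_mpullbackWithin_vectorField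
      (s := Set.univ) (I := 𝓡 n) (hZ.mdifferentiableAt (by simp)).mdifferentiableWithinAt
    rw [← differentiableWithinAt_univ]
    simpa [chartField, hφ] using this
  have hsec (Z W : ∀ y : M, TangentSpace (𝓡 n) y)
      (hZ : ContMDiffAt (𝓡 n) (𝓡 n).tangent ∞
        (fun y => (⟨y, Z y⟩ : TangentBundle (𝓡 n) M)) x) :
      mvfderiv (𝓡 n) (fun y => mvfderiv (𝓡 n) f y (Z y)) x (W x) =
        fderiv ℝ (fun z => fderiv ℝ f' z (chartField x Z z)) (φ x) (chartField x W (φ x)) := by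
    rw [(eventually_mvfderiv_eq_fderiv (contMDiffAt_mvfderiv_apply hf hZ) W).self_of_nhds]
    congr 1
    apply Filter.EventuallyEq.fderiv_eq
    have h1 := eventually_mvfderiv_eq_fderiv hf Z
    have h2 : Filter.Tendsto φ.symm (𝓝 (φ x)) (𝓝 x) := by
      simpa [hφ] using (continuousAt_extChartAt_symm (I := 𝓡 n) x).tendsto
    filter_upwards [h2.eventually h1, extChartAt_target_mem_nhds (I := 𝓡 n) x] with z hz hzt
    simp only [Function.comp_apply]
    rw [hz, ← hφ, φ.right_inv hzt]
  rw [hsec Y X hY, hsec X Y hX,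
    (eventually_mvfderiv_eq_fderiv hf (mlieBracket (𝓡 n) X Y)).self_of_nhds,
    ← fderiv_apply_lieBracket hfx (by simpa using ENat.LEInfty.out) (hd hY) (hd hX)]
  congr 1
  rw [← (eventually_mfderiv_extChartAt_apply x (mlieBracket (𝓡 n) X Y)).self_of_nhds,
    ← mlieBracketWithin_univ, mlieBracketWithin_apply]
  refine ((isInvertible_mfderiv_extChartAt hx).self_apply_inverse _).trans ?_
  simp only [modelWithCornersSelf_coe, Set.range_id, Set.preimage_univ, Set.inter_univ,
    chartField, hφ]
  exact lieBracketWithin_univ_euclideanSpace _ _ _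


/-- Smoothness of a vector field at a point. -/
abbrev FieldAt (X : ∀ y : M, TangentSpace (𝓡 n) y) (x : M) : Prop :=
  ContMDiffAt (𝓡 n) (𝓡 n).tangent ∞ (fun y => (⟨y, X y⟩ : TangentBundle (𝓡 n) M)) x

/-- Smoothness of a function at a point. -/
abbrev FunAt (f : M → ℝ) (x : M) : Prop := ContMDiffAt (𝓡 n) 𝓘(ℝ, ℝ) ∞ f x

theorem FieldAt.mdiff {X : ∀ y : M, TangentSpace (𝓡 n) y} {x : M} (hX : FieldAt X x) :
    MDifferentiableAt (𝓡 n) (𝓡 n).tangent (fun y => (⟨y, X y⟩ : TangentBundle (𝓡 n) M)) x :=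
  hX.mdifferentiableAt (by simp)

theorem FieldAt.mlieBracket {X Y : ∀ y : M, TangentSpace (𝓡 n) y} {x : M}
    (hX : FieldAt X x) (hY : FieldAt Y x) : FieldAt (mlieBracket (𝓡 n) X Y) x := by
  have : IsManifold (𝓡 n) (minSmoothness ℝ 2) M :=
    IsManifold.of_le (n := ∞) (by simpa using ENat.LEInfty.out)
  have : IsManifold (𝓡 n) ((⊤ : ℕ∞) + 1) M :=
    IsManifold.of_le (n := ∞) (by simp)
  exact ContMDiffAt.mlieBracket_vectorField (m := (⊤ : ℕ∞)) (n := (⊤ : ℕ∞)) hX hY (by simp)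

theorem FieldAt.smul {f : M → ℝ} {X : ∀ y : M, TangentSpace (𝓡 n) y} {x : M}
    (hf : FunAt (n := n) f x) (hX : FieldAt X x) : FieldAt (fun y => f y • X y) x :=
  ContMDiffAt.smul_section hf hX

theorem FieldAt.add {X Y : ∀ y : M, TangentSpace (𝓡 n) y} {x : M}
    (hX : FieldAt X x) (hY : FieldAt Y x) : FieldAt (fun y => X y + Y y) x :=
  ContMDiffAt.add_section hX hY

theorem FieldAt.sub {X Y : ∀ y : M, TangentSpace (𝓡 n) y} {x : M}
    (hX : FieldAt X x) (hY : FieldAt Y x) : FieldAt (fun y => X y - Y y) x :=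
  ContMDiffAt.sub_section hX hY

theorem FieldAt.sum {ι : Type*} {s : Finset ι} {X : ι → ∀ y : M, TangentSpace (𝓡 n) y} {x : M}
    (hX : ∀ i ∈ s, FieldAt (X i) x) : FieldAt (fun y => ∑ i ∈ s, X i y) x :=
  ContMDiffAt.sum_section hX

theorem FieldAt.congr {X Y : ∀ y : M, TangentSpace (𝓡 n) y} {x : M}
    (hX : FieldAt X x) (h : ∀ᶠ y in 𝓝 x, Y y = X y) : FieldAt Y x :=
  ContMDiffAt.congr_of_eventuallyEq hX (h.mono fun y hy => by simp [hy])

theorem FieldAt.inner {X Y : ∀ y : M, TangentSpace (𝓡 n) y} {x : M} (g : Metric n M)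
    (hX : FieldAt X x) (hY : FieldAt Y x) : FunAt (n := n) (fun y => g.inner y (X y) (Y y)) x := by
  have h := ContMDiffAt.clm_bundle_apply₂ (E₁ := fun x : M => TangentSpace (𝓡 n) x)
    (E₂ := fun x : M => TangentSpace (𝓡 n) x) (E₃ := Bundle.Trivial M ℝ)
    g.contMDiff.contMDiffAt hX hY
  simp only [contMDiffAt_totalSpace] at h
  exact h.2

theorem mdiff_inner {X Y : ∀ y : M, TangentSpace (𝓡 n) y} {x : M} (g : Metric n M)
    (hX : MDifferentiableAt (𝓡 n) (𝓡 n).tangent (fun y => (⟨y, X y⟩ : TangentBundle (𝓡 n) M)) x)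
    (hY : MDifferentiableAt (𝓡 n) (𝓡 n).tangent (fun y => (⟨y, Y y⟩ : TangentBundle (𝓡 n) M)) x) :
    MDifferentiableAt (𝓡 n) 𝓘(ℝ, ℝ) (fun y => g.inner y (X y) (Y y)) x := by
  have h := MDifferentiableAt.clm_bundle_apply₂ (E₁ := fun x : M => TangentSpace (𝓡 n) x)
    (E₂ := fun x : M => TangentSpace (𝓡 n) x) (E₃ := Bundle.Trivial M ℝ)
    (g.contMDiff.contMDiffAt.mdifferentiableAt (by simp)) hX hY
  simp only [mdifferentiableAt_totalSpace] at h
  exact h.2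

theorem FieldAt.oneForm {α : ∀ x : M, TangentSpace (𝓡 n) x →L[ℝ] ℝ} (hα : SmoothOneForm α)
    {X : ∀ y : M, TangentSpace (𝓡 n) y} {x : M} (hX : FieldAt X x) :
    FunAt (n := n) (fun y => α y (X y)) x := by
  have h := ContMDiffAt.clm_bundle_apply (E₁ := fun x : M => TangentSpace (𝓡 n) x)
    (E₂ := Bundle.Trivial M ℝ) hα.contMDiffAt hX
  simp only [contMDiffAt_totalSpace] at h
  exact h.2

variable (n) in
/-- The algebra of smooth functions on an open set. -/
def smoothFunctions (U : TopologicalSpace.Opens M) : Subalgebra ℝ (U → ℝ) where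
  carrier := {f | ∃ F : M → ℝ, (∀ x ∈ U, FunAt (n := n) F x) ∧ ∀ x : U, f x = F x}
  mul_mem' := by
    rintro f g ⟨F, hF, hf⟩ ⟨G, hG, hg⟩
    exact ⟨F * G, fun x hx => (hF x hx).mul (hG x hx), fun x => by simp [hf, hg]⟩
  add_mem' := by
    rintro f g ⟨F, hF, hf⟩ ⟨G, hG, hg⟩
    exact ⟨F + G, fun x hx => (hF x hx).add (hG x hx), fun x => by simp [hf, hg]⟩
  algebraMap_mem' r := ⟨fun _ => r, fun x hx => contMDiffAt_const, fun x => rfl⟩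

variable (n) in
/-- Smooth functions on an open set. -/
abbrev Fn (U : TopologicalSpace.Opens M) := ↥(smoothFunctions n U)

variable {U : TopologicalSpace.Opens M}

/-- Restriction of a function to an open set on which it is smooth. -/
def Fn.of (F : M → ℝ) (hF : ∀ x ∈ U, FunAt (n := n) F x) : Fn n U := ⟨fun x => F x, F, hF, fun _ => rfl⟩

@[simp] theorem Fn.of_apply (F : M → ℝ) (hF : ∀ x ∈ U, FunAt (n := n) F x) (x : U) :
    (Fn.of F hF).1 x = F x := rfl

/-- An extension of a smooth function by arbitrary values. -/
def Fn.lift (f : Fn n U) : M → ℝ := f.2.choose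

theorem Fn.lift_smooth (f : Fn n U) : ∀ x ∈ U, FunAt (n := n) f.lift x := f.2.choose_spec.1

theorem Fn.lift_apply (f : Fn n U) (x : U) : f.lift x = f.1 x := (f.2.choose_spec.2 x).symm

theorem Fn.of_lift (f : Fn n U) : Fn.of f.lift f.lift_smooth = f :=
  Subtype.ext (funext fun x => f.lift_apply x)

theorem Fn.ext {f g : Fn n U} (h : ∀ x : U, f.1 x = g.1 x) : f = g := Subtype.ext (funext h)

theorem Fn.add_apply (f g : Fn n U) (x : U) : (f + g).1 x = f.1 x + g.1 x := rfl
theorem Fn.sub_apply (f g : Fn n U) (x : U) : (f - g).1 x = f.1 x - g.1 x := rfl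
theorem Fn.neg_apply (f : Fn n U) (x : U) : (-f).1 x = -f.1 x := rfl
theorem Fn.mul_apply (f g : Fn n U) (x : U) : (f * g).1 x = f.1 x * g.1 x := rfl
theorem Fn.smul_apply (r : ℝ) (f : Fn n U) (x : U) : (r • f).1 x = r * f.1 x := rfl
theorem Fn.zero_apply (x : U) : (0 : Fn n U).1 x = 0 := rfl

theorem eventually_mem_opens (x : U) : ∀ᶠ y in 𝓝 (x : M), y ∈ U := U.isOpen.mem_nhds x.2

variable (n) in
/-- Smooth vector fields on an open set. -/
structure Vec (U : TopologicalSpace.Opens M) where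
  toFun : ∀ x : M, TangentSpace (𝓡 n) x
  smooth : ∀ x ∈ U, FieldAt toFun x

instance : CoeFun (Vec n U) fun _ => ∀ x : M, TangentSpace (𝓡 n) x := ⟨Vec.toFun⟩

/-- `Fn.lift` is an arbitrary choice, but two extensions of the same function agree near each point
of `U`, so derivatives do not depend on it. -/
theorem mvfderiv_lift_of (F : M → ℝ) (hF : ∀ x ∈ U, FunAt (n := n) F x) (x : U) :
    mvfderiv (𝓡 n) (Fn.of F hF).lift x = mvfderiv (𝓡 n) F x :=
  mvfderiv_congr ((eventually_mem_opens x).mono fun y hy => Fn.lift_apply (Fn.of F hF) ⟨y, hy⟩)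

theorem FunAt.mdiff {f : M → ℝ} {x : M} (hf : FunAt (n := n) f x) :
    MDifferentiableAt (𝓡 n) 𝓘(ℝ, ℝ) f x := hf.mdifferentiableAt (by simp)

theorem mvfderiv_lift_add (f g : Fn n U) (x : U) :
    mvfderiv (𝓡 n) (f + g).lift (x : M) =
      mvfderiv (𝓡 n) f.lift (x : M) + mvfderiv (𝓡 n) g.lift (x : M) := by
  have h : (f + g).lift =ᶠ[𝓝 (x : M)] f.lift + g.lift :=
    (eventually_mem_opens x).mono fun y hy => by
      rw [Fn.lift_apply _ ⟨y, hy⟩, Pi.add_apply, f.lift_apply ⟨y, hy⟩,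
        g.lift_apply ⟨y, hy⟩, Fn.add_apply]
  rw [mvfderiv_congr h, mvfderiv_add (f.lift_smooth x x.2).mdiff (g.lift_smooth x x.2).mdiff]

theorem mvfderiv_lift_mul (f g : Fn n U) (x : U) :
    mvfderiv (𝓡 n) (f * g).lift (x : M) =
      f.1 x • mvfderiv (𝓡 n) g.lift (x : M) + g.1 x • mvfderiv (𝓡 n) f.lift (x : M) := by
  have h : (f * g).lift =ᶠ[𝓝 (x : M)] f.lift * g.lift :=
    (eventually_mem_opens x).mono fun y hy => by
      rw [Fn.lift_apply _ ⟨y, hy⟩, Pi.mul_apply, f.lift_apply ⟨y, hy⟩,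
        g.lift_apply ⟨y, hy⟩, Fn.mul_apply]
  rw [mvfderiv_congr h, mvfderiv_mul (f.lift_smooth x x.2).mdiff (g.lift_smooth x x.2).mdiff,
    f.lift_apply, g.lift_apply]

theorem mvfderiv_lift_smul (r : ℝ) (f : Fn n U) (x : U) :
    mvfderiv (𝓡 n) (r • f).lift (x : M) = r • mvfderiv (𝓡 n) f.lift (x : M) := by
  have h : (r • f).lift =ᶠ[𝓝 (x : M)] (fun _ => r) * f.lift :=
    (eventually_mem_opens x).mono fun y hy => by
      rw [Fn.lift_apply _ ⟨y, hy⟩, Pi.mul_apply, f.lift_apply ⟨y, hy⟩, Fn.smul_apply]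
  rw [mvfderiv_congr h, mvfderiv_mul mdifferentiableAt_const (f.lift_smooth x x.2).mdiff,
    mvfderiv_const]
  simp

/-- The derivation of the algebra of smooth functions defined by a vector field. -/
def Vec.d (X : Vec n U) : Derivation ℝ (Fn n U) (Fn n U) :=
  Derivation.mk'
    { toFun := fun f => Fn.of (fun y => mvfderiv (𝓡 n) f.lift y (X y))
        fun x hx => contMDiffAt_mvfderiv_apply (f.lift_smooth x hx) (X.smooth x hx)
      map_add' := fun f g => Fn.ext fun x => by
        simp [mvfderiv_lift_add]
      map_smul' := fun r f => Fn.ext fun x => by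
        simp [mvfderiv_lift_smul] }
    fun f g => Fn.ext fun x => by
      simp [mvfderiv_lift_mul]

theorem Vec.d_of (X : Vec n U) (F : M → ℝ) (hF : ∀ x ∈ U, FunAt (n := n) F x) :
    X.d (Fn.of F hF) = Fn.of (fun y => mvfderiv (𝓡 n) F y (X y))
      fun x hx => contMDiffAt_mvfderiv_apply (hF x hx) (X.smooth x hx) :=
  Fn.ext fun x => congrArg (fun L => L (X x)) (mvfderiv_lift_of F hF x)

theorem Vec.d_apply (X : Vec n U) (f : Fn n U) (x : U) :
    (X.d f).1 x = mvfderiv (𝓡 n) f.lift x (X x) := rfl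

/-- The Lie bracket of two vector fields. -/
def Vec.br (X Y : Vec n U) : Vec n U :=
  ⟨mlieBracket (𝓡 n) X Y, fun x hx => (X.smooth x hx).mlieBracket (Y.smooth x hx)⟩

theorem Vec.d_br (X Y : Vec n U) (f : Fn n U) :
    (X.br Y).d f = X.d (Y.d f) - Y.d (X.d f) := by
  rw [← f.of_lift]
  simp only [Vec.d_of]
  exact Fn.ext fun x => mvfderiv_mlieBracket (f.lift_smooth x x.2) (X.smooth x x.2)
    (Y.smooth x x.2)

/-- The inner product of two vector fields. -/
def Vec.ip (g : Metric n M) (X Y : Vec n U) : Fn n U :=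
  Fn.of (fun y => g.inner y (X y) (Y y)) fun x hx => (X.smooth x hx).inner g (Y.smooth x hx)

theorem Vec.ip_apply (g : Metric n M) (X Y : Vec n U) (x : U) :
    (X.ip g Y).1 x = g.inner x (X x) (Y x) := rfl

theorem Vec.ip_comm (g : Metric n M) (X Y : Vec n U) : X.ip g Y = Y.ip g X :=
  Fn.ext fun x => g.symm x _ _

/-- A smooth `1`-form evaluated on a vector field. -/
def Vec.form (α : ∀ x : M, TangentSpace (𝓡 n) x →L[ℝ] ℝ) (hα : SmoothOneForm α) (X : Vec n U) :
    Fn n U := Fn.of (fun y => α y (X y)) fun x hx => (X.smooth x hx).oneForm hα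

/-- Smooth functions act on vector fields. -/
def Vec.smul (f : Fn n U) (X : Vec n U) : Vec n U :=
  ⟨fun y => f.lift y • X.toFun y, fun x hx => FieldAt.smul (f.lift_smooth x hx) (X.smooth x hx)⟩

theorem Vec.smul_at (f : Fn n U) (X : Vec n U) (x : U) : (Vec.smul f X).toFun x = f.1 x • X.toFun x := by
  simp [Vec.smul, f.lift_apply]

/-- Smooth functions separate tangent vectors. -/
theorem eq_of_mvfderiv_eq {x : M} {u v : TangentSpace (𝓡 n) x}
    (h : ∀ f : M → ℝ, (∀ y ∈ (chartAt (EuclideanSpace ℝ (Fin n)) x).source, FunAt (n := n) f y) →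
      mvfderiv (𝓡 n) f x u = mvfderiv (𝓡 n) f x v) : u = v := by
  have hφ : ∀ y ∈ (chartAt (EuclideanSpace ℝ (Fin n)) x).source,
      ContMDiffAt (𝓡 n) 𝓘(ℝ, EuclideanSpace ℝ (Fin n)) ∞ (extChartAt (𝓡 n) x) y := fun y hy =>
    contMDiffAt_extChartAt' hy
  have hx : x ∈ (chartAt (EuclideanSpace ℝ (Fin n)) x).source := mem_chart_source _ x
  -- The coordinate functions of the chart at `x` are enough test functions, since the differential
  -- of the chart is injective.
  have key : mfderiv (𝓡 n) 𝓘(ℝ, EuclideanSpace ℝ (Fin n)) (extChartAt (𝓡 n) x) x u =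
      mfderiv (𝓡 n) 𝓘(ℝ, EuclideanSpace ℝ (Fin n)) (extChartAt (𝓡 n) x) x v := by
    refine PiLp.ext fun i => ?_
    have := h (EuclideanSpace.proj (𝕜 := ℝ) i ∘ extChartAt (𝓡 n) x) fun y hy =>
      (EuclideanSpace.proj (𝕜 := ℝ) i).contDiff.contDiffAt.comp_contMDiffAt (hφ y hy)
    have hd : MDifferentiableAt 𝓘(ℝ, EuclideanSpace ℝ (Fin n)) 𝓘(ℝ, ℝ)
        (EuclideanSpace.proj (𝕜 := ℝ) i : EuclideanSpace ℝ (Fin n) →L[ℝ] ℝ)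
        (extChartAt (𝓡 n) x x) :=
      (EuclideanSpace.proj (𝕜 := ℝ) i).differentiableAt.mdifferentiableAt
    rw [mvfderiv_comp_apply x hd ((hφ x hx).mdifferentiableAt (by simp)),
      mvfderiv_comp_apply x hd ((hφ x hx).mdifferentiableAt (by simp))] at this
    simp only [mvfderiv, mfderiv_eq_fderiv, ContinuousLinearMap.fderiv] at this
    exact this
  exact (isInvertible_mfderiv_extChartAt (mem_extChartAt_source x)).injective key

end Basic

/-! ### Weyl connections from the Koszul formula. -/

section WeylConnection
variable {n : ℕ} {M : Type*} [TopologicalSpace M] [ChartedSpace (EuclideanSpace ℝ (Fin n)) M]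
  [IsManifold (𝓡 n) ∞ M]

instance instFiniteDimensionalTangentSpace (x : M) : FiniteDimensional ℝ (TangentSpace (𝓡 n) x) :=
  inferInstanceAs (FiniteDimensional ℝ (EuclideanSpace ℝ (Fin n)))

theorem finrank_tangentSpace (x : M) : Module.finrank ℝ (TangentSpace (𝓡 n) x) = n :=
  finrank_euclideanSpace_fin (𝕜 := ℝ)

instance instT2TangentSpace (x : M) : T2Space (TangentSpace (𝓡 n) x) :=
  inferInstanceAs (T2Space (EuclideanSpace ℝ (Fin n)))

/-- Differentiability of a vector field at a point. -/
abbrev DiffAt (X : ∀ y : M, TangentSpace (𝓡 n) y) (x : M) : Prop :=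
  MDifferentiableAt (𝓡 n) (𝓡 n).tangent (fun y => (⟨y, X y⟩ : TangentBundle (𝓡 n) M)) x

theorem diffAt_extend {x : M} (u : TangentSpace (𝓡 n) x) :
    DiffAt (extend (EuclideanSpace ℝ (Fin n)) u) x := mdifferentiableAt_extend ..

theorem fieldAt_extend {x : M} (u : TangentSpace (𝓡 n) x) :
    FieldAt (extend (EuclideanSpace ℝ (Fin n)) u) x := contMDiffAt_extend ..

theorem eq_of_inner_eq (g : Metric n M) {x : M} {u v : TangentSpace (𝓡 n) x}
    (h : ∀ w, g.inner x u w = g.inner x v w) : u = v := by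
  by_contra hne
  have h1 := g.pos x (u - v) (sub_ne_zero.2 hne)
  have h2 : g.inner x (u - v) (u - v) = g.inner x u (u - v) - g.inner x v (u - v) := by
    rw [map_sub (g.inner x)]; rfl
  linarith [h (u - v)]

theorem inner_bijective (g : Metric n M) (x : M) : Function.Bijective (g.inner x) := by
  have hinj : Function.Injective (g.inner x) := fun u v h =>
    eq_of_inner_eq g fun w => by rw [h]
  refine ⟨hinj, ?_⟩
  have hfr : Module.finrank ℝ (TangentSpace (𝓡 n) x) =
      Module.finrank ℝ (TangentSpace (𝓡 n) x →L[ℝ] ℝ) := by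
    rw [(LinearMap.toContinuousLinearMap (𝕜 := ℝ) (E := TangentSpace (𝓡 n) x)
      (F' := ℝ)).symm.finrank_eq]
    exact (Subspace.dual_finrank_eq).symm
  exact (LinearMap.injective_iff_surjective_of_finrank_eq_finrank (f := (g.inner x).toLinearMap)
    hfr).1 hinj

/-- The isomorphism from covectors to vectors defined by a metric. -/
def sharp (g : Metric n M) (x : M) : (TangentSpace (𝓡 n) x →L[ℝ] ℝ) →L[ℝ] TangentSpace (𝓡 n) x :=
  LinearMap.toContinuousLinearMap
    (LinearEquiv.ofBijective (g.inner x).toLinearMap (inner_bijective g x)).symm.toLinearMap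

theorem inner_sharp (g : Metric n M) (x : M) (φ : TangentSpace (𝓡 n) x →L[ℝ] ℝ)
    (w : TangentSpace (𝓡 n) x) : g.inner x (sharp g x φ) w = φ w :=
  congrArg (fun ψ : TangentSpace (𝓡 n) x →L[ℝ] ℝ => ψ w)
    ((LinearEquiv.ofBijective (g.inner x).toLinearMap (inner_bijective g x)).apply_symm_apply φ)

variable (g : Metric n M) (lee : ∀ x : M, TangentSpace (𝓡 n) x →L[ℝ] ℝ)

theorem mvfderiv_inner_smul {f : M → ℝ} {X Z : ∀ y : M, TangentSpace (𝓡 n) y} {x : M}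
    (hf : MDifferentiableAt (𝓡 n) 𝓘(ℝ, ℝ) f x) (hX : DiffAt X x) (hZ : DiffAt Z x) :
    mvfderiv (𝓡 n) (fun y => g.inner y ((f • X) y) (Z y)) x =
      f x • mvfderiv (𝓡 n) (fun y => g.inner y (X y) (Z y)) x +
        g.inner x (X x) (Z x) • mvfderiv (𝓡 n) f x := by
  have : (fun y => g.inner y ((f • X) y) (Z y)) = f * fun y => g.inner y (X y) (Z y) := by
    ext y; simp
  rw [this, mvfderiv_mul hf (mdiff_inner g hX hZ)]

theorem mvfderiv_inner_add {X Y Z : ∀ y : M, TangentSpace (𝓡 n) y} {x : M}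
    (hX : DiffAt X x) (hY : DiffAt Y x) (hZ : DiffAt Z x) :
    mvfderiv (𝓡 n) (fun y => g.inner y ((X + Y) y) (Z y)) x =
      mvfderiv (𝓡 n) (fun y => g.inner y (X y) (Z y)) x +
        mvfderiv (𝓡 n) (fun y => g.inner y (Y y) (Z y)) x := by
  have : (fun y => g.inner y ((X + Y) y) (Z y)) =
      (fun y => g.inner y (X y) (Z y)) + fun y => g.inner y (Y y) (Z y) := by
    ext y; simp
  rw [this, mvfderiv_add (mdiff_inner g hX hZ) (mdiff_inner g hY hZ)]

theorem inner_fun_comm (X Z : ∀ y : M, TangentSpace (𝓡 n) y) :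
    (fun y => g.inner y (X y) (Z y)) = fun y => g.inner y (Z y) (X y) :=
  funext fun y => g.symm y _ _

/-- The Koszul expression of the Weyl connection of a metric and a `1`-form. -/
def koszul (x : M) (Y X Z : ∀ y : M, TangentSpace (𝓡 n) y) : ℝ :=
  (mvfderiv (𝓡 n) (fun y => g.inner y (Y y) (Z y)) x (X x)
      + 2 * lee x (X x) * g.inner x (Y x) (Z x))
    + (mvfderiv (𝓡 n) (fun y => g.inner y (X y) (Z y)) x (Y x)
      + 2 * lee x (Y x) * g.inner x (X x) (Z x))
    - (mvfderiv (𝓡 n) (fun y => g.inner y (X y) (Y y)) x (Z x)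
      + 2 * lee x (Z x) * g.inner x (X x) (Y x))
    + g.inner x (mlieBracket (𝓡 n) X Y x) (Z x) - g.inner x (mlieBracket (𝓡 n) X Z x) (Y x)
    - g.inner x (mlieBracket (𝓡 n) Y Z x) (X x)

/-- The derivatives of a factor `f` produced by the metric terms cancel those produced by the
brackets, and the terms in the Lee form are tensorial already. With its analogue in `Z`, this makes
the Koszul expression a bilinear form on one tangent space. -/
theorem koszul_tensorial_left {x : M} {Y Z : ∀ y : M, TangentSpace (𝓡 n) y}
    (hY : DiffAt Y x) (hZ : DiffAt Z x) :
    TensorialAt (𝓡 n) (EuclideanSpace ℝ (Fin n)) (fun X => koszul g lee x Y X Z) x where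
  smul {f X} hf hX := by
    simp only [koszul]
    rw [mvfderiv_inner_smul g hf hX hZ, mvfderiv_inner_smul g hf hX hY,
      mlieBracket_smul_left hf hX, mlieBracket_smul_left hf hX]
    simp
    ring
  add {X X'} hX hX' := by
    simp only [koszul]
    rw [mvfderiv_inner_add g hX hX' hZ, mvfderiv_inner_add g hX hX' hY,
      mlieBracket_add_left hX hX', mlieBracket_add_left hX hX']
    simp
    ring

theorem koszul_tensorial_right {x : M} {Y X : ∀ y : M, TangentSpace (𝓡 n) y}
    (hY : DiffAt Y x) (hX : DiffAt X x) :
    TensorialAt (𝓡 n) (EuclideanSpace ℝ (Fin n)) (fun Z => koszul g lee x Y X Z) x where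
  smul {f Z} hf hZ := by
    simp only [koszul]
    rw [inner_fun_comm g Y, inner_fun_comm g X, inner_fun_comm g Y Z, inner_fun_comm g X Z,
      mvfderiv_inner_smul g hf hZ hX, mvfderiv_inner_smul g hf hZ hY,
      mlieBracket_smul_right hf hZ, mlieBracket_smul_right hf hZ]
    simp
    ring
  add {Z Z'} hZ hZ' := by
    simp only [koszul]
    rw [inner_fun_comm g Y, inner_fun_comm g X, inner_fun_comm g Y Z, inner_fun_comm g X Z,
      inner_fun_comm g Y Z', inner_fun_comm g X Z',
      mvfderiv_inner_add g hZ hZ' hX, mvfderiv_inner_add g hZ hZ' hY,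
      mlieBracket_add_right hZ hZ', mlieBracket_add_right hZ hZ']
    simp
    ring

theorem koszul_add {x : M} {Y Y' X Z : ∀ y : M, TangentSpace (𝓡 n) y}
    (hY : DiffAt Y x) (hY' : DiffAt Y' x) (hX : DiffAt X x) (hZ : DiffAt Z x) :
    koszul g lee x (Y + Y') X Z = koszul g lee x Y X Z + koszul g lee x Y' X Z := by
  simp only [koszul]
  rw [inner_fun_comm g X (Y + Y'), inner_fun_comm g X Y, inner_fun_comm g X Y',
    mvfderiv_inner_add g hY hY' hX, mvfderiv_inner_add g hY hY' hZ,
    mlieBracket_add_right hY hY', mlieBracket_add_left hY hY']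
  simp
  ring

theorem koszul_leibniz {x : M} {f : M → ℝ} {Y X Z : ∀ y : M, TangentSpace (𝓡 n) y}
    (hf : MDifferentiableAt (𝓡 n) 𝓘(ℝ, ℝ) f x)
    (hY : DiffAt Y x) (hX : DiffAt X x) (hZ : DiffAt Z x) :
    koszul g lee x (f • Y) X Z =
      f x * koszul g lee x Y X Z + 2 * mvfderiv (𝓡 n) f x (X x) * g.inner x (Y x) (Z x) := by
  simp only [koszul]
  rw [inner_fun_comm g X (f • Y), inner_fun_comm g X Y,
    mvfderiv_inner_smul g hf hY hX, mvfderiv_inner_smul g hf hY hZ,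
    mlieBracket_smul_right hf hY, mlieBracket_smul_left hf hY]
  simp [g.symm x (Y x) (X x)]
  ring

/-- The bilinear form `2 ⟨D_X Y, Z⟩` at a point, for a field `Y` differentiable there. -/
def koszulForm (x : M) (Y : ∀ y : M, TangentSpace (𝓡 n) y) (hY : DiffAt Y x) :
    TangentSpace (𝓡 n) x →L[ℝ] TangentSpace (𝓡 n) x →L[ℝ] ℝ :=
  TensorialAt.mkHom₂ (I := 𝓡 n) (F := EuclideanSpace ℝ (Fin n)) (F' := EuclideanSpace ℝ (Fin n))
    (fun X Z => koszul g lee x Y X Z) x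
    (fun _ hZ => koszul_tensorial_left g lee hY hZ) (fun _ hX => koszul_tensorial_right g lee hY hX)

open Classical in
/-- The Weyl connection of a metric and a `1`-form. -/
def weylConn (Y : ∀ y : M, TangentSpace (𝓡 n) y) (x : M) :
    TangentSpace (𝓡 n) x →L[ℝ] TangentSpace (𝓡 n) x :=
  -- The value 0 where `Y` is not differentiable is harmless, because the axioms of a covariant
  -- derivative only concern differentiable sections.
  if hY : DiffAt Y x then (1 / 2 : ℝ) • (sharp g x).comp (koszulForm g lee x Y hY) else 0

theorem inner_weylConn {x : M} {Y X Z : ∀ y : M, TangentSpace (𝓡 n) y}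
    (hY : DiffAt Y x) (hX : DiffAt X x) (hZ : DiffAt Z x) :
    g.inner x (weylConn g lee Y x (X x)) (Z x) = 1 / 2 * koszul g lee x Y X Z := by
  have : koszulForm g lee x Y hY (X x) (Z x) = koszul g lee x Y X Z :=
    TensorialAt.mkHom₂_apply _ _ hX hZ
  simp [weylConn, hY, inner_sharp, this]

/-- The Koszul formula defines the connection; adding or subtracting two instances of it gives
compatibility and vanishing torsion. With zero Lee form it supplies the Levi-Civita connection of
the constructed metric, and with the descended Lee form the Weyl connection of the base. -/
theorem exists_isWeylConnection : ∃ D : Connection n M, IsWeylConnection g lee D := by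
  have hcov : IsCovariantDerivativeOn (EuclideanSpace ℝ (Fin n)) (weylConn g lee) Set.univ := by
    refine ⟨?_, ?_⟩
    · intro Y Y' x hY hY' _
      ext u : 1
      refine eq_of_inner_eq g fun w => ?_
      have hu := extend_apply_self (F := EuclideanSpace ℝ (Fin n)) u
      have hw := extend_apply_self (F := EuclideanSpace ℝ (Fin n)) w
      rw [← hu, ← hw, add_apply, map_add, add_apply,
        inner_weylConn g lee hY (diffAt_extend u) (diffAt_extend w),
        inner_weylConn g lee hY' (diffAt_extend u) (diffAt_extend w),
        inner_weylConn g lee (mdifferentiableAt_add_section hY hY') (diffAt_extend u)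
          (diffAt_extend w),
        koszul_add g lee hY hY' (diffAt_extend u) (diffAt_extend w)]
      ring
    · intro Y f x hY hf _
      ext u : 1
      refine eq_of_inner_eq g fun w => ?_
      have hu := extend_apply_self (F := EuclideanSpace ℝ (Fin n)) u
      have hw := extend_apply_self (F := EuclideanSpace ℝ (Fin n)) w
      rw [← hu, ← hw]
      simp only [add_apply, map_add, smul_apply, map_smul,
        ContinuousLinearMap.smulRight_apply]
      rw [inner_weylConn g lee hY (diffAt_extend u) (diffAt_extend w),
        inner_weylConn g lee (hf.smul_section hY) (diffAt_extend u) (diffAt_extend w),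
        koszul_leibniz g lee hf hY (diffAt_extend u) (diffAt_extend w)]
      simp only [smul_eq_mul]
      ring
  refine ⟨⟨weylConn g lee, hcov⟩, ?_, ?_⟩
  · rw [CovariantDerivative.torsion_eq_zero_iff]
    intro X Y x hX hY
    refine eq_of_inner_eq g fun w => ?_
    have hw := extend_apply_self (F := EuclideanSpace ℝ (Fin n)) w
    rw [← hw, map_sub, sub_apply]
    change g.inner x (weylConn g lee Y x (X x)) _ - g.inner x (weylConn g lee X x (Y x)) _ = _
    rw [inner_weylConn g lee hY hX (diffAt_extend w), inner_weylConn g lee hX hY (diffAt_extend w)]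
    simp only [koszul]
    rw [mlieBracket_swap_apply (V := Y) (W := X), inner_fun_comm g Y X, g.symm x (Y x) (X x)]
    simp
    ring
  · intro x u Y Z hY hZ
    have hu := extend_apply_self (F := EuclideanSpace ℝ (Fin n)) u
    change _ = g.inner x (weylConn g lee Y x u) _ + g.inner x _ (weylConn g lee Z x u) - _
    rw [g.symm x (Y x) (weylConn g lee Z x u), ← hu,
      inner_weylConn g lee hY (diffAt_extend u) hZ, inner_weylConn g lee hZ (diffAt_extend u) hY]
    simp only [koszul]
    rw [mlieBracket_swap_apply (V := Z) (W := Y), inner_fun_comm g Z Y, g.symm x (Z x) (Y x)]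
    simp
    ring

theorem IsWeylConnection.torsion_apply {D : Connection n M} (hD : IsWeylConnection g lee D) {x : M}
    {X Y : ∀ y : M, TangentSpace (𝓡 n) y} (hX : DiffAt X x) (hY : DiffAt Y x) :
    D Y x (X x) - D X x (Y x) = mlieBracket (𝓡 n) X Y x :=
  (CovariantDerivative.torsion_eq_zero_iff D).1 hD.torsion_free hX hY

/-- The definition of a Weyl connection does not ask that smooth fields be mapped to smooth fields.
The Koszul formula, valid for any Weyl connection, is what yields that smoothness. -/
theorem IsWeylConnection.koszul {D : Connection n M} (hD : IsWeylConnection g lee D) {x : M}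
    {X Y Z : ∀ y : M, TangentSpace (𝓡 n) y} (hX : DiffAt X x) (hY : DiffAt Y x) (hZ : DiffAt Z x) :
    g.inner x (D Y x (X x)) (Z x) = 1 / 2 * koszul g lee x Y X Z := by
  simp only [HitchinLeBrun.koszul]
  rw [hD.compatible x (X x) Y Z hY hZ, hD.compatible x (Y x) X Z hX hZ,
    hD.compatible x (Z x) X Y hX hY, ← hD.torsion_apply g lee hX hY, ← hD.torsion_apply g lee hX hZ,
    ← hD.torsion_apply g lee hY hZ]
  simp only [map_sub, sub_apply]
  rw [g.symm x (Y x) (D Z x (X x)), g.symm x (X x) (D Z x (Y x)), g.symm x (X x) (D Y x (Z x))]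
  ring

end WeylConnection

/-! ### Orthonormal bases and local orthonormal frames. -/

section Frames
variable {n : ℕ} {M : Type*} [TopologicalSpace M] [ChartedSpace (EuclideanSpace ℝ (Fin n)) M]
  [IsManifold (𝓡 n) ∞ M] (g : Metric n M)

/-- Orthonormality of a family of tangent vectors. -/
def IsON (x : M) {ι : Type*} [DecidableEq ι] (u : ι → TangentSpace (𝓡 n) x) : Prop :=
  ∀ i j, g.inner x (u i) (u j) = if i = j then 1 else 0

theorem inner_sum_left (x : M) {ι : Type*} (s : Finset ι) (v : ι → TangentSpace (𝓡 n) x)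
    (w : TangentSpace (𝓡 n) x) : g.inner x (∑ i ∈ s, v i) w = ∑ i ∈ s, g.inner x (v i) w := by
  rw [map_sum, sum_apply]

theorem inner_smul_left (x : M) (c : ℝ) (v w : TangentSpace (𝓡 n) x) :
    g.inner x (c • v) w = c * g.inner x v w := by
  rw [map_smul]; rfl

theorem inner_add_left (x : M) (u v w : TangentSpace (𝓡 n) x) :
    g.inner x (u + v) w = g.inner x u w + g.inner x v w := by
  rw [map_add]; rfl

theorem inner_sub_left (x : M) (u v w : TangentSpace (𝓡 n) x) :
    g.inner x (u - v) w = g.inner x u w - g.inner x v w := by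
  rw [map_sub (g.inner x)]; rfl

variable {g} in
theorem IsON.linearIndependent {x : M} {ι : Type*} [DecidableEq ι] [Fintype ι]
    {u : ι → TangentSpace (𝓡 n) x}
    (hu : IsON g x u) : LinearIndependent ℝ u := by
  rw [Fintype.linearIndependent_iff]
  intro c hc i
  have := congrArg (fun v => g.inner x v (u i)) hc
  simpa [hu _ i] using this

variable {g} in
theorem IsON.expand {x : M} {u : Fin n → TangentSpace (𝓡 n) x} (hu : IsON g x u)
    (v : TangentSpace (𝓡 n) x) : v = ∑ i, g.inner x v (u i) • u i := by
  have hspan := hu.linearIndependent.span_eq_top_of_card_eq_finrank'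
    (by rw [finrank_tangentSpace, Fintype.card_fin])
  have hv : v ∈ Submodule.span ℝ (Set.range u) := hspan ▸ Submodule.mem_top
  obtain ⟨c, rfl⟩ := (Submodule.mem_span_range_iff_exists_fun ℝ).1 hv
  refine Finset.sum_congr rfl fun j _ => ?_
  congr 1
  simp [hu _ j]

variable {g} in
theorem IsON.inner_eq {x : M} {u : Fin n → TangentSpace (𝓡 n) x} (hu : IsON g x u)
    (v w : TangentSpace (𝓡 n) x) :
    g.inner x v w = ∑ i, g.inner x v (u i) * g.inner x w (u i) := by
  conv_lhs => rw [hu.expand v]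
  rw [inner_sum_left]
  exact Finset.sum_congr rfl fun i _ => by rw [inner_smul_left, g.symm x w]

/-- An orthonormal family as a basis. -/
def IsON.basis {g : Metric n M} {x : M} {u : Fin n → TangentSpace (𝓡 n) x} (hu : IsON g x u) :
    Module.Basis (Fin n) ℝ (TangentSpace (𝓡 n) x) :=
  Module.Basis.mk hu.linearIndependent (hu.linearIndependent.span_eq_top_of_card_eq_finrank'
    (by rw [finrank_tangentSpace, Fintype.card_fin])).ge

theorem IsON.basis_apply {g : Metric n M} {x : M} {u : Fin n → TangentSpace (𝓡 n) x}
    (hu : IsON g x u) (i : Fin n) : hu.basis i = u i := by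
  simp [IsON.basis]

theorem IsON.basis_repr {g : Metric n M} {x : M} {u : Fin n → TangentSpace (𝓡 n) x}
    (hu : IsON g x u) (v : TangentSpace (𝓡 n) x) (i : Fin n) :
    hu.basis.repr v i = g.inner x v (u i) := by
  conv_rhs => rw [← hu.basis.sum_repr v]
  simp [hu _ i, IsON.basis_apply]

/-- The standard basis of the model space, as a basis of the tangent space. -/
def stdBasis (x : M) : Module.Basis (Fin n) ℝ (TangentSpace (𝓡 n) x) :=
  (EuclideanSpace.basisFun (Fin n) ℝ).toBasis

theorem stdBasis_apply (x : M) (i : Fin n) : stdBasis x i = stdVec x i := by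
  change (EuclideanSpace.basisFun (Fin n) ℝ).toBasis i = _
  simp [stdVec]

theorem stdBasis_repr (x : M) (u : TangentSpace (𝓡 n) x) (i : Fin n) :
    (stdBasis x).repr u i = stdCoord x i u := rfl

variable {g} in
-- The trace does not depend on the basis; Ricci tensors and divergences, defined in the standard
-- basis, become sums over any orthonormal one.
theorem IsON.trace {x : M} {u : Fin n → TangentSpace (𝓡 n) x} (hu : IsON g x u)
    (L : TangentSpace (𝓡 n) x →ₗ[ℝ] TangentSpace (𝓡 n) x) :
    ∑ i, stdCoord x i (L (stdVec x i)) = ∑ a, g.inner x (L (u a)) (u a) := by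
  have h1 := LinearMap.trace_eq_matrix_trace ℝ (stdBasis x) L
  have h2 := LinearMap.trace_eq_matrix_trace ℝ hu.basis L
  rw [h1] at h2
  simpa [Matrix.trace, LinearMap.toMatrix_apply, stdBasis_apply, stdBasis_repr, IsON.basis_repr,
    IsON.basis_apply] using h2

variable {g} in
-- If `P` holds the coordinates of the orthonormal basis and G is the Gram matrix, then PᵀGP = 1,
-- hence G⁻¹ = PPᵀ.
theorem IsON.metricTrace {x : M} {u : Fin n → TangentSpace (𝓡 n) x} (hu : IsON g x u)
    {β : TangentSpace (𝓡 n) x → TangentSpace (𝓡 n) x → ℝ} (hβ : IsBilinearMap ℝ β) :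
    metricTrace g x β = ∑ a, β (u a) (u a) := by
  set P : Matrix (Fin n) (Fin n) ℝ := Matrix.of fun i a => stdCoord x i (u a) with hP
  have hexp (a : Fin n) : u a = ∑ i, P i a • stdVec x i := by
    conv_lhs => rw [← (stdBasis x).sum_repr (u a)]
    simp [stdBasis_apply, stdBasis_repr, hP]
  have hβs (v : Fin n → ℝ) (w : Fin n → ℝ) :
      β (∑ i, v i • stdVec x i) (∑ i, w i • stdVec x i) =
        ∑ i, ∑ j, v i * w j * β (stdVec x i) (stdVec x j) := by
    change hβ.toLinearMap (∑ i, v i • stdVec x i) (∑ i, w i • stdVec x i) = _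
    simp only [map_sum, LinearMap.sum_apply, map_smul, LinearMap.smul_apply, smul_eq_mul]
    rw [Finset.sum_comm]
    refine Finset.sum_congr rfl fun i _ => ?_
    rw [Finset.mul_sum]
    refine Finset.sum_congr rfl fun j _ => ?_
    change _ = v j * w i * hβ.toLinearMap (stdVec x j) (stdVec x i)
    ring
  have hG : P.transpose * gram g x * P = 1 := by
    ext a b
    have := hu a b
    have hgs : g.inner x (u a) (u b) =
        ∑ i, ∑ j, P i a * P j b * g.inner x (stdVec x i) (stdVec x j) := by
      rw [hexp a, hexp b]
      simp only [map_sum, sum_apply, map_smul, smul_apply, smul_eq_mul]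
      rw [Finset.sum_comm]
      refine Finset.sum_congr rfl fun i _ => ?_
      rw [Finset.mul_sum]
      exact Finset.sum_congr rfl fun j _ => by ring
    rw [Matrix.one_apply, ← this, hgs]
    simp only [Matrix.mul_apply, Matrix.transpose_apply, gram, Matrix.of_apply, Finset.sum_mul]
    rw [Finset.sum_comm]
    exact Finset.sum_congr rfl fun i _ => Finset.sum_congr rfl fun j _ => by ring
  have hinv : (gram g x)⁻¹ = P * P.transpose := by
    apply Matrix.inv_eq_left_inv
    have h1 : P.transpose * (gram g x * P) = 1 := by rw [← Matrix.mul_assoc, hG]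
    have h2 : gram g x * P * P.transpose = 1 := mul_eq_one_comm.1 h1
    rw [Matrix.mul_assoc] at h2
    exact mul_eq_one_comm.1 h2
  rw [HitchinLeBrun.metricTrace, hinv]
  have : ∀ a, β (u a) (u a) = ∑ i, ∑ j, P i a * P j a * β (stdVec x i) (stdVec x j) := fun a => by
    conv_lhs => rw [hexp a]
    exact hβs _ _
  simp only [this, Matrix.mul_apply, Matrix.transpose_apply, Finset.sum_mul]
  rw [Finset.sum_comm' (t' := Finset.univ) (s' := fun _ => Finset.univ) (by simp)]
  rw [Finset.sum_comm]
  conv_rhs => rw [Finset.sum_comm]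
  refine Finset.sum_congr rfl fun i _ => ?_
  rw [Finset.sum_comm]

/-- Smoothness of a family of fields on an open set. -/
def SmoothOn (U : TopologicalSpace.Opens M) (X : ∀ y : M, TangentSpace (𝓡 n) y) : Prop :=
  ∀ y ∈ U, FieldAt X y

theorem exists_smooth_basis (x : M) : ∃ U : TopologicalSpace.Opens M, x ∈ U ∧
    ∃ e : Fin n → ∀ y : M, TangentSpace (𝓡 n) y, (∀ i, SmoothOn U (e i)) ∧
      ∀ y ∈ U, LinearIndependent ℝ fun i => e i y := by
  set t := trivializationAt (EuclideanSpace ℝ (Fin n)) (TangentSpace (𝓡 n) : M → Type _) x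
  set b := (EuclideanSpace.basisFun (Fin n) ℝ).toBasis
  refine ⟨⟨t.baseSet, t.open_baseSet⟩, FiberBundle.mem_baseSet_trivializationAt _ _ x,
    t.localFrame b, fun i y hy => contMDiffAt_localFrame_of_mem ∞ t b i hy, fun y hy => ?_⟩
  exact (t.isLocalFrameOn_localFrame_baseSet (𝓡 n) ∞ b).linearIndependent hy

theorem FieldAt.normalize {X : ∀ y : M, TangentSpace (𝓡 n) y} {x : M} (hX : FieldAt X x)
    (h : 0 < g.inner x (X x) (X x)) :
    FieldAt (fun y => (√(g.inner y (X y) (X y)))⁻¹ • X y) x := by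
  refine FieldAt.smul ?_ hX
  have h1 : FunAt (n := n) (fun y => g.inner y (X y) (X y)) x := hX.inner g hX
  have h2 : ContDiffAt ℝ ∞ (fun r : ℝ => (√r)⁻¹) (g.inner x (X x) (X x)) :=
    (Real.contDiffAt_sqrt h.ne').inv (Real.sqrt_pos.2 h).ne'
  exact ContDiffAt.comp_contMDiffAt (f := fun y => g.inner y (X y) (X y)) h2 h1

/-- Extension of an orthonormal family by one field. -/
theorem exists_extend_on {m : ℕ} (hm : m < n) {U : TopologicalSpace.Opens M} {x : M} (hx : x ∈ U)
    (u : ℕ → ∀ y : M, TangentSpace (𝓡 n) y) (hu : ∀ i < m, SmoothOn U (u i))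
    (hon : ∀ y ∈ U, IsON g y fun i : Fin m => u i y) :
    ∃ V : TopologicalSpace.Opens M, V ≤ U ∧ x ∈ V ∧ ∃ v : ∀ y : M, TangentSpace (𝓡 n) y,
      SmoothOn V v ∧ ∀ y ∈ V, g.inner y (v y) (v y) = 1 ∧
        ∀ i : Fin m, g.inner y (u i y) (v y) = 0 := by
  obtain ⟨U₀, hx₀, e, he, hli⟩ := exists_smooth_basis (n := n) x
  -- By dimension, `m < n` vectors cannot span all vectors of a basis.
  obtain ⟨k, hk⟩ : ∃ k, e k x ∉ Submodule.span ℝ (Set.range fun i : Fin m => u i x) := by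
    by_contra! hcon
    have h1 : Submodule.span ℝ (Set.range fun i => e i x) ≤
        Submodule.span ℝ (Set.range fun i : Fin m => u i x) :=
      Submodule.span_le.2 (by rintro _ ⟨i, rfl⟩; exact hcon i)
    have h2 := Submodule.finrank_mono h1
    rw [finrank_span_eq_card (hli x hx₀), Fintype.card_fin] at h2
    have h3 := finrank_range_le_card (R := ℝ) (fun i : Fin m => u i x)
    rw [Fintype.card_fin, Set.finrank] at h3
    omega
  -- One step of the Gram-Schmidt process; the new field stays nonzero near `x` by continuity.
  set w : ∀ y : M, TangentSpace (𝓡 n) y := fun y =>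
    e k y - ∑ i : Fin m, g.inner y (e k y) (u i y) • u i y with hw
  have hwS : ∀ y ∈ U ⊓ U₀, FieldAt w y := fun y hy =>
    (he k y hy.2).sub (FieldAt.sum fun i _ =>
      FieldAt.smul ((he k y hy.2).inner g (hu i i.2 y hy.1)) (hu i i.2 y hy.1))
  have hw0 : w x ≠ 0 := fun h0 => hk <| by
    rw [sub_eq_zero.1 h0]
    exact Submodule.sum_mem _ fun i _ => Submodule.smul_mem _ _ (Submodule.subset_span ⟨i, rfl⟩)
  have hcont : ContinuousOn (fun y => g.inner y (w y) (w y)) (U ⊓ U₀ : TopologicalSpace.Opens M) :=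
    fun y hy => ((hwS y hy).inner g (hwS y hy)).continuousAt.continuousWithinAt
  refine ⟨⟨(U ⊓ U₀ : TopologicalSpace.Opens M) ∩ (fun y => g.inner y (w y) (w y)) ⁻¹' Set.Ioi 0,
    hcont.isOpen_inter_preimage (U ⊓ U₀).isOpen isOpen_Ioi⟩, fun y hy => hy.1.1,
    ⟨⟨hx, hx₀⟩, g.pos x _ hw0⟩, fun y => (√(g.inner y (w y) (w y)))⁻¹ • w y,
    fun y hy => (hwS y hy.1).normalize g hy.2, fun y hy => ⟨?_, fun i => ?_⟩⟩
  · have hp : 0 < g.inner y (w y) (w y) := hy.2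
    rw [inner_smul_left, map_smul, smul_eq_mul, ← mul_assoc, ← mul_inv,
      Real.mul_self_sqrt hp.le, inv_mul_cancel₀ hp.ne']
  · have h0 : g.inner y (w y) (u i y) = 0 := by
      rw [hw, inner_sub_left, inner_sum_left]
      simp [hon y hy.1.1 _ i]
    rw [map_smul, g.symm y (u i y) (w y), h0, smul_zero]

/-- Every orthonormal family of fields extends, locally, to an orthonormal frame. -/
theorem exists_extend_frame {m : ℕ} (hm : m ≤ n) {U : TopologicalSpace.Opens M} {x : M} (hx : x ∈ U)
    (u : ℕ → ∀ y : M, TangentSpace (𝓡 n) y) (hu : ∀ i < m, SmoothOn U (u i))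
    (hon : ∀ y ∈ U, IsON g y fun i : Fin m => u i y) :
    ∃ V : TopologicalSpace.Opens M, V ≤ U ∧ x ∈ V ∧ ∃ v : ℕ → ∀ y : M, TangentSpace (𝓡 n) y,
      (∀ i < m, v i = u i) ∧ (∀ i < n, SmoothOn V (v i)) ∧
        ∀ y ∈ V, IsON g y fun i : Fin n => v i y := by
  induction hk : n - m generalizing m U u with
  | zero =>
    obtain rfl : m = n := by omega
    exact ⟨U, le_rfl, hx, u, fun _ _ => rfl, hu, hon⟩
  | succ k ih =>
    obtain ⟨V, hVU, hxV, v, hv, hvu⟩ := exists_extend_on g (by omega : m < n) hx u hu hon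
    obtain ⟨V', hV', hxV', v', h1, h2, h3⟩ := ih (by omega : m + 1 ≤ n) hxV (Function.update u m v)
      (fun i hi => by
        rcases Nat.lt_succ_iff_lt_or_eq.1 hi with h | rfl
        · rw [Function.update_of_ne h.ne]
          exact fun y hy => hu i h y (hVU hy)
        · rwa [Function.update_self])
      (fun y hy i j => by
        have hh (i : Fin (m + 1)) : i = Fin.last m ∨ ∃ k : Fin m, i = k.castSucc := by
          rcases Fin.eq_castSucc_or_eq_last i with ⟨k, h⟩ | h
          · exact .inr ⟨k, h⟩
          · exact .inl h
        have hne (k : Fin m) : Function.update u m v (k : ℕ) = u k :=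
          Function.update_of_ne k.2.ne _ _
        rcases hh i with rfl | ⟨i, rfl⟩ <;> rcases hh j with rfl | ⟨j, rfl⟩
        · simp [(hvu y hy).1]
        · have := (hvu y hy).2 j
          rw [g.symm] at this
          simp [hne, this, (Fin.castSucc_lt_last j).ne']
        · have := (hvu y hy).2 i
          simp [hne, this, (Fin.castSucc_lt_last i).ne]
        · have := hon y (hVU hy) i j
          simp [hne, this]) (by omega)
    refine ⟨V', hV'.trans hVU, hxV', v', fun i hi => ?_, h2, h3⟩
    rw [h1 i (by omega), Function.update_of_ne hi.ne]

theorem exists_frame (x : M) :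
    ∃ U : TopologicalSpace.Opens M, x ∈ U ∧ ∃ u : Fin n → Vec n U, ∀ y ∈ U, IsON g y fun i => u i y := by
  obtain ⟨V, -, hx, v, -, hv, hon⟩ := exists_extend_frame g (Nat.zero_le n)
    (U := ⊤) (x := x) trivial (fun _ _ => 0) (by simp) (fun _ _ i => i.elim0)
  exact ⟨V, hx, fun i => ⟨v i, hv i i.2⟩, hon⟩

end Frames

/-! ### Tensoriality of the curvature. -/

section Curvature
variable {n : ℕ} {M : Type*} [TopologicalSpace M] [ChartedSpace (EuclideanSpace ℝ (Fin n)) M]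
  [IsManifold (𝓡 n) ∞ M]

theorem FieldAt.eventually_diff {X : ∀ y : M, TangentSpace (𝓡 n) y} {x : M} (hX : FieldAt X x) :
    ∀ᶠ y in 𝓝 x, DiffAt X y := by
  have h1 : ContMDiffAt (𝓡 n) (𝓡 n).tangent 1
      (fun y => (⟨y, X y⟩ : TangentBundle (𝓡 n) M)) x := hX.of_le (by simp)
  exact ((contMDiffAt_iff_contMDiffAt_nhds (by simp)).1 h1).mono fun y hy =>
    hy.mdifferentiableAt (by simp)

theorem FunAt.eventually_diff {f : M → ℝ} {x : M} (hf : FunAt (n := n) f x) :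
    ∀ᶠ y in 𝓝 x, MDifferentiableAt (𝓡 n) 𝓘(ℝ, ℝ) f y := by
  have h1 : ContMDiffAt (𝓡 n) 𝓘(ℝ, ℝ) 1 f x := hf.of_le (by simp)
  exact ((contMDiffAt_iff_contMDiffAt_nhds (by simp)).1 h1).mono fun y hy =>
    hy.mdifferentiableAt (by simp)

variable (g : Metric n M) {lee : ∀ x : M, TangentSpace (𝓡 n) x →L[ℝ] ℝ}

theorem FunAt.koszul (hlee : SmoothOneForm lee) {X Y Z : ∀ y : M, TangentSpace (𝓡 n) y} {x : M}
    (hX : FieldAt X x) (hY : FieldAt Y x) (hZ : FieldAt Z x) :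
    FunAt (n := n) (fun y => koszul g lee y Y X Z) x := by
  have c : FunAt (n := n) (fun _ : M => (2 : ℝ)) x := contMDiffAt_const
  have h1 := contMDiffAt_mvfderiv_apply (hY.inner g hZ) hX
  have h2 := contMDiffAt_mvfderiv_apply (hX.inner g hZ) hY
  have h3 := contMDiffAt_mvfderiv_apply (hX.inner g hY) hZ
  have l1 := ((c.mul (hX.oneForm hlee)).mul (hY.inner g hZ))
  have l2 := ((c.mul (hY.oneForm hlee)).mul (hX.inner g hZ))
  have l3 := ((c.mul (hZ.oneForm hlee)).mul (hX.inner g hY))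
  exact (((((h1.add l1).add (h2.add l2)).sub (h3.add l3)).add
    ((hX.mlieBracket hY).inner g hZ)).sub ((hX.mlieBracket hZ).inner g hY)).sub
    ((hY.mlieBracket hZ).inner g hX)

/-- A connection which maps smooth fields to smooth fields. -/
def SmoothConn (D : Connection n M) : Prop :=
  ∀ ⦃X Y : ∀ y : M, TangentSpace (𝓡 n) y⦄ ⦃x : M⦄, FieldAt X x → FieldAt Y x →
    FieldAt (fun y => D Y y (X y)) x

/-- In an orthonormal frame the coefficients of the derivative are Koszul expressions in smooth
fields. -/
theorem IsWeylConnection.smooth {D : Connection n M} (hlee : SmoothOneForm lee)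
    (hD : IsWeylConnection g lee D) : SmoothConn D := by
  intro X Y x hX hY
  obtain ⟨U, hx, u, hu⟩ := exists_frame g x
  have hs : FieldAt (fun y => ∑ i, (1 / 2 * HitchinLeBrun.koszul g lee y Y X (u i)) • u i y) x :=
    FieldAt.sum fun i _ => FieldAt.smul
      (f := fun y => 1 / 2 * HitchinLeBrun.koszul g lee y Y X (u i))
      (contMDiffAt_const.mul (FunAt.koszul g hlee hX hY ((u i).smooth x hx))) ((u i).smooth x hx)
  refine hs.congr ?_
  filter_upwards [hX.eventually_diff, hY.eventually_diff, U.isOpen.mem_nhds hx] with y h1 h2 hy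
  conv_lhs => rw [(hu y hy).expand (D Y y (X y))]
  exact Finset.sum_congr rfl fun i _ => by
    rw [hD.koszul g lee h1 h2 ((u i).smooth y hy).mdiff]

theorem smoothOneForm_zero : SmoothOneForm (fun x : M => (0 : TangentSpace (𝓡 n) x →L[ℝ] ℝ)) :=
  fun x => by
    have := contMDiff_zeroSection (IB := 𝓡 n) (n := ∞) ℝ
      (F := EuclideanSpace ℝ (Fin n) →L[ℝ] ℝ) (fun x : M => TangentSpace (𝓡 n) x →L[ℝ] ℝ)
    exact this x

theorem IsLeviCivita.smooth {D : Connection n M} (hD : IsLeviCivita g D) : SmoothConn D :=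
  IsWeylConnection.smooth g smoothOneForm_zero hD

variable {A : Type*} [AddCommGroup A] [Module ℝ A]

/-- Linearity of an operation on fields over the germs of smooth functions at a point. -/
structure SmoothTensorialAt (Φ : (∀ y : M, TangentSpace (𝓡 n) y) → A) (x : M) : Prop where
  smul : ∀ ⦃f : M → ℝ⦄ ⦃X : ∀ y : M, TangentSpace (𝓡 n) y⦄, FunAt (n := n) f x → FieldAt X x →
    Φ (fun y => f y • X y) = f x • Φ X
  add : ∀ ⦃X Y : ∀ y : M, TangentSpace (𝓡 n) y⦄, FieldAt X x → FieldAt Y x →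
    Φ (fun y => X y + Y y) = Φ X + Φ Y

/-- No bump function is needed: the indicator function of the set where the two fields agree equals
1 near `x`, so it is smooth at `x`, and multiplying by it makes the two fields equal everywhere. -/
theorem SmoothTensorialAt.congr {Φ : (∀ y : M, TangentSpace (𝓡 n) y) → A} {x : M}
    (hΦ : SmoothTensorialAt Φ x) {X Y : ∀ y : M, TangentSpace (𝓡 n) y} (hX : FieldAt X x)
    (hY : FieldAt Y x) (h : ∀ᶠ y in 𝓝 x, X y = Y y) : Φ X = Φ Y := by
  classical
  let ψ (y : M) : ℝ := if X y = Y y then 1 else 0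
  have hψx : ψ x = 1 := by simp [ψ, h.self_of_nhds]
  have he : (fun y => ψ y • X y) = fun y => ψ y • Y y := by
    ext y : 1
    dsimp [ψ]
    split_ifs with hy <;> simp [hy]
  have hψ : FunAt (n := n) ψ x :=
    (contMDiffAt_const (c := (1 : ℝ))).congr_of_eventuallyEq (h.mono fun y hy => by simp [ψ, hy])
  have h1 := hΦ.smul hψ hX
  rw [he, hΦ.smul hψ hY, hψx, one_smul, one_smul] at h1
  exact h1.symm

theorem SmoothTensorialAt.sum {Φ : (∀ y : M, TangentSpace (𝓡 n) y) → A} {x : M}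
    (hΦ : SmoothTensorialAt Φ x) {ι : Type*} (s : Finset ι)
    {X : ι → ∀ y : M, TangentSpace (𝓡 n) y} (hX : ∀ i, FieldAt (X i) x) :
    Φ (fun y => ∑ i ∈ s, X i y) = ∑ i ∈ s, Φ (X i) := by
  classical
  induction s using Finset.induction_on with
  | empty =>
    have hz : FieldAt (fun y : M => (0 : TangentSpace (𝓡 n) y)) x := by
      have := FieldAt.sum (n := n) (x := x) (s := (∅ : Finset ℕ)) (X := fun _ _ => 0) (by simp)
      simpa using this
    have := hΦ.smul (f := fun _ => (0 : ℝ)) contMDiffAt_const hz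
    simpa using this
  | insert a s ha ih =>
    simp only [Finset.sum_insert ha, ← ih]
    exact hΦ.add (hX a) (FieldAt.sum fun i _ => hX i)

include g in
-- Expansion in a local frame shows that the value only involves the coefficients at `x`. The metric
-- serves to provide the frame.
theorem SmoothTensorialAt.pointwise {Φ : (∀ y : M, TangentSpace (𝓡 n) y) → A} {x : M}
    (hΦ : SmoothTensorialAt Φ x) {X Y : ∀ y : M, TangentSpace (𝓡 n) y} (hX : FieldAt X x)
    (hY : FieldAt Y x) (h : X x = Y x) : Φ X = Φ Y := by
  obtain ⟨U, hx, u, hu⟩ := exists_frame g x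
  have key : ∀ Z : ∀ y : M, TangentSpace (𝓡 n) y, FieldAt Z x →
      Φ Z = ∑ i, g.inner x (Z x) (u i x) • Φ (u i) := fun Z hZ => by
    have h1 : ∀ i, FieldAt (fun y => g.inner y (Z y) (u i y) • u i y) x := fun i =>
      FieldAt.smul (hZ.inner g ((u i).smooth x hx)) ((u i).smooth x hx)
    rw [hΦ.congr hZ (FieldAt.sum fun i (_ : i ∈ Finset.univ) => h1 i)
      (by filter_upwards [U.isOpen.mem_nhds hx] with y hy using (hu y hy).expand (Z y)),
      hΦ.sum _ h1]
    exact Finset.sum_congr rfl fun i _ =>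
      hΦ.smul (hZ.inner g ((u i).smooth x hx)) ((u i).smooth x hx)
  rw [key X hX, key Y hY, h]

theorem conn_congr (D : Connection n M) {X Y : ∀ y : M, TangentSpace (𝓡 n) y} {x : M}
    (hX : DiffAt X x) (hY : DiffAt Y x) (h : ∀ᶠ y in 𝓝 x, X y = Y y) : D X x = D Y x :=
  D.isCovariantDerivativeOn.congr_of_eventuallyEq hX hY Filter.univ_mem h

theorem conn_add (D : Connection n M) {X Y : ∀ y : M, TangentSpace (𝓡 n) y} {x : M}
    (hX : DiffAt X x) (hY : DiffAt Y x) : D (fun y => X y + Y y) x = D X x + D Y x :=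
  D.isCovariantDerivativeOn.add hX hY

theorem conn_smul (D : Connection n M) {f : M → ℝ} {X : ∀ y : M, TangentSpace (𝓡 n) y} {x : M}
    (hf : MDifferentiableAt (𝓡 n) 𝓘(ℝ, ℝ) f x) (hX : DiffAt X x) (u : TangentSpace (𝓡 n) x) :
    D (fun y => f y • X y) x u = f x • D X x u + mvfderiv (𝓡 n) f x u • X x := by
  have := D.isCovariantDerivativeOn.leibniz hX hf (x := x)
  exact congrArg (fun L : TangentSpace (𝓡 n) x →L[ℝ] TangentSpace (𝓡 n) x => L u) this

/-- The curvature expression on vector fields. -/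
def curvFields (D : Connection n M) (X Y Z : ∀ y : M, TangentSpace (𝓡 n) y) (x : M) :
    TangentSpace (𝓡 n) x :=
  D (fun y => D Z y (Y y)) x (X x) - D (fun y => D Z y (X y)) x (Y x)
    - D Z x (mlieBracket (𝓡 n) X Y x)

theorem curvFields_swap (D : Connection n M) (X Y Z : ∀ y : M, TangentSpace (𝓡 n) y) (x : M) :
    curvFields D X Y Z x = -curvFields D Y X Z x := by
  rw [curvFields, curvFields, mlieBracket_swap_apply, map_neg]
  abel

variable {D : Connection n M} (hD : SmoothConn D)
include hD

theorem curvFields_tensorial_left {Y Z : ∀ y : M, TangentSpace (𝓡 n) y} {x : M}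
    (_hY : FieldAt Y x) (hZ : FieldAt Z x) :
    SmoothTensorialAt (fun X => curvFields D X Y Z x) x where
  smul f X hf hX := by
    simp only [curvFields, map_smul]
    rw [conn_smul D hf.mdiff (hD hX hZ).mdiff]
    have := mlieBracket_smul_left (W := Y) hf.mdiff hX.mdiff
    change mlieBracket (𝓡 n) (fun y => f y • X y) Y x = _ at this
    rw [this, map_add, map_smul, map_smul]
    simp only [smul_sub, neg_smul]
    abel
  add X X' hX hX' := by
    simp only [curvFields, map_add]
    rw [conn_add D (hD hX hZ).mdiff (hD hX' hZ).mdiff]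
    have := mlieBracket_add_left (W := Y) hX.mdiff hX'.mdiff
    change mlieBracket (𝓡 n) (fun y => X y + X' y) Y x = _ at this
    rw [this, map_add, add_apply]
    abel

theorem curvFields_tensorial_middle {X Z : ∀ y : M, TangentSpace (𝓡 n) y} {x : M}
    (hX : FieldAt X x) (hZ : FieldAt Z x) :
    SmoothTensorialAt (fun Y => curvFields D X Y Z x) x where
  smul f Y hf hY := by
    rw [curvFields_swap, curvFields_swap D X, (curvFields_tensorial_left hD hX hZ).smul hf hY,
      smul_neg]
  add Y Y' hY hY' := by
    rw [curvFields_swap, curvFields_swap D X, curvFields_swap D X,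
      (curvFields_tensorial_left hD hX hZ).add hY hY', neg_add]

/-- The second derivatives of the factor `f` form X(Yf) - Y(Xf) - [X, Y]f, which vanishes by
`mvfderiv_mlieBracket`. -/
theorem curvFields_tensorial_right {X Y : ∀ y : M, TangentSpace (𝓡 n) y} {x : M}
    (hX : FieldAt X x) (hY : FieldAt Y x) :
    SmoothTensorialAt (fun Z => curvFields D X Y Z x) x where
  smul f Z hf hZ := by
    have key : ∀ X Y : ∀ y : M, TangentSpace (𝓡 n) y, FieldAt X x → FieldAt Y x →
        D (fun y => D (fun z => f z • Z z) y (Y y)) x (X x) =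
          f x • D (fun y => D Z y (Y y)) x (X x) + mvfderiv (𝓡 n) f x (X x) • D Z x (Y x) +
          (mvfderiv (𝓡 n) f x (Y x) • D Z x (X x) +
            mvfderiv (𝓡 n) (fun y => mvfderiv (𝓡 n) f y (Y y)) x (X x) • Z x) :=
        fun X Y hX hY => by
      have h1 : FieldAt (fun y => f y • D Z y (Y y)) x := FieldAt.smul hf (hD hY hZ)
      have h2f := contMDiffAt_mvfderiv_apply hf hY
      have h2 : FieldAt (fun y => mvfderiv (𝓡 n) f y (Y y) • Z y) x := FieldAt.smul h2f hZ
      rw [conn_congr D (hD hY (FieldAt.smul hf hZ)).mdiff (h1.add h2).mdiff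
        (by filter_upwards [hf.eventually_diff, hZ.eventually_diff] with y h3 h4 using
          conn_smul D h3 h4 (Y y)), conn_add D h1.mdiff h2.mdiff, add_apply,
        conn_smul D hf.mdiff (hD hY hZ).mdiff, conn_smul D (FunAt.mdiff h2f) hZ.mdiff]
    simp only [curvFields]
    rw [key X Y hX hY, key Y X hY hX, conn_smul D hf.mdiff hZ.mdiff, mvfderiv_mlieBracket hf hX hY]
    simp only [smul_sub, sub_smul]
    abel
  add Z Z' hZ hZ' := by
    have key : ∀ X Y : ∀ y : M, TangentSpace (𝓡 n) y, FieldAt X x → FieldAt Y x →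
        D (fun y => D (fun z => Z z + Z' z) y (Y y)) x (X x) =
          D (fun y => D Z y (Y y)) x (X x) + D (fun y => D Z' y (Y y)) x (X x) :=
        fun X Y hX hY => by
      rw [conn_congr D (hD hY (hZ.add hZ')).mdiff ((hD hY hZ).add (hD hY hZ')).mdiff
        (by
            filter_upwards [hZ.eventually_diff, hZ'.eventually_diff] with y h3 h4
            rw [conn_add D h3 h4, add_apply]), conn_add D (hD hY hZ).mdiff (hD hY hZ').mdiff,
        add_apply]
    simp only [curvFields]
    rw [key X Y hX hY, key Y X hY hX, conn_add D hZ.mdiff hZ'.mdiff, add_apply]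
    abel

include g in
-- `curvature` is defined through particular extensions of three tangent vectors; tensoriality
-- allows any smooth fields instead, in particular frame fields.
theorem curvature_eq {X Y Z : ∀ y : M, TangentSpace (𝓡 n) y} {x : M}
    (hX : FieldAt X x) (hY : FieldAt Y x) (hZ : FieldAt Z x) :
    curvature D x (X x) (Y x) (Z x) = curvFields D X Y Z x := by
  have hs (u : TangentSpace (𝓡 n) x) := extend_apply_self (F := EuclideanSpace ℝ (Fin n)) u
  have h0 : curvature D x (X x) (Y x) (Z x) =
      curvFields D (extend (EuclideanSpace ℝ (Fin n)) (X x))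
        (extend (EuclideanSpace ℝ (Fin n)) (Y x)) (extend (EuclideanSpace ℝ (Fin n)) (Z x)) x := by
    simp only [curvature, curvFields, hs]
  rw [h0, (curvFields_tensorial_left hD (fieldAt_extend _) (fieldAt_extend _)).pointwise g
      (fieldAt_extend _) hX (hs _),
    (curvFields_tensorial_middle hD hX (fieldAt_extend _)).pointwise g (fieldAt_extend _) hY (hs _),
    (curvFields_tensorial_right hD hX hY).pointwise g (fieldAt_extend _) hZ (hs _)]

include g in
theorem curvature_isTrilinear (x : M) :
    (∀ v w, IsLinearMap ℝ fun u => curvature D x u v w) ∧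
    (∀ u w, IsLinearMap ℝ fun v => curvature D x u v w) ∧
    (∀ u v, IsLinearMap ℝ fun w => curvature D x u v w) := by
  have hs (u : TangentSpace (𝓡 n) x) := extend_apply_self (F := EuclideanSpace ℝ (Fin n)) u
  have hf := fun u : TangentSpace (𝓡 n) x => fieldAt_extend u
  have h0 (u v w : TangentSpace (𝓡 n) x) : curvature D x u v w =
      curvFields D (extend (EuclideanSpace ℝ (Fin n)) u)
        (extend (EuclideanSpace ℝ (Fin n)) v) (extend (EuclideanSpace ℝ (Fin n)) w) x := by
    simp only [curvature, curvFields, hs]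
  refine ⟨fun v w => ⟨fun a b => ?_, fun c a => ?_⟩, fun u w => ⟨fun a b => ?_, fun c a => ?_⟩,
    fun u v => ⟨fun a b => ?_, fun c a => ?_⟩⟩ <;> simp only [h0]
  · rw [← (curvFields_tensorial_left hD (hf v) (hf w)).add (hf a) (hf b)]
    exact (curvFields_tensorial_left hD (hf v) (hf w)).pointwise g (hf _) ((hf a).add (hf b))
      (by simp)
  · rw [← (curvFields_tensorial_left hD (hf v) (hf w)).smul (f := fun _ => c) contMDiffAt_const
      (hf a)]
    exact (curvFields_tensorial_left hD (hf v) (hf w)).pointwise g (hf _)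
      (FieldAt.smul contMDiffAt_const (hf a)) (by simp)
  · rw [← (curvFields_tensorial_middle hD (hf u) (hf w)).add (hf a) (hf b)]
    exact (curvFields_tensorial_middle hD (hf u) (hf w)).pointwise g (hf _) ((hf a).add (hf b))
      (by simp)
  · rw [← (curvFields_tensorial_middle hD (hf u) (hf w)).smul (f := fun _ => c) contMDiffAt_const
      (hf a)]
    exact (curvFields_tensorial_middle hD (hf u) (hf w)).pointwise g (hf _)
      (FieldAt.smul contMDiffAt_const (hf a)) (by simp)
  · rw [← (curvFields_tensorial_right hD (hf u) (hf v)).add (hf a) (hf b)]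
    exact (curvFields_tensorial_right hD (hf u) (hf v)).pointwise g (hf _) ((hf a).add (hf b))
      (by simp)
  · rw [← (curvFields_tensorial_right hD (hf u) (hf v)).smul (f := fun _ => c) contMDiffAt_const
      (hf a)]
    exact (curvFields_tensorial_right hD (hf u) (hf v)).pointwise g (hf _)
      (FieldAt.smul contMDiffAt_const (hf a)) (by simp)

include g in
theorem ricci_eq_sum {x : M} {u : Fin n → TangentSpace (𝓡 n) x} (hu : IsON g x u)
    (v w : TangentSpace (𝓡 n) x) :
    ricci D x v w = ∑ a, g.inner x (curvature D x (u a) v w) (u a) :=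
  hu.trace (((curvature_isTrilinear g hD x).1 v w).mk' _)

include g in
theorem ricci_isBilinear (x : M) : IsBilinearMap ℝ (ricci D x) := by
  obtain ⟨-, h2, h3⟩ := curvature_isTrilinear g hD x
  have hc (i : Fin n) (u v : TangentSpace (𝓡 n) x) :
      stdCoord x i (u + v) = stdCoord x i u + stdCoord x i v := rfl
  have hm (i : Fin n) (c : ℝ) (v : TangentSpace (𝓡 n) x) :
      stdCoord x i (c • v) = c * stdCoord x i v := rfl
  refine ⟨fun a b w => ?_, fun c a w => ?_, fun v a b => ?_, fun c v a => ?_⟩ <;>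
    simp only [ricci, smul_eq_mul, Finset.mul_sum, ← Finset.sum_add_distrib] <;>
    refine Finset.sum_congr rfl fun i _ => ?_
  · rw [(h2 _ _).map_add, hc]
  · rw [(h2 _ _).map_smul, hm]
  · rw [(h3 _ _).map_add, hc]
  · rw [(h3 _ _).map_smul, hm]

theorem scalarCurv_eq_sum {x : M} {u : Fin n → TangentSpace (𝓡 n) x} (hu : IsON g x u) :
    scalarCurv g D x = ∑ a, ricci D x (u a) (u a) :=
  hu.metricTrace (ricci_isBilinear g hD x)

end Curvature

/-! ### Covariant calculus with frames, inside the ring of functions of an open set. -/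

section FrameCalculus
variable {n : ℕ} {M : Type*} [TopologicalSpace M] [ChartedSpace (EuclideanSpace ℝ (Fin n)) M]
  [IsManifold (𝓡 n) ∞ M] {U : TopologicalSpace.Opens M}

theorem Vec.diff (X : Vec n U) (x : U) : DiffAt X.toFun (x : M) := (X.smooth x x.2).mdiff

theorem Vec.d_eq (X : Vec n U) (F : M → ℝ) (hF : ∀ x ∈ U, FunAt (n := n) F x) (f : Fn n U)
    (h : ∀ x : U, f.1 x = F x) (x : U) : (X.d f).1 x = mvfderiv (𝓡 n) F (x : M) (X.toFun x) := by
  have : f = Fn.of F hF := Fn.ext h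
  rw [this, Vec.d_of]
  rfl

theorem Vec.d_ip (g : Metric n M) (X Y Z : Vec n U) (x : U) :
    (X.d (Y.ip g Z)).1 x =
      mvfderiv (𝓡 n) (fun y => g.inner y (Y.toFun y) (Z.toFun y)) (x : M) (X.toFun x) :=
  Vec.d_eq X _ (fun y hy => (Y.smooth y hy).inner g (Z.smooth y hy)) _ (fun _ => rfl) x

/-- The covariant derivative of a vector field on an open set. -/
def Vec.nab {D : Connection n M} (hD : SmoothConn D) (X Y : Vec n U) : Vec n U :=
  ⟨fun y => D Y.toFun y (X.toFun y), fun x hx => hD (X.smooth x hx) (Y.smooth x hx)⟩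

variable {g : Metric n M} {lee : ∀ x : M, TangentSpace (𝓡 n) x →L[ℝ] ℝ} {D : Connection n M}

theorem IsWeylConnection.d_ip (hW : IsWeylConnection g lee D) (hlee : SmoothOneForm lee)
    (hD : SmoothConn D) (X Y Z : Vec n U) :
    X.d (Y.ip g Z) = (X.nab hD Y).ip g Z + Y.ip g (X.nab hD Z)
      - 2 * X.form lee hlee * Y.ip g Z := by
  refine Fn.ext fun x => ?_
  rw [Vec.d_ip, hW.compatible x _ _ _ (Y.diff x) (Z.diff x)]
  rfl

theorem IsWeylConnection.br_ip (hW : IsWeylConnection g lee D) (hD : SmoothConn D)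
    (X Y Z : Vec n U) : (X.br Y).ip g Z = (X.nab hD Y).ip g Z - (Y.nab hD X).ip g Z := by
  refine Fn.ext fun x => ?_
  have := hW.torsion_apply g lee (X.diff x) (Y.diff x)
  rw [Fn.sub_apply, Vec.ip_apply, Vec.ip_apply, Vec.ip_apply, ← inner_sub_left]
  exact congrArg (fun v => g.inner (x : M) v (Z.toFun x)) this.symm

theorem IsWeylConnection.koszul_ip (hW : IsWeylConnection g lee D) (hlee : SmoothOneForm lee)
    (hD : SmoothConn D) (X Y Z : Vec n U) :
    2 * (X.nab hD Y).ip g Z = X.d (Y.ip g Z) + Y.d (X.ip g Z) - Z.d (X.ip g Y)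
      + (X.br Y).ip g Z - (X.br Z).ip g Y - (Y.br Z).ip g X
      + 2 * X.form lee hlee * Y.ip g Z + 2 * Y.form lee hlee * X.ip g Z
      - 2 * Z.form lee hlee * X.ip g Y := by
  rw [hW.d_ip hlee hD, hW.d_ip hlee hD, hW.d_ip hlee hD, hW.br_ip hD, hW.br_ip hD, hW.br_ip hD,
    Vec.ip_comm g Y (X.nab hD Z), Vec.ip_comm g X (Y.nab hD Z), Vec.ip_comm g X (Z.nab hD Y)]
  ring

theorem form_zero (X : Vec n U) : X.form _ (smoothOneForm_zero (n := n) (M := M)) = 0 := rfl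

theorem IsLeviCivita.koszul_ip (hW : IsLeviCivita g D) (hD : SmoothConn D) (X Y Z : Vec n U) :
    2 * (X.nab hD Y).ip g Z = X.d (Y.ip g Z) + Y.d (X.ip g Z) - Z.d (X.ip g Y)
      + (X.br Y).ip g Z - (X.br Z).ip g Y - (Y.br Z).ip g X := by
  rw [IsWeylConnection.koszul_ip hW smoothOneForm_zero hD, form_zero, form_zero, form_zero]
  ring

theorem IsLeviCivita.d_ip (hW : IsLeviCivita g D) (hD : SmoothConn D) (X Y Z : Vec n U) :
    X.d (Y.ip g Z) = (X.nab hD Y).ip g Z + Y.ip g (X.nab hD Z) := by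
  rw [IsWeylConnection.d_ip hW smoothOneForm_zero hD, form_zero]
  ring

theorem IsLeviCivita.br_ip (hW : IsLeviCivita g D) (hD : SmoothConn D) (X Y Z : Vec n U) :
    (X.br Y).ip g Z = (X.nab hD Y).ip g Z - (Y.nab hD X).ip g Z :=
  IsWeylConnection.br_ip hW hD X Y Z

/-- A frame of an open set, orthonormal at each point. -/
abbrev FrameON (g : Metric n M) (u : Fin n → Vec n U) : Prop :=
  ∀ x ∈ U, IsON g x fun i => (u i).toFun x

theorem FrameON.ip {u : Fin n → Vec n U} (hu : FrameON g u) (i j : Fin n) :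
    (u i).ip g (u j) = if i = j then 1 else 0 := by
  refine Fn.ext fun x => ?_
  rw [Vec.ip_apply, hu x x.2 i j]
  split_ifs <;> rfl

theorem FrameON.ip_eq {u : Fin n → Vec n U} (hu : FrameON g u) (X Y : Vec n U) :
    X.ip g Y = ∑ i, X.ip g (u i) * Y.ip g (u i) := by
  refine Fn.ext fun x => ?_
  rw [Vec.ip_apply, (hu x x.2).inner_eq]
  simp [Vec.ip_apply]

/-- The curvature applied to vector fields on an open set. -/
def Vec.curv (hD : SmoothConn D) (X Y Z : Vec n U) : Vec n U :=
  ⟨fun y => (X.nab hD (Y.nab hD Z)).toFun y - (Y.nab hD (X.nab hD Z)).toFun y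
      - ((X.br Y).nab hD Z).toFun y, fun x hx =>
    (((X.nab hD (Y.nab hD Z)).smooth x hx).sub ((Y.nab hD (X.nab hD Z)).smooth x hx)).sub
      (((X.br Y).nab hD Z).smooth x hx)⟩

theorem Vec.curv_apply (g : Metric n M) (hD : SmoothConn D) (X Y Z : Vec n U) (x : U) :
    (Vec.curv hD X Y Z).toFun x =
      curvature D (x : M) (X.toFun x) (Y.toFun x) (Z.toFun x) := by
  rw [curvature_eq g hD (X.smooth x x.2) (Y.smooth x x.2) (Z.smooth x x.2)]
  rfl

theorem Vec.curv_ip (hD : SmoothConn D) (X Y Z W : Vec n U) :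
    (Vec.curv hD X Y Z).ip g W = (X.nab hD (Y.nab hD Z)).ip g W - (Y.nab hD (X.nab hD Z)).ip g W
      - ((X.br Y).nab hD Z).ip g W := by
  refine Fn.ext fun x => ?_
  rw [Fn.sub_apply, Fn.sub_apply, Vec.ip_apply, Vec.ip_apply, Vec.ip_apply, Vec.ip_apply]
  simp only [Vec.curv, inner_sub_left]

/-- Skew-symmetry of the connection form in an orthonormal frame, up to the `1`-form. -/
theorem IsWeylConnection.frame_skew (hW : IsWeylConnection g lee D) (hlee : SmoothOneForm lee)
    (hD : SmoothConn D) {u : Fin n → Vec n U} (hu : FrameON g u) (X : Vec n U) (b c : Fin n) :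
    (X.nab hD (u b)).ip g (u c) + (X.nab hD (u c)).ip g (u b) =
      if b = c then 2 * X.form lee hlee else 0 := by
  have h := hW.d_ip hlee hD X (u b) (u c)
  have h0 : X.d ((u b).ip g (u c)) = 0 := by
    rw [hu.ip]
    split_ifs
    · exact X.d.map_one_eq_zero
    · exact X.d.map_zero
  rw [h0, hu.ip, Vec.ip_comm g (u b)] at h
  split_ifs at h ⊢ <;> linear_combination -h

/-- Cartan's second structure equation. The connection matrix is skew only up to the Lee form on its
diagonal, and the extra term cancels the one in the derivative of the inner product. -/
theorem IsWeylConnection.curv_frame (hW : IsWeylConnection g lee D) (hlee : SmoothOneForm lee)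
    (hD : SmoothConn D) {u : Fin n → Vec n U} (hu : FrameON g u) (X Y : Vec n U) (b c : Fin n) :
    (Vec.curv hD X Y (u b)).ip g (u c) =
      X.d ((Y.nab hD (u b)).ip g (u c)) - Y.d ((X.nab hD (u b)).ip g (u c))
      - ((X.br Y).nab hD (u b)).ip g (u c)
      + ∑ d, ((Y.nab hD (u b)).ip g (u d) * (X.nab hD (u d)).ip g (u c)
        - (X.nab hD (u b)).ip g (u d) * (Y.nab hD (u d)).ip g (u c)) := by
  have key (X Y : Vec n U) : (X.nab hD (Y.nab hD (u b))).ip g (u c) =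
      X.d ((Y.nab hD (u b)).ip g (u c))
        + ∑ d, (Y.nab hD (u b)).ip g (u d) * (X.nab hD (u d)).ip g (u c) := by
    have h1 := hW.d_ip hlee hD X (Y.nab hD (u b)) (u c)
    have h2 : (Y.nab hD (u b)).ip g (X.nab hD (u c)) =
        2 * X.form lee hlee * (Y.nab hD (u b)).ip g (u c) -
        ∑ d, (Y.nab hD (u b)).ip g (u d) * (X.nab hD (u d)).ip g (u c) := by
      have h3 (d : Fin n) : (X.nab hD (u c)).ip g (u d) =
          (if c = d then 2 * X.form lee hlee else 0) - (X.nab hD (u d)).ip g (u c) :=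
        eq_sub_of_add_eq (hW.frame_skew hlee hD hu X c d)
      rw [hu.ip_eq]
      simp only [h3, mul_sub, Finset.sum_sub_distrib, mul_ite, mul_zero, Finset.sum_ite_eq,
        Finset.mem_univ, if_true]
      ring
    linear_combination -h1 - h2
  rw [Vec.curv_ip, key X Y, key Y X, Finset.sum_sub_distrib]
  ring

/-- A `Vec` also has irrelevant values outside `U`, so expansions of vector fields are kept as
pointwise identities on `U` and used only after pairing with another field. -/
theorem Vec.nab_ip_congr (hD : SmoothConn D) {X : Vec n U} {ι : Type*} [Fintype ι]
    {c : ι → Fn n U} {V : ι → Vec n U}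
    (h : ∀ x : U, X.toFun x = ∑ i, (c i).1 x • (V i).toFun x) (Y Z : Vec n U) :
    (X.nab hD Y).ip g Z = ∑ i, c i * ((V i).nab hD Y).ip g Z := by
  refine Fn.ext fun x => ?_
  have : (∑ i, c i * ((V i).nab hD Y).ip g Z).1 x =
      ∑ i, (c i).1 x * (((V i).nab hD Y).ip g Z).1 x := by
    simp
  rw [this, Vec.ip_apply]
  change g.inner (x : M) (D Y.toFun x (X.toFun x)) _ = _
  rw [h x, map_sum, inner_sum_left]
  exact Finset.sum_congr rfl fun i _ => by rw [map_smul, inner_smul_left]; rfl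

theorem Vec.ip_congr {X : Vec n U} {ι : Type*} [Fintype ι]
    {c : ι → Fn n U} {V : ι → Vec n U}
    (h : ∀ x : U, X.toFun x = ∑ i, (c i).1 x • (V i).toFun x) (Z : Vec n U) :
    X.ip g Z = ∑ i, c i * (V i).ip g Z := by
  refine Fn.ext fun x => ?_
  have : (∑ i, c i * (V i).ip g Z).1 x = ∑ i, (c i).1 x * ((V i).ip g Z).1 x := by simp
  rw [this, Vec.ip_apply, h x, inner_sum_left]
  exact Finset.sum_congr rfl fun i _ => by rw [inner_smul_left]; rfl

theorem Vec.d_congr {X : Vec n U} {ι : Type*} [Fintype ι] {c : ι → Fn n U} {V : ι → Vec n U}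
    (h : ∀ x : U, X.toFun x = ∑ i, (c i).1 x • (V i).toFun x) (f : Fn n U) :
    X.d f = ∑ i, c i * (V i).d f := by
  refine Fn.ext fun x => ?_
  have : (∑ i, c i * (V i).d f).1 x = ∑ i, (c i).1 x * ((V i).d f).1 x := by simp
  rw [this, Vec.d_apply, h x, map_sum]
  exact Finset.sum_congr rfl fun i _ => by rw [map_smul, smul_eq_mul]; rfl

theorem FrameON.br_expand {u : Fin n → Vec n U} (hu : FrameON g u) (X : Vec n U) (x : U) :
    X.toFun x = ∑ i, (X.ip g (u i)).1 x • (u i).toFun x :=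
  (hu x x.2).expand _

end FrameCalculus

/-! ### Symmetries of the curvature tensor. -/

section Symmetries
variable {n : ℕ} {M : Type*} [TopologicalSpace M] [ChartedSpace (EuclideanSpace ℝ (Fin n)) M]
  [IsManifold (𝓡 n) ∞ M] {g : Metric n M} {lee : ∀ x : M, TangentSpace (𝓡 n) x →L[ℝ] ℝ}
  {D : Connection n M}

theorem curvature_swap (D : Connection n M) (x : M) (u v w : TangentSpace (𝓡 n) x) :
    curvature D x u v w = -curvature D x v u w := by
  simp only [curvature]
  rw [mlieBracket_swap_apply, map_neg]
  abel

/-- Vanishing torsion replaces each difference of second covariant derivatives by the derivative of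
a bracket; the cyclic sum then becomes the Jacobi identity. -/
theorem IsWeylConnection.curvature_bianchi (hW : IsWeylConnection g lee D) (hD : SmoothConn D)
    (x : M) (u v w : TangentSpace (𝓡 n) x) :
    curvature D x u v w + curvature D x v w u + curvature D x w u v = 0 := by
  set X := extend (EuclideanSpace ℝ (Fin n)) u
  set Y := extend (EuclideanSpace ℝ (Fin n)) v
  set Z := extend (EuclideanSpace ℝ (Fin n)) w
  have hX : FieldAt X x := fieldAt_extend u
  have hY : FieldAt Y x := fieldAt_extend v
  have hZ : FieldAt Z x := fieldAt_extend w
  have hu : X x = u := extend_apply_self ..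
  have hv : Y x = v := extend_apply_self ..
  have hw : Z x = w := extend_apply_self ..
  rw [← hu, ← hv, ← hw, curvature_eq g hD hX hY hZ, curvature_eq g hD hY hZ hX,
    curvature_eq g hD hZ hX hY]
  have key : ∀ X Y Z : ∀ y : M, TangentSpace (𝓡 n) y, FieldAt X x → FieldAt Y x → FieldAt Z x →
      D (fun y => D Z y (Y y)) x (X x) - D (fun y => D Y y (Z y)) x (X x) =
        D (mlieBracket (𝓡 n) Y Z) x (X x) := fun X Y Z hX hY hZ => by
    have h1 : D (fun y => D Z y (Y y)) x =
        D (fun y => D Y y (Z y) + mlieBracket (𝓡 n) Y Z y) x := by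
      refine conn_congr D (hD hY hZ).mdiff ((hD hZ hY).add (hY.mlieBracket hZ)).mdiff ?_
      filter_upwards [hY.eventually_diff, hZ.eventually_diff] with y h1 h2
      rw [← hW.torsion_apply g lee h1 h2]
      abel
    rw [h1, conn_add D (hD hZ hY).mdiff (hY.mlieBracket hZ).mdiff, add_apply]
    abel
  have jac : ∀ X Y Z : ∀ y : M, TangentSpace (𝓡 n) y, FieldAt X x → FieldAt Y x → FieldAt Z x →
      D (mlieBracket (𝓡 n) Y Z) x (X x) - D X x (mlieBracket (𝓡 n) Y Z x) =
        mlieBracket (𝓡 n) X (mlieBracket (𝓡 n) Y Z) x := fun X Y Z hX hY hZ =>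
    hW.torsion_apply g lee hX.mdiff (hY.mlieBracket hZ).mdiff
  have hm : minSmoothness ℝ 2 ≤ ∞ := by simpa using ENat.LEInfty.out
  have : IsManifold (𝓡 n) (minSmoothness ℝ 3) M :=
    IsManifold.of_le (n := ∞) (by simpa using ENat.LEInfty.out)
  have hj := leibniz_identity_mlieBracket_apply (hX.of_le hm) (hY.of_le hm) (hZ.of_le hm)
  have h1 := key X Y Z hX hY hZ
  have h2 := key Y Z X hY hZ hX
  have h3 := key Z X Y hZ hX hY
  have j1 := jac X Y Z hX hY hZ
  have j2 := jac Y Z X hY hZ hX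
  have j3 := jac Z X Y hZ hX hY
  have e1 : mlieBracket (𝓡 n) (mlieBracket (𝓡 n) X Y) Z x =
      -mlieBracket (𝓡 n) Z (mlieBracket (𝓡 n) X Y) x := mlieBracket_swap_apply
  have e2 : mlieBracket (𝓡 n) Y (mlieBracket (𝓡 n) X Z) x =
      -mlieBracket (𝓡 n) Y (mlieBracket (𝓡 n) Z X) x := by
    have h4 := hW.torsion_apply g lee hY.mdiff (hX.mlieBracket hZ).mdiff
    have h5 := hW.torsion_apply g lee hY.mdiff (hZ.mlieBracket hX).mdiff
    rw [← h4, ← h5]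
    have h6 : D (mlieBracket (𝓡 n) X Z) x = -D (mlieBracket (𝓡 n) Z X) x := by
      have h7 := D.isCovariantDerivativeOn.smul_const (-1) (hZ.mlieBracket hX).mdiff (x := x)
      rw [mlieBracket_swap (V := X)]
      simpa using h7
    rw [h6, mlieBracket_swap_apply (V := X) (W := Z), map_neg, neg_apply]
    abel
  simp only [curvFields]
  rw [e1, e2] at hj
  have : mlieBracket (𝓡 n) X (mlieBracket (𝓡 n) Y Z) x +
      mlieBracket (𝓡 n) Y (mlieBracket (𝓡 n) Z X) x +
      mlieBracket (𝓡 n) Z (mlieBracket (𝓡 n) X Y) x = 0 := by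
    rw [hj]; abel
  rw [← this, ← j1, ← j2, ← j3, ← h1, ← h2, ← h3]
  abel

/-- In an orthonormal frame the connection matrix is skew, so the structure equation gives a skew
curvature matrix. The general case follows by linearity, one argument at a time. -/
theorem IsLeviCivita.curvature_skew (hW : IsLeviCivita g D)
    (x : M) (u v w z : TangentSpace (𝓡 n) x) :
    g.inner x (curvature D x u v w) z = -g.inner x (curvature D x u v z) w := by
  have hD := hW.smooth g
  obtain ⟨U, hx, e, he⟩ := exists_frame g x
  have hlin := curvature_isTrilinear g hD x
  have hb (X Y : Vec n U) (b c : Fin n) : (Vec.curv hD X Y (e b)).ip g (e c) =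
      -(Vec.curv hD X Y (e c)).ip g (e b) := by
    have hW' : IsWeylConnection g (fun _ => 0) D := hW
    rw [hW'.curv_frame smoothOneForm_zero hD he, hW'.curv_frame smoothOneForm_zero hD he]
    have sk : ∀ (X : Vec n U) (b c : Fin n), (X.nab hD (e b)).ip g (e c) =
        -(X.nab hD (e c)).ip g (e b) := fun X b c => by
      have := hW'.frame_skew smoothOneForm_zero hD he X b c
      rw [form_zero, mul_zero, ite_self] at this
      exact eq_neg_of_add_eq_zero_left this
    rw [sk Y b c, sk X b c, sk (X.br Y) b c, map_neg, map_neg]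
    have : ∑ d, ((Y.nab hD (e b)).ip g (e d) * (X.nab hD (e d)).ip g (e c)
        - (X.nab hD (e b)).ip g (e d) * (Y.nab hD (e d)).ip g (e c)) =
        -∑ d, ((Y.nab hD (e c)).ip g (e d) * (X.nab hD (e d)).ip g (e b)
        - (X.nab hD (e c)).ip g (e d) * (Y.nab hD (e d)).ip g (e b)) := by
      rw [← Finset.sum_neg_distrib]
      refine Finset.sum_congr rfl fun d _ => ?_
      rw [sk Y b d, sk X d c, sk X b d, sk Y d c]
      ring
    rw [this]
    ring
  have hon := he x hx
  have hfr (b c a d : Fin n) : g.inner x (curvature D x (e a x) (e d x) (e b x)) (e c x) =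
      -g.inner x (curvature D x (e a x) (e d x) (e c x)) (e b x) := by
    have := congrArg (fun f : Fn n U => f.1 ⟨x, hx⟩) (hb (e a) (e d) b c)
    have hc (b : Fin n) : (Vec.curv hD (e a) (e d) (e b)).toFun x =
        curvature D x (e a x) (e d x) (e b x) := Vec.curv_apply g hD (e a) (e d) (e b) ⟨x, hx⟩
    rw [← hc, ← hc]
    exact this
  have step1 : ∀ (L : TangentSpace (𝓡 n) x →ₗ[ℝ] TangentSpace (𝓡 n) x),
      (∀ b c, g.inner x (L (e b x)) (e c x) = -g.inner x (L (e c x)) (e b x)) →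
      ∀ w z, g.inner x (L w) z = -g.inner x (L z) w := fun L hL w z => by
    rw [hon.expand w, hon.expand z]
    simp only [map_sum, map_smul, sum_apply, smul_apply,
      smul_eq_mul, Finset.mul_sum]
    rw [Finset.sum_comm, ← Finset.sum_neg_distrib]
    refine Finset.sum_congr rfl fun i _ => ?_
    rw [← Finset.sum_neg_distrib]
    refine Finset.sum_congr rfl fun j _ => ?_
    rw [hL]
    ring
  have step2 : ∀ a d w z, g.inner x (curvature D x (e a x) (e d x) w) z =
      -g.inner x (curvature D x (e a x) (e d x) z) w := fun a d =>
    step1 ((hlin.2.2 (e a x) (e d x)).mk' _) fun b c => hfr b c a d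
  have step3 : ∀ a v w z, g.inner x (curvature D x (e a x) v w) z =
      -g.inner x (curvature D x (e a x) v z) w := fun a v w z => by
    have h1 : ∀ w, curvature D x (e a x) v w =
        ∑ d, g.inner x v (e d x) • curvature D x (e a x) (e d x) w := fun w => by
      conv_lhs => rw [hon.expand v]
      exact (map_sum ((hlin.2.1 (e a x) w).mk' _) _ _).trans
        (Finset.sum_congr rfl fun d _ => (hlin.2.1 (e a x) w).map_smul _ _)
    rw [h1, h1, inner_sum_left, inner_sum_left, ← Finset.sum_neg_distrib]
    exact Finset.sum_congr rfl fun d _ => by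
      rw [inner_smul_left, inner_smul_left, step2]; ring
  have h1 : ∀ w, curvature D x u v w =
      ∑ d, g.inner x u (e d x) • curvature D x (e d x) v w := fun w => by
    conv_lhs => rw [hon.expand u]
    exact (map_sum ((hlin.1 v w).mk' _) _ _).trans
      (Finset.sum_congr rfl fun d _ => (hlin.1 v w).map_smul _ _)
  rw [h1, h1, inner_sum_left, inner_sum_left, ← Finset.sum_neg_distrib]
  exact Finset.sum_congr rfl fun d _ => by
    rw [inner_smul_left, inner_smul_left, step3]; ring

/-- The octahedron argument: four instances of the first Bianchi identity, combined by means of the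
two skew symmetries. -/
theorem IsLeviCivita.curvature_pair (hW : IsLeviCivita g D)
    (x : M) (u v w z : TangentSpace (𝓡 n) x) :
    g.inner x (curvature D x u v w) z = g.inner x (curvature D x w z u) v := by
  have hD := hW.smooth g
  have B : ∀ u v w z : TangentSpace (𝓡 n) x, g.inner x (curvature D x u v w) z +
      g.inner x (curvature D x v w u) z + g.inner x (curvature D x w u v) z = 0 :=
    fun u v w z => by
      rw [← inner_add_left, ← inner_add_left,
        IsWeylConnection.curvature_bianchi (lee := fun _ => 0) hW hD, map_zero]
      rfl
  have S : ∀ u v w z : TangentSpace (𝓡 n) x, g.inner x (curvature D x u v w) z =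
      -g.inner x (curvature D x v u w) z := fun u v w z => by
    rw [curvature_swap, map_neg, neg_apply]
  have K := hW.curvature_skew x
  linarith [B u v w z, B v w z u, B w z u v, B z u v w, S u v w z, S v w u z, S w u v z,
    K v w z u, K z v w u, S z v w u, K w z v u, K w z u v, S u w z v, K z u w v, K u w z v,
    S u v z w, K u v w z, K v z u w, S v z u w, K z u v w, S w z u v, K v w u z, K w u v z,
    S z u w v, S z v u w, K z v u w, S u w v z, K u w v z, K z u v w, S w z v u, S v w z u,
    K u v z w, S z u v w]

end Symmetries

/-! ### Exterior derivative of a 1-form. -/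

section ExtDeriv
variable {n : ℕ} {M : Type*} [TopologicalSpace M] [ChartedSpace (EuclideanSpace ℝ (Fin n)) M]
  [IsManifold (𝓡 n) ∞ M]

/-- A field of linear forms which is smooth at a point, when evaluated on smooth fields. -/
structure FormAt (α : ∀ x : M, TangentSpace (𝓡 n) x → ℝ) (x : M) : Prop where
  linear : ∀ y, IsLinearMap ℝ (α y)
  smooth : ∀ ⦃X : ∀ y : M, TangentSpace (𝓡 n) y⦄, FieldAt X x →
    FunAt (n := n) (fun y => α y (X y)) x

/-- The exterior derivative on vector fields. -/
def extFields (α : ∀ x : M, TangentSpace (𝓡 n) x → ℝ) (X Y : ∀ y : M, TangentSpace (𝓡 n) y)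
    (x : M) : ℝ :=
  mvfderiv (𝓡 n) (fun y => α y (Y y)) x (X x) - mvfderiv (𝓡 n) (fun y => α y (X y)) x (Y x)
    - α x (mlieBracket (𝓡 n) X Y x)

variable {α : ∀ x : M, TangentSpace (𝓡 n) x → ℝ} {x : M} (hα : FormAt α x)
include hα

theorem extFields_tensorial_left {Y : ∀ y : M, TangentSpace (𝓡 n) y} (_hY : FieldAt Y x) :
    SmoothTensorialAt (fun X => extFields α X Y x) x where
  smul f X hf hX := by
    have h1 : (fun y => α y (f y • X y)) = f * fun y => α y (X y) :=
      funext fun y => (hα.linear y).map_smul _ _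
    have h2 := mlieBracket_smul_left (W := Y) hf.mdiff hX.mdiff
    change mlieBracket (𝓡 n) (fun y => f y • X y) Y x = _ at h2
    simp only [extFields]
    rw [h1, h2, mvfderiv_mul hf.mdiff (FunAt.mdiff (hα.smooth hX)), (hα.linear x).map_add,
      (hα.linear x).map_smul, (hα.linear x).map_smul]
    simp
    ring
  add X X' hX hX' := by
    have h1 : (fun y => α y (X y + X' y)) = (fun y => α y (X y)) + fun y => α y (X' y) :=
      funext fun y => (hα.linear y).map_add _ _
    have h2 := mlieBracket_add_left (W := Y) hX.mdiff hX'.mdiff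
    change mlieBracket (𝓡 n) (fun y => X y + X' y) Y x = _ at h2
    simp only [extFields]
    rw [h1, h2, mvfderiv_add (FunAt.mdiff (hα.smooth hX)) (FunAt.mdiff (hα.smooth hX')),
      (hα.linear x).map_add]
    simp
    ring

theorem extFields_swap (X Y : ∀ y : M, TangentSpace (𝓡 n) y) :
    extFields α X Y x = -extFields α Y X x := by
  simp only [extFields]
  rw [mlieBracket_swap_apply, (hα.linear x).map_neg]
  ring

theorem extFields_tensorial_right {X : ∀ y : M, TangentSpace (𝓡 n) y} (hX : FieldAt X x) :
    SmoothTensorialAt (fun Y => extFields α X Y x) x where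
  smul f Y hf hY := by
    rw [extFields_swap hα, extFields_swap hα X, (extFields_tensorial_left hα hX).smul hf hY,
      smul_neg]
  add Y Y' hY hY' := by
    rw [extFields_swap hα, extFields_swap hα X, extFields_swap hα X,
      (extFields_tensorial_left hα hX).add hY hY', neg_add]

/-- The definition uses particular extensions of two vectors; any smooth fields give the same value,
as for the curvature. Forms are plain functions here, because the Lee form of the minimal Weyl
derivative is not given as a continuous linear map. -/
theorem extDerivOne_eq (g : Metric n M) {X Y : ∀ y : M, TangentSpace (𝓡 n) y} (hX : FieldAt X x)
    (hY : FieldAt Y x) : extDerivOne α x (X x) (Y x) = extFields α X Y x := by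
  have hs (u : TangentSpace (𝓡 n) x) := extend_apply_self (F := EuclideanSpace ℝ (Fin n)) u
  have h0 : extDerivOne α x (X x) (Y x) = extFields α (extend (EuclideanSpace ℝ (Fin n)) (X x))
      (extend (EuclideanSpace ℝ (Fin n)) (Y x)) x := by
    simp only [extDerivOne, extFields, hs]
  rw [h0, (extFields_tensorial_left hα (fieldAt_extend _)).pointwise g (fieldAt_extend _) hX (hs _),
    (extFields_tensorial_right hα hX).pointwise g (fieldAt_extend _) hY (hs _)]

theorem extDerivOne_isBilinear (g : Metric n M) : IsBilinearMap ℝ (extDerivOne α x) := by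
  have hs (u : TangentSpace (𝓡 n) x) := extend_apply_self (F := EuclideanSpace ℝ (Fin n)) u
  have hf := fun u : TangentSpace (𝓡 n) x => fieldAt_extend u
  have h0 (u v : TangentSpace (𝓡 n) x) : extDerivOne α x u v =
      extFields α (extend (EuclideanSpace ℝ (Fin n)) u) (extend (EuclideanSpace ℝ (Fin n)) v) x := by
    simp only [extDerivOne, extFields, hs]
  refine ⟨fun a b v => ?_, fun c a v => ?_, fun u a b => ?_, fun c u a => ?_⟩ <;> simp only [h0]
  · rw [← (extFields_tensorial_left hα (hf v)).add (hf a) (hf b)]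
    exact (extFields_tensorial_left hα (hf v)).pointwise g (hf _) ((hf a).add (hf b)) (by simp)
  · rw [← (extFields_tensorial_left hα (hf v)).smul (f := fun _ => c) contMDiffAt_const (hf a)]
    exact (extFields_tensorial_left hα (hf v)).pointwise g (hf _)
      (FieldAt.smul contMDiffAt_const (hf a)) (by simp)
  · rw [← (extFields_tensorial_right hα (hf u)).add (hf a) (hf b)]
    exact (extFields_tensorial_right hα (hf u)).pointwise g (hf _) ((hf a).add (hf b)) (by simp)
  · rw [← (extFields_tensorial_right hα (hf u)).smul (f := fun _ => c) contMDiffAt_const (hf a)]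
    exact (extFields_tensorial_right hα (hf u)).pointwise g (hf _)
      (FieldAt.smul contMDiffAt_const (hf a)) (by simp)

theorem extDerivOne_swap (u v : TangentSpace (𝓡 n) x) :
    extDerivOne α x u v = -extDerivOne α x v u := by
  simp only [extDerivOne]
  rw [mlieBracket_swap_apply, (hα.linear x).map_neg]
  ring

omit hα

theorem SmoothOneForm.formAt {α : ∀ x : M, TangentSpace (𝓡 n) x →L[ℝ] ℝ} (hα : SmoothOneForm α)
    (x : M) : FormAt (fun y => α y) x :=
  ⟨fun y => (α y).toLinearMap.isLinear, fun _ hX => hX.oneForm hα⟩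

/-- Evaluation of a field of linear forms on vector fields of an open set. -/
def Vec.ev {U : TopologicalSpace.Opens M} {α : ∀ x : M, TangentSpace (𝓡 n) x → ℝ}
    (hα : ∀ x ∈ U, FormAt α x) (X : Vec n U) : Fn n U :=
  Fn.of (fun y => α y (X.toFun y)) fun x hx => (hα x hx).smooth (X.smooth x hx)

theorem extDerivOne_vec {U : TopologicalSpace.Opens M} {α : ∀ x : M, TangentSpace (𝓡 n) x → ℝ}
    (hα : ∀ x ∈ U, FormAt α x) (g : Metric n M) (X Y : Vec n U) (x : U) :
    extDerivOne α (x : M) (X.toFun x) (Y.toFun x) =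
      (X.d (Y.ev hα) - Y.d (X.ev hα) - (X.br Y).ev hα).1 x := by
  rw [extDerivOne_eq (hα x x.2) g (X.smooth x x.2) (Y.smooth x x.2), Fn.sub_apply, Fn.sub_apply,
    Vec.d_eq X (fun y => α y (Y.toFun y)) (fun y hy => (hα y hy).smooth (Y.smooth y hy)) _
      (fun _ => rfl) x,
    Vec.d_eq Y (fun y => α y (X.toFun y)) (fun y hy => (hα y hy).smooth (X.smooth y hy)) _
      (fun _ => rfl) x]
  rfl

end ExtDeriv

/-! ### Star operators in oriented orthonormal bases. -/

section Star

theorem bilinear_ext {V ι : Type*} [AddCommGroup V] [Module ℝ V] (b : Module.Basis ι ℝ V)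
    {β β' : V → V → ℝ} (hβ : IsBilinearMap ℝ β) (hβ' : IsBilinearMap ℝ β')
    (h : ∀ i j, β (b i) (b j) = β' (b i) (b j)) (u v : V) : β u v = β' u v := by
  have : hβ.toLinearMap = hβ'.toLinearMap := b.ext fun i => b.ext fun j => h i j
  exact congrArg (fun L : V →ₗ[ℝ] V →ₗ[ℝ] ℝ => L u v) this

variable {V : Type*} [AddCommGroup V] [Module ℝ V]

theorem alt3_swap01 (η : AlternatingMap ℝ V ℝ (Fin 3)) (a b c : V) :
    η ![b, a, c] = -η ![a, b, c] := by
  rw [← η.map_swap ![a, b, c] (show (0 : Fin 3) ≠ 1 by decide)]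
  congr 1
  ext i
  fin_cases i <;> rfl

theorem alt3_swap12 (η : AlternatingMap ℝ V ℝ (Fin 3)) (a b c : V) :
    η ![a, c, b] = -η ![a, b, c] := by
  rw [← η.map_swap ![a, b, c] (show (1 : Fin 3) ≠ 2 by decide)]
  congr 1
  ext i
  fin_cases i <;> rfl

theorem alt3_isLinear0 (η : AlternatingMap ℝ V ℝ (Fin 3)) (b c : V) :
    IsLinearMap ℝ fun a => η ![a, b, c] :=
  ⟨fun _ _ => η.map_vecCons_add _ _ _, fun _ _ => η.map_vecCons_smul _ _ _⟩

theorem alt3_isLinear1 (η : AlternatingMap ℝ V ℝ (Fin 3)) (b c : V) :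
    IsLinearMap ℝ fun a => η ![b, a, c] := by
  simp only [fun a => alt3_swap01 η a b c]
  exact ⟨fun a a' => by rw [(alt3_isLinear0 η b c).map_add, neg_add],
    fun r a => by rw [(alt3_isLinear0 η b c).map_smul, smul_neg]⟩

theorem alt3_isLinear2 (η : AlternatingMap ℝ V ℝ (Fin 3)) (b c : V) :
    IsLinearMap ℝ fun a => η ![b, c, a] := by
  simp only [fun a => alt3_swap12 η b a c]
  exact ⟨fun a a' => by rw [(alt3_isLinear1 η b c).map_add, neg_add],
    fun r a => by rw [(alt3_isLinear1 η b c).map_smul, smul_neg]⟩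

theorem alt4_swap01 (η : AlternatingMap ℝ V ℝ (Fin 4)) (a b c d : V) :
    η ![b, a, c, d] = -η ![a, b, c, d] := by
  rw [← η.map_swap ![a, b, c, d] (show (0 : Fin 4) ≠ 1 by decide)]
  congr 1
  ext i
  fin_cases i <;> rfl

theorem alt4_swap12 (η : AlternatingMap ℝ V ℝ (Fin 4)) (a b c d : V) :
    η ![a, c, b, d] = -η ![a, b, c, d] := by
  rw [← η.map_swap ![a, b, c, d] (show (1 : Fin 4) ≠ 2 by decide)]
  congr 1
  ext i
  fin_cases i <;> rfl

theorem alt4_swap23 (η : AlternatingMap ℝ V ℝ (Fin 4)) (a b c d : V) :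
    η ![a, b, d, c] = -η ![a, b, c, d] := by
  rw [← η.map_swap ![a, b, c, d] (show (2 : Fin 4) ≠ 3 by decide)]
  congr 1
  ext i
  fin_cases i <;> rfl

theorem alt4_isLinear0 (η : AlternatingMap ℝ V ℝ (Fin 4)) (b c d : V) :
    IsLinearMap ℝ fun a => η ![a, b, c, d] :=
  ⟨fun _ _ => η.map_vecCons_add _ _ _, fun _ _ => η.map_vecCons_smul _ _ _⟩

theorem alt4_isLinear1 (η : AlternatingMap ℝ V ℝ (Fin 4)) (b c d : V) :
    IsLinearMap ℝ fun a => η ![b, a, c, d] := by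
  simp only [fun a => alt4_swap01 η a b c d]
  exact ⟨fun a a' => by rw [(alt4_isLinear0 η b c d).map_add, neg_add],
    fun r a => by rw [(alt4_isLinear0 η b c d).map_smul, smul_neg]⟩

theorem alt4_isLinear2 (η : AlternatingMap ℝ V ℝ (Fin 4)) (b c d : V) :
    IsLinearMap ℝ fun a => η ![b, c, a, d] := by
  simp only [fun a => alt4_swap12 η b a c d]
  exact ⟨fun a a' => by rw [(alt4_isLinear1 η b c d).map_add, neg_add],
    fun r a => by rw [(alt4_isLinear1 η b c d).map_smul, smul_neg]⟩

theorem alt4_isLinear3 (η : AlternatingMap ℝ V ℝ (Fin 4)) (b c d : V) :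
    IsLinearMap ℝ fun a => η ![b, c, d, a] := by
  simp only [fun a => alt4_swap23 η b c a d]
  exact ⟨fun a a' => by rw [(alt4_isLinear2 η b c d).map_add, neg_add],
    fun r a => by rw [(alt4_isLinear2 η b c d).map_smul, smul_neg]⟩

theorem alt4_eq_zero (η : AlternatingMap ℝ V ℝ (Fin 4)) (a b c : V) :
    η ![a, a, b, c] = 0 ∧ η ![a, b, a, c] = 0 ∧ η ![a, b, c, a] = 0 ∧ η ![b, a, a, c] = 0 ∧
      η ![b, a, c, a] = 0 ∧ η ![b, c, a, a] = 0 :=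
  ⟨η.map_eq_zero_of_eq _ (i := 0) (j := 1) rfl (by decide),
    η.map_eq_zero_of_eq _ (i := 0) (j := 2) rfl (by decide),
    η.map_eq_zero_of_eq _ (i := 0) (j := 3) rfl (by decide),
    η.map_eq_zero_of_eq _ (i := 1) (j := 2) rfl (by decide),
    η.map_eq_zero_of_eq _ (i := 1) (j := 3) rfl (by decide),
    η.map_eq_zero_of_eq _ (i := 2) (j := 3) rfl (by decide)⟩

theorem alt3_eq_zero (η : AlternatingMap ℝ V ℝ (Fin 3)) (a b : V) :
    η ![a, a, b] = 0 ∧ η ![a, b, a] = 0 ∧ η ![b, a, a] = 0 :=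
  ⟨η.map_eq_zero_of_eq _ (i := 0) (j := 1) rfl (by decide),
    η.map_eq_zero_of_eq _ (i := 0) (j := 2) rfl (by decide),
    η.map_eq_zero_of_eq _ (i := 1) (j := 2) rfl (by decide)⟩

section Three
variable {B : Type*} [TopologicalSpace B] [ChartedSpace (EuclideanSpace ℝ (Fin 3)) B]
  [IsManifold (𝓡 3) ∞ B] {h : Metric 3 B}

theorem star3_eq_sum {x : B} {e : Fin 3 → TangentSpace (𝓡 3) x} (he : IsON h x e)
    (vol : ∀ x : B, AlternatingMap ℝ (TangentSpace (𝓡 3) x) ℝ (Fin 3))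
    {F : TangentSpace (𝓡 3) x → TangentSpace (𝓡 3) x → ℝ} (hF : IsBilinearMap ℝ F)
    (u : TangentSpace (𝓡 3) x) :
    star3 h vol x F u = 1 / 2 * ∑ a, ∑ b, F (e a) (e b) * vol x ![e b, e a, u] := by
  have h1 (a a' : TangentSpace (𝓡 3) x) :
      metricTrace h x (fun b b' => F a b * vol x ![b', a', u]) =
        ∑ b, F a (e b) * vol x ![e b, a', u] :=
    he.metricTrace ⟨fun _ _ _ => by rw [hF.add_right, add_mul],
      fun _ _ _ => by rw [hF.smul_right, smul_eq_mul, smul_eq_mul, mul_assoc],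
      fun _ _ _ => by rw [(alt3_isLinear0 (vol x) _ _).map_add, mul_add],
      fun _ _ _ => by rw [(alt3_isLinear0 (vol x) _ _).map_smul]; simp; ring⟩
  rw [star3]
  simp only [h1]
  rw [he.metricTrace]
  refine ⟨fun _ _ _ => ?_, fun _ _ _ => ?_, fun _ _ _ => ?_, fun _ _ _ => ?_⟩ <;>
    simp only [smul_eq_mul, Finset.mul_sum, ← Finset.sum_add_distrib] <;>
    refine Finset.sum_congr rfl fun i _ => ?_
  · rw [hF.add_left, add_mul]
  · rw [hF.smul_left, smul_eq_mul, mul_assoc]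
  · rw [(alt3_isLinear1 (vol x) _ _).map_add, mul_add]
  · rw [(alt3_isLinear1 (vol x) _ _).map_smul]; simp; ring

/-- The minus sign comes from the convention *(e₁ ∧ e₂) = vol(e₂, e₁, ·). It is responsible for the
sign of F in `IsHLCoordinate`. -/
theorem star3_apply {x : B} {e : Fin 3 → TangentSpace (𝓡 3) x} (he : IsON h x e)
    (vol : ∀ x : B, AlternatingMap ℝ (TangentSpace (𝓡 3) x) ℝ (Fin 3))
    (hvol : vol x ![e 0, e 1, e 2] = 1)
    {F : TangentSpace (𝓡 3) x → TangentSpace (𝓡 3) x → ℝ} (hF : IsBilinearMap ℝ F)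
    (hs : ∀ u v, F u v = -F v u) (l : Fin 3) :
    star3 h vol x F (e l) = -F (e (l + 1)) (e (l + 2)) := by
  rw [star3_eq_sum he vol hF]
  have z := alt3_eq_zero (vol x)
  have v1 : vol x ![e 1, e 2, e 0] = 1 := by
    rw [alt3_swap12 (vol x) (e 1) (e 0) (e 2), alt3_swap01 (vol x) (e 0), hvol]; ring
  have v2 : vol x ![e 2, e 0, e 1] = 1 := by
    rw [alt3_swap01 (vol x) (e 0), alt3_swap12 (vol x) (e 0) (e 1), hvol]; ring
  have w0 : vol x ![e 1, e 0, e 2] = -1 := by rw [alt3_swap01 (vol x) (e 0), hvol]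
  have w1 : vol x ![e 2, e 1, e 0] = -1 := by rw [alt3_swap01 (vol x) (e 1), v1]
  have w2 : vol x ![e 0, e 2, e 1] = -1 := by rw [alt3_swap12 (vol x) (e 0) (e 1), hvol]
  have s (i j : Fin 3) := hs (e i) (e j)
  fin_cases l <;>
    simp [Fin.sum_univ_three, (z _ _).1, (z _ _).2.1, (z _ _).2.2, hvol, v1, v2, w0, w1, w2] <;>
    [rw [s 2 1]; rw [s 2 0]; rw [s 1 0]] <;> ring

theorem star3_isLinear {x : B} {e : Fin 3 → TangentSpace (𝓡 3) x} (he : IsON h x e)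
    (vol : ∀ x : B, AlternatingMap ℝ (TangentSpace (𝓡 3) x) ℝ (Fin 3))
    {F : TangentSpace (𝓡 3) x → TangentSpace (𝓡 3) x → ℝ} (hF : IsBilinearMap ℝ F) :
    IsLinearMap ℝ (star3 h vol x F) := by
  refine ⟨fun u v => ?_, fun c u => ?_⟩ <;> simp only [star3_eq_sum he vol hF]
  · simp only [(alt3_isLinear2 (vol x) _ _).map_add, mul_add, Finset.sum_add_distrib]
  · simp only [(alt3_isLinear2 (vol x) _ _).map_smul, smul_eq_mul, Finset.mul_sum]
    exact Finset.sum_congr rfl fun _ _ => Finset.sum_congr rfl fun _ _ => by ring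

end Three

section Four
variable {M : Type*} [TopologicalSpace M] [ChartedSpace (EuclideanSpace ℝ (Fin 4)) M]
  [IsManifold (𝓡 4) ∞ M] {g : Metric 4 M}

theorem star4_eq_sum {x : M} {e : Fin 4 → TangentSpace (𝓡 4) x} (he : IsON g x e)
    (vol : ∀ x : M, AlternatingMap ℝ (TangentSpace (𝓡 4) x) ℝ (Fin 4))
    {F : TangentSpace (𝓡 4) x → TangentSpace (𝓡 4) x → ℝ} (hF : IsBilinearMap ℝ F)
    (u v : TangentSpace (𝓡 4) x) :
    star4 g vol x F u v = 1 / 2 * ∑ a, ∑ b, F (e a) (e b) * vol x ![e b, e a, u, v] := by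
  have h1 (a a' : TangentSpace (𝓡 4) x) :
      metricTrace g x (fun b b' => F a b * vol x ![b', a', u, v]) =
        ∑ b, F a (e b) * vol x ![e b, a', u, v] :=
    he.metricTrace ⟨fun _ _ _ => by rw [hF.add_right, add_mul],
      fun _ _ _ => by rw [hF.smul_right, smul_eq_mul, smul_eq_mul, mul_assoc],
      fun _ _ _ => by rw [(alt4_isLinear0 (vol x) _ _ _).map_add, mul_add],
      fun _ _ _ => by rw [(alt4_isLinear0 (vol x) _ _ _).map_smul]; simp; ring⟩
  rw [star4]
  simp only [h1]
  rw [he.metricTrace]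
  refine ⟨fun _ _ _ => ?_, fun _ _ _ => ?_, fun _ _ _ => ?_, fun _ _ _ => ?_⟩ <;>
    simp only [smul_eq_mul, Finset.mul_sum, ← Finset.sum_add_distrib] <;>
    refine Finset.sum_congr rfl fun i _ => ?_
  · rw [hF.add_left, add_mul]
  · rw [hF.smul_left, smul_eq_mul, mul_assoc]
  · rw [(alt4_isLinear1 (vol x) _ _ _).map_add, mul_add]
  · rw [(alt4_isLinear1 (vol x) _ _ _).map_smul]; simp; ring

/-- Selfduality of a `2`-form in an orthonormal basis. -/
theorem isSelfdualForm_iff {x : M} {e : Fin 4 → TangentSpace (𝓡 4) x} (he : IsON g x e)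
    (vol : ∀ x : M, AlternatingMap ℝ (TangentSpace (𝓡 4) x) ℝ (Fin 4))
    (hvol : vol x ![e 0, e 1, e 2, e 3] = 1)
    {F : TangentSpace (𝓡 4) x → TangentSpace (𝓡 4) x → ℝ} (hF : IsBilinearMap ℝ F)
    (hs : ∀ u v, F u v = -F v u) :
    IsSelfdualForm g vol x F ↔ F (e 1) (e 2) = F (e 3) (e 0) ∧ F (e 2) (e 0) = F (e 3) (e 1) ∧
      F (e 0) (e 1) = F (e 3) (e 2) := by
  set η := vol x with hη
  have z := alt4_eq_zero η
  have z0 := fun a b c => (z a b c).1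
  have z1 := fun a b c => (z a b c).2.1
  have z2 := fun a b c => (z a b c).2.2.1
  have z3 := fun a b c => (z a b c).2.2.2.1
  have z4 := fun a b c => (z a b c).2.2.2.2.1
  have zF (u) : F u u = 0 := by linarith [hs u u]
  have p01 := alt4_swap01 η
  have p12 := alt4_swap12 η
  have p23 := alt4_swap23 η
  -- These values follow from `hvol` by transpositions. As the first two arguments of the volume
  -- form are exchanged, `star4` is minus the usual Hodge star, so selfdual means F₁₂ = F₃₀ and
  -- cyclically in 0, 1, 2.
  have v3201 : η ![e 3, e 2, e 0, e 1] = -1 := by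
    linarith [p01 (e 2) (e 3) (e 0) (e 1), p12 (e 2) (e 0) (e 3) (e 1), p01 (e 0) (e 2) (e 3) (e 1), p23 (e 0) (e 2) (e 1) (e 3), p12 (e 0) (e 1) (e 2) (e 3), hvol]
  have v2301 : η ![e 2, e 3, e 0, e 1] = 1 := by
    linarith [p12 (e 2) (e 0) (e 3) (e 1), p01 (e 0) (e 2) (e 3) (e 1), p23 (e 0) (e 2) (e 1) (e 3), p12 (e 0) (e 1) (e 2) (e 3), hvol]
  have v3102 : η ![e 3, e 1, e 0, e 2] = 1 := by
    linarith [p01 (e 1) (e 3) (e 0) (e 2), p12 (e 1) (e 0) (e 3) (e 2), p01 (e 0) (e 1) (e 3) (e 2), p23 (e 0) (e 1) (e 2) (e 3), hvol]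
  have v1302 : η ![e 1, e 3, e 0, e 2] = -1 := by
    linarith [p12 (e 1) (e 0) (e 3) (e 2), p01 (e 0) (e 1) (e 3) (e 2), p23 (e 0) (e 1) (e 2) (e 3), hvol]
  have v2103 : η ![e 2, e 1, e 0, e 3] = -1 := by
    linarith [p01 (e 1) (e 2) (e 0) (e 3), p12 (e 1) (e 0) (e 2) (e 3), p01 (e 0) (e 1) (e 2) (e 3), hvol]
  have v1203 : η ![e 1, e 2, e 0, e 3] = 1 := by
    linarith [p12 (e 1) (e 0) (e 2) (e 3), p01 (e 0) (e 1) (e 2) (e 3), hvol]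
  have v3012 : η ![e 3, e 0, e 1, e 2] = -1 := by
    linarith [p01 (e 0) (e 3) (e 1) (e 2), p12 (e 0) (e 1) (e 3) (e 2), p23 (e 0) (e 1) (e 2) (e 3), hvol]
  have v0312 : η ![e 0, e 3, e 1, e 2] = 1 := by
    linarith [p12 (e 0) (e 1) (e 3) (e 2), p23 (e 0) (e 1) (e 2) (e 3), hvol]
  have v2013 : η ![e 2, e 0, e 1, e 3] = 1 := by
    linarith [p01 (e 0) (e 2) (e 1) (e 3), p12 (e 0) (e 1) (e 2) (e 3), hvol]
  have v0213 : η ![e 0, e 2, e 1, e 3] = -1 := by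
    linarith [p12 (e 0) (e 1) (e 2) (e 3), hvol]
  have v1023 : η ![e 1, e 0, e 2, e 3] = -1 := by
    linarith [p01 (e 0) (e 1) (e 2) (e 3), hvol]
  have hst (u v) := star4_eq_sum he vol hF u v
  rw [← hη] at hst
  have s01 : star4 g vol x F (e 0) (e 1) = F (e 3) (e 2) := by
    rw [hst]; simp [Fin.sum_univ_four, z0, z1, z2, z3, z4, v3201, v2301]; linarith [hs (e 2) (e 3)]
  have s02 : star4 g vol x F (e 0) (e 2) = F (e 1) (e 3) := by
    rw [hst]; simp [Fin.sum_univ_four, z0, z1, z2, z3, z4, v3102, v1302]; linarith [hs (e 1) (e 3)]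
  have s03 : star4 g vol x F (e 0) (e 3) = F (e 2) (e 1) := by
    rw [hst]; simp [Fin.sum_univ_four, z0, z1, z2, z3, z4, v2103, v1203]; linarith [hs (e 1) (e 2)]
  have s12 : star4 g vol x F (e 1) (e 2) = F (e 3) (e 0) := by
    rw [hst]; simp [Fin.sum_univ_four, z0, z1, z2, z3, z4, v3012, v0312]; linarith [hs (e 0) (e 3)]
  have s13 : star4 g vol x F (e 1) (e 3) = F (e 0) (e 2) := by
    rw [hst]; simp [Fin.sum_univ_four, z0, z1, z2, z3, z4, v2013, v0213]; linarith [hs (e 0) (e 2)]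
  have s23 : star4 g vol x F (e 2) (e 3) = F (e 1) (e 0) := by
    rw [hst]; simp [Fin.sum_univ_four, z0, z1, z2, z3, z4, hvol, v1023]; linarith [hs (e 0) (e 1)]
  have sk (u v) : star4 g vol x F u v = -star4 g vol x F v u := by
    rw [hst, hst, ← mul_neg, ← Finset.sum_neg_distrib]
    congr 1
    refine Finset.sum_congr rfl fun a _ => ?_
    rw [← Finset.sum_neg_distrib]
    exact Finset.sum_congr rfl fun c _ => by rw [p23 _ _ v u]; ring
  constructor
  · intro H
    refine ⟨?_, ?_, ?_⟩
    · rw [← H (e 1) (e 2), s12]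
    · rw [← H (e 2) (e 0), sk, s02, hs (e 3)]
    · rw [← H (e 0) (e 1), s01]
  · rintro ⟨H0, H1, H2⟩
    have hb : IsBilinearMap ℝ (star4 g vol x F) := by
      refine ⟨fun u u' v => ?_, fun c u v => ?_, fun u v v' => ?_, fun c u v => ?_⟩ <;>
        simp only [hst]
      · simp only [(alt4_isLinear2 η _ _ _).map_add, mul_add, Finset.sum_add_distrib]
      · simp only [(alt4_isLinear2 η _ _ _).map_smul, smul_eq_mul, Finset.mul_sum]
        exact Finset.sum_congr rfl fun _ _ => Finset.sum_congr rfl fun _ _ => by ring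
      · simp only [(alt4_isLinear3 η _ _ _).map_add, mul_add, Finset.sum_add_distrib]
      · simp only [(alt4_isLinear3 η _ _ _).map_smul, smul_eq_mul, Finset.mul_sum]
        exact Finset.sum_congr rfl fun _ _ => Finset.sum_congr rfl fun _ _ => by ring
    have zs (u) : star4 g vol x F u u = 0 := by linarith [sk u u]
    refine bilinear_ext he.basis hb hF fun i j => ?_
    rw [he.basis_apply, he.basis_apply]
    fin_cases i <;> fin_cases j <;> simp only [Fin.zero_eta, Fin.mk_one, Fin.reduceFinMk, zs, zF] <;>
      linarith [sk (e 1) (e 0), sk (e 2) (e 0), sk (e 2) (e 1), sk (e 3) (e 0), sk (e 3) (e 1),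
        sk (e 3) (e 2), hs (e 1) (e 0), hs (e 2) (e 0), hs (e 2) (e 1), hs (e 3) (e 0),
        hs (e 3) (e 1), hs (e 3) (e 2)]

end Four
end Star

/-! ### Algebra of the antiselfdual half of the curvature operator. -/

section AlgebraicCurvature

/-- A curvature tensor in dimension `4`, in an orthonormal basis. -/
structure CurvComp (R : Fin 4 → Fin 4 → Fin 4 → Fin 4 → ℝ) : Prop where
  swap : ∀ a b c d, R a b c d = -R b a c d
  skew : ∀ a b c d, R a b c d = -R a b d c
  pair : ∀ a b c d, R a b c d = R c d a b
  bianchi : ∀ a b c d, R a b c d + R b c a d + R c a b d = 0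

/-- The antiselfdual part of the curvature is that of an Einstein metric with vanishing
antiselfdual Weyl curvature; the vector `3` is vertical. -/
def AsdEinstein (c : ℝ) (R : Fin 4 → Fin 4 → Fin 4 → Fin 4 → ℝ) : Prop :=
  (R 1 2 1 2 - R 1 2 3 0 = -(c / 3) ∧ R 2 0 1 2 - R 2 0 3 0 = 0 ∧ R 0 1 1 2 - R 0 1 3 0 = 0 ∧
    R 1 2 2 0 - R 1 2 3 1 = 0 ∧ R 2 0 2 0 - R 2 0 3 1 = -(c / 3) ∧ R 0 1 2 0 - R 0 1 3 1 = 0 ∧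
    R 1 2 0 1 - R 1 2 3 2 = 0 ∧ R 2 0 0 1 - R 2 0 3 2 = 0 ∧ R 0 1 0 1 - R 0 1 3 2 = -(c / 3)) ∧
  (R 3 0 1 2 - R 3 0 3 0 = c / 3 ∧ R 3 1 1 2 - R 3 1 3 0 = 0 ∧ R 3 2 1 2 - R 3 2 3 0 = 0 ∧
    R 3 0 2 0 - R 3 0 3 1 = 0 ∧ R 3 1 2 0 - R 3 1 3 1 = c / 3 ∧ R 3 2 2 0 - R 3 2 3 1 = 0 ∧
    R 3 0 0 1 - R 3 0 3 2 = 0 ∧ R 3 1 0 1 - R 3 1 3 2 = 0 ∧ R 3 2 0 1 - R 3 2 3 2 = c / 3)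

/-- The block of the curvature operator between selfdual and antiselfdual forms is the tracefree
Ricci tensor, and the first Bianchi identity equates the traces of the two diagonal blocks. So the
antiselfdual half alone determines the Ricci tensor. -/
theorem AsdEinstein.sum_eq {c : ℝ} {R : Fin 4 → Fin 4 → Fin 4 → Fin 4 → ℝ} (hR : CurvComp R)
    (h : AsdEinstein c R) (v w : Fin 4) : ∑ a, R a v w a = if v = w then c else 0 := by
  obtain ⟨S, K, P, B⟩ := hR
  obtain ⟨⟨h1, h2, h3, h4, h5, h6, h7, h8, h9⟩, ⟨k1, k2, k3, k4, k5, k6, k7, k8, k9⟩⟩ := h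
  have B0 := B 0 1 2 3
  have f0 := P 3 0 1 2
  have f1 := P 2 0 1 2
  have f2 := P 3 1 1 2
  have f3 := P 3 1 3 0
  have f4 := P 0 1 1 2
  have f5 := P 3 2 1 2
  have f6 := P 3 2 3 0
  have f7 := P 3 0 2 0
  have f8 := P 3 1 2 0
  have f9 := P 0 1 2 0
  have f10 := P 3 2 2 0
  have f11 := P 3 2 3 1
  have f12 := P 3 0 0 1
  have f13 := P 3 1 0 1
  have f14 := P 3 2 0 1
  have f15 := K 0 1 2 3
  have f16 := K 1 2 0 3
  have f17 := K 2 0 1 3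
  rw [Fin.sum_univ_four]
  fin_cases v
  · fin_cases w <;> simp only [Fin.zero_eta, Fin.mk_one, Fin.reduceFinMk, Fin.isValue, Fin.reduceEq, if_true, if_false]
    · linarith [S 0 0 0 0, S 1 0 0 1, K 2 0 0 2, K 3 0 0 3]
    · linarith [S 0 0 1 0, K 1 0 1 1, K 3 0 1 3]
    · linarith [S 0 0 2 0, S 1 0 2 1, K 0 1 2 1, K 2 0 2 2, K 3 0 2 3]
    · linarith [S 0 0 3 0, S 1 0 3 1, K 3 0 3 3]
  · fin_cases w <;> simp only [Fin.zero_eta, Fin.mk_one, Fin.reduceFinMk, Fin.isValue, Fin.reduceEq, if_true, if_false]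
    · linarith [K 0 1 0 0, S 1 1 0 1, S 2 1 0 2, K 1 2 0 2, K 3 1 0 3]
    · linarith [K 0 1 1 0, S 1 1 1 1, S 2 1 1 2, K 3 1 1 3]
    · linarith [S 1 1 2 1, K 2 1 2 2, K 3 1 2 3]
    · linarith [S 1 1 3 1, S 2 1 3 2, K 3 1 3 3]
  · fin_cases w <;> simp only [Fin.zero_eta, Fin.mk_one, Fin.reduceFinMk, Fin.isValue, Fin.reduceEq, if_true, if_false]
    · linarith [K 0 2 0 0, S 2 2 0 2, K 3 2 0 3]
    · linarith [S 0 2 1 0, K 2 0 1 0, K 1 2 1 1, S 2 2 1 2, K 3 2 1 3]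
    · linarith [S 0 2 2 0, K 1 2 2 1, S 2 2 2 2, K 3 2 2 3]
    · linarith [S 0 2 3 0, S 2 2 3 2, K 3 2 3 3]
  · fin_cases w <;> simp only [Fin.zero_eta, Fin.mk_one, Fin.reduceFinMk, Fin.isValue, Fin.reduceEq, if_true, if_false]
    · linarith [K 0 3 0 0, S 1 3 0 1, S 2 3 0 2, K 3 2 0 2, S 3 3 0 3]
    · linarith [S 0 3 1 0, K 3 0 1 0, K 1 3 1 1, S 2 3 1 2, S 3 3 1 3]
    · linarith [S 0 3 2 0, S 1 3 2 1, K 3 1 2 1, K 2 3 2 2, S 3 3 2 3]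
    · linarith [S 0 3 3 0, S 1 3 3 1, S 2 3 3 2, S 3 3 3 3]

/-- The antiselfdual part of the curvature, as a bilinear form in the last two arguments. -/
def AsdEinsteinForm (c : ℝ) (R : Fin 4 → Fin 4 → Fin 4 → Fin 4 → ℝ) : Prop :=
  ∀ a b : Fin 4, R 1 2 a b - R 3 0 a b = c / 3 * ((if (2 : Fin 4) = a then 1 else 0) * (if (1 : Fin 4) = b then 1 else 0)
      - (if (1 : Fin 4) = a then 1 else 0) * (if (2 : Fin 4) = b then 1 else 0) - ((if (0 : Fin 4) = a then 1 else 0) * (if (3 : Fin 4) = b then 1 else 0)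
      - (if (3 : Fin 4) = a then 1 else 0) * (if (0 : Fin 4) = b then 1 else 0))) ∧
    R 2 0 a b - R 3 1 a b = c / 3 * ((if (0 : Fin 4) = a then 1 else 0) * (if (2 : Fin 4) = b then 1 else 0)
      - (if (2 : Fin 4) = a then 1 else 0) * (if (0 : Fin 4) = b then 1 else 0) - ((if (1 : Fin 4) = a then 1 else 0) * (if (3 : Fin 4) = b then 1 else 0)
      - (if (3 : Fin 4) = a then 1 else 0) * (if (1 : Fin 4) = b then 1 else 0))) ∧
    R 0 1 a b - R 3 2 a b = c / 3 * ((if (1 : Fin 4) = a then 1 else 0) * (if (0 : Fin 4) = b then 1 else 0)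
      - (if (0 : Fin 4) = a then 1 else 0) * (if (1 : Fin 4) = b then 1 else 0) - ((if (2 : Fin 4) = a then 1 else 0) * (if (3 : Fin 4) = b then 1 else 0)
      - (if (3 : Fin 4) = a then 1 else 0) * (if (2 : Fin 4) = b then 1 else 0)))

theorem skew_ext_fin_four {ψ φ : Fin 4 → Fin 4 → ℝ} (hψ : ∀ a b, ψ a b = -ψ b a)
    (hφ : ∀ a b, φ a b = -φ b a) (h12 : ψ 1 2 = φ 1 2) (h20 : ψ 2 0 = φ 2 0) (h01 : ψ 0 1 = φ 0 1)
    (h30 : ψ 3 0 = φ 3 0) (h31 : ψ 3 1 = φ 3 1) (h32 : ψ 3 2 = φ 3 2) (a b : Fin 4) :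
    ψ a b = φ a b := by
  have Z (a : Fin 4) : ψ a a = φ a a := by linarith [hψ a a, hφ a a]
  have T (a b : Fin 4) (h : ψ a b = φ a b) : ψ b a = φ b a := by rw [hψ, hφ, h]
  fin_cases a <;> fin_cases b
  exacts [Z 0, h01, T _ _ h20, T _ _ h30, T _ _ h01, Z 1, h12, T _ _ h31, h20, T _ _ h12, Z 2,
    T _ _ h32, h30, h31, h32, Z 3]

/-- Pair symmetry moves the antiselfdual projection from the last two indices to the first two,
where the definition of a selfdual metric puts it. -/
theorem AsdEinstein.form {c : ℝ} {R : Fin 4 → Fin 4 → Fin 4 → Fin 4 → ℝ} (hR : CurvComp R)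
    (h : AsdEinstein c R) : AsdEinsteinForm c R := by
  obtain ⟨S, K, P, B⟩ := hR
  obtain ⟨⟨h1, h2, h3, h4, h5, h6, h7, h8, h9⟩, ⟨k1, k2, k3, k4, k5, k6, k7, k8, k9⟩⟩ := h
  intro a b
  refine ⟨?_, ?_, ?_⟩
  · refine skew_ext_fin_four (ψ := fun a b => R 1 2 a b - R 3 0 a b)
      (φ := fun a b => c / 3 * ((if (2 : Fin 4) = a then 1 else 0) * (if (1 : Fin 4) = b then 1 else 0)
      - (if (1 : Fin 4) = a then 1 else 0) * (if (2 : Fin 4) = b then 1 else 0) - ((if (0 : Fin 4) = a then 1 else 0) * (if (3 : Fin 4) = b then 1 else 0)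
      - (if (3 : Fin 4) = a then 1 else 0) * (if (0 : Fin 4) = b then 1 else 0))))
      (fun a b => by rw [K 1 2, K 3 0]; ring) (fun a b => by ring)
      ?_ ?_ ?_ ?_ ?_ ?_ a b <;> rw [P 1 2, P 3 0] <;>
      simp only [Fin.isValue, Fin.reduceEq, if_true, if_false] <;> linarith [P 1 2 3 0]
  · refine skew_ext_fin_four (ψ := fun a b => R 2 0 a b - R 3 1 a b)
      (φ := fun a b => c / 3 * ((if (0 : Fin 4) = a then 1 else 0) * (if (2 : Fin 4) = b then 1 else 0)
      - (if (2 : Fin 4) = a then 1 else 0) * (if (0 : Fin 4) = b then 1 else 0) - ((if (1 : Fin 4) = a then 1 else 0) * (if (3 : Fin 4) = b then 1 else 0)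
      - (if (3 : Fin 4) = a then 1 else 0) * (if (1 : Fin 4) = b then 1 else 0))))
      (fun a b => by rw [K 2 0, K 3 1]; ring) (fun a b => by ring)
      ?_ ?_ ?_ ?_ ?_ ?_ a b <;> rw [P 2 0, P 3 1] <;>
      simp only [Fin.isValue, Fin.reduceEq, if_true, if_false] <;> linarith [P 2 0 3 1]
  · refine skew_ext_fin_four (ψ := fun a b => R 0 1 a b - R 3 2 a b)
      (φ := fun a b => c / 3 * ((if (1 : Fin 4) = a then 1 else 0) * (if (0 : Fin 4) = b then 1 else 0)
      - (if (0 : Fin 4) = a then 1 else 0) * (if (1 : Fin 4) = b then 1 else 0) - ((if (2 : Fin 4) = a then 1 else 0) * (if (3 : Fin 4) = b then 1 else 0)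
      - (if (3 : Fin 4) = a then 1 else 0) * (if (2 : Fin 4) = b then 1 else 0))))
      (fun a b => by rw [K 0 1, K 3 2]; ring) (fun a b => by ring)
      ?_ ?_ ?_ ?_ ?_ ?_ a b <;> rw [P 0 1, P 3 2] <;>
      simp only [Fin.isValue, Fin.reduceEq, if_true, if_false] <;> linarith [P 0 1 3 2]

theorem AsdEinsteinForm.asdEinstein {c : ℝ} {R : Fin 4 → Fin 4 → Fin 4 → Fin 4 → ℝ}
    (hR : CurvComp R) (h : AsdEinsteinForm c R) : AsdEinstein c R := by
  have key (a b : Fin 4) := h a b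
  simp only [hR.pair 1 2, hR.pair 2 0, hR.pair 0 1, hR.pair 3] at key
  refine ⟨⟨?_, ?_, ?_, ?_, ?_, ?_, ?_, ?_, ?_⟩, ⟨?_, ?_, ?_, ?_, ?_, ?_, ?_, ?_, ?_⟩⟩
  · refine (key 1 2).1.trans ?_; simp
  · refine (key 2 0).1.trans ?_; simp
  · refine (key 0 1).1.trans ?_; simp
  · refine (key 1 2).2.1.trans ?_; simp
  · refine (key 2 0).2.1.trans ?_; simp
  · refine (key 0 1).2.1.trans ?_; simp
  · refine (key 1 2).2.2.trans ?_; simp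
  · refine (key 2 0).2.2.trans ?_; simp
  · refine (key 0 1).2.2.trans ?_; simp
  · refine (key 3 0).1.trans ?_; simp
  · refine (key 3 1).1.trans ?_; simp
  · refine (key 3 2).1.trans ?_; simp
  · refine (key 3 0).2.1.trans ?_; simp
  · refine (key 3 1).2.1.trans ?_; simp
  · refine (key 3 2).2.1.trans ?_; simp
  · refine (key 3 0).2.2.trans ?_; simp
  · refine (key 3 1).2.2.trans ?_; simp
  · refine (key 3 2).2.2.trans ?_; simp

end AlgebraicCurvature

/-! ### The selfdual Einstein condition in terms of `AsdEinstein`. -/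

section Dim4
variable {M : Type*} [TopologicalSpace M] [ChartedSpace (EuclideanSpace ℝ (Fin 4)) M]
  [IsManifold (𝓡 4) ∞ M] {g : Metric 4 M} {D : Connection 4 M}

/-- The components of the curvature in a basis. -/
def curvComp (g : Metric 4 M) (D : Connection 4 M) (x : M) (w : Fin 4 → TangentSpace (𝓡 4) x)
    (a b c d : Fin 4) : ℝ := g.inner x (curvature D x (w a) (w b) (w c)) (w d)

theorem IsLeviCivita.curvComp (hW : IsLeviCivita g D) (x : M) (w : Fin 4 → TangentSpace (𝓡 4) x) :
    CurvComp (curvComp g D x w) where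
  swap a b c d := by
    simp only [HitchinLeBrun.curvComp]
    rw [curvature_swap, map_neg, neg_apply]
  skew a b c d := hW.curvature_skew x _ _ _ _
  pair a b c d := hW.curvature_pair x _ _ _ _
  bianchi a b c d := by
    simp only [HitchinLeBrun.curvComp]
    rw [← inner_add_left, ← inner_add_left,
      IsWeylConnection.curvature_bianchi (lee := fun _ => 0) hW (hW.smooth g), map_zero]
    rfl

/-- The Schouten tensor is (c/6)g, so only the constant curvature part is removed. -/
theorem weylTensor_of_einstein (hW : IsLeviCivita g D) {x : M} {w : Fin 4 → TangentSpace (𝓡 4) x}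
    (hw : IsON g x w) {c : ℝ} (hc : ∀ u v, ricci D x u v = c * g.inner x u v)
    (u v y z : TangentSpace (𝓡 4) x) :
    weylTensor g D x u v y z = g.inner x (curvature D x u v y) z
      - c / 3 * (g.inner x v y * g.inner x u z - g.inner x u y * g.inner x v z) := by
  have hs : scalarCurv g D x = 4 * c := by
    rw [scalarCurv_eq_sum g (hW.smooth g) hw, Fin.sum_univ_four]
    simp only [hc, hw _ _, if_true]
    ring
  simp only [weylTensor, schouten, hs, hc]
  ring

theorem inner_curvature_isBilinear (hD : SmoothConn D) (x : M) (y z : TangentSpace (𝓡 4) x) :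
    IsBilinearMap ℝ fun u v => g.inner x (curvature D x u v y) z := by
  obtain ⟨h1, h2, -⟩ := curvature_isTrilinear g hD x
  exact ⟨fun _ _ _ => by rw [(h1 _ _).map_add, inner_add_left],
    fun _ _ _ => by rw [(h1 _ _).map_smul, inner_smul_left, smul_eq_mul],
    fun _ _ _ => by rw [(h2 _ _).map_add, inner_add_left],
    fun _ _ _ => by rw [(h2 _ _).map_smul, inner_smul_left, smul_eq_mul]⟩

theorem inner_curvature_isBilinear_right (hD : SmoothConn D) (x : M)
    (u v : TangentSpace (𝓡 4) x) :
    IsBilinearMap ℝ fun y z => g.inner x (curvature D x u v y) z := by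
  obtain ⟨-, -, h3⟩ := curvature_isTrilinear g hD x
  exact ⟨fun _ _ _ => by rw [(h3 _ _).map_add, inner_add_left],
    fun _ _ _ => by rw [(h3 _ _).map_smul, inner_smul_left, smul_eq_mul],
    fun _ _ _ => by rw [map_add], fun _ _ _ => by rw [map_smul]⟩

theorem weylTensor_isBilinear (hW : IsLeviCivita g D) {x : M}
    {w : Fin 4 → TangentSpace (𝓡 4) x} (hw : IsON g x w) {c : ℝ}
    (hc : ∀ u v, ricci D x u v = c * g.inner x u v) (y z : TangentSpace (𝓡 4) x) :
    IsBilinearMap ℝ fun u v => weylTensor g D x u v y z := by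
  have h := inner_curvature_isBilinear (g := g) (hW.smooth g) x y z
  simp only [weylTensor_of_einstein hW hw hc]
  refine ⟨fun _ _ _ => ?_, fun _ _ _ => ?_, fun _ _ _ => ?_, fun _ _ _ => ?_⟩
  · rw [h.add_left, inner_add_left, inner_add_left]; ring
  · rw [h.smul_left, inner_smul_left, inner_smul_left]; simp only [smul_eq_mul]; ring
  · rw [h.add_right, inner_add_left, inner_add_left]; ring
  · rw [h.smul_right, inner_smul_left, inner_smul_left]; simp only [smul_eq_mul]; ring

theorem weylTensor_isBilinear_right (hW : IsLeviCivita g D) {x : M}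
    {w : Fin 4 → TangentSpace (𝓡 4) x} (hw : IsON g x w) {c : ℝ}
    (hc : ∀ u v, ricci D x u v = c * g.inner x u v) (u v : TangentSpace (𝓡 4) x) :
    IsBilinearMap ℝ fun y z => weylTensor g D x u v y z := by
  have h := inner_curvature_isBilinear_right (g := g) (hW.smooth g) x u v
  simp only [weylTensor_of_einstein hW hw hc]
  refine ⟨fun _ _ _ => ?_, fun _ _ _ => ?_, fun _ _ _ => ?_, fun _ _ _ => ?_⟩
  · rw [h.add_left, map_add, map_add]; ring
  · rw [h.smul_left, map_smul, map_smul]; simp only [smul_eq_mul]; ring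
  · rw [h.add_right, map_add, map_add]; ring
  · rw [h.smul_right, map_smul, map_smul]; simp only [smul_eq_mul]; ring

theorem weylTensor_swap (hW : IsLeviCivita g D) {x : M}
    {w : Fin 4 → TangentSpace (𝓡 4) x} (hw : IsON g x w) {c : ℝ}
    (hc : ∀ u v, ricci D x u v = c * g.inner x u v) (u v y z : TangentSpace (𝓡 4) x) :
    weylTensor g D x u v y z = -weylTensor g D x v u y z := by
  rw [weylTensor_of_einstein hW hw hc, weylTensor_of_einstein hW hw hc, curvature_swap, map_neg,
    neg_apply]
  ring

/-- Together with `AsdEinstein.isEinstein` and `AsdEinstein.isSelfdual`, this makes "Einstein and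
selfdual" equivalent to conditions on the components `curvComp`. -/
theorem asdEinstein_of_isSelfdual (hW : IsLeviCivita g D) {x : M}
    {w : Fin 4 → TangentSpace (𝓡 4) x} (hw : IsON g x w)
    {vol : ∀ x : M, AlternatingMap ℝ (TangentSpace (𝓡 4) x) ℝ (Fin 4)}
    (hvol : vol x ![w 0, w 1, w 2, w 3] = 1) {c : ℝ}
    (hc : ∀ u v, ricci D x u v = c * g.inner x u v)
    (hsd : ∀ y z, IsSelfdualForm g vol x fun u v => weylTensor g D x u v y z) :
    AsdEinstein c (curvComp g D x w) := by
  have hbil (y z : TangentSpace (𝓡 4) x) := weylTensor_isBilinear hW hw hc y z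
  have hsk (y z u v : TangentSpace (𝓡 4) x) := weylTensor_swap hW hw hc u v y z
  have hon := hw
  have E (a b : Fin 4) : _ ∧ _ ∧ _ :=
    (isSelfdualForm_iff hw vol hvol (hbil (w a) (w b)) (hsk (w a) (w b))).1 (hsd (w a) (w b))
  simp only [weylTensor_of_einstein hW hw hc, hon _ _] at E
  refine AsdEinsteinForm.asdEinstein (hW.curvComp x w) fun a b => ?_
  obtain ⟨e1, e2, e3⟩ := E a b
  simp only [curvComp]
  exact ⟨by linarith, by linarith, by linarith⟩

theorem AsdEinstein.isEinstein (hW : IsLeviCivita g D) {x : M}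
    {w : Fin 4 → TangentSpace (𝓡 4) x} (hw : IsON g x w) {c : ℝ}
    (h : AsdEinstein c (curvComp g D x w)) (u v : TangentSpace (𝓡 4) x) :
    ricci D x u v = c * g.inner x u v := by
  refine bilinear_ext hw.basis (ricci_isBilinear g (hW.smooth g) x)
    (β' := fun u v => c * g.inner x u v)
    ⟨fun _ _ _ => by rw [inner_add_left, mul_add],
      fun _ _ _ => by rw [inner_smul_left, smul_eq_mul]; ring,
      fun _ _ _ => by rw [map_add, mul_add],
      fun _ _ _ => by rw [map_smul, smul_eq_mul, smul_eq_mul]; ring⟩ (fun i j => ?_) u v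
  rw [hw.basis_apply, hw.basis_apply, ricci_eq_sum g (hW.smooth g) hw, hw i j]
  have := h.sum_eq (hW.curvComp x w) i j
  simp only [curvComp] at this
  rw [this]
  split_ifs <;> simp

theorem AsdEinstein.isSelfdual (hW : IsLeviCivita g D) {x : M}
    {w : Fin 4 → TangentSpace (𝓡 4) x} (hw : IsON g x w)
    {vol : ∀ x : M, AlternatingMap ℝ (TangentSpace (𝓡 4) x) ℝ (Fin 4)}
    (hvol : vol x ![w 0, w 1, w 2, w 3] = 1) {c : ℝ}
    (h : AsdEinstein c (curvComp g D x w)) (y z : TangentSpace (𝓡 4) x) :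
    IsSelfdualForm g vol x fun u v => weylTensor g D x u v y z := by
  have hc := h.isEinstein hW hw
  rw [isSelfdualForm_iff hw vol hvol (weylTensor_isBilinear hW hw hc y z)
    (weylTensor_swap hW hw hc · · y z)]
  have hE := h.form (hW.curvComp x w)
  have bil (u v : TangentSpace (𝓡 4) x) := weylTensor_isBilinear_right hW hw hc u v
  have W (a b c' d : Fin 4) : weylTensor g D x (w a) (w b) (w c') (w d) = curvComp g D x w a b c' d
      - c / 3 * ((if b = c' then 1 else 0) * (if a = d then 1 else 0)
        - (if a = c' then 1 else 0) * (if b = d then 1 else 0)) := by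
    rw [weylTensor_of_einstein hW hw hc, hw b c', hw a d, hw a c', hw b d]
    rfl
  refine ⟨?_, ?_, ?_⟩
  · refine bilinear_ext hw.basis (bil _ _) (bil _ _) (fun i j => ?_) y z
    rw [hw.basis_apply, hw.basis_apply, W, W]
    linarith [(hE i j).1]
  · refine bilinear_ext hw.basis (bil _ _) (bil _ _) (fun i j => ?_) y z
    rw [hw.basis_apply, hw.basis_apply, W, W]
    linarith [(hE i j).2.1]
  · refine bilinear_ext hw.basis (bil _ _) (bil _ _) (fun i j => ?_) y z
    rw [hw.basis_apply, hw.basis_apply, W, W]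
    linarith [(hE i j).2.2]

end Dim4

/-! ### Further rules for vector fields of an open set. -/

section Fields
variable {n : ℕ} {M : Type*} [TopologicalSpace M] [ChartedSpace (EuclideanSpace ℝ (Fin n)) M]
  [IsManifold (𝓡 n) ∞ M] {U : TopologicalSpace.Opens M} {g : Metric n M} {D : Connection n M}

/-- Keeps the frame identities free of division: they are proved after multiplication by 2, where
ring manipulations suffice. -/
theorem Fn.two_cancel {a b : Fn n U} (h : 2 * a = 2 * b) : a = b := by
  refine Fn.ext fun x => ?_
  have h2 := congrArg (fun f : Fn n U => f.1 x) h
  simp only [two_mul, Fn.add_apply] at h2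
  linarith

theorem Vec.jacobi (X Y Z : Vec n U) (x : U) :
    (X.br (Y.br Z)).toFun x = ((X.br Y).br Z).toFun x + (Y.br (X.br Z)).toFun x := by
  have hm : minSmoothness ℝ 2 ≤ ∞ := by simpa using ENat.LEInfty.out
  have : IsManifold (𝓡 n) (minSmoothness ℝ 3) M :=
    IsManifold.of_le (n := ∞) (by simpa using ENat.LEInfty.out)
  exact leibniz_identity_mlieBracket_apply ((X.smooth x x.2).of_le hm) ((Y.smooth x x.2).of_le hm)
    ((Z.smooth x x.2).of_le hm)

theorem Vec.ip_smul_left (f : Fn n U) (X Y : Vec n U) :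
    (Vec.smul f X).ip g Y = f * X.ip g Y := by
  refine Fn.ext fun x => ?_
  rw [Vec.ip_apply, Vec.smul_at, inner_smul_left]
  rfl

theorem Vec.ip_smul_right (f : Fn n U) (X Y : Vec n U) :
    X.ip g (Vec.smul f Y) = f * X.ip g Y := by
  rw [Vec.ip_comm, Vec.ip_smul_left, Vec.ip_comm]

theorem Vec.nab_ip_smul_left (hD : SmoothConn D) (f : Fn n U) (X Y Z : Vec n U) :
    ((Vec.smul f X).nab hD Y).ip g Z = f * (X.nab hD Y).ip g Z := by
  refine Fn.ext fun x => ?_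
  have : ((Vec.smul f X).nab hD Y).toFun x = f.1 x • (X.nab hD Y).toFun x := by
    change D Y.toFun x ((Vec.smul f X).toFun x) = _
    rw [Vec.smul_at, map_smul]
    rfl
  rw [Vec.ip_apply, this, inner_smul_left]
  rfl

theorem IsLeviCivita.nab_ip_smul (hW : IsLeviCivita g D) (hD : SmoothConn D) (f : Fn n U)
    (X Y Z : Vec n U) :
    (X.nab hD (Vec.smul f Y)).ip g Z = X.d f * Y.ip g Z + f * (X.nab hD Y).ip g Z := by
  have h1 := hW.d_ip hD X (Vec.smul f Y) Z
  have h2 := hW.d_ip hD X Y Z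
  rw [Vec.ip_smul_left, Vec.ip_smul_left, Derivation.leibniz, smul_eq_mul, smul_eq_mul] at h1
  linear_combination f * h2 - h1

theorem IsLeviCivita.br_ip_comm (hW : IsLeviCivita g D) (hD : SmoothConn D) (X Y Z : Vec n U) :
    (X.br Y).ip g Z = -(Y.br X).ip g Z := by
  rw [hW.br_ip hD, hW.br_ip hD]
  ring

/-- The Leibniz rule for a bracket, derived through the connection because the expansion of `Y` is
only known on `U`. -/
theorem IsLeviCivita.br_ip_congr (hW : IsLeviCivita g D) (hD : SmoothConn D) {Y : Vec n U}
    {ι : Type*} [Fintype ι] {c : ι → Fn n U} {V : ι → Vec n U}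
    (h : ∀ x : U, Y.toFun x = ∑ i, (c i).1 x • (V i).toFun x) (X Z : Vec n U) :
    (X.br Y).ip g Z = ∑ i, (X.d (c i) * (V i).ip g Z + c i * (X.br (V i)).ip g Z) := by
  have h1 := hW.d_ip hD X Y Z
  have h2 (i : ι) := hW.d_ip hD X (V i) Z
  rw [hW.br_ip hD, Vec.nab_ip_congr hD h X Z]
  rw [Vec.ip_congr h Z, Vec.ip_congr h (X.nab hD Z), map_sum] at h1
  have h3 : (X.nab hD Y).ip g Z =
      ∑ i, (X.d (c i * (V i).ip g Z) - c i * (V i).ip g (X.nab hD Z)) := by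
    rw [Finset.sum_sub_distrib]
    linear_combination -h1
  rw [h3, ← Finset.sum_sub_distrib]
  refine Finset.sum_congr rfl fun i _ => ?_
  rw [Derivation.leibniz, smul_eq_mul, smul_eq_mul, hW.br_ip hD, h2 i]
  ring

/-- The exterior derivative of the `1`-form dual to a vector field. -/
theorem IsLeviCivita.nab_ip_sub (hW : IsLeviCivita g D) (hD : SmoothConn D) (X Y Z : Vec n U) :
    (X.nab hD Z).ip g Y - (Y.nab hD Z).ip g X =
      X.d (Z.ip g Y) - Y.d (Z.ip g X) - (X.br Y).ip g Z := by
  rw [hW.d_ip hD, hW.d_ip hD, hW.br_ip hD, Vec.ip_comm g Z, Vec.ip_comm g Z]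
  ring

end Fields

/-! ### The connection on antiselfdual 2-forms. -/

section AsdConnection
variable {M : Type*} [TopologicalSpace M] [ChartedSpace (EuclideanSpace ℝ (Fin 4)) M]
  [IsManifold (𝓡 4) ∞ M] {U : TopologicalSpace.Opens M} {g : Metric 4 M} {D : Connection 4 M}

/-- The connection form on antiselfdual `2`-forms, in an orthonormal frame with `w 3` vertical. -/
def asdForm (g : Metric 4 M) (hD : SmoothConn D) (w : Fin 4 → Vec 4 U) (l : Fin 3) (X : Vec 4 U) :
    Fn 4 U :=
  (X.nab hD (w (l + 1).castSucc)).ip g (w (l + 2).castSucc) - (X.nab hD (w 3)).ip g (w l.castSucc)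

/-- The antiselfdual part of the curvature is the curvature of `asdForm`. -/
theorem IsLeviCivita.asd_curv (hW : IsLeviCivita g D) (hD : SmoothConn D) {w : Fin 4 → Vec 4 U}
    (hw : FrameON g w) (l : Fin 3) (X Y : Vec 4 U) :
    (Vec.curv hD X Y (w (l + 1).castSucc)).ip g (w (l + 2).castSucc)
        - (Vec.curv hD X Y (w 3)).ip g (w l.castSucc) =
      X.d (asdForm g hD w l Y) - Y.d (asdForm g hD w l X) - asdForm g hD w l (X.br Y)
        + (asdForm g hD w (l + 1) X * asdForm g hD w (l + 2) Y
          - asdForm g hD w (l + 1) Y * asdForm g hD w (l + 2) X) := by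
  have C := IsWeylConnection.curv_frame hW smoothOneForm_zero hD hw X Y
  have S (X : Vec 4 U) (b c : Fin 4) : (X.nab hD (w b)).ip g (w c) = -(X.nab hD (w c)).ip g (w b) := by
    have h := IsWeylConnection.frame_skew hW smoothOneForm_zero hD hw X b c
    rw [form_zero] at h
    split_ifs at h <;> linear_combination h
  have Z (X : Vec 4 U) (b : Fin 4) : (X.nab hD (w b)).ip g (w b) = 0 := by
    have h := IsWeylConnection.frame_skew hW smoothOneForm_zero hD hw X b b
    rw [form_zero, if_pos rfl] at h
    refine Fn.ext fun x => ?_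
    have h2 := congrArg (fun f : Fn 4 U => f.1 x) h
    simp only [Fn.add_apply] at h2
    have h3 : (2 * (0 : Fn 4 U)).1 x = 0 := by rw [mul_zero]; rfl
    rw [h3] at h2
    change _ = (0 : ℝ)
    linarith
  have S10 (X : Vec 4 U) := S X 1 0
  have S20 (X : Vec 4 U) := S X 2 0
  have S21 (X : Vec 4 U) := S X 2 1
  have S30 (X : Vec 4 U) := S X 3 0
  have S31 (X : Vec 4 U) := S X 3 1
  have S32 (X : Vec 4 U) := S X 3 2
  -- The quadratic terms reduce to the three antiselfdual connection forms because so(4) is the sum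
  -- of two ideals so(3).
  fin_cases l <;>
  · simp only [asdForm, C, Fin.sum_univ_four, map_sub, Fin.castSucc, Fin.castAdd, Fin.castLE,
      Fin.zero_eta, Fin.mk_one, Fin.reduceFinMk, Fin.reduceAdd, zero_add, Fin.isValue,
      Fin.coe_ofNat_eq_mod, Nat.reduceMod, Z, S10, S20, S21, S30, S31, S32, map_neg]
    ring
end AsdConnection

/-! ### Frames adapted to a conformal submersion and their Levi-Civita connection. -/

section Frame
variable {M : Type*} [TopologicalSpace M] [ChartedSpace (EuclideanSpace ℝ (Fin 4)) M]
  [IsManifold (𝓡 4) ∞ M]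

/-- A frame adapted to a conformal submersion: `E i` is horizontal of length `lam`, `T` is vertical
of length `lam⁻¹`, and `E i` is projectable up to the vertical direction. -/
structure SubmersionFrame (g : Metric 4 M) (U : TopologicalSpace.Opens M) where
  E : Fin 3 → Vec 4 U
  T : Vec 4 U
  lam : Fn 4 U
  lamInv : Fn 4 U
  c : Fin 3 → Fin 3 → Fn 4 U
  κ : Fin 3 → Fn 4 U
  Ω : Fin 3 → Fn 4 U
  lam_mul : lam * lamInv = 1
  ip_T : T.ip g T = lamInv ^ 2
  ip_T_E : ∀ i, T.ip g (E i) = 0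
  ip_E : ∀ i j, (E i).ip g (E j) = if i = j then lam ^ 2 else 0
  br_T : ∀ i (x : U), (T.br (E i)).toFun x = (κ i).1 x • T.toFun x
  br_E : ∀ p (x : U), ((E (p + 1)).br (E (p + 2))).toFun x =
    (c p 0).1 x • (E 0).toFun x + (c p 1).1 x • (E 1).toFun x + (c p 2).1 x • (E 2).toFun x
      + (Ω p).1 x • T.toFun x

namespace SubmersionFrame
variable {U : TopologicalSpace.Opens M} {g : Metric 4 M} {D : Connection 4 M}
  (S : SubmersionFrame g U)

/-- The square of the dilation. -/
def Q : Fn 4 U := S.lam ^ 2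

/-- The inverse of the square of the dilation. -/
def QInv : Fn 4 U := S.lamInv ^ 2

theorem Q_mul : S.Q * S.QInv = 1 := by
  rw [Q, QInv, ← mul_pow, S.lam_mul, one_pow]

/-- Half of the vertical derivative of `Q`. -/
def ν : Fn 4 U := (1 / 2 : ℝ) • S.T.d S.Q

theorem two_ν : 2 * S.ν = S.T.d S.Q := by
  refine Fn.ext fun x => ?_
  rw [two_mul, Fn.add_apply, ν, Fn.smul_apply]
  ring

/-- Twice the horizontal part of the Lee form of the minimal Weyl derivative. -/
def pp (i : Fin 3) : Fn 4 U := S.QInv * (S.E i).d S.Q - 2 * S.κ i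

theorem d_QInv (X : Vec 4 U) : X.d S.QInv = -S.QInv ^ 2 * X.d S.Q := by
  have h : X.d (S.Q * S.QInv) = 0 := by rw [S.Q_mul]; exact X.d.map_one_eq_zero
  rw [Derivation.leibniz, smul_eq_mul, smul_eq_mul] at h
  linear_combination S.QInv * h - X.d S.QInv * S.Q_mul

/-- The vectors `E 0, E 1, E 2, T`. -/
def fields : Fin 4 → Vec 4 U := ![S.E 0, S.E 1, S.E 2, S.T]

/-- The coefficients of the bracket of `E (p + 1)` and `E (p + 2)`. -/
def coeffs (p : Fin 3) : Fin 4 → Fn 4 U := ![S.c p 0, S.c p 1, S.c p 2, S.Ω p]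

theorem br_E_sum (p : Fin 3) (x : U) : ((S.E (p + 1)).br (S.E (p + 2))).toFun x =
    ∑ k, (S.coeffs p k).1 x • (S.fields k).toFun x := by
  rw [Fin.sum_univ_four]
  exact S.br_E p x

theorem br_T_sum (i : Fin 3) (x : U) : (S.T.br (S.E i)).toFun x =
    ∑ k : Unit, (S.κ i).1 x • S.T.toFun x := by
  rw [S.br_T]; simp

theorem ip_br_E (p : Fin 3) (Z : Vec 4 U) : ((S.E (p + 1)).br (S.E (p + 2))).ip g Z =
    S.c p 0 * (S.E 0).ip g Z + S.c p 1 * (S.E 1).ip g Z + S.c p 2 * (S.E 2).ip g Z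
      + S.Ω p * S.T.ip g Z := by
  rw [Vec.ip_congr (S.br_E_sum p), Fin.sum_univ_four]
  rfl

theorem ip_br_T (i : Fin 3) (Z : Vec 4 U) : (S.T.br (S.E i)).ip g Z = S.κ i * S.T.ip g Z := by
  rw [Vec.ip_congr (S.br_T_sum i)]
  simp

theorem nab_br_E (hD : SmoothConn D) (p : Fin 3) (Y Z : Vec 4 U) :
    (((S.E (p + 1)).br (S.E (p + 2))).nab hD Y).ip g Z =
    S.c p 0 * ((S.E 0).nab hD Y).ip g Z + S.c p 1 * ((S.E 1).nab hD Y).ip g Z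
      + S.c p 2 * ((S.E 2).nab hD Y).ip g Z + S.Ω p * (S.T.nab hD Y).ip g Z := by
  rw [Vec.nab_ip_congr hD (S.br_E_sum p), Fin.sum_univ_four]
  rfl

theorem nab_br_T (hD : SmoothConn D) (i : Fin 3) (Y Z : Vec 4 U) :
    ((S.T.br (S.E i)).nab hD Y).ip g Z = S.κ i * (S.T.nab hD Y).ip g Z := by
  rw [Vec.nab_ip_congr hD (S.br_T_sum i)]
  simp

theorem d_br_E (p : Fin 3) (f : Fn 4 U) : (S.E (p + 1)).d ((S.E (p + 2)).d f)
      - (S.E (p + 2)).d ((S.E (p + 1)).d f) =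
    S.c p 0 * (S.E 0).d f + S.c p 1 * (S.E 1).d f + S.c p 2 * (S.E 2).d f + S.Ω p * S.T.d f := by
  rw [← Vec.d_br, Vec.d_congr (S.br_E_sum p), Fin.sum_univ_four]
  rfl

theorem d_br_T (i : Fin 3) (f : Fn 4 U) : S.T.d ((S.E i).d f) - (S.E i).d (S.T.d f) =
    S.κ i * S.T.d f := by
  rw [← Vec.d_br, Vec.d_congr (S.br_T_sum i)]
  simp

theorem ip_E_T (i : Fin 3) : (S.E i).ip g S.T = 0 := by rw [Vec.ip_comm, S.ip_T_E]

theorem d_lam (X : Vec 4 U) : 2 * (S.lam * X.d S.lam) = X.d S.Q := by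
  rw [Q, pow_two, Derivation.leibniz, smul_eq_mul]
  ring

variable (hW : IsLeviCivita g D) (hD : SmoothConn D)

include hW

/-- This and the next lemmas evaluate the Koszul formula on `E` and `T`. The acceleration of the
fibres produces `pp`, the horizontal Lee form. -/
theorem two_nab_T_T (l : Fin 3) : 2 * (S.T.nab hD S.T).ip g (S.E l) = S.QInv * S.pp l := by
  have h1 : (S.T.br S.T).ip g (S.E l) = 0 := by rw [hW.br_ip hD, sub_self]
  have h2 : S.T.ip g S.T = S.QInv := S.ip_T
  rw [hW.koszul_ip hD, h1, S.ip_T_E, h2, S.ip_br_T, h2, S.d_QInv, map_zero, pp]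
  ring

/-- Since [T, E_l] is vertical, only T(Q) survives in the Koszul formula. On horizontal vectors ∇T
is thus ν times the identity plus the skew part carried by Ω: the congruence is shear-free. -/
theorem nab_E_T_self (l : Fin 3) : ((S.E l).nab hD S.T).ip g (S.E l) = S.ν := by
  have h1 : ((S.E l).br (S.E l)).ip g S.T = 0 := by rw [hW.br_ip hD, sub_self]
  have h2 : (S.E l).ip g (S.E l) = S.Q := by rw [S.ip_E, if_pos rfl]; rfl
  have h := hW.koszul_ip hD (S.E l) S.T (S.E l)
  rw [h1, h2, S.ip_E_T, hW.br_ip_comm hD (S.E l) S.T, S.ip_br_T, S.ip_T_E, ← S.two_ν] at h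
  simp only [map_zero] at h
  exact Fn.two_cancel (by linear_combination h)

theorem two_nab_E_T (p : Fin 3) :
    2 * ((S.E (p + 1)).nab hD S.T).ip g (S.E (p + 2)) = -(S.Ω p * S.QInv) ∧
    2 * ((S.E (p + 2)).nab hD S.T).ip g (S.E (p + 1)) = S.Ω p * S.QInv := by
  have hT : S.T.ip g S.T = S.QInv := S.ip_T
  have n1 : ¬p + 1 = p + 2 := by fin_cases p <;> decide
  have n2 : ¬p + 2 = p + 1 := by fin_cases p <;> decide
  have hE : ((S.E (p + 1)).br (S.E (p + 2))).ip g S.T = S.Ω p * S.QInv := by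
    rw [S.ip_br_E, S.ip_E_T, S.ip_E_T, S.ip_E_T, hT]; ring
  constructor
  · rw [hW.koszul_ip hD, hE, hW.br_ip_comm hD (S.E (p + 1)) S.T, S.ip_br_T, S.ip_br_T, S.ip_T_E,
      S.ip_T_E, S.ip_E_T, S.ip_E, if_neg n1]
    simp only [map_zero]; ring
  · rw [hW.koszul_ip hD, hW.br_ip_comm hD (S.E (p + 2)) (S.E (p + 1)), hE,
      hW.br_ip_comm hD (S.E (p + 2)) S.T, S.ip_br_T, S.ip_br_T, S.ip_T_E,
      S.ip_T_E, S.ip_E_T, S.ip_E, if_neg n2]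
    simp only [map_zero]; ring

theorem two_nab_T_E (l : Fin 3) :
    2 * (S.T.nab hD (S.E (l + 1))).ip g (S.E (l + 2)) = -(S.Ω l * S.QInv) := by
  have n1 : ¬l + 1 = l + 2 := by fin_cases l <;> decide
  have hT : S.T.ip g S.T = S.QInv := S.ip_T
  rw [hW.koszul_ip hD, S.ip_br_E, S.ip_br_T, S.ip_br_T, S.ip_T_E, S.ip_T_E, S.ip_E, if_neg n1,
    S.ip_E_T, S.ip_E_T, S.ip_E_T, hT]
  simp only [map_zero]; ring

theorem two_nab_E_E (l : Fin 3) :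
    2 * ((S.E l).nab hD (S.E (l + 1))).ip g (S.E (l + 2)) =
      S.Q * (S.c (l + 1) (l + 1) + S.c (l + 2) (l + 2) - S.c l l) ∧
    2 * ((S.E (l + 1)).nab hD (S.E (l + 1))).ip g (S.E (l + 2)) =
      -(S.E (l + 2)).d S.Q - 2 * S.Q * S.c l (l + 1) ∧
    2 * ((S.E (l + 2)).nab hD (S.E (l + 1))).ip g (S.E (l + 2)) =
      (S.E (l + 1)).d S.Q - 2 * S.Q * S.c l (l + 2) := by
  have hE (p k : Fin 3) : ((S.E (p + 1)).br (S.E (p + 2))).ip g (S.E k) = S.Q * S.c p k := by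
    rw [S.ip_br_E, S.ip_T_E, S.ip_E, S.ip_E, S.ip_E]
    fin_cases k <;> simp [Q] <;> ring
  have hself (l k : Fin 3) : ((S.E l).br (S.E l)).ip g (S.E k) = 0 := by
    rw [hW.br_ip hD, sub_self]
  have hs := hE 0
  have hs1 := hE 1
  have hs2 := hE 2
  have h10 (k : Fin 3) := hW.br_ip_comm hD (S.E 1) (S.E 0) (S.E k)
  have h21 (k : Fin 3) := hW.br_ip_comm hD (S.E 2) (S.E 1) (S.E k)
  have h02 (k : Fin 3) := hW.br_ip_comm hD (S.E 0) (S.E 2) (S.E k)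
  have hQ : S.lam ^ 2 = S.Q := rfl
  simp only [zero_add, Fin.isValue, Fin.reduceAdd] at hs hs1 hs2
  fin_cases l <;>
  · simp only [Fin.zero_eta, Fin.mk_one, Fin.reduceFinMk, Fin.reduceAdd, zero_add, Fin.isValue]
    refine ⟨?_, ?_, ?_⟩ <;>
    · rw [hW.koszul_ip hD]
      simp only [S.ip_E, Fin.isValue, Fin.reduceEq, if_true, if_false, hself, h10, h21, h02, hs, hs1,
        hs2, map_zero, hQ]
      ring

end SubmersionFrame
end Frame

/-! ### The antiselfdual connection and its curvature for a Legendrian submersion. -/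

section FrameCurvature
variable {M : Type*} [TopologicalSpace M] [ChartedSpace (EuclideanSpace ℝ (Fin 4)) M]
  [IsManifold (𝓡 4) ∞ M]

namespace SubmersionFrame
variable {U : TopologicalSpace.Opens M} {g : Metric 4 M} {D : Connection 4 M}
  (S : SubmersionFrame g U)

/-- The vertical unit vector field. -/
def ξ : Vec 4 U := Vec.smul (-S.lam) S.T

/-- The orthonormal frame. -/
def w : Fin 4 → Vec 4 U :=
  ![Vec.smul S.lamInv (S.E 0), Vec.smul S.lamInv (S.E 1), Vec.smul S.lamInv (S.E 2), S.ξ]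

theorem w_castSucc (i : Fin 3) : S.w i.castSucc = Vec.smul S.lamInv (S.E i) := by
  fin_cases i <;> rfl

theorem w_three : S.w 3 = S.ξ := rfl

theorem w_frameON : FrameON g S.w := by
  intro x hx
  have hl : S.lam.1 ⟨x, hx⟩ * S.lamInv.1 ⟨x, hx⟩ = 1 := congrArg (fun f : Fn 4 U => f.1 ⟨x, hx⟩) S.lam_mul
  have h (i j : Fin 4) : (S.w i).ip g (S.w j) = if i = j then 1 else 0 := by
    refine Fin.lastCases ?_ (fun i => ?_) i <;> refine Fin.lastCases ?_ (fun j => ?_) j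
    · change (S.w 3).ip g (S.w 3) = _
      rw [w_three, ξ, Vec.ip_smul_left, Vec.ip_smul_right, S.ip_T, if_pos rfl]
      linear_combination (S.lam * S.lamInv + 1) * S.lam_mul
    · change (S.w 3).ip g (S.w j.castSucc) = _
      rw [w_three, w_castSucc, ξ, Vec.ip_smul_left, Vec.ip_smul_right, S.ip_T_E,
        if_neg (Fin.castSucc_lt_last j).ne']
      ring
    · change (S.w i.castSucc).ip g (S.w 3) = _
      rw [w_three, w_castSucc, ξ, Vec.ip_smul_left, Vec.ip_smul_right, S.ip_E_T,
        if_neg (Fin.castSucc_lt_last i).ne]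
      ring
    · rw [w_castSucc, w_castSucc, Vec.ip_smul_left, Vec.ip_smul_right, S.ip_E]
      by_cases hij : i = j
      · rw [if_pos hij, if_pos (congrArg _ hij)]
        linear_combination (S.lam * S.lamInv + 1) * S.lam_mul
      · rw [if_neg hij, if_neg fun h => hij (Fin.castSucc_injective _ h)]
        ring
  intro i j
  have := congrArg (fun f : Fn 4 U => f.1 ⟨x, hx⟩) (h i j)
  rw [apply_ite (fun f : Fn 4 U => f.1 ⟨x, hx⟩)] at this
  exact this

/-- The coefficients of the brackets are those of a Weyl connection in an orthonormal frame with
connection coefficients `Γ` and `om`. -/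
structure IsWeylCoeffs (Γ : Fin 3 → Fin 3 → Fn 4 U) (om : Fin 3 → Fn 4 U) : Prop where
  d_Γ : ∀ i j, S.T.d (Γ i j) = 0
  κ_eq : ∀ i, S.κ i = om i
  c_self : ∀ p, S.c p p = Γ (p + 1) (p + 1) + Γ (p + 2) (p + 2)
  c_one : ∀ p, S.c p (p + 1) = -Γ (p + 1) p - om (p + 2)
  c_two : ∀ p, S.c p (p + 2) = om (p + 1) - Γ (p + 2) p

/-- The curvature of the connection with coefficients `Γ`. -/
def RR (Γ : Fin 3 → Fin 3 → Fn 4 U) (p l : Fin 3) : Fn 4 U :=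
  (S.E (p + 1)).d (Γ (p + 2) l) - (S.E (p + 2)).d (Γ (p + 1) l)
    - (S.c p 0 * Γ 0 l + S.c p 1 * Γ 1 l + S.c p 2 * Γ 2 l)
    + (Γ (p + 1) (l + 1) * Γ (p + 2) (l + 2) - Γ (p + 2) (l + 1) * Γ (p + 1) (l + 2))

variable (hW : IsLeviCivita g D) (hD : SmoothConn D)
include hW

/-- The factors `lam` of the normalized frame combine into `QInv` or cancel. Their derivatives drop
out, being multiplied by inner products of orthogonal fields. -/
theorem asdForm_eq (l : Fin 3) (X : Vec 4 U) : asdForm g hD S.w l X =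
    S.QInv * (X.nab hD (S.E (l + 1))).ip g (S.E (l + 2)) + (X.nab hD S.T).ip g (S.E l) := by
  have n1 : ¬l + 1 = l + 2 := by fin_cases l <;> decide
  rw [asdForm, w_three, w_castSucc, w_castSucc, w_castSucc, ξ, hW.nab_ip_smul, hW.nab_ip_smul,
    Vec.ip_smul_right, Vec.ip_smul_right, Vec.ip_smul_right, Vec.ip_smul_right, S.ip_E, if_neg n1,
    S.ip_T_E, QInv]
  linear_combination (X.nab hD S.T).ip g (S.E l) * S.lam_mul

section Coefficients
variable {Γ : Fin 3 → Fin 3 → Fn 4 U} {om : Fin 3 → Fn 4 U} (hC : S.IsWeylCoeffs Γ om)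
  (hL : ∀ l, S.Ω l = S.Q * S.pp l)
include hC hL

/-- Twice the left side is Q⁻²(Q pp - Ω), so its vanishing is precisely the Legendrian condition. -/
theorem asdForm_T (l : Fin 3) : asdForm g hD S.w l S.T = 0 := by
  rw [S.asdForm_eq hW hD]
  refine Fn.two_cancel ?_
  linear_combination S.QInv * S.two_nab_T_E hW hD l + S.two_nab_T_T hW hD l
    - S.QInv ^ 2 * hL l - S.QInv * S.pp l * S.Q_mul

/-- The heart of the computation: the derivatives of Q, the form κ and the twist Ω contained in the
Levi-Civita connection cancel through the Legendrian condition. What remains is the Weyl connection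
of the base and, on the diagonal, ν. -/
theorem asdForm_E (l : Fin 3) : asdForm g hD S.w l (S.E l) = S.ν + Γ l l ∧
    asdForm g hD S.w l (S.E (l + 1)) = Γ (l + 1) l ∧
    asdForm g hD S.w l (S.E (l + 2)) = Γ (l + 2) l := by
  obtain ⟨h1, h2, h3⟩ := S.two_nab_E_E hW hD l
  have a0 := S.nab_E_T_self hW hD l
  have a1 := (S.two_nab_E_T hW hD (l + 2)).2
  have a2 := (S.two_nab_E_T hW hD (l + 1)).1
  have e1 : l + 2 + 2 = l + 1 := by fin_cases l <;> rfl
  have e2 : l + 2 + 1 = l := by fin_cases l <;> rfl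
  have e3 : l + 1 + 1 = l + 2 := by fin_cases l <;> rfl
  have e4 : l + 1 + 2 = l := by fin_cases l <;> rfl
  rw [e1, e2] at a1
  rw [e3, e4] at a2
  have c1 := hC.c_self (l + 1)
  have c2 := hC.c_self (l + 2)
  have c0 := hC.c_self l
  rw [e3, e4] at c1
  rw [e1, e2] at c2
  have hm := S.Q_mul
  have p1 : S.pp (l + 1) = S.QInv * (S.E (l + 1)).d S.Q - 2 * om (l + 1) := by
    rw [pp, hC.κ_eq]
  have p2 : S.pp (l + 2) = S.QInv * (S.E (l + 2)).d S.Q - 2 * om (l + 2) := by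
    rw [pp, hC.κ_eq]
  refine ⟨?_, ?_, ?_⟩ <;> rw [S.asdForm_eq hW hD] <;> refine Fn.two_cancel ?_
  · linear_combination S.QInv * h1 + 2 * a0 + S.QInv * S.Q * (c1 + c2 - c0) + 2 * Γ l l * hm
  · linear_combination S.QInv * h2 + a1 - 2 * S.QInv * S.Q * hC.c_one l
      + 2 * (Γ (l + 1) l + om (l + 2)) * hm + S.QInv * hL (l + 2) + S.pp (l + 2) * hm + p2
  · linear_combination S.QInv * h3 + a2 - 2 * S.QInv * S.Q * hC.c_two l
      + 2 * (Γ (l + 2) l - om (l + 1)) * hm - S.QInv * hL (l + 1) - S.pp (l + 1) * hm - p1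

/-- The antiselfdual curvature as a function of two vector fields. -/
theorem asdCurv_T (l m : Fin 3) :
    (Vec.curv hD S.T (S.E m) (S.w (l + 1).castSucc)).ip g (S.w (l + 2).castSucc)
        - (Vec.curv hD S.T (S.E m) (S.w 3)).ip g (S.w l.castSucc) =
      if m = l then S.T.d S.ν else 0 := by
  have hA (l : Fin 3) := S.asdForm_T hW hD hC hL l
  -- The bracket [T, E_m] is vertical, where the connection forms vanish.
  have hb : asdForm g hD S.w l (S.T.br (S.E m)) = 0 := by
    have h := hA l
    rw [S.asdForm_eq hW hD] at h ⊢
    rw [S.nab_br_T, S.nab_br_T]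
    linear_combination S.κ m * h
  rw [hW.asd_curv hD S.w_frameON, hb, hA, hA, hA, map_zero]
  obtain ⟨h1, h2, h3⟩ := S.asdForm_E hW hD hC hL l
  have hm : m = l ∨ m = l + 1 ∨ m = l + 2 := by
    fin_cases l <;> fin_cases m <;> decide
  have n1 : l + 1 ≠ l := by fin_cases l <;> decide
  have n2 : l + 2 ≠ l := by fin_cases l <;> decide
  obtain rfl | rfl | rfl := hm
  · rw [h1, if_pos rfl, map_add, hC.d_Γ]; ring
  · rw [h2, if_neg n1, hC.d_Γ]; ring
  · rw [h3, if_neg n2, hC.d_Γ]; ring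

/-- The antiselfdual curvature as a function of two vector fields. -/
theorem asdCurv_E (l p : Fin 3) :
    (Vec.curv hD (S.E (p + 1)) (S.E (p + 2)) (S.w (l + 1).castSucc)).ip g (S.w (l + 2).castSucc)
        - (Vec.curv hD (S.E (p + 1)) (S.E (p + 2)) (S.w 3)).ip g (S.w l.castSucc) =
      S.RR Γ p l + if p = l then S.ν ^ 2 else
        if p = l + 1 then (S.E (l + 2)).d S.ν - S.ν * om (l + 2) else
          S.ν * om (l + 1) - (S.E (l + 1)).d S.ν := by
  -- The vertical part Ω_p T of the bracket does not contribute, by `asdForm_T`.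
  have hb : asdForm g hD S.w l ((S.E (p + 1)).br (S.E (p + 2))) =
      S.c p 0 * asdForm g hD S.w l (S.E 0) + S.c p 1 * asdForm g hD S.w l (S.E 1)
        + S.c p 2 * asdForm g hD S.w l (S.E 2) := by
    have h := S.asdForm_T hW hD hC hL l
    simp only [S.asdForm_eq hW hD] at h ⊢
    rw [S.nab_br_E, S.nab_br_E]
    linear_combination S.Ω p * h
  rw [hW.asd_curv hD S.w_frameON, hb]
  obtain ⟨a00, a10, a20⟩ := S.asdForm_E hW hD hC hL 0
  obtain ⟨a11, a21, a01⟩ := S.asdForm_E hW hD hC hL 1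
  obtain ⟨a22, a02, a12⟩ := S.asdForm_E hW hD hC hL 2
  have c0 := hC.c_self 0
  have c1 := hC.c_self 1
  have c2 := hC.c_self 2
  have c01 := hC.c_one 0
  have c12 := hC.c_one 1
  have c20 := hC.c_one 2
  have c02 := hC.c_two 0
  have c10 := hC.c_two 1
  have c21 := hC.c_two 2
  simp only [zero_add, Fin.isValue, Fin.reduceAdd] at a10 a20 a21 a01 a02 a12 c0 c1 c2 c01 c12 c20 c02 c10 c21
  fin_cases l <;> fin_cases p <;>
  · simp only [Fin.zero_eta, Fin.mk_one, Fin.reduceFinMk, Fin.reduceAdd, zero_add, Fin.isValue,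
      Fin.reduceEq, if_true, if_false, a00, a10, a20, a11, a21, a01, a22, a02, a12, map_add, RR,
      c0, c1, c2, c01, c12, c20, c02, c10, c21]
    ring

end Coefficients

end SubmersionFrame
end FrameCurvature

/-! ### The Legendrian and selfduality conditions in an adapted frame. -/

section FrameForms
variable {M : Type*} [TopologicalSpace M] [ChartedSpace (EuclideanSpace ℝ (Fin 4)) M]
  [IsManifold (𝓡 4) ∞ M]

theorem minimalForm_isLinear (g : Metric 4 M) (D : Connection 4 M)
    (ξ : ∀ x : M, TangentSpace (𝓡 4) x) (x : M) : IsLinearMap ℝ (minimalForm g D ξ x) := by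
  refine ⟨fun u v => ?_, fun r u => ?_⟩ <;> simp only [minimalForm, map_add, map_smul, smul_eq_mul] <;>
    ring

namespace SubmersionFrame
variable {U : TopologicalSpace.Opens M} {g : Metric 4 M} {D : Connection 4 M}
  (S : SubmersionFrame g U)

theorem ξ_toFun (x : U) : S.ξ.toFun x = (-S.lam.1 x) • S.T.toFun x := Vec.smul_at _ _ _

/-- Selfduality in an adapted frame. -/
theorem isSelfdualForm_iff_frame {vol : ∀ x : M, AlternatingMap ℝ (TangentSpace (𝓡 4) x) ℝ (Fin 4)}
    {x : U} (hvol : vol x ![(S.w 0).toFun x, (S.w 1).toFun x, (S.w 2).toFun x, (S.w 3).toFun x] = 1)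
    {F : TangentSpace (𝓡 4) (x : M) → TangentSpace (𝓡 4) (x : M) → ℝ} (hF : IsBilinearMap ℝ F)
    (hs : ∀ u v, F u v = -F v u) :
    IsSelfdualForm g vol x F ↔ ∀ p, F ((S.E (p + 1)).toFun x) ((S.E (p + 2)).toFun x) =
      -(S.Q.1 x * F (S.T.toFun x) ((S.E p).toFun x)) := by
  have hl : S.lam.1 x * S.lamInv.1 x = 1 := congrArg (fun f : Fn 4 U => f.1 x) S.lam_mul
  have hli : S.lamInv.1 x ≠ 0 := fun h => by simp [h] at hl
  have hQ : S.Q.1 x = S.lam.1 x ^ 2 := rfl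
  rw [isSelfdualForm_iff (S.w_frameON x x.2) vol hvol hF hs]
  have w0 : (S.w 0).toFun x = S.lamInv.1 x • (S.E 0).toFun x := Vec.smul_at _ _ _
  have w1 : (S.w 1).toFun x = S.lamInv.1 x • (S.E 1).toFun x := Vec.smul_at _ _ _
  have w2 : (S.w 2).toFun x = S.lamInv.1 x • (S.E 2).toFun x := Vec.smul_at _ _ _
  have w3 : (S.w 3).toFun x = (-S.lam.1 x) • S.T.toFun x := Vec.smul_at _ _ _
  have key (p a b : Fin 3) : F (S.lamInv.1 x • (S.E a).toFun x) (S.lamInv.1 x • (S.E b).toFun x) =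
      F ((-S.lam.1 x) • S.T.toFun x) (S.lamInv.1 x • (S.E p).toFun x) ↔
      F ((S.E a).toFun x) ((S.E b).toFun x) = -(S.Q.1 x * F (S.T.toFun x) ((S.E p).toFun x)) := by
    rw [hF.smul_left, hF.smul_right, hF.smul_left, hF.smul_right, hQ]
    simp only [smul_eq_mul]
    constructor
    · intro h
      have : S.lamInv.1 x ^ 2 * F ((S.E a).toFun x) ((S.E b).toFun x) =
          S.lamInv.1 x ^ 2 * -(S.lam.1 x ^ 2 * F (S.T.toFun x) ((S.E p).toFun x)) := by
        linear_combination h + F (S.T.toFun x) ((S.E p).toFun x) * S.lam.1 x * S.lamInv.1 x * hl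
      exact mul_left_cancel₀ (pow_ne_zero 2 hli) this
    · intro h
      rw [h]
      linear_combination -F (S.T.toFun x) ((S.E p).toFun x) * S.lam.1 x * S.lamInv.1 x * hl
  simp only [w0, w1, w2, w3, key, Fin.forall_fin_succ]
  simp only [Fin.succ_zero_eq_one, zero_add, Fin.isValue, Fin.succ_one_eq_two, Fin.reduceAdd,
    IsEmpty.forall_iff, and_true]

/-- The Lee form of the minimal Weyl derivative on vector fields of the open set. -/
def gam (hD : SmoothConn D) (X : Vec 4 U) : Fn 4 U :=
  (S.ξ.nab hD S.ξ).ip g X + S.ν * S.lamInv * S.ξ.ip g X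

variable (hW : IsLeviCivita g D) (hD : SmoothConn D)

theorem gam_br_E (p : Fin 3) : S.gam hD ((S.E (p + 1)).br (S.E (p + 2))) =
    S.c p 0 * S.gam hD (S.E 0) + S.c p 1 * S.gam hD (S.E 1) + S.c p 2 * S.gam hD (S.E 2)
      + S.Ω p * S.gam hD S.T := by
  simp only [gam, Vec.ip_comm g _ ((S.E (p + 1)).br (S.E (p + 2))), S.ip_br_E,
    Vec.ip_comm g (S.E _), Vec.ip_comm g S.T]
  ring

theorem gam_br_T (i : Fin 3) : S.gam hD (S.T.br (S.E i)) = S.κ i * S.gam hD S.T := by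
  simp only [gam, Vec.ip_comm g _ (S.T.br (S.E i)), S.ip_br_T, Vec.ip_comm g S.T]
  ring

include hW

theorem nab_ξ_ip_ξ (X : Vec 4 U) : (X.nab hD S.ξ).ip g S.ξ = 0 := by
  have h := IsWeylConnection.frame_skew hW smoothOneForm_zero hD S.w_frameON X 3 3
  rw [form_zero, if_pos rfl, S.w_three] at h
  exact Fn.two_cancel (by linear_combination h)

/-- Identifies `pp` with twice the Lee form of the minimal Weyl derivative on the lifted frame. -/
theorem two_gam_E (l : Fin 3) : 2 * S.gam hD (S.E l) = S.pp l := by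
  rw [gam, ξ, Vec.nab_ip_smul_left, hW.nab_ip_smul, Vec.ip_smul_left, S.ip_T_E]
  have h := S.two_nab_T_T hW hD l
  have h2 : S.lam ^ 2 * S.QInv = 1 := S.Q_mul
  linear_combination S.lam ^ 2 * h + S.pp l * h2

theorem gam_T : S.gam hD S.T = -(S.ν * S.QInv) := by
  have h := S.nab_ξ_ip_ξ hW hD S.ξ
  rw [gam]
  have h1 : (S.ξ.nab hD S.ξ).ip g S.ξ = -S.lam * (S.ξ.nab hD S.ξ).ip g S.T :=
    Vec.ip_smul_right _ _ _
  have h2 : S.ξ.ip g S.T = -S.lam * S.QInv := by rw [ξ, Vec.ip_smul_left, S.ip_T]; rfl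
  rw [h2]
  linear_combination -S.lamInv * h + S.lamInv * h1
    - ((S.ξ.nab hD S.ξ).ip g S.T + S.ν * S.QInv) * S.lam_mul

/-- Each of the three horizontal directions contributes -νλ⁻¹ and the vertical one nothing. So
-(1/3) div ξ is νλ⁻¹, the coefficient in `gam`. -/
theorem div_eq : ∑ i, ((S.w i).nab hD S.ξ).ip g (S.w i) = -3 * (S.ν * S.lamInv) := by
  have h3 := S.nab_ξ_ip_ξ hW hD S.ξ
  have h (i : Fin 3) : ((S.w i.castSucc).nab hD S.ξ).ip g (S.w i.castSucc) = -(S.ν * S.lamInv) := by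
    rw [w_castSucc, Vec.nab_ip_smul_left, Vec.ip_smul_right, ξ, hW.nab_ip_smul, S.ip_T_E,
      S.nab_E_T_self hW]
    linear_combination -S.lamInv * S.ν * S.lam_mul
  rw [Fin.sum_univ_castSucc]
  simp only [h, Finset.sum_const, Finset.card_univ, Fintype.card_fin]
  change _ + ((S.w 3).nab hD S.ξ).ip g (S.w 3) = _
  rw [w_three, h3]
  simp only [nsmul_eq_mul]
  push_cast
  ring

variable {ζ : ∀ x : M, TangentSpace (𝓡 4) x} (hζ : ∀ x ∈ U, ζ x = S.ξ.toFun x)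
include hζ

theorem conn_vertical (x : U) : D ζ (x : M) = D S.ξ.toFun x := by
  have he : ∀ᶠ y in 𝓝 (x : M), ζ y = S.ξ.toFun y :=
    (eventually_mem_opens x).mono fun y hy => hζ y hy
  have hs : FieldAt ζ (x : M) := (S.ξ.smooth x x.2).congr he
  exact conn_congr D hs.mdiff (S.ξ.diff x) he

theorem minimalForm_apply (x : U) (v : TangentSpace (𝓡 4) (x : M)) :
    minimalForm g D ζ x v = g.inner x ((S.ξ.nab hD S.ξ).toFun x) v
      + (S.ν * S.lamInv).1 x * g.inner x (S.ξ.toFun x) v := by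
  have h1 := S.conn_vertical hW hζ x
  have h2 : divergence D ζ x = (-3 * (S.ν * S.lamInv)).1 x := by
    rw [← S.div_eq hW hD, divergence, h1]
    refine ((S.w_frameON x x.2).trace (D S.ξ.toFun x).toLinearMap).trans ?_
    simp only [AddSubmonoidClass.coe_finset_sum, Finset.sum_apply]
    rfl
  have h3 : (-3 * (S.ν * S.lamInv)).1 x = -3 * (S.ν * S.lamInv).1 x := rfl
  rw [minimalForm, h1, h2, h3, hζ x x.2]
  change g.inner (x : M) (D S.ξ.toFun x (S.ξ.toFun x)) v - _ = g.inner (x : M) (D S.ξ.toFun x (S.ξ.toFun x)) v + _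
  ring

theorem minimalForm_vec (X : Vec 4 U) (x : U) :
    minimalForm g D ζ x (X.toFun x) = (S.gam hD X).1 x := by
  rw [S.minimalForm_apply hW hD hζ]
  rfl

include hD in
theorem minimalForm_formAt : ∀ x ∈ U, FormAt (minimalForm g D ζ) x := fun x hx =>
  ⟨minimalForm_isLinear g D ζ, fun X hX => by
    have he : ∀ᶠ y in 𝓝 x, minimalForm g D ζ y (X y) =
        g.inner y ((S.ξ.nab hD S.ξ).toFun y) (X y)
        + (S.ν * S.lamInv).lift y * g.inner y (S.ξ.toFun y) (X y) := by
      filter_upwards [U.isOpen.mem_nhds hx] with y hy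
      have := S.minimalForm_apply hW hD hζ ⟨y, hy⟩ (X y)
      rw [this, ← Fn.lift_apply]
    refine ContMDiffAt.congr_of_eventuallyEq ?_ he
    exact (((S.ξ.nab hD S.ξ).smooth x hx).inner g hX).add
      (((S.ν * S.lamInv).lift_smooth x hx).mul ((S.ξ.smooth x hx).inner g hX))⟩

/-- The Faraday curvature of the minimal Weyl derivative. -/
theorem faraday_vec (X Y : Vec 4 U) (x : U) :
    extDerivOne (minimalForm g D ζ) x (X.toFun x) (Y.toFun x) =
      (X.d (S.gam hD Y) - Y.d (S.gam hD X) - S.gam hD (X.br Y)).1 x := by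
  have hα := S.minimalForm_formAt hW hD hζ
  have he (Z : Vec 4 U) : Z.ev hα = S.gam hD Z :=
    Fn.ext fun y => S.minimalForm_vec hW hD hζ Z y
  rw [extDerivOne_vec hα g, he, he, he]

variable {vol : ∀ x : M, AlternatingMap ℝ (TangentSpace (𝓡 4) x) ℝ (Fin 4)}
  (hvol : ∀ x : U,
    vol x ![(S.w 0).toFun x, (S.w 1).toFun x, (S.w 2).toFun x, (S.w 3).toFun x] = 1)
include hvol

theorem isSelfdual_faraday_iff : (∀ x ∈ U, IsSelfdualForm g vol x fun u v =>
      extDerivOne (minimalForm g D ζ) x u v) ↔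
    ∀ p, (S.E (p + 1)).d (S.gam hD (S.E (p + 2))) - (S.E (p + 2)).d (S.gam hD (S.E (p + 1)))
        - S.gam hD ((S.E (p + 1)).br (S.E (p + 2))) =
      -(S.Q * (S.T.d (S.gam hD (S.E p)) - (S.E p).d (S.gam hD S.T)
        - S.gam hD (S.T.br (S.E p)))) := by
  have hα := S.minimalForm_formAt hW hD hζ
  have key (x : U) := S.isSelfdualForm_iff_frame (hvol x)
    (extDerivOne_isBilinear (hα x x.2) g) (extDerivOne_swap (hα x x.2))
  simp only [S.faraday_vec hW hD hζ] at key
  constructor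
  · intro h p
    exact Fn.ext fun x => (key x).1 (h x x.2) p
  · intro h x hx
    exact (key ⟨x, hx⟩).2 fun p => congrArg (fun f : Fn 4 U => f.1 ⟨x, hx⟩) (h p)

include hD in
-- For the dual form of ξ, the form in question is half of dξ - γ ∧ ξ. Before halving, its
-- horizontal components are Ω_pλQ⁻¹ and its value on (T, E_p) is -λ⁻¹pp_p; the comparison required
-- by selfduality is Ω = Q pp.
theorem isLegendrian_iff : (∀ x ∈ U, IsSelfdualForm g vol x fun u v =>
      ((g.inner x (D ζ x u) v - minimalForm g D ζ x u * g.inner x (ζ x) v)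
      - (g.inner x (D ζ x v) u - minimalForm g D ζ x v * g.inner x (ζ x) u)) / 2) ↔
    ∀ p, S.Ω p = S.Q * S.pp p := by
  have hbil (x : M) : IsBilinearMap ℝ fun u v : TangentSpace (𝓡 4) x =>
      ((g.inner x (D ζ x u) v - minimalForm g D ζ x u * g.inner x (ζ x) v)
      - (g.inner x (D ζ x v) u - minimalForm g D ζ x v * g.inner x (ζ x) u)) / 2 := by
    have hl := minimalForm_isLinear g D ζ x
    refine ⟨fun _ _ _ => ?_, fun _ _ _ => ?_, fun _ _ _ => ?_, fun _ _ _ => ?_⟩ <;>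
      simp only [map_add, map_smul, hl.map_add, hl.map_smul, add_apply, smul_apply, smul_eq_mul] <;>
      ring
  have hsw (x : M) (u v : TangentSpace (𝓡 4) x) :
      ((g.inner x (D ζ x u) v - minimalForm g D ζ x u * g.inner x (ζ x) v)
      - (g.inner x (D ζ x v) u - minimalForm g D ζ x v * g.inner x (ζ x) u)) / 2 =
      -(((g.inner x (D ζ x v) u - minimalForm g D ζ x v * g.inner x (ζ x) u)
      - (g.inner x (D ζ x u) v - minimalForm g D ζ x u * g.inner x (ζ x) v)) / 2) := by ring
  have val (X Y : Vec 4 U) (x : U) :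
      ((g.inner (x : M) (D ζ x (X.toFun x)) (Y.toFun x)
          - minimalForm g D ζ x (X.toFun x) * g.inner (x : M) (ζ x) (Y.toFun x))
      - (g.inner (x : M) (D ζ x (Y.toFun x)) (X.toFun x)
          - minimalForm g D ζ x (Y.toFun x) * g.inner (x : M) (ζ x) (X.toFun x))) / 2 =
      (((X.nab hD S.ξ).ip g Y - (Y.nab hD S.ξ).ip g X) - (S.gam hD X * S.ξ.ip g Y
        - S.gam hD Y * S.ξ.ip g X)).1 x / 2 := by
    rw [S.conn_vertical hW hζ, S.minimalForm_vec hW hD hζ, S.minimalForm_vec hW hD hζ, hζ x x.2]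
    congr 1
    change _ = (g.inner (x : M) (D S.ξ.toFun x (X.toFun x)) (Y.toFun x)
        - g.inner (x : M) (D S.ξ.toFun x (Y.toFun x)) (X.toFun x))
        - ((S.gam hD X).1 x * g.inner (x : M) (S.ξ.toFun x) (Y.toFun x)
        - (S.gam hD Y).1 x * g.inner (x : M) (S.ξ.toFun x) (X.toFun x))
    ring
  have hξT : S.ξ.ip g S.T = -S.lam * S.QInv := by rw [ξ, Vec.ip_smul_left, S.ip_T]; rfl
  have hξE (i : Fin 3) : S.ξ.ip g (S.E i) = 0 := by rw [ξ, Vec.ip_smul_left, S.ip_T_E, mul_zero]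
  have hN1 (p : Fin 3) : ((S.E (p + 1)).nab hD S.ξ).ip g (S.E (p + 2))
      - ((S.E (p + 2)).nab hD S.ξ).ip g (S.E (p + 1)) = S.Ω p * S.lam * S.QInv := by
    rw [hW.nab_ip_sub hD, hξE, hξE, S.ip_br_E, Vec.ip_comm g _ S.ξ, Vec.ip_comm g _ S.ξ,
      Vec.ip_comm g _ S.ξ, Vec.ip_comm g _ S.ξ, hξE, hξE, hξE, hξT]
    simp only [map_zero]; ring
  have hN2 (p : Fin 3) : 2 * (S.lam * (((S.T).nab hD S.ξ).ip g (S.E p)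
      - ((S.E p).nab hD S.ξ).ip g S.T)) =
        -S.pp p := by
    rw [hW.nab_ip_sub hD, hξE, S.ip_br_T, Vec.ip_comm g _ S.ξ, hξT, Derivation.leibniz, smul_eq_mul,
      smul_eq_mul, map_neg, S.d_QInv]
    simp only [map_zero]
    have hQ : S.lam ^ 2 = S.Q := rfl
    rw [pp]
    linear_combination S.QInv * S.d_lam (S.E p) + 2 * (S.κ p * S.QInv - S.QInv ^ 2 * (S.E p).d S.Q) * hQ
      + 2 * (S.κ p - S.QInv * (S.E p).d S.Q) * S.Q_mul
  have hli : IsUnit S.lam := IsUnit.of_mul_eq_one _ S.lam_mul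
  have hgE := S.two_gam_E hW hD
  have hQ : S.lam ^ 2 = S.Q := rfl
  have hmid (p : Fin 3) : S.lam * (((S.T).nab hD S.ξ).ip g (S.E p)
      - ((S.E p).nab hD S.ξ).ip g S.T - (S.gam hD S.T * S.ξ.ip g (S.E p)
        - S.gam hD (S.E p) * S.ξ.ip g S.T)) = -S.pp p := by
    refine Fn.two_cancel ?_
    rw [hξE, hξT]
    linear_combination hN2 p - S.QInv * S.lam ^ 2 * hgE p - S.QInv * S.pp p * hQ
      - S.pp p * S.Q_mul
  have heq (p : Fin 3) : S.Ω p = S.Q * S.pp p ↔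
      ((S.E (p + 1)).nab hD S.ξ).ip g (S.E (p + 2)) - ((S.E (p + 2)).nab hD S.ξ).ip g (S.E (p + 1))
        - (S.gam hD (S.E (p + 1)) * S.ξ.ip g (S.E (p + 2))
        - S.gam hD (S.E (p + 2)) * S.ξ.ip g (S.E (p + 1))) =
      -(S.Q * (((S.T).nab hD S.ξ).ip g (S.E p)
        - ((S.E p).nab hD S.ξ).ip g S.T - (S.gam hD S.T * S.ξ.ip g (S.E p)
        - S.gam hD (S.E p) * S.ξ.ip g S.T))) := by
    rw [hN1, hξE, hξE]
    constructor
    · intro h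
      refine hli.mul_left_cancel ?_
      linear_combination h + S.Ω p * S.Q_mul + S.Ω p * S.QInv * hQ + S.Q * hmid p
    · intro h
      have h := congrArg (S.lam * ·) h
      linear_combination h - S.Ω p * S.Q_mul - S.Ω p * S.QInv * hQ - S.Q * hmid p
  have key (x : U) := S.isSelfdualForm_iff_frame (hvol x) (hbil x) (hsw x)
  simp only [val] at key
  simp only [heq]
  constructor
  · intro h p
    refine Fn.ext fun x => ?_
    have h1 := (key x).1 (h x x.2) p
    rw [Fn.neg_apply, Fn.mul_apply]
    linarith
  · intro h x hx
    refine (key ⟨x, hx⟩).2 fun p => ?_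
    rw [h p, Fn.neg_apply, Fn.mul_apply]
    ring

include hD in
/-- Selfduality of the minimal Weyl derivative of a Legendrian congruence. -/
theorem isSelfdual_iff_of_legendrian (hL : ∀ p, S.Ω p = S.Q * S.pp p) :
    (∀ x ∈ U, IsSelfdualForm g vol x fun u v => extDerivOne (minimalForm g D ζ) x u v) ↔
      ∀ p, S.T.d (S.κ p) = 0 := by
  rw [S.isSelfdual_faraday_iff hW hD hζ hvol]
  have hgE := S.two_gam_E hW hD
  have hgT := S.gam_T hW hD
  have hQQ : IsUnit S.Q := IsUnit.of_mul_eq_one _ S.Q_mul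
  -- The T-component of the Jacobi identity for T, E_{p+1}, E_{p+2}: the vertical derivative of Ω is
  -- the exterior derivative of κ.
  have jac (p : Fin 3) : S.T.d (S.Ω p) = (S.E (p + 1)).d (S.κ (p + 2))
      - (S.E (p + 2)).d (S.κ (p + 1)) - (S.c p 0 * S.κ 0 + S.c p 1 * S.κ 1 + S.c p 2 * S.κ 2) := by
    have hj : (S.T.br ((S.E (p + 1)).br (S.E (p + 2)))).ip g S.T =
        ((S.T.br (S.E (p + 1))).br (S.E (p + 2))).ip g S.T
          + ((S.E (p + 1)).br (S.T.br (S.E (p + 2)))).ip g S.T := by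
      refine Fn.ext fun x => ?_
      rw [Fn.add_apply, Vec.ip_apply, Vec.ip_apply, Vec.ip_apply, ← inner_add_left,
        ← Vec.jacobi]
    have hTT : (S.T.br S.T).ip g S.T = 0 := by rw [hW.br_ip hD, sub_self]
    rw [hW.br_ip_congr hD (S.br_E_sum p), hW.br_ip_comm hD (S.T.br (S.E (p + 1))),
      hW.br_ip_congr hD (S.br_T_sum (p + 1)), hW.br_ip_congr hD (S.br_T_sum (p + 2)),
      Fin.sum_univ_four] at hj
    simp only [Finset.univ_unique, Finset.sum_singleton] at hj
    change S.T.d (S.c p 0) * (S.E 0).ip g S.T + S.c p 0 * (S.T.br (S.E 0)).ip g S.T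
      + (S.T.d (S.c p 1) * (S.E 1).ip g S.T + S.c p 1 * (S.T.br (S.E 1)).ip g S.T)
      + (S.T.d (S.c p 2) * (S.E 2).ip g S.T + S.c p 2 * (S.T.br (S.E 2)).ip g S.T)
      + (S.T.d (S.Ω p) * S.T.ip g S.T + S.Ω p * (S.T.br S.T).ip g S.T) = _ at hj
    rw [hTT, hW.br_ip_comm hD _ S.T, hW.br_ip_comm hD _ S.T, S.ip_br_T, S.ip_br_T, S.ip_br_T,
      S.ip_br_T, S.ip_br_T, S.ip_E_T, S.ip_E_T, S.ip_E_T] at hj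
    have hT : S.T.ip g S.T = S.QInv := S.ip_T
    rw [hT] at hj
    linear_combination S.Q * hj + (-S.T.d (S.Ω p) + (S.E (p + 1)).d (S.κ (p + 2))
      - (S.E (p + 2)).d (S.κ (p + 1)) - (S.c p 0 * S.κ 0 + S.c p 1 * S.κ 1 + S.c p 2 * S.κ 2)) * S.Q_mul
  have d2 (X : Vec 4 U) : X.d (S.T.d S.Q) = 2 * X.d S.ν := by
    rw [← S.two_ν, two_mul, map_add, two_mul]
  have dpp (X : Vec 4 U) (p : Fin 3) : X.d (S.pp p) =
      -S.QInv ^ 2 * X.d S.Q * (S.E p).d S.Q + S.QInv * X.d ((S.E p).d S.Q) - 2 * X.d (S.κ p) := by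
    rw [pp, two_mul, map_sub, map_add, Derivation.leibniz, smul_eq_mul, smul_eq_mul, S.d_QInv]
    ring
  have d2g (X : Vec 4 U) (p : Fin 3) : 2 * X.d (S.gam hD (S.E p)) = X.d (S.pp p) := by
    rw [← hgE p, two_mul, two_mul, map_add]
  have hFT (p : Fin 3) : 2 * (S.T.d (S.gam hD (S.E p)) - (S.E p).d (S.gam hD S.T)
      - S.gam hD (S.T.br (S.E p))) = 4 * ((S.E p).d S.ν * S.QInv - S.ν * S.QInv ^ 2 * (S.E p).d S.Q
        + S.κ p * S.ν * S.QInv) - 2 * S.T.d (S.κ p) := by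
    have h1 := S.d_br_T p S.Q
    have h2 := S.two_ν
    rw [d2] at h1
    rw [S.gam_br_T, hgT, map_neg, Derivation.leibniz, smul_eq_mul, smul_eq_mul, S.d_QInv]
    linear_combination d2g S.T p + dpp S.T p + S.QInv * h1
      + (S.QInv ^ 2 * (S.E p).d S.Q - S.QInv * S.κ p) * h2
  have hFE (p : Fin 3) : 2 * ((S.E (p + 1)).d (S.gam hD (S.E (p + 2)))
      - (S.E (p + 2)).d (S.gam hD (S.E (p + 1))) - S.gam hD ((S.E (p + 1)).br (S.E (p + 2)))) =
      4 * (S.ν * S.QInv * S.Ω p) - 2 * S.T.d (S.Ω p) := by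
    have h1 := S.d_br_E p S.Q
    have h2 := S.two_ν
    have p0 : S.pp 0 = S.QInv * (S.E 0).d S.Q - 2 * S.κ 0 := rfl
    have p1 : S.pp 1 = S.QInv * (S.E 1).d S.Q - 2 * S.κ 1 := rfl
    have p2 : S.pp 2 = S.QInv * (S.E 2).d S.Q - 2 * S.κ 2 := rfl
    rw [S.gam_br_E, hgT]
    linear_combination d2g (S.E (p + 1)) (p + 2) - d2g (S.E (p + 2)) (p + 1) + dpp (S.E (p + 1)) (p + 2)
      - dpp (S.E (p + 2)) (p + 1) + S.QInv * h1 - S.c p 0 * (hgE 0 + p0) - S.c p 1 * (hgE 1 + p1)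
      - S.c p 2 * (hgE 2 + p2) + 2 * jac p - S.QInv * S.Ω p * h2
  have hTO (p : Fin 3) : S.T.d (S.Ω p) = 2 * S.ν * S.pp p + S.Q * (-S.QInv ^ 2 * (2 * S.ν)
      * (S.E p).d S.Q + S.QInv * (2 * (S.E p).d S.ν + S.κ p * (2 * S.ν)) - 2 * S.T.d (S.κ p)) := by
    have h1 := S.d_br_T p S.Q
    rw [d2, ← S.two_ν] at h1
    rw [hL, Derivation.leibniz, smul_eq_mul, smul_eq_mul, dpp, ← S.two_ν]
    linear_combination S.Q * S.QInv * h1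
  -- The left side is the antiselfdual component of F⁰. Under the Legendrian condition everything in
  -- it cancels except the vertical derivative of κ.
  have key (p : Fin 3) : ((S.E (p + 1)).d (S.gam hD (S.E (p + 2)))
      - (S.E (p + 2)).d (S.gam hD (S.E (p + 1))) - S.gam hD ((S.E (p + 1)).br (S.E (p + 2)))) +
      S.Q * (S.T.d (S.gam hD (S.E p)) - (S.E p).d (S.gam hD S.T)
      - S.gam hD (S.T.br (S.E p))) = S.Q * S.T.d (S.κ p) := by
    refine Fn.two_cancel ?_
    linear_combination hFE p + S.Q * hFT p + 4 * S.ν * S.QInv * hL p - 2 * hTO p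
      + 4 * S.ν * S.pp p * S.Q_mul
  refine forall_congr' fun p => ?_
  rw [eq_neg_iff_add_eq_zero, key p]
  exact hQQ.mul_right_eq_zero


end SubmersionFrame
end FrameForms

/-! ### The selfdual Einstein condition in an adapted frame. -/

section FrameEinstein
variable {M : Type*} [TopologicalSpace M] [ChartedSpace (EuclideanSpace ℝ (Fin 4)) M]
  [IsManifold (𝓡 4) ∞ M]

theorem asdEinstein_iff_forall {c : ℝ} {R : Fin 4 → Fin 4 → Fin 4 → Fin 4 → ℝ} : AsdEinstein c R ↔
    (∀ l p : Fin 3, R (p + 1).castSucc (p + 2).castSucc (l + 1).castSucc (l + 2).castSucc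
      - R (p + 1).castSucc (p + 2).castSucc 3 l.castSucc = if p = l then -(c / 3) else 0) ∧
    (∀ l m : Fin 3, R 3 m.castSucc (l + 1).castSucc (l + 2).castSucc
      - R 3 m.castSucc 3 l.castSucc = if m = l then c / 3 else 0) := by
  constructor
  · rintro ⟨⟨h1, h2, h3, h4, h5, h6, h7, h8, h9⟩, ⟨k1, k2, k3, k4, k5, k6, k7, k8, k9⟩⟩
    refine ⟨fun l p => ?_, fun l p => ?_⟩
    · fin_cases l <;> fin_cases p <;> assumption
    · fin_cases l <;> fin_cases p <;> assumption
  · rintro ⟨h, k⟩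
    exact ⟨⟨h 0 0, h 0 1, h 0 2, h 1 0, h 1 1, h 1 2, h 2 0, h 2 1, h 2 2⟩,
      ⟨k 0 0, k 0 1, k 0 2, k 1 0, k 1 1, k 1 2, k 2 0, k 2 1, k 2 2⟩⟩

namespace SubmersionFrame
variable {U : TopologicalSpace.Opens M} {g : Metric 4 M} {D : Connection 4 M}
  (S : SubmersionFrame g U)

/-- The orthonormal basis at a point. -/
def wAt (x : U) (i : Fin 4) : TangentSpace (𝓡 4) (x : M) := (S.w i).toFun x

/-- A component of the antiselfdual curvature on vector fields. -/
def asdCurv (hD : SmoothConn D) (l : Fin 3) (X Y : Vec 4 U) : Fn 4 U :=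
  (Vec.curv hD X Y (S.w (l + 1).castSucc)).ip g (S.w (l + 2).castSucc)
    - (Vec.curv hD X Y (S.w 3)).ip g (S.w l.castSucc)

variable (hD : SmoothConn D)

theorem asdCurv_apply (l : Fin 3) (X Y : Vec 4 U) (x : U) : (S.asdCurv hD l X Y).1 x =
    g.inner x (curvature D x (X.toFun x) (Y.toFun x) (S.wAt x (l + 1).castSucc))
        (S.wAt x (l + 2).castSucc)
      - g.inner x (curvature D x (X.toFun x) (Y.toFun x) (S.wAt x 3)) (S.wAt x l.castSucc) := by
  rw [asdCurv, Fn.sub_apply, Vec.ip_apply, Vec.ip_apply, Vec.curv_apply g, Vec.curv_apply g]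
  rfl

/-- Passing from the orthonormal frame to E and T scales a pair of horizontal arguments by λ² and a
vertical-horizontal pair by -1, which explains the factor Q in the first set of equations only and
the sign in the second. -/
theorem asdEinstein_iff (x : U) (c : ℝ) : AsdEinstein c (curvComp g D x (S.wAt x)) ↔
    (∀ l p, (S.asdCurv hD l (S.E (p + 1)) (S.E (p + 2))).1 x =
      if p = l then -(c / 3) * S.Q.1 x else 0) ∧
    (∀ l m, (S.asdCurv hD l S.T (S.E m)).1 x = if m = l then -(c / 3) else 0) := by
  have hl : S.lam.1 x * S.lamInv.1 x = 1 := congrArg (fun f : Fn 4 U => f.1 x) S.lam_mul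
  have hl0 : S.lam.1 x ≠ 0 := fun h => by simp [h] at hl
  have hQ : S.Q.1 x = S.lam.1 x ^ 2 := rfl
  obtain ⟨t1, t2, -⟩ := curvature_isTrilinear g hD (x : M)
  have e1 (i j k : Fin 3) : curvComp g D x (S.wAt x) i.castSucc j.castSucc (k + 1).castSucc (k + 2).castSucc
        - curvComp g D x (S.wAt x) i.castSucc j.castSucc 3 k.castSucc =
      S.lamInv.1 x ^ 2 * (S.asdCurv hD k (S.E i) (S.E j)).1 x := by
    have hi : S.wAt x i.castSucc = S.lamInv.1 x • (S.E i).toFun x := by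
      rw [wAt, w_castSucc, Vec.smul_at]
    have hj : S.wAt x j.castSucc = S.lamInv.1 x • (S.E j).toFun x := by
      rw [wAt, w_castSucc, Vec.smul_at]
    rw [asdCurv_apply]
    simp only [curvComp]
    rw [hi, hj, (t1 _ _).map_smul, (t2 _ _).map_smul, (t1 _ _).map_smul, (t2 _ _).map_smul]
    simp only [inner_smul_left]
    ring
  have e2 (m k : Fin 3) : curvComp g D x (S.wAt x) 3 m.castSucc (k + 1).castSucc (k + 2).castSucc
        - curvComp g D x (S.wAt x) 3 m.castSucc 3 k.castSucc =
      -(S.asdCurv hD k S.T (S.E m)).1 x := by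
    have hi : S.wAt x 3 = (-S.lam.1 x) • S.T.toFun x := S.ξ_toFun x
    have hj : S.wAt x m.castSucc = S.lamInv.1 x • (S.E m).toFun x := by
      rw [wAt, w_castSucc, Vec.smul_at]
    rw [asdCurv_apply]
    have h (z z' : TangentSpace (𝓡 4) (x : M)) :
        g.inner x (curvature D x (S.wAt x 3) (S.wAt x m.castSucc) z) z' =
        -g.inner x (curvature D x (S.T.toFun x) ((S.E m).toFun x) z) z' := by
      rw [hi, hj, (t1 _ _).map_smul, (t2 _ _).map_smul]
      simp only [inner_smul_left]
      linear_combination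
        -g.inner x (curvature D x (S.T.toFun x) ((S.E m).toFun x) z) z' * hl
    simp only [curvComp, h]
    ring
  have hli : S.lamInv.1 x ≠ 0 := fun h => by simp [h] at hl
  rw [asdEinstein_iff_forall]
  simp only [e1, e2]
  refine and_congr (forall_congr' fun l => forall_congr' fun p => ?_)
    (forall_congr' fun l => forall_congr' fun m => ?_)
  · have h (a : ℝ) : S.lamInv.1 x ^ 2 * a = -(c / 3) ↔ a = -(c / 3) * S.Q.1 x := by
      rw [hQ]
      constructor
      · intro h
        linear_combination S.lam.1 x ^ 2 * h - a * (S.lam.1 x * S.lamInv.1 x + 1) * hl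
      · rintro rfl
        linear_combination -(c / 3) * (S.lam.1 x * S.lamInv.1 x + 1) * hl
    split_ifs
    · exact h _
    · exact mul_eq_zero_iff_left (pow_ne_zero 2 hli)
  · split_ifs
    · exact neg_eq_iff_eq_neg
    · exact neg_eq_zero

end SubmersionFrame
end FrameEinstein

/-! ### Curvature, Bianchi identities and the Einstein-Weyl equation in a frame of the base. -/

section WeylFrame
variable {B : Type*} [TopologicalSpace B] [ChartedSpace (EuclideanSpace ℝ (Fin 3)) B]
  [IsManifold (𝓡 3) ∞ B]

theorem WeylStructure.smoothConn (W : WeylStructure B) : SmoothConn W.conn :=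
  W.isWeyl.smooth W.metric W.lee_smooth

variable {V : TopologicalSpace.Opens B} (W : WeylStructure B) (e : Fin 3 → Vec 3 V)

namespace WeylStructure

/-- Connection coefficients in a frame. -/
def frameΓ (m l : Fin 3) : Fn 3 V := ((e m).nab W.smoothConn (e (l + 1))).ip W.metric (e (l + 2))

/-- The Lee form in a frame. -/
def frameOm (m : Fin 3) : Fn 3 V := (e m).form W.lee W.lee_smooth

/-- Bracket coefficients in an orthonormal frame. -/
def frameC (p k : Fin 3) : Fn 3 V := ((e (p + 1)).br (e (p + 2))).ip W.metric (e k)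

/-- The Faraday curvature in a frame. -/
def frameF (p : Fin 3) : Fn 3 V :=
  (e (p + 1)).d (W.frameOm e (p + 2)) - (e (p + 2)).d (W.frameOm e (p + 1))
    - (W.frameC e p 0 * W.frameOm e 0 + W.frameC e p 1 * W.frameOm e 1 + W.frameC e p 2 * W.frameOm e 2)

/-- Components of the curvature in a frame. -/
def frameR (p l : Fin 3) : Fn 3 V :=
  (e (p + 1)).d (W.frameΓ e (p + 2) l) - (e (p + 2)).d (W.frameΓ e (p + 1) l)
    - (W.frameC e p 0 * W.frameΓ e 0 l + W.frameC e p 1 * W.frameΓ e 1 l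
      + W.frameC e p 2 * W.frameΓ e 2 l)
    + (W.frameΓ e (p + 1) (l + 1) * W.frameΓ e (p + 2) (l + 2)
      - W.frameΓ e (p + 2) (l + 1) * W.frameΓ e (p + 1) (l + 2))

variable {W e} (he : FrameON W.metric e)
include he

theorem br_expand_three (X : Vec 3 V) (x : V) : X.toFun x =
    ∑ k, (X.ip W.metric (e k)).1 x • (e k).toFun x := FrameON.br_expand he X x

theorem nab_ip_self (X : Vec 3 V) (l : Fin 3) :
    (X.nab W.smoothConn (e l)).ip W.metric (e l) = X.form W.lee W.lee_smooth := by
  have h := W.isWeyl.frame_skew W.lee_smooth W.smoothConn he X l l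
  rw [if_pos rfl] at h
  exact Fn.two_cancel (by linear_combination h)

theorem nab_ip_swap (X : Vec 3 V) (l : Fin 3) :
    (X.nab W.smoothConn (e (l + 2))).ip W.metric (e (l + 1)) =
      -(X.nab W.smoothConn (e (l + 1))).ip W.metric (e (l + 2)) := by
  have h := W.isWeyl.frame_skew W.lee_smooth W.smoothConn he X (l + 2) (l + 1)
  have n1 : ¬l + 2 = l + 1 := by fin_cases l <;> decide
  rw [if_neg n1] at h
  linear_combination h

/-- Vanishing torsion expresses the brackets by connection coefficients. This lemma and the next two
give the pattern demanded by `IsWeylCoeffs`. -/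
theorem frameC_self (p : Fin 3) : W.frameC e p p =
    W.frameΓ e (p + 1) (p + 1) + W.frameΓ e (p + 2) (p + 2) := by
  have h := nab_ip_swap he (e (p + 2)) (p + 2)
  rw [frameC, W.isWeyl.br_ip W.smoothConn]
  fin_cases p <;>
  · simp only [Fin.zero_eta, Fin.mk_one, Fin.reduceFinMk, Fin.reduceAdd, zero_add, Fin.isValue,
      frameΓ] at h ⊢
    linear_combination -h

theorem frameC_one (p : Fin 3) : W.frameC e p (p + 1) =
    -W.frameΓ e (p + 1) p - W.frameOm e (p + 2) := by
  have h := nab_ip_swap he (e (p + 1)) p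
  rw [frameC, W.isWeyl.br_ip W.smoothConn, nab_ip_self he, h]
  rfl

theorem frameC_two (p : Fin 3) : W.frameC e p (p + 2) =
    W.frameOm e (p + 1) - W.frameΓ e (p + 2) p := by
  rw [frameC, W.isWeyl.br_ip W.smoothConn, nab_ip_self he]
  rfl

theorem frame_d_br (p : Fin 3) (f : Fn 3 V) :
    (e (p + 1)).d ((e (p + 2)).d f) - (e (p + 2)).d ((e (p + 1)).d f) =
      W.frameC e p 0 * (e 0).d f + W.frameC e p 1 * (e 1).d f + W.frameC e p 2 * (e 2).d f := by
  rw [← Vec.d_br, Vec.d_congr (br_expand_three he _), Fin.sum_univ_three]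
  rfl

theorem frame_form_br (p : Fin 3) : ((e (p + 1)).br (e (p + 2))).form W.lee W.lee_smooth =
    W.frameC e p 0 * W.frameOm e 0 + W.frameC e p 1 * W.frameOm e 1
      + W.frameC e p 2 * W.frameOm e 2 := by
  refine Fn.ext fun x => ?_
  change W.lee (x : B) (((e (p + 1)).br (e (p + 2))).toFun x) = _
  rw [br_expand_three he, map_sum, Fin.sum_univ_three, map_smul, map_smul, map_smul]
  rfl

theorem frame_nab_br (p : Fin 3) (Y Z : Vec 3 V) :
    (((e (p + 1)).br (e (p + 2))).nab W.smoothConn Y).ip W.metric Z =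
    W.frameC e p 0 * ((e 0).nab W.smoothConn Y).ip W.metric Z
      + W.frameC e p 1 * ((e 1).nab W.smoothConn Y).ip W.metric Z
      + W.frameC e p 2 * ((e 2).nab W.smoothConn Y).ip W.metric Z := by
  rw [Vec.nab_ip_congr W.smoothConn (br_expand_three he _), Fin.sum_univ_three]
  rfl

theorem frameF_apply (p : Fin 3) (x : V) :
    W.faraday x ((e (p + 1)).toFun x) ((e (p + 2)).toFun x) = (W.frameF e p).1 x := by
  have hα : ∀ y ∈ V, FormAt (fun y => W.lee y) y := fun y _ => W.lee_smooth.formAt y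
  have h (X : Vec 3 V) : X.ev hα = X.form W.lee W.lee_smooth := rfl
  rw [faraday, extDerivOne_vec hα W.metric, h, h, h, frame_form_br he]
  rfl

/-- A Weyl connection does not preserve the representative metric: the part of its curvature
symmetric in the last two arguments is F times the metric. -/
theorem curv_self (p l : Fin 3) :
    (Vec.curv W.smoothConn (e (p + 1)) (e (p + 2)) (e l)).ip W.metric (e l) = W.frameF e p := by
  have S0 (X : Vec 3 V) := nab_ip_swap he X 0
  have S1 (X : Vec 3 V) := nab_ip_swap he X 1
  have S2 (X : Vec 3 V) := nab_ip_swap he X 2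
  simp only [Fin.reduceAdd, zero_add, Fin.isValue] at S0 S1 S2
  rw [W.isWeyl.curv_frame W.lee_smooth W.smoothConn he, Fin.sum_univ_three, nab_ip_self he,
    nab_ip_self he, nab_ip_self he, frame_form_br he, frameF]
  have hd (p : Fin 3) : (e p).form W.lee W.lee_smooth = W.frameOm e p := rfl
  rw [hd, hd]
  fin_cases l <;>
  · simp only [Fin.zero_eta, Fin.mk_one, Fin.reduceFinMk, Fin.isValue, S0, S1, S2]
    ring

theorem curv_pos (p l : Fin 3) :
    (Vec.curv W.smoothConn (e (p + 1)) (e (p + 2)) (e (l + 1))).ip W.metric (e (l + 2)) =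
      W.frameR e p l := by
  have S0 (X : Vec 3 V) := nab_ip_swap he X 0
  have S1 (X : Vec 3 V) := nab_ip_swap he X 1
  have S2 (X : Vec 3 V) := nab_ip_swap he X 2
  simp only [Fin.reduceAdd, zero_add, Fin.isValue] at S0 S1 S2
  rw [W.isWeyl.curv_frame W.lee_smooth W.smoothConn he, Fin.sum_univ_three, frame_nab_br he, frameR]
  have I (X : Vec 3 V) (l : Fin 3) := nab_ip_self he X l
  simp only [frameΓ]
  fin_cases l <;>
  · simp only [Fin.zero_eta, Fin.mk_one, Fin.reduceFinMk, Fin.isValue, Fin.reduceAdd, zero_add,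
      S0, S1, S2, I]
    ring

theorem curv_neg (p l : Fin 3) :
    (Vec.curv W.smoothConn (e (p + 1)) (e (p + 2)) (e (l + 2))).ip W.metric (e (l + 1)) =
      -W.frameR e p l := by
  have S0 (X : Vec 3 V) := nab_ip_swap he X 0
  have S1 (X : Vec 3 V) := nab_ip_swap he X 1
  have S2 (X : Vec 3 V) := nab_ip_swap he X 2
  simp only [Fin.reduceAdd, zero_add, Fin.isValue] at S0 S1 S2
  rw [← curv_pos he, W.isWeyl.curv_frame W.lee_smooth W.smoothConn he,
    W.isWeyl.curv_frame W.lee_smooth W.smoothConn he, Fin.sum_univ_three, Fin.sum_univ_three]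
  have I (X : Vec 3 V) (l : Fin 3) := nab_ip_self he X l
  fin_cases l <;>
  · simp only [Fin.zero_eta, Fin.mk_one, Fin.reduceFinMk, Fin.isValue, Fin.reduceAdd, zero_add,
      S0, S1, S2, I, map_neg]
    ring

theorem curv_ip_swap (X Y Z Z' : Vec 3 V) : (Vec.curv W.smoothConn X Y Z).ip W.metric Z' =
    -(Vec.curv W.smoothConn Y X Z).ip W.metric Z' := by
  refine Fn.ext fun x => ?_
  rw [Fn.neg_apply, Vec.ip_apply, Vec.ip_apply, Vec.curv_apply W.metric, Vec.curv_apply W.metric,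
    curvature_swap, map_neg, neg_apply]

/-- The first Bianchi identity. -/
theorem frame_bianchi (l : Fin 3) :
    W.frameF e l = W.frameR e (l + 1) (l + 2) - W.frameR e (l + 2) (l + 1) := by
  have hb (l : Fin 3) : (Vec.curv W.smoothConn (e 0) (e 1) (e 2)).ip W.metric (e l)
      + (Vec.curv W.smoothConn (e 1) (e 2) (e 0)).ip W.metric (e l)
      + (Vec.curv W.smoothConn (e 2) (e 0) (e 1)).ip W.metric (e l) = 0 := by
    refine Fn.ext fun x => ?_
    rw [Fn.add_apply, Fn.add_apply, Vec.ip_apply, Vec.ip_apply, Vec.ip_apply,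
      Vec.curv_apply W.metric, Vec.curv_apply W.metric, Vec.curv_apply W.metric, ← inner_add_left,
      ← inner_add_left, W.isWeyl.curvature_bianchi W.smoothConn, map_zero]
    rfl
  have h0 := hb 0
  have h1 := hb 1
  have h2 := hb 2
  have a := curv_self he
  have b := curv_pos he
  have c := curv_neg he
  have a0 := a 0 0
  have a1 := a 1 1
  have a2 := a 2 2
  have b1 := b 1 0
  have b2 := b 2 1
  have b0 := b 0 2
  have c2 := c 2 0
  have c0 := c 0 1
  have c1 := c 1 2
  simp only [Fin.reduceAdd, zero_add, Fin.isValue] at a0 a1 a2 b0 b1 b2 c0 c1 c2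
  fin_cases l <;> simp only [Fin.zero_eta, Fin.mk_one, Fin.reduceFinMk, Fin.isValue, Fin.reduceAdd, zero_add]
  · linear_combination h0 - a0 - c1 - b2
  · linear_combination h1 - a1 - c2 - b0
  · linear_combination h2 - a2 - c0 - b1

theorem ricci_frame (x : V) (a b : Fin 3) : ricci W.conn x ((e a).toFun x) ((e b).toFun x) =
    ∑ i, ((Vec.curv W.smoothConn (e i) (e a) (e b)).ip W.metric (e i)).1 x := by
  rw [ricci_eq_sum W.metric W.smoothConn (he x x.2)]
  refine Finset.sum_congr rfl fun i _ => ?_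
  rw [Vec.ip_apply, Vec.curv_apply W.metric]

theorem ricci_frame_self (x : V) (l : Fin 3) : ricci W.conn x ((e l).toFun x) ((e l).toFun x) =
    -(W.frameR e (l + 1) (l + 1)).1 x - (W.frameR e (l + 2) (l + 2)).1 x := by
  rw [ricci_frame he, Fin.sum_univ_three]
  have b := curv_pos he
  have c := curv_neg he
  have s := curv_ip_swap he
  have b0 := b 0 0
  have b1 := b 1 1
  have b2 := b 2 2
  have c0 := c 0 0
  have c1 := c 1 1
  have c2 := c 2 2
  have s01 := s (e 1) (e 0)
  have s12 := s (e 2) (e 1)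
  have s20 := s (e 0) (e 2)
  have z (i k l : Fin 3) : (Vec.curv W.smoothConn (e i) (e i) (e k)).ip W.metric (e l) = 0 :=
    Fn.two_cancel (by linear_combination s (e i) (e i) (e k) (e l))
  simp only [Fin.reduceAdd, zero_add, Fin.isValue] at b0 b1 b2 c0 c1 c2
  fin_cases l <;>
  · simp only [Fin.zero_eta, Fin.mk_one, Fin.reduceFinMk, Fin.isValue, Fin.reduceAdd, zero_add, z,
      s01, s12, s20, b0, b1, b2, c0, c1, c2, Fn.zero_apply, Fn.neg_apply]
    ring

/-- The Faraday terms make the Ricci tensor nonsymmetric; they cancel in the symmetrization, so the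
Einstein-Weyl equation only involves `frameR`. -/
theorem ricci_frame_off (x : V) (l : Fin 3) :
    ricci W.conn x ((e l).toFun x) ((e (l + 1)).toFun x) =
      (W.frameR e (l + 1) l).1 x - (W.frameF e (l + 2)).1 x ∧
    ricci W.conn x ((e (l + 1)).toFun x) ((e l).toFun x) =
      (W.frameR e l (l + 1)).1 x + (W.frameF e (l + 2)).1 x := by
  rw [ricci_frame he, ricci_frame he, Fin.sum_univ_three, Fin.sum_univ_three]
  have b := curv_pos he
  have c := curv_neg he
  have s := curv_ip_swap he
  have a0 := curv_self he 0
  have a1 := curv_self he 1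
  have a2 := curv_self he 2
  have b0 := b 0
  have b1 := b 1
  have b2 := b 2
  have c0 := c 0
  have c1 := c 1
  have c2 := c 2
  have s01 := s (e 1) (e 0)
  have s12 := s (e 2) (e 1)
  have s20 := s (e 0) (e 2)
  have z (i k l : Fin 3) : (Vec.curv W.smoothConn (e i) (e i) (e k)).ip W.metric (e l) = 0 :=
    Fn.two_cancel (by linear_combination s (e i) (e i) (e k) (e l))
  have b00 := b0 0
  have b01 := b0 1
  have b02 := b0 2
  have b10 := b1 0
  have b11 := b1 1
  have b12 := b1 2
  have b20 := b2 0
  have b21 := b2 1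
  have b22 := b2 2
  have c00 := c0 0
  have c01 := c0 1
  have c02 := c0 2
  have c10 := c1 0
  have c11 := c1 1
  have c12 := c1 2
  have c20 := c2 0
  have c21 := c2 1
  have c22 := c2 2
  simp only [Fin.reduceAdd, zero_add, Fin.isValue] at a0 a1 a2 b00 b01 b02 b10 b11 b12 b20 b21 b22
  simp only [Fin.reduceAdd, zero_add, Fin.isValue] at c00 c01 c02 c10 c11 c12 c20 c21 c22
  fin_cases l <;>
  · simp only [Fin.zero_eta, Fin.mk_one, Fin.reduceFinMk, Fin.isValue, Fin.reduceAdd, zero_add, z,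
      s01, s12, s20, a0, a1, a2, b00, b01, b02, b10, b11, b12, b20, b21, b22,
      c00, c01, c02, c10, c11, c12, c20, c21, c22, Fn.zero_apply, Fn.neg_apply]
    constructor <;> ring

theorem scal_frame (x : V) : W.scal x = -2 * ((W.frameR e 0 0).1 x + (W.frameR e 1 1).1 x
    + (W.frameR e 2 2).1 x) := by
  have h0 := ricci_frame_self he x 0
  have h1 := ricci_frame_self he x 1
  have h2 := ricci_frame_self he x 2
  simp only [Fin.reduceAdd, zero_add, Fin.isValue] at h0 h1 h2
  rw [scal, scalarCurv_eq_sum W.metric W.smoothConn (he x x.2), Fin.sum_univ_three, h0, h1, h2]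
  ring

/-- The Einstein-Weyl equation in a frame. -/
theorem frame_einsteinWeyl (hEW : W.IsEinsteinWeyl) (x : V) (l : Fin 3) :
    (W.frameR e l l).1 x = -(W.scal x / 6) ∧
    (W.frameR e (l + 1) (l + 2)).1 x = (W.frameF e l).1 x / 2 ∧
    (W.frameR e (l + 2) (l + 1)).1 x = -((W.frameF e l).1 x / 2) := by
  have hd (l : Fin 3) : -(W.frameR e (l + 1) (l + 1)).1 x - (W.frameR e (l + 2) (l + 2)).1 x =
      W.scal x / 3 := by
    have h := hEW x ((e l).toFun x) ((e l).toFun x)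
    rw [ricci_frame_self he, he x x.2 l l, if_pos rfl] at h
    linarith
  have ho (l : Fin 3) : (W.frameR e (l + 1) l).1 x + (W.frameR e l (l + 1)).1 x = 0 := by
    have h := hEW x ((e l).toFun x) ((e (l + 1)).toFun x)
    have n1 : ¬l = l + 1 := by fin_cases l <;> decide
    rw [(ricci_frame_off he x l).1, (ricci_frame_off he x l).2, he x x.2 l (l + 1), if_neg n1] at h
    linarith
  have hb (l : Fin 3) : (W.frameF e l).1 x =
      (W.frameR e (l + 1) (l + 2)).1 x - (W.frameR e (l + 2) (l + 1)).1 x :=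
    congrArg (fun f : Fn 3 V => f.1 x) (frame_bianchi he l)
  have hs := scal_frame he x
  have d0 := hd 0
  have d1 := hd 1
  have d2 := hd 2
  have o0 := ho 0
  have o1 := ho 1
  have o2 := ho 2
  have b := hb l
  simp only [Fin.reduceAdd, zero_add, Fin.isValue] at d0 d1 d2 o0 o1 o2
  fin_cases l <;>
  · simp only [Fin.zero_eta, Fin.mk_one, Fin.reduceFinMk, Fin.isValue, Fin.reduceAdd, zero_add] at b ⊢
    exact ⟨by linarith, by linarith, by linarith⟩

/-- The Einstein-Weyl equation at a point, from a frame. -/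
theorem einsteinWeyl_of_frame {x : V} (hd : (W.frameR e 0 0).1 x = (W.frameR e 1 1).1 x ∧
      (W.frameR e 1 1).1 x = (W.frameR e 2 2).1 x)
    (ho : ∀ l, (W.frameR e (l + 1) l).1 x + (W.frameR e l (l + 1)).1 x = 0)
    (u v : TangentSpace (𝓡 3) (x : B)) :
    (ricci W.conn x u v + ricci W.conn x v u) / 2 = W.scal x / 3 * W.metric.inner x u v := by
  have hr := ricci_isBilinear W.metric W.smoothConn (x : B)
  refine bilinear_ext (he x x.2).basis
    (β := fun u v => (ricci W.conn x u v + ricci W.conn x v u) / 2)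
    (β' := fun u v => W.scal x / 3 * W.metric.inner x u v)
    ⟨fun _ _ _ => by rw [hr.add_left, hr.add_right]; ring,
      fun _ _ _ => by rw [hr.smul_left, hr.smul_right]; simp only [smul_eq_mul]; ring,
      fun _ _ _ => by rw [hr.add_left, hr.add_right]; ring,
      fun _ _ _ => by rw [hr.smul_left, hr.smul_right]; simp only [smul_eq_mul]; ring⟩
    ⟨fun _ _ _ => by rw [inner_add_left, mul_add],
      fun _ _ _ => by rw [inner_smul_left, smul_eq_mul]; ring,
      fun _ _ _ => by rw [map_add, mul_add],
      fun _ _ _ => by rw [map_smul, smul_eq_mul, smul_eq_mul]; ring⟩ (fun i j => ?_) u v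
  rw [IsON.basis_apply, IsON.basis_apply, he x x.2 i j, scal_frame he x]
  have s (l : Fin 3) := ricci_frame_self he x l
  have o (l : Fin 3) := ricci_frame_off he x l
  have s0 := s 0
  have s1 := s 1
  have s2 := s 2
  obtain ⟨o0, o0'⟩ := o 0
  obtain ⟨o1, o1'⟩ := o 1
  obtain ⟨o2, o2'⟩ := o 2
  have h0 := ho 0
  have h1 := ho 1
  have h2 := ho 2
  simp only [Fin.reduceAdd, zero_add, Fin.isValue] at s0 s1 s2 o0 o0' o1 o1' o2 o2' h0 h1 h2
  fin_cases i <;> fin_cases j <;>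
  · simp only [Fin.zero_eta, Fin.mk_one, Fin.reduceFinMk, Fin.isValue, s0, s1, s2, o0, o0', o1,
      o1', o2, o2', if_true, if_false, Fin.reduceEq]
    linarith [hd.1, hd.2]

/-- For a torsion-free connection, the first Bianchi identity turns into the Jacobi identity of the
frame when the bracket coefficients are written as connection coefficients. -/
theorem frame_jacobi (k : Fin 3) :
    (e 0).d (W.frameC e 0 k) + (e 1).d (W.frameC e 1 k) + (e 2).d (W.frameC e 2 k)
      + (W.frameC e 0 1 * W.frameC e 2 k - W.frameC e 0 2 * W.frameC e 1 k)
      + (W.frameC e 1 2 * W.frameC e 0 k - W.frameC e 1 0 * W.frameC e 2 k)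
      + (W.frameC e 2 0 * W.frameC e 1 k - W.frameC e 2 1 * W.frameC e 0 k) = 0 := by
  have h := frame_bianchi he k
  have c0 := frameC_self he 0
  have c1 := frameC_self he 1
  have c2 := frameC_self he 2
  have c01 := frameC_one he 0
  have c12 := frameC_one he 1
  have c20 := frameC_one he 2
  have c02 := frameC_two he 0
  have c10 := frameC_two he 1
  have c21 := frameC_two he 2
  simp only [zero_add, Fin.isValue, Fin.reduceAdd] at c0 c1 c2 c01 c12 c20 c02 c10 c21
  fin_cases k <;>
  · simp only [Fin.zero_eta, Fin.mk_one, Fin.reduceFinMk, Fin.isValue, Fin.reduceAdd, zero_add,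
      frameF, frameR, c0, c1, c2, c01, c12, c20, c02, c10, c21, map_add, map_sub, map_neg] at h ⊢
    linear_combination h

/-- The second Bianchi identity. -/
theorem frame_bianchi_two (l : Fin 3) :
    (e 0).d (W.frameR e 0 l) + (e 1).d (W.frameR e 1 l) + (e 2).d (W.frameR e 2 l)
      + (W.frameC e 0 1 * W.frameR e 2 l - W.frameC e 0 2 * W.frameR e 1 l)
      + (W.frameC e 1 2 * W.frameR e 0 l - W.frameC e 1 0 * W.frameR e 2 l)
      + (W.frameC e 2 0 * W.frameR e 1 l - W.frameC e 2 1 * W.frameR e 0 l)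
      + (W.frameΓ e 0 (l + 1) * W.frameR e 0 (l + 2) - W.frameΓ e 0 (l + 2) * W.frameR e 0 (l + 1))
      + (W.frameΓ e 1 (l + 1) * W.frameR e 1 (l + 2) - W.frameΓ e 1 (l + 2) * W.frameR e 1 (l + 1))
      + (W.frameΓ e 2 (l + 1) * W.frameR e 2 (l + 2) - W.frameΓ e 2 (l + 2) * W.frameR e 2 (l + 1))
      = 0 := by
  have j0 := frame_jacobi he 0
  have j1 := frame_jacobi he 1
  have j2 := frame_jacobi he 2
  have b0 := frame_d_br he 0 (W.frameΓ e 0 l)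
  have b1 := frame_d_br he 1 (W.frameΓ e 1 l)
  have b2 := frame_d_br he 2 (W.frameΓ e 2 l)
  have e1 : l + 1 + 1 = l + 2 := by fin_cases l <;> rfl
  have e2 : l + 1 + 2 = l := by fin_cases l <;> rfl
  have e3 : l + 2 + 1 = l := by fin_cases l <;> rfl
  have e4 : l + 2 + 2 = l + 1 := by fin_cases l <;> rfl
  simp only [zero_add, Fin.isValue, Fin.reduceAdd] at b0 b1 b2
  simp only [frameR, zero_add, Fin.isValue, Fin.reduceAdd, e1, e2, e3, e4, map_add, map_sub,
    Derivation.leibniz, smul_eq_mul]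
  -- Commutators of derivations remove the second derivatives of Γ, and the Jacobi identity removes
  -- the terms in which Γ multiplies derivatives of the bracket coefficients.
  linear_combination b0 + b1 + b2 - W.frameΓ e 0 l * j0 - W.frameΓ e 1 l * j1 - W.frameΓ e 2 l * j2

/-- The second Bianchi identity for the curvature of an Einstein-Weyl structure. -/
theorem frame_einsteinWeyl_bianchi (hEW : W.IsEinsteinWeyl) (p : Fin 3) :
    (e (p + 1)).d (W.frameF e (p + 2)) - (e (p + 2)).d (W.frameF e (p + 1))
      - (W.frameC e p 0 * W.frameF e 0 + W.frameC e p 1 * W.frameF e 1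
        + W.frameC e p 2 * W.frameF e 2)
      + W.frameF e (p + 1) * W.frameOm e (p + 2) - W.frameF e (p + 2) * W.frameOm e (p + 1) =
    2 * (e p).d (W.frameR e p p) - 4 * W.frameR e p p * W.frameOm e p := by
  -- For an Einstein-Weyl structure the matrix `frameR` is a scalar plus a skew matrix equivalent to
  -- F/2, so the second Bianchi identity becomes a relation between derivatives of F and of the
  -- scalar curvature.
  have h (l : Fin 3) : W.frameR e (l + 1) (l + 1) = W.frameR e l l ∧
      W.frameF e l = 2 * W.frameR e (l + 1) (l + 2) ∧
      W.frameR e (l + 2) (l + 1) = -W.frameR e (l + 1) (l + 2) := by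
    refine ⟨Fn.ext fun x => ?_, Fn.ext fun x => ?_, Fn.ext fun x => ?_⟩
    · rw [(frame_einsteinWeyl he hEW x _).1, (frame_einsteinWeyl he hEW x _).1]
    · rw [two_mul, Fn.add_apply, (frame_einsteinWeyl he hEW x l).2.1]
      ring
    · rw [Fn.neg_apply, (frame_einsteinWeyl he hEW x l).2.1, (frame_einsteinWeyl he hEW x l).2.2]
  have hB := frame_bianchi_two he p
  obtain ⟨d0, f0, r0⟩ := h 0
  obtain ⟨d1, f1, r1⟩ := h 1
  obtain ⟨d2, f2, r2⟩ := h 2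
  have c0 := frameC_self he 0
  have c1 := frameC_self he 1
  have c2 := frameC_self he 2
  have c01 := frameC_one he 0
  have c12 := frameC_one he 1
  have c20 := frameC_one he 2
  have c02 := frameC_two he 0
  have c10 := frameC_two he 1
  have c21 := frameC_two he 2
  simp only [zero_add, Fin.isValue, Fin.reduceAdd] at c0 c1 c2 c01 c12 c20 c02 c10 c21 d0 d1 f0 f1
  simp only [zero_add, Fin.isValue, Fin.reduceAdd] at f2 r0 r1 r2
  fin_cases p <;>
  · simp only [Fin.zero_eta, Fin.mk_one, Fin.reduceFinMk, Fin.isValue, Fin.reduceAdd, zero_add,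
      f0, f1, f2, r0, r1, r2, c0, c1, c2, c01, c12, c20, c02, c10, c21, d1, d0, two_mul, map_add,
      map_neg] at hB ⊢
    linear_combination -2 * hB

end WeylStructure
end WeylFrame

/-! ### Vector fields along a map, related fields and pulled back functions. -/

section Along
variable {m n : ℕ} {M : Type*} [TopologicalSpace M] [ChartedSpace (EuclideanSpace ℝ (Fin m)) M]
  [IsManifold (𝓡 m) ∞ M]
  {B : Type*} [TopologicalSpace B] [ChartedSpace (EuclideanSpace ℝ (Fin n)) B]
  [IsManifold (𝓡 n) ∞ B]

/-- Smoothness of a vector field along a map. -/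
abbrev AlongAt (pr : M → B) (Z : ∀ y : M, TangentSpace (𝓡 n) (pr y)) (x : M) : Prop :=
  ContMDiffAt (𝓡 m) (𝓡 n).tangent ∞ (fun y => (⟨pr y, Z y⟩ : TangentBundle (𝓡 n) B)) x

variable {pr : M → B} {x : M}

theorem FieldAt.push (hpr : ContMDiff (𝓡 m) (𝓡 n) ∞ pr) {X : ∀ y : M, TangentSpace (𝓡 m) y}
    (hX : FieldAt X x) : AlongAt (m := m) pr (fun y => mfderiv (𝓡 m) (𝓡 n) pr y (X y)) x :=
  (hpr.contMDiff_tangentMap (m := ∞) le_rfl).contMDiffAt.comp x hX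

theorem FieldAt.along (hpr : ContMDiff (𝓡 m) (𝓡 n) ∞ pr) {a : ∀ y : B, TangentSpace (𝓡 n) y}
    (ha : FieldAt a (pr x)) : AlongAt (m := m) pr (fun y => a (pr y)) x :=
  ContMDiffAt.comp (g := fun y => (⟨y, a y⟩ : TangentBundle (𝓡 n) B)) x ha hpr.contMDiffAt

theorem AlongAt.inner (hpr : ContMDiff (𝓡 m) (𝓡 n) ∞ pr) (h : Metric n B)
    {Z Z' : ∀ y : M, TangentSpace (𝓡 n) (pr y)}
    (hZ : AlongAt (m := m) pr Z x) (hZ' : AlongAt (m := m) pr Z' x) :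
    FunAt (n := m) (fun y => h.inner (pr y) (Z y) (Z' y)) x := by
  have h := ContMDiffAt.clm_bundle_apply₂ (E₁ := fun x : B => TangentSpace (𝓡 n) x)
    (E₂ := fun x : B => TangentSpace (𝓡 n) x) (E₃ := Bundle.Trivial B ℝ) (b := pr)
    (h.contMDiff.contMDiffAt.comp x hpr.contMDiffAt) hZ hZ'
  simp only [contMDiffAt_totalSpace] at h
  exact h.2

theorem AlongAt.oneForm (hpr : ContMDiff (𝓡 m) (𝓡 n) ∞ pr)
    {α : ∀ x : B, TangentSpace (𝓡 n) x →L[ℝ] ℝ} (hα : SmoothOneForm α)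
    {Z : ∀ y : M, TangentSpace (𝓡 n) (pr y)} (hZ : AlongAt (m := m) pr Z x) :
    FunAt (n := m) (fun y => α (pr y) (Z y)) x := by
  have h := ContMDiffAt.clm_bundle_apply (E₁ := fun x : B => TangentSpace (𝓡 n) x)
    (E₂ := Bundle.Trivial B ℝ) (b := pr) (hα.contMDiffAt.comp x hpr.contMDiffAt) hZ
  simp only [contMDiffAt_totalSpace] at h
  exact h.2

theorem mvfderiv_comp_proj (hpr : ContMDiff (𝓡 m) (𝓡 n) ∞ pr) {f : B → ℝ}
    (hf : FunAt (n := n) f (pr x)) (v : TangentSpace (𝓡 m) x) :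
    mvfderiv (𝓡 m) (f ∘ pr) x v = mvfderiv (𝓡 n) f (pr x) (mfderiv (𝓡 m) (𝓡 n) pr x v) :=
  mvfderiv_comp_apply x hf.mdiff (hpr.contMDiffAt.mdifferentiableAt (by simp)) v

/-- The Lie bracket of related vector fields. -/
theorem mfderiv_mlieBracket_of_related (hpr : ContMDiff (𝓡 m) (𝓡 n) ∞ pr)
    {X Y : ∀ y : M, TangentSpace (𝓡 m) y} {a b : ∀ y : B, TangentSpace (𝓡 n) y}
    (hX : FieldAt X x) (hY : FieldAt Y x) (ha : FieldAt a (pr x)) (hb : FieldAt b (pr x))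
    (hXa : ∀ᶠ y in 𝓝 x, mfderiv (𝓡 m) (𝓡 n) pr y (X y) = a (pr y))
    (hYb : ∀ᶠ y in 𝓝 x, mfderiv (𝓡 m) (𝓡 n) pr y (Y y) = b (pr y)) :
    mfderiv (𝓡 m) (𝓡 n) pr x (mlieBracket (𝓡 m) X Y x) = mlieBracket (𝓡 n) a b (pr x) := by
  -- Both sides are compared as derivations on functions near `pr x`.
  refine eq_of_mvfderiv_eq fun f hf => ?_
  have hfx : FunAt (n := n) f (pr x) := hf _ (mem_chart_source _ _)
  have hs : ∀ᶠ y in 𝓝 x, FunAt (n := n) f (pr y) :=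
    (hpr.continuous.continuousAt.eventually ((chartAt (EuclideanSpace ℝ (Fin n)) (pr x)).open_source.mem_nhds
      (mem_chart_source _ _))).mono fun y hy => hf _ hy
  rw [← mvfderiv_comp_proj hpr hfx, mvfderiv_mlieBracket (hfx.comp x hpr.contMDiffAt) hX hY,
    mvfderiv_mlieBracket hfx ha hb]
  have key {Z : ∀ y : M, TangentSpace (𝓡 m) y} {c : ∀ y : B, TangentSpace (𝓡 n) y}
      (hc : FieldAt c (pr x)) (hZ : ∀ᶠ y in 𝓝 x, mfderiv (𝓡 m) (𝓡 n) pr y (Z y) = c (pr y))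
      (v : TangentSpace (𝓡 m) x) :
      mvfderiv (𝓡 m) (fun z => mvfderiv (𝓡 m) (f ∘ pr) z (Z z)) x v =
        mvfderiv (𝓡 n) (fun z => mvfderiv (𝓡 n) f z (c z)) (pr x)
          (mfderiv (𝓡 m) (𝓡 n) pr x v) := by
    rw [← mvfderiv_comp_proj hpr (contMDiffAt_mvfderiv_apply hfx hc)]
    refine congrArg (fun L => L v) (mvfderiv_congr ?_)
    filter_upwards [hs, hZ] with y h1 h2
    rw [mvfderiv_comp_proj hpr h1, h2]
    rfl
  rw [key hb hYb, key ha hXa, hXa.self_of_nhds, hYb.self_of_nhds]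

variable {U : TopologicalSpace.Opens M} {V : TopologicalSpace.Opens B}

/-- The pullback of functions. -/
def Fn.comap (hpr : ContMDiff (𝓡 m) (𝓡 n) ∞ pr) (hUV : ∀ y ∈ U, pr y ∈ V) :
    Fn n V →ₐ[ℝ] Fn m U where
  toFun f := ⟨fun y => f.1 ⟨pr y, hUV y y.2⟩, f.lift ∘ pr, fun x hx =>
    (f.lift_smooth (pr x) (hUV x hx)).comp x hpr.contMDiffAt, fun y =>
      (f.lift_apply ⟨pr y, hUV y y.2⟩).symm⟩
  map_one' := rfl
  map_mul' _ _ := rfl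
  map_zero' := rfl
  map_add' _ _ := rfl
  commutes' _ := rfl

theorem Vec.d_comap_apply (hpr : ContMDiff (𝓡 m) (𝓡 n) ∞ pr) (hUV : ∀ y ∈ U, pr y ∈ V) (X : Vec m U)
    (f : Fn n V) (x : U) : (X.d (Fn.comap hpr hUV f)).1 x =
      mvfderiv (𝓡 n) f.lift (pr x) (mfderiv (𝓡 m) (𝓡 n) pr x (X.toFun x)) := by
  have hs := f.lift_smooth (pr x) (hUV x x.2)
  rw [← mvfderiv_comp_proj hpr hs]
  exact Vec.d_eq X (f.lift ∘ pr) (fun y hy => (f.lift_smooth (pr y) (hUV y hy)).comp y hpr.contMDiffAt)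
    _ (fun y => (f.lift_apply ⟨pr y, hUV y y.2⟩).symm) x

theorem Vec.d_comap (hpr : ContMDiff (𝓡 m) (𝓡 n) ∞ pr) (hUV : ∀ y ∈ U, pr y ∈ V) {X : Vec m U}
    {a : Vec n V} (h : ∀ y ∈ U, mfderiv (𝓡 m) (𝓡 n) pr y (X.toFun y) = a.toFun (pr y))
    (f : Fn n V) : X.d (Fn.comap hpr hUV f) = Fn.comap hpr hUV (a.d f) := by
  refine Fn.ext fun x => ?_
  rw [Vec.d_comap_apply, h x x.2]
  rfl

theorem Vec.d_comap_eq_zero (hpr : ContMDiff (𝓡 m) (𝓡 n) ∞ pr) (hUV : ∀ y ∈ U, pr y ∈ V) {X : Vec m U}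
    (h : ∀ y ∈ U, mfderiv (𝓡 m) (𝓡 n) pr y (X.toFun y) = 0)
    (f : Fn n V) : X.d (Fn.comap hpr hUV f) = 0 := by
  refine Fn.ext fun x => ?_
  rw [Vec.d_comap_apply, h x x.2, map_zero]
  rfl

end Along

/-! ### Horizontal lifts. -/

section Adapted
variable {M : Type*} [TopologicalSpace M] [ChartedSpace (EuclideanSpace ℝ (Fin 4)) M]
  [IsManifold (𝓡 4) ∞ M]
  {B : Type*} [TopologicalSpace B] [ChartedSpace (EuclideanSpace ℝ (Fin 3)) B]
  [IsManifold (𝓡 3) ∞ B]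
  {g : Metric 4 M} {h : Metric 3 B} {pr : M → B} {ξ : ∀ x : M, TangentSpace (𝓡 4) x}

/-- The kernel of the differential of a conformal submersion. -/
theorem IsConformalSubmersion.eq_smul (hS : IsConformalSubmersion g h pr ξ) {x : M}
    {v : TangentSpace (𝓡 4) x} (hv : mfderiv (𝓡 4) (𝓡 3) pr x v = 0) :
    v = g.inner x v (ξ x) • ξ x := by
  obtain ⟨c, hc, hcon⟩ := hS.conformal x
  set v' := v - g.inner x v (ξ x) • ξ x with hv'
  have h1 : g.inner x v' (ξ x) = 0 := by
    rw [hv', inner_sub_left, inner_smul_left, hS.unit]; ring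
  have h2 : mfderiv (𝓡 4) (𝓡 3) pr x v' = 0 := by
    rw [hv', map_sub, map_smul, hv, hS.vertical]; simp
  have h3 := hcon v' v' h1 h1
  rw [h2, map_zero] at h3
  have h4 : g.inner x v' v' = 0 := by
    rcases mul_eq_zero.1 h3.symm with h | h
    · exact absurd h hc.ne'
    · exact h
  have h5 : v' = 0 := by
    by_contra hne
    exact (g.pos x v' hne).ne' h4
  exact sub_eq_zero.1 h5

/-- A horizontal vector is determined by its projection. -/
theorem IsConformalSubmersion.eq_of_horizontal (hS : IsConformalSubmersion g h pr ξ) {x : M}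
    {v w : TangentSpace (𝓡 4) x} (hv : g.inner x v (ξ x) = 0) (hw : g.inner x w (ξ x) = 0)
    (hvw : mfderiv (𝓡 4) (𝓡 3) pr x v = mfderiv (𝓡 4) (𝓡 3) pr x w) : v = w := by
  have h1 := hS.eq_smul (v := v - w) (by rw [map_sub, hvw, sub_self])
  rw [inner_sub_left, hv, hw, sub_zero, zero_smul] at h1
  exact sub_eq_zero.1 h1

/-- Smooth horizontal lifts. -/
theorem IsConformalSubmersion.exists_lift (hS : IsConformalSubmersion g h pr ξ) (x : M)
    {V : TopologicalSpace.Opens B} (hV : pr x ∈ V) (e : Fin 3 → Vec 3 V) :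
    ∃ U : TopologicalSpace.Opens M, x ∈ U ∧ (∀ y ∈ U, pr y ∈ V) ∧ ∃ E : Fin 3 → Vec 4 U,
      (∀ i, ∀ y ∈ U, mfderiv (𝓡 4) (𝓡 3) pr y ((E i).toFun y) = (e i).toFun (pr y)) ∧
      ∀ i, ∀ y ∈ U, g.inner y (ξ y) ((E i).toFun y) = 0 := by
  have hc : Continuous pr := hS.smooth.continuous
  obtain ⟨U, hUV, hx, u, hu0, hu, hon⟩ := exists_extend_frame g (n := 4) (m := 1) (by norm_num)
    (U := ⟨pr ⁻¹' V, V.isOpen.preimage hc⟩) (x := x) hV (fun _ => ξ)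
    (fun _ _ y _ => hS.smooth_vertical.contMDiffAt) (fun y _ i j => by
      have : i = j := Subsingleton.elim _ _
      simp [this, hS.unit])
  have h0 : u 0 = ξ := hu0 0 (by norm_num)
  have hun (a : Fin 3) (y : M) (hy : y ∈ U) : g.inner y (ξ y) (u (a + 1) y) = 0 := by
    have := hon y hy 0 a.succ
    rw [if_neg (Fin.succ_ne_zero a).symm] at this
    rw [← h0]
    exact this
  have hun' (a : Fin 3) (y : M) (hy : y ∈ U) : g.inner y (u (a + 1) y) (ξ y) = 0 := by
    rw [g.symm]; exact hun a y hy
  have huu (a b : Fin 3) (y : M) (hy : y ∈ U) : g.inner y (u (a + 1) y) (u (b + 1) y) =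
      if a = b then 1 else 0 := by
    have := hon y hy a.succ b.succ
    simp only [Fin.succ_inj] at this
    exact this
  -- The projections of an orthonormal horizontal frame are orthogonal and of equal length by
  -- conformality. The coefficients of a lift are therefore quotients of inner products on the base,
  -- which are smooth.
  set p : Fin 3 → ∀ y : M, TangentSpace (𝓡 3) (pr y) :=
    fun a y => mfderiv (𝓡 4) (𝓡 3) pr y (u (a + 1) y) with hp
  have hps (a : Fin 3) (y : M) (hy : y ∈ U) : AlongAt (m := 4) pr (p a) y :=
    FieldAt.push hS.smooth (hu (a + 1) (by omega) y hy)
  have hpp (y : M) (hy : y ∈ U) : ∃ c : ℝ, 0 < c ∧ ∀ a b, h.inner (pr y) (p a y) (p b y) =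
      if a = b then c else 0 := by
    obtain ⟨c, hc, hcon⟩ := hS.conformal y
    refine ⟨c, hc, fun a b => ?_⟩
    rw [hp, hcon _ _ (hun' a y hy) (hun' b y hy), huu a b y hy]
    split_ifs <;> simp
  have hpos (y : M) (hy : y ∈ U) : h.inner (pr y) (p 0 y) (p 0 y) ≠ 0 := by
    obtain ⟨c, hc, hcon⟩ := hpp y hy
    rw [hcon, if_pos rfl]; exact hc.ne'
  have hsm (i a : Fin 3) (y : M) (hy : y ∈ U) : FunAt (n := 4)
      (fun y => h.inner (pr y) (p a y) ((e i).toFun (pr y)) / h.inner (pr y) (p 0 y) (p 0 y)) y := by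
    have h1 : FunAt (n := 4) (fun y => h.inner (pr y) (p a y) ((e i).toFun (pr y))) y :=
      (hps a y hy).inner hS.smooth h (FieldAt.along hS.smooth ((e i).smooth (pr y) (hUV hy)))
    have h2 : FunAt (n := 4) (fun y => h.inner (pr y) (p 0 y) (p 0 y)) y :=
      (hps 0 y hy).inner hS.smooth h (hps 0 y hy)
    exact h1.div₀ h2 (hpos y hy)
  refine ⟨U, hx, fun y hy => hUV hy, fun i => ⟨fun y => ∑ a : Fin 3,
    (h.inner (pr y) (p a y) ((e i).toFun (pr y)) / h.inner (pr y) (p 0 y) (p 0 y)) • u (a + 1) y,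
    fun y hy => FieldAt.sum fun a _ => FieldAt.smul (hsm i a y hy) (hu (a + 1) (by omega) y hy)⟩,
    fun i y hy => ?_, fun i y hy => ?_⟩
  · obtain ⟨c, hc, hcon⟩ := hpp y hy
    have hsq : Real.sqrt c ≠ 0 := (Real.sqrt_pos.2 hc).ne'
    have hss : Real.sqrt c * Real.sqrt c = c := Real.mul_self_sqrt hc.le
    have hbon : IsON h (pr y) fun a => (Real.sqrt c)⁻¹ • p a y := by
      intro a b
      rw [inner_smul_left, map_smul, smul_eq_mul, hcon]
      split_ifs
      · field_simp; linarith [hss]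
      · simp
    conv_rhs => rw [hbon.expand ((e i).toFun (pr y))]
    dsimp only
    rw [map_sum]
    refine Finset.sum_congr rfl fun a _ => ?_
    rw [map_smul, map_smul, smul_eq_mul, smul_smul, hcon, if_pos rfl, h.symm (pr y) (p a y)]
    congr 1
    field_simp
    rw [pow_two, hss]
  · dsimp only
    rw [map_sum]
    refine Finset.sum_eq_zero fun a _ => ?_
    rw [map_smul, hun a y hy, smul_zero]

end Adapted

/-! ### Existence of adapted frames. -/

section Adapted
variable {M : Type*} [TopologicalSpace M] [ChartedSpace (EuclideanSpace ℝ (Fin 4)) M]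
  [IsManifold (𝓡 4) ∞ M]
  {B : Type*} [TopologicalSpace B] [ChartedSpace (EuclideanSpace ℝ (Fin 3)) B]
  [IsManifold (𝓡 3) ∞ B]
  {g : Metric 4 M} {h : Metric 3 B} {pr : M → B} {ξ : ∀ x : M, TangentSpace (𝓡 4) x}

/-- A frame adapted to a conformal submersion and to an orthonormal frame of the base. -/
structure SubmersionFrame.IsAdapted {U : TopologicalSpace.Opens M} {V : TopologicalSpace.Opens B}
    (S : SubmersionFrame g U) (h : Metric 3 B) (hpr : ContMDiff (𝓡 4) (𝓡 3) ∞ pr)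
    (hUV : ∀ y ∈ U, pr y ∈ V) (e : Fin 3 → Vec 3 V) (ξ : ∀ x : M, TangentSpace (𝓡 4) x) : Prop where
  proj_E : ∀ i, ∀ y ∈ U, mfderiv (𝓡 4) (𝓡 3) pr y ((S.E i).toFun y) = (e i).toFun (pr y)
  proj_T : ∀ y ∈ U, mfderiv (𝓡 4) (𝓡 3) pr y (S.T.toFun y) = 0
  lam_pos : ∀ y : U, 0 < S.lam.1 y
  ξ_eq : ∀ y ∈ U, ξ y = S.ξ.toFun y
  c_eq : ∀ p k, S.c p k = Fn.comap hpr hUV (((e (p + 1)).br (e (p + 2))).ip h (e k))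

theorem fieldAt_zero (y : B) : FieldAt (fun y : B => (0 : TangentSpace (𝓡 3) y)) y :=
  Bundle.contMDiff_zeroSection ℝ (fun y : B => TangentSpace (𝓡 3) y) y

/-- The lifts of an orthonormal frame are orthogonal of a common length, which defines λ. Brackets
of projectable fields project to brackets, and a vector in the kernel of the differential is a
multiple of T; this gives the bracket relations. -/
theorem IsConformalSubmersion.exists_adapted (hS : IsConformalSubmersion g h pr ξ) (x : M)
    {V : TopologicalSpace.Opens B} (hV : pr x ∈ V) {e : Fin 3 → Vec 3 V} (he : FrameON h e) :
    ∃ (U : TopologicalSpace.Opens M) (_ : x ∈ U) (hUV : ∀ y ∈ U, pr y ∈ V) (S : SubmersionFrame g U),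
      S.IsAdapted h hS.smooth hUV e ξ := by
  obtain ⟨U, hx, hUV, E, hE, hEξ⟩ := hS.exists_lift x hV e
  have hEξ' (i : Fin 3) (y : M) (hy : y ∈ U) : g.inner y ((E i).toFun y) (ξ y) = 0 := by
    rw [g.symm]; exact hEξ i y hy
  have hQpos (y : M) (hy : y ∈ U) : 0 < g.inner y ((E 0).toFun y) ((E 0).toFun y) := by
    refine g.pos y _ fun h0 => ?_
    have h1 := hE 0 y hy
    rw [h0, map_zero] at h1
    have h2 := he (pr y) (hUV y hy) 0 0
    rw [if_pos rfl] at h2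
    dsimp only at h2
    rw [← h1, map_zero] at h2
    exact zero_ne_one h2
  have hEE (y : M) (hy : y ∈ U) (i j : Fin 3) : g.inner y ((E i).toFun y) ((E j).toFun y) =
      if i = j then g.inner y ((E 0).toFun y) ((E 0).toFun y) else 0 := by
    obtain ⟨c, hc, hcon⟩ := hS.conformal y
    have h1 (i j : Fin 3) : (if i = j then 1 else 0) = c * g.inner y ((E i).toFun y) ((E j).toFun y) := by
      rw [← hcon _ _ (hEξ' i y hy) (hEξ' j y hy), hE i y hy, hE j y hy]
      exact (he (pr y) (hUV y hy) i j).symm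
    have h0 := h1 0 0
    have hij := h1 i j
    rw [if_pos rfl] at h0
    split_ifs at hij ⊢
    · exact mul_left_cancel₀ hc.ne' (hij.symm.trans h0)
    · exact (mul_eq_zero.1 hij.symm).resolve_left hc.ne'
  set q : M → ℝ := fun y => g.inner y ((E 0).toFun y) ((E 0).toFun y) with hq
  have hqs (y : M) (hy : y ∈ U) : FunAt (n := 4) q y := ((E 0).smooth y hy).inner g ((E 0).smooth y hy)
  have hls (y : M) (hy : y ∈ U) : FunAt (n := 4) (fun y => Real.sqrt (q y)) y :=
    ContDiffAt.comp_contMDiffAt (f := q) (Real.contDiffAt_sqrt (hQpos y hy).ne') (hqs y hy)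
  have hl0 (y : M) (hy : y ∈ U) : Real.sqrt (q y) ≠ 0 := (Real.sqrt_pos.2 (hQpos y hy)).ne'
  have hlis (y : M) (hy : y ∈ U) : FunAt (n := 4) (fun y => (Real.sqrt (q y))⁻¹) y :=
    (hls y hy).inv₀ (hl0 y hy)
  let lam : Fn 4 U := Fn.of _ hls
  let lamInv : Fn 4 U := Fn.of _ hlis
  have hlam : lam * lamInv = 1 := Fn.ext fun y => mul_inv_cancel₀ (hl0 y y.2)
  have hlam2 (y : U) : lam.1 y ^ 2 = q y := Real.sq_sqrt (hQpos y y.2).le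
  -- The length λ⁻¹ is chosen so that ν = ½T(Q) has constant derivative along T when the metric is
  -- selfdual Einstein.
  let T : Vec 4 U := Vec.smul (-lamInv) ⟨ξ, fun y _ => hS.smooth_vertical.contMDiffAt⟩
  have hT (y : U) : T.toFun y = (-lamInv.1 y) • ξ y := Vec.smul_at _ _ _
  have hξT (y : U) : ξ y = (-lam.1 y) • T.toFun y := by
    have h1 : lam.1 y * lamInv.1 y = 1 := congrArg (fun f : Fn 4 U => f.1 y) hlam
    rw [hT, smul_smul, neg_mul_neg, h1, one_smul]
  have hker (y : U) (v : TangentSpace (𝓡 4) (y : M)) (hv : mfderiv (𝓡 4) (𝓡 3) pr y v = 0) :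
      v = (lam.1 y ^ 2 * g.inner y v (T.toFun y)) • T.toFun y := by
    have h1 := hS.eq_smul hv
    rw [hξT y, map_smul, smul_smul, smul_eq_mul] at h1
    conv_lhs => rw [h1]
    congr 1
    ring
  have hprT (y : M) (hy : y ∈ U) : mfderiv (𝓡 4) (𝓡 3) pr y (T.toFun y) = 0 := by
    rw [hT ⟨y, hy⟩, map_smul, hS.vertical, smul_zero]
  let C (p k : Fin 3) : Fn 4 U := Fn.comap hS.smooth hUV (((e (p + 1)).br (e (p + 2))).ip h (e k))
  have hev {P : M → Prop} (hP : ∀ y ∈ U, P y) (y : U) : ∀ᶠ z in 𝓝 (y : M), P z :=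
    (eventually_mem_opens y).mono hP
  have hbrE (i j : Fin 3) (y : U) : mfderiv (𝓡 4) (𝓡 3) pr y (((E i).br (E j)).toFun y) =
      ((e i).br (e j)).toFun (pr y) :=
    mfderiv_mlieBracket_of_related hS.smooth ((E i).smooth y y.2) ((E j).smooth y y.2)
      ((e i).smooth _ (hUV y y.2)) ((e j).smooth _ (hUV y y.2)) (hev (hE i) y) (hev (hE j) y)
  -- T is related to the zero field of the base, so its bracket with a projectable field is
  -- vertical.
  have hbrT (i : Fin 3) (y : U) : mfderiv (𝓡 4) (𝓡 3) pr y ((T.br (E i)).toFun y) = 0 := by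
    have h1 := mfderiv_mlieBracket_of_related hS.smooth (T.smooth y y.2) ((E i).smooth y y.2)
      (fieldAt_zero _) ((e i).smooth _ (hUV y y.2)) (hev hprT y) (hev (hE i) y)
    refine h1.trans ?_
    have h2 : (fun y : B => (0 : TangentSpace (𝓡 3) y)) = 0 := rfl
    rw [h2, mlieBracket_zero_left]
    rfl
  have hTE (i : Fin 3) (y : U) : g.inner y (T.toFun y) ((E i).toFun y) = 0 := by
    rw [hT, inner_smul_left, hEξ i y y.2, mul_zero]
  refine ⟨U, hx, hUV, ⟨E, T, lam, lamInv, C, fun i => lam ^ 2 * (T.br (E i)).ip g T,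
    fun p => lam ^ 2 * ((E (p + 1)).br (E (p + 2))).ip g T, hlam, ?_, ?_, ?_, ?_, ?_⟩,
    hE, hprT, fun y => Real.sqrt_pos.2 (hQpos y y.2), fun y hy => ?_, fun p k => rfl⟩
  · refine Fn.ext fun y => ?_
    rw [Vec.ip_apply, hT, inner_smul_left, map_smul, hS.unit, pow_two, Fn.mul_apply, smul_eq_mul]
    ring
  · exact fun i => Fn.ext fun y => hTE i y
  · refine fun i j => Fn.ext fun y => ?_
    rw [Vec.ip_apply, hEE y y.2, apply_ite (fun f : Fn 4 U => f.1 y)]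
    split_ifs
    · exact (hlam2 y).symm
    · rfl
  · exact fun i y => hker y _ (hbrT i y)
  · intro p y
    have h1 : mfderiv (𝓡 4) (𝓡 3) pr y (((E (p + 1)).br (E (p + 2))).toFun y
        - ((C p 0).1 y • (E 0).toFun y + (C p 1).1 y • (E 1).toFun y + (C p 2).1 y • (E 2).toFun y))
        = 0 := by
      rw [map_sub, map_add, map_add, map_smul, map_smul, map_smul, hE 0 y y.2, hE 1 y y.2,
        hE 2 y y.2, hbrE, sub_eq_zero]
      have h2 := FrameON.br_expand he ((e (p + 1)).br (e (p + 2))) ⟨pr y, hUV y y.2⟩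
      rw [Fin.sum_univ_three] at h2
      exact h2
    have h3 := hker y _ h1
    rw [inner_sub_left, inner_add_left, inner_add_left, inner_smul_left, inner_smul_left,
      inner_smul_left, g.symm y ((E 0).toFun y), g.symm y ((E 1).toFun y),
      g.symm y ((E 2).toFun y), hTE, hTE, hTE] at h3
    rw [sub_eq_iff_eq_add'] at h3
    rw [h3]
    congr 2
    simp only [mul_zero, add_zero, sub_zero]
    rfl
  · exact (hξT ⟨y, hy⟩).trans (Vec.smul_at (-lam) T ⟨y, hy⟩).symm

end Adapted

/-! ### Oriented frames and the induced volume form. -/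

section Orientation
variable {n : ℕ} {B : Type*} [TopologicalSpace B] [ChartedSpace (EuclideanSpace ℝ (Fin n)) B]
  [IsManifold (𝓡 n) ∞ B] {h : Metric n B}

/-- The restriction of a vector field. -/
def Vec.restrict {V V' : TopologicalSpace.Opens B} (hV : V' ≤ V) (X : Vec n V) : Vec n V' :=
  ⟨X.toFun, fun x hx => X.smooth x (hV hx)⟩

theorem IsUnitForm.sq_eq_one {vol : ∀ x : B, AlternatingMap ℝ (TangentSpace (𝓡 n) x) ℝ (Fin n)}
    (hv : IsUnitForm h vol) {x : B} {e : Fin n → TangentSpace (𝓡 n) x} (he : IsON h x e) :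
    vol x e ^ 2 = 1 := by
  rw [hv x e]
  have : (Matrix.of fun i j => h.inner x (e i) (e j)) = 1 := by
    ext i j
    rw [Matrix.of_apply, he i j, Matrix.one_apply]
  rw [this, Matrix.det_one]

end Orientation

section OrientedFrame
variable {M : Type*} [TopologicalSpace M] [ChartedSpace (EuclideanSpace ℝ (Fin 4)) M]
  [IsManifold (𝓡 4) ∞ M]
  {B : Type*} [TopologicalSpace B] [ChartedSpace (EuclideanSpace ℝ (Fin 3)) B]
  [IsManifold (𝓡 3) ∞ B]
  {g : Metric 4 M} {h : Metric 3 B} {pr : M → B} {ξ : ∀ x : M, TangentSpace (𝓡 4) x}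
  {volB : ∀ x : B, AlternatingMap ℝ (TangentSpace (𝓡 3) x) ℝ (Fin 3)}
  {volM : ∀ x : M, AlternatingMap ℝ (TangentSpace (𝓡 4) x) ℝ (Fin 4)}

theorem vec_three {V : Type*} (e : Fin 3 → V) : ![e 0, e 1, e 2] = e := by
  ext i; fin_cases i <;> rfl

theorem vec_four {V : Type*} (e : Fin 4 → V) : ![e 0, e 1, e 2, e 3] = e := by
  ext i; fin_cases i <;> rfl

/-- A unit volume form is ±1 on orthonormal frames. The sign is made positive at `b` by exchanging
two vectors, and stays positive nearby by continuity. -/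
theorem IsVolumeForm.exists_frame (hv : IsVolumeForm h volB) (b : B) :
    ∃ V : TopologicalSpace.Opens B, b ∈ V ∧ ∃ e : Fin 3 → Vec 3 V, FrameON h e ∧
      ∀ y ∈ V, volB y ![(e 0).toFun y, (e 1).toFun y, (e 2).toFun y] = 1 := by
  obtain ⟨V, hb, u, hu⟩ := HitchinLeBrun.exists_frame h b
  have main : ∃ u : Fin 3 → Vec 3 V, FrameON h u ∧ 0 < volB b fun i => (u i).toFun b := by
    have h1 := hv.unit.sq_eq_one (hu b hb)
    rcases lt_or_ge 0 (volB b fun i => (u i).toFun b) with h2 | h2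
    · exact ⟨u, hu, h2⟩
    · let u' : Fin 3 → Vec 3 V := ![u 1, u 0, u 2]
      refine ⟨u', fun y hy i j => ?_, ?_⟩
      · have H := hu y hy
        fin_cases i <;> fin_cases j
        exacts [H 1 1, H 1 0, H 1 2, H 0 1, H 0 0, H 0 2, H 2 1, H 2 0, H 2 2]
      · have h3 : (fun i => (u' i).toFun b) = ![(u 1).toFun b, (u 0).toFun b, (u 2).toFun b] := by
          ext i; fin_cases i <;> rfl
        rw [h3, alt3_swap01]
        rw [← vec_three fun i => (u i).toFun b] at h1 h2
        nlinarith
  obtain ⟨e, he, hpos⟩ := main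
  have hc := hv.continuous b (fun i => (e i).toFun) fun i => (e i).smooth b hb
  obtain ⟨V', hV', hV'o, hbV'⟩ := eventually_nhds_iff.1 (hc.eventually (lt_mem_nhds hpos))
  refine ⟨⟨V', hV'o⟩ ⊓ V, ⟨hbV', hb⟩, fun i => (e i).restrict inf_le_right,
    fun y hy => he y hy.2, fun y hy => ?_⟩
  have h1 := hv.unit.sq_eq_one (he y hy.2)
  have h2 : 0 < volB y fun i => (e i).toFun y := hV' y hy.1
  change volB y ![(e 0).toFun y, (e 1).toFun y, (e 2).toFun y] = 1
  rw [vec_three fun i => (e i).toFun y]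
  nlinarith

variable {U : TopologicalSpace.Opens M} {V : TopologicalSpace.Opens B} {S : SubmersionFrame g U}
  {hpr : ContMDiff (𝓡 4) (𝓡 3) ∞ pr} {hUV : ∀ y ∈ U, pr y ∈ V} {e : Fin 3 → Vec 3 V}

theorem SubmersionFrame.IsAdapted.proj_w (hA : S.IsAdapted h hpr hUV e ξ) (x : U) (i : Fin 3) :
    mfderiv (𝓡 4) (𝓡 3) pr x ((S.w i.castSucc).toFun x) = S.lamInv.1 x • (e i).toFun (pr x) := by
  rw [S.w_castSucc, Vec.smul_at, map_smul, hA.proj_E i x x.2]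

theorem SubmersionFrame.lamInv_pos (hl : ∀ y : U, 0 < S.lam.1 y) (y : U) : 0 < S.lamInv.1 y := by
  have h1 : S.lam.1 y * S.lamInv.1 y = 1 := congrArg (fun f : Fn 4 U => f.1 y) S.lam_mul
  exact (pos_iff_pos_of_mul_pos (h1 ▸ one_pos)).1 (hl y)

/-- The adapted orthonormal frame is oriented. -/
theorem SubmersionFrame.IsAdapted.volume (hA : S.IsAdapted h hpr hUV e ξ)
    (hv : ∀ y ∈ V, volB y ![(e 0).toFun y, (e 1).toFun y, (e 2).toFun y] = 1)
    (hM : IsInducedVolume g pr ξ volB volM) (x : U) :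
    volM x ![(S.w 0).toFun x, (S.w 1).toFun x, (S.w 2).toFun x, (S.w 3).toFun x] = 1 := by
  have h1 := hM.unit.sq_eq_one (S.w_frameON x x.2)
  have hl := S.lamInv_pos hA.lam_pos x
  have h2 := hM.positive x ((S.w 0).toFun x) ((S.w 1).toFun x) ((S.w 2).toFun x) (by
    have w0 := hA.proj_w x 0
    have w1 := hA.proj_w x 1
    have w2 := hA.proj_w x 2
    simp only [Fin.castSucc_zero, Fin.castSucc_one, Fin.isValue] at w0 w1
    rw [w0, w1]
    change 0 < volB (pr x) ![_, _, mfderiv (𝓡 4) (𝓡 3) pr x ((S.w (Fin.castSucc 2)).toFun x)]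
    rw [w2, (alt3_isLinear0 _ _ _).map_smul, (alt3_isLinear1 _ _ _).map_smul,
      (alt3_isLinear2 _ _ _).map_smul, hv _ (hUV x x.2)]
    simp only [smul_eq_mul]
    positivity)
  rw [hA.ξ_eq x x.2] at h2
  rw [← vec_four fun i => (S.w i).toFun x] at h1
  change 0 < volM x ![(S.w 0).toFun x, (S.w 1).toFun x, (S.w 2).toFun x, (S.w 3).toFun x] at h2
  nlinarith

theorem IsON.det_sq {n : ℕ} {M : Type*} [TopologicalSpace M] [ChartedSpace (EuclideanSpace ℝ (Fin n)) M]
    [IsManifold (𝓡 n) ∞ M] {g : Metric n M} {x : M} {w : Fin n → TangentSpace (𝓡 n) x}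
    (hw : IsON g x w) (v : Fin n → TangentSpace (𝓡 n) x) :
    (hw.basis.det v) ^ 2 = Matrix.det (Matrix.of fun i j => g.inner x (v i) (v j)) := by
  have : (Matrix.of fun i j => g.inner x (v i) (v j)) =
      (hw.basis.toMatrix v).transpose * hw.basis.toMatrix v := by
    ext i j
    rw [Matrix.of_apply, hw.inner_eq, Matrix.mul_apply]
    exact Finset.sum_congr rfl fun k _ => by
      rw [Matrix.transpose_apply, Module.Basis.toMatrix_apply, Module.Basis.toMatrix_apply,
        hw.basis_repr, hw.basis_repr]
  rw [this, Matrix.det_mul, Matrix.det_transpose, Module.Basis.det_apply, pow_two]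

/-- `IsInducedVolume` is a pointwise condition, so the determinant in an oriented orthonormal basis
ending with ξ can be chosen at each point separately. Expansion along the last column shows that the
determinant of the projections is λ⁻³ times that of the four vectors. -/
theorem IsConformalSubmersion.exists_inducedVolume (hS : IsConformalSubmersion g h pr ξ)
    (hv : IsVolumeForm h volB) :
    ∃ volM : ∀ x : M, AlternatingMap ℝ (TangentSpace (𝓡 4) x) ℝ (Fin 4),
      IsInducedVolume g pr ξ volB volM := by
  have key (x : M) : ∃ w : Fin 4 → TangentSpace (𝓡 4) x, ∃ hw : IsON g x w, w 3 = ξ x ∧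
      ∀ a b c : TangentSpace (𝓡 4) x,
        0 < volB (pr x) ![mfderiv (𝓡 4) (𝓡 3) pr x a, mfderiv (𝓡 4) (𝓡 3) pr x b,
          mfderiv (𝓡 4) (𝓡 3) pr x c] → 0 < hw.basis.det ![a, b, c, ξ x] := by
    obtain ⟨V, hb, e, he, hev⟩ := hv.exists_frame (pr x)
    obtain ⟨U, hx, hUV, S, hA⟩ := hS.exists_adapted x hb he
    have hw := S.w_frameON x hx
    have h3 : (S.w 3).toFun x = ξ x := (hA.ξ_eq x hx).symm
    refine ⟨_, hw, h3, fun a b c hpos => ?_⟩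
    have hl := S.lamInv_pos hA.lam_pos ⟨x, hx⟩
    have heb := he (pr x) hb
    have hvol : volB (pr x) = heb.basis.det := by
      have h1 := (volB (pr x)).eq_smul_basis_det heb.basis
      have h2 : (volB (pr x)) heb.basis = 1 := by
        rw [← hev (pr x) hb, vec_three fun i => (e i).toFun (pr x)]
        congr 1
        ext i; rw [heb.basis_apply]
      rw [h2, one_smul] at h1
      exact h1
    have hcoord (v : TangentSpace (𝓡 4) x) (i : Fin 3) :
        heb.basis.repr (mfderiv (𝓡 4) (𝓡 3) pr x v) i =
          S.lamInv.1 ⟨x, hx⟩ * hw.basis.repr v i.castSucc := by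
      rw [heb.basis_repr, hw.basis_repr]
      conv_lhs => rw [hw.expand v]
      rw [map_sum, inner_sum_left, Fin.sum_univ_castSucc]
      have hlast : mfderiv (𝓡 4) (𝓡 3) pr x ((S.w (Fin.last 3)).toFun x) = 0 := by
        change mfderiv (𝓡 4) (𝓡 3) pr x ((S.w 3).toFun x) = 0
        rw [h3, hS.vertical]
      rw [map_smul, hlast, smul_zero, map_zero]
      have hj (j : Fin 3) : h.inner (pr x) (mfderiv (𝓡 4) (𝓡 3) pr x
          (g.inner x v ((S.w j.castSucc).toFun x) • (S.w j.castSucc).toFun x)) ((e i).toFun (pr x)) =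
          if j = i then S.lamInv.1 ⟨x, hx⟩ * g.inner x v ((S.w j.castSucc).toFun x) else 0 := by
        rw [map_smul, inner_smul_left, hA.proj_w ⟨x, hx⟩ j, inner_smul_left]
        have h1 : h.inner (pr x) ((e j).toFun (pr x)) ((e i).toFun (pr x)) =
          if j = i then 1 else 0 := heb j i
        change _ * (_ * h.inner (pr x) ((e j).toFun (pr x)) ((e i).toFun (pr x))) = _
        rw [h1]
        split_ifs <;> ring
      rw [zero_apply, add_zero, Finset.sum_congr rfl fun j _ => hj j, Finset.sum_ite_eq', if_pos (Finset.mem_univ i)]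
    have hdet : heb.basis.det ![mfderiv (𝓡 4) (𝓡 3) pr x a, mfderiv (𝓡 4) (𝓡 3) pr x b,
        mfderiv (𝓡 4) (𝓡 3) pr x c] = S.lamInv.1 ⟨x, hx⟩ ^ 3 * hw.basis.det ![a, b, c, ξ x] := by
      have hξ3 (i : Fin 4) : hw.basis.repr (ξ x) i = if i = 3 then 1 else 0 := by
        rw [hw.basis_repr, ← h3]
        exact (hw 3 i).trans (by simp [eq_comm])
      rw [Module.Basis.det_apply, Module.Basis.det_apply,
        Matrix.det_succ_column (hw.basis.toMatrix ![a, b, c, ξ x]) 3, Fin.sum_univ_four,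
        Matrix.det_fin_three, Matrix.det_fin_three, Matrix.det_fin_three, Matrix.det_fin_three,
        Matrix.det_fin_three]
      have c0 := fun v => hcoord v 0
      have c1 := fun v => hcoord v 1
      have c2 := fun v => hcoord v 2
      simp only [Fin.castSucc_zero, Fin.castSucc_one, Fin.isValue] at c0 c1
      change ∀ v, _ = _ * hw.basis.repr v 2 at c2
      simp [Module.Basis.toMatrix_apply, hξ3, c0, c1, c2, Fin.succAbove]
      ring
    rw [hvol, hdet] at hpos
    exact (pos_iff_pos_of_mul_pos hpos).1 (by positivity)
  choose w hw hw3 hpos using key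
  refine ⟨fun x => (hw x).basis.det, fun x v => (hw x).det_sq v, hpos⟩

end OrientedFrame

/-! ### From the equations of `IsHLCoordinate` to the selfdual Einstein condition. -/

section Construction
variable {M : Type*} [TopologicalSpace M] [ChartedSpace (EuclideanSpace ℝ (Fin 4)) M]
  [IsManifold (𝓡 4) ∞ M]
  {B : Type*} [TopologicalSpace B] [ChartedSpace (EuclideanSpace ℝ (Fin 3)) B]
  [IsManifold (𝓡 3) ∞ B]
  {g : Metric 4 M} {W : WeylStructure B} {pr : M → B} {ξ : ∀ x : M, TangentSpace (𝓡 4) x}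
  {U : TopologicalSpace.Opens M} {V : TopologicalSpace.Opens B} {S : SubmersionFrame g U}
  {hpr : ContMDiff (𝓡 4) (𝓡 3) ∞ pr} {hUV : ∀ y ∈ U, pr y ∈ V} {e : Fin 3 → Vec 3 V}
  {D : Connection 4 M}

open WeylStructure

namespace SubmersionFrame

theorem IsAdapted.isWeylCoeffs (hA : S.IsAdapted W.metric hpr hUV e ξ) (he : FrameON W.metric e)
    (hκ : ∀ i, S.κ i = Fn.comap hpr hUV (W.frameOm e i)) :
    S.IsWeylCoeffs (fun i j => Fn.comap hpr hUV (W.frameΓ e i j))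
      fun i => Fn.comap hpr hUV (W.frameOm e i) where
  d_Γ _ _ := Vec.d_comap_eq_zero hpr hUV hA.proj_T _
  κ_eq := hκ
  c_self p := by
    rw [hA.c_eq, ← map_add]
    exact congrArg _ (frameC_self he p)
  c_one p := by
    rw [hA.c_eq, ← map_neg, ← map_sub]
    exact congrArg _ (frameC_one he p)
  c_two p := by
    rw [hA.c_eq, ← map_sub]
    exact congrArg _ (frameC_two he p)

theorem IsAdapted.RR_eq (hA : S.IsAdapted W.metric hpr hUV e ξ) (p l : Fin 3) :
    S.RR (fun i j => Fn.comap hpr hUV (W.frameΓ e i j)) p l = Fn.comap hpr hUV (W.frameR e p l) := by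
  simp only [RR, frameR, map_add, map_sub, map_mul, Vec.d_comap hpr hUV (hA.proj_E _), hA.c_eq]
  rfl

variable (hA : S.IsAdapted W.metric hpr hUV e ξ) (he : FrameON W.metric e)
include hA he

/-- The equations satisfied by the coordinate `ν` of the construction. -/
structure IsHLCoordinate (S : SubmersionFrame g U) (hpr : ContMDiff (𝓡 4) (𝓡 3) ∞ pr)
    (hUV : ∀ y ∈ U, pr y ∈ V) (W : WeylStructure B) (e : Fin 3 → Vec 3 V) (r : ℝ) (ν : Fn 4 U) :
    Prop where
  d_T : S.T.d ν = algebraMap ℝ _ r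
  d_E : ∀ l, 2 * (S.E l).d ν =
    2 * (ν * Fn.comap hpr hUV (W.frameOm e l)) + Fn.comap hpr hUV (W.frameF e l)
  Q_eq : algebraMap ℝ _ r * S.Q = ν ^ 2 + Fn.comap hpr hUV (W.frameR e 0 0)

variable {r : ℝ} (hr : r ≠ 0) {ν : Fn 4 U} (hν : S.IsHLCoordinate hpr hUV W e r ν)
include hr hν

omit hA he hν in
theorem isUnit_const : IsUnit (algebraMap ℝ (Fn 4 U) r) := (IsUnit.mk0 r hr).map _

omit he in
-- Apply [T, E_l] = κ_l T to ν. As T(ν) = r is constant and ω, F are pulled back, the left side is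
-- rω_l and the right side rκ_l.
theorem IsHLCoordinate.κ_eq (l : Fin 3) : S.κ l = Fn.comap hpr hUV (W.frameOm e l) := by
  have h1 := S.d_br_T l ν
  have h2 : S.T.d (2 * (S.E l).d ν) = _ := congrArg _ (hν.d_E l)
  rw [hν.d_T, Derivation.map_algebraMap] at h1
  rw [two_mul, two_mul, map_add, map_add, map_add, Derivation.leibniz,
    Vec.d_comap_eq_zero hpr hUV hA.proj_T, Vec.d_comap_eq_zero hpr hUV hA.proj_T, hν.d_T, smul_eq_mul,
    smul_eq_mul] at h2
  refine (isUnit_const hr).mul_left_cancel (Fn.two_cancel ?_)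
  linear_combination h2 - 2 * h1

omit he in
-- Differentiating the equation for Q along T gives r T(Q) = 2νr. So the given coordinate is the ν
-- of the frame.
theorem IsHLCoordinate.ν_eq : S.ν = ν := by
  have h : S.T.d (algebraMap ℝ (Fn 4 U) r * S.Q) = _ := congrArg _ hν.Q_eq
  rw [Derivation.leibniz, Derivation.map_algebraMap, map_add, Vec.d_comap_eq_zero hpr hUV hA.proj_T,
    pow_two, Derivation.leibniz, hν.d_T, ← S.two_ν] at h
  simp only [smul_eq_mul] at h
  refine (isUnit_const hr).mul_left_cancel (Fn.two_cancel ?_)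
  linear_combination h

variable (hEW : W.IsEinsteinWeyl)
include hEW

/-- Applying [E_{p+1}, E_{p+2}] to ν brings in Ω_p r. The other side contains derivatives of F,
which the second Bianchi identity of the Einstein-Weyl structure trades for E_p of the scalar
curvature, hence for E_p(Q) by the equation for Q. -/
theorem IsHLCoordinate.legendrian (p : Fin 3) : S.Ω p = S.Q * S.pp p := by
  have hd (i : Fin 3) (f : Fn 3 V) : (S.E i).d (Fn.comap hpr hUV f) = Fn.comap hpr hUV ((e i).d f) :=
    Vec.d_comap hpr hUV (hA.proj_E i) f
  have h1 := S.d_br_E p ν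
  have hE0 := hν.d_E 0
  have hE1 := hν.d_E 1
  have hE2 := hν.d_E 2
  have hEp := hν.d_E p
  have ha := hν.d_E (p + 1)
  have hb := hν.d_E (p + 2)
  have key (i j : Fin 3) : 2 * (S.E i).d ((S.E j).d ν) =
      2 * ((S.E i).d ν * Fn.comap hpr hUV (W.frameOm e j) + ν * Fn.comap hpr hUV ((e i).d (W.frameOm e j)))
        + Fn.comap hpr hUV ((e i).d (W.frameF e j)) := by
    have h2 : (S.E i).d (2 * (S.E j).d ν) = _ := congrArg _ (hν.d_E j)
    rw [two_mul, two_mul, map_add, map_add, map_add, Derivation.leibniz] at h2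
    simp only [smul_eq_mul, hd] at h2
    linear_combination h2
  have k1 := key (p + 1) (p + 2)
  have k2 := key (p + 2) (p + 1)
  have hF : Fn.comap hpr hUV (W.frameF e p) = Fn.comap hpr hUV ((e (p + 1)).d (W.frameOm e (p + 2)))
      - Fn.comap hpr hUV ((e (p + 2)).d (W.frameOm e (p + 1))) - (S.c p 0 * Fn.comap hpr hUV (W.frameOm e 0)
      + S.c p 1 * Fn.comap hpr hUV (W.frameOm e 1) + S.c p 2 * Fn.comap hpr hUV (W.frameOm e 2)) := by
    simp only [frameF, map_sub, map_add, map_mul, hA.c_eq]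
    rfl
  have hRp : W.frameR e p p = W.frameR e 0 0 := Fn.ext fun x => by
    rw [(frame_einsteinWeyl he hEW x p).1, (frame_einsteinWeyl he hEW x 0).1]
  have hB := congrArg (Fn.comap hpr hUV) (frame_einsteinWeyl_bianchi he hEW p)
  rw [hRp] at hB
  have h2f : Fn.comap hpr hUV 2 = 2 := map_ofNat (Fn.comap hpr hUV) 2
  have h4f : Fn.comap hpr hUV 4 = 4 := map_ofNat (Fn.comap hpr hUV) 4
  have hc (k : Fin 3) : Fn.comap hpr hUV (W.frameC e p k) = S.c p k := (hA.c_eq p k).symm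
  simp only [map_sub, map_add, map_mul, h2f, h4f, hc] at hB
  have hQ : (S.E p).d (algebraMap ℝ (Fn 4 U) r * S.Q) = _ := congrArg _ hν.Q_eq
  rw [Derivation.leibniz, Derivation.map_algebraMap, map_add, pow_two, Derivation.leibniz, hd] at hQ
  simp only [smul_eq_mul] at hQ
  have hpp : S.Q * S.pp p = (S.E p).d S.Q - 2 * S.Q * Fn.comap hpr hUV (W.frameOm e p) := by
    rw [pp, hν.κ_eq hA hr]
    linear_combination (S.E p).d S.Q * S.Q_mul
  rw [hν.d_T] at h1
  have hQe := hν.Q_eq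
  refine (isUnit_const hr).mul_left_cancel (Fn.two_cancel ?_)
  rw [hpp]
  linear_combination -2 * h1 + k1 - k2 - S.c p 0 * hE0 - S.c p 1 * hE1 - S.c p 2 * hE2
    + Fn.comap hpr hUV (W.frameOm e (p + 2)) * ha - Fn.comap hpr hUV (W.frameOm e (p + 1)) * hb + hB - 2 * ν * hF
    - 2 * hQ + 4 * Fn.comap hpr hUV (W.frameOm e p) * hQe - 2 * ν * hEp

variable (hW : IsLeviCivita g D) (hD : SmoothConn D)
include hW hD

/-- With ν identified, the three defining equations cancel the entries of the antiselfdual curvature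
one by one. The value -3r of the Einstein constant is forced by T(ν) = r. -/
theorem IsHLCoordinate.asdEinstein (x : U) :
    AsdEinstein (-3 * r) (curvComp g D x (S.wAt x)) := by
  have hC := hA.isWeylCoeffs he (hν.κ_eq hA hr)
  have hL := hν.legendrian hA he hr hEW
  have hνe := hν.ν_eq hA hr
  rw [S.asdEinstein_iff hD]
  refine ⟨fun l p => ?_, fun l m => ?_⟩
  · have h := S.asdCurv_E hW hD hC hL l p
    rw [hA.RR_eq, hνe] at h
    rw [asdCurv, h]
    set b : V := ⟨pr x, hUV x x.2⟩
    have hR (p l : Fin 3) : (Fn.comap hpr hUV (W.frameR e p l)).1 x = (W.frameR e p l).1 b := rfl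
    have hF (i : Fin 3) : (Fn.comap hpr hUV (W.frameF e i)).1 x = (W.frameF e i).1 b := rfl
    have hQ : r * S.Q.1 x = ν.1 x ^ 2 + (W.frameR e 0 0).1 b :=
      congrArg (fun f : Fn 4 U => f.1 x) hν.Q_eq
    have hE (i : Fin 3) : 2 * ((S.E i).d ν).1 x =
        2 * (ν.1 x * (Fn.comap hpr hUV (W.frameOm e i)).1 x) + (W.frameF e i).1 b :=
      congrArg (fun f : Fn 4 U => f.1 x) (hν.d_E i)
    have n1 : l + 1 ≠ l := by fin_cases l <;> decide
    have n2 : l + 2 ≠ l := by fin_cases l <;> decide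
    have n3 : l + 2 ≠ l + 1 := by fin_cases l <;> decide
    have e1 : l + 2 + 2 = l + 1 := by fin_cases l <;> rfl
    have e2 : l + 2 + 1 = l := by fin_cases l <;> rfl
    have e3 : l + 1 + 1 = l + 2 := by fin_cases l <;> rfl
    have e4 : l + 1 + 2 = l := by fin_cases l <;> rfl
    have hm : p = l ∨ p = l + 1 ∨ p = l + 2 := by
      fin_cases l <;> fin_cases p <;> decide
    obtain rfl | rfl | rfl := hm
    · rw [if_pos rfl, if_pos rfl, Fn.add_apply, hR, (frame_einsteinWeyl he hEW b _).1]
      rw [(frame_einsteinWeyl he hEW b 0).1] at hQ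
      have : (ν ^ 2).1 x = ν.1 x ^ 2 := rfl
      rw [this]
      linear_combination -hQ
    · have h2 := (frame_einsteinWeyl he hEW b (l + 2)).2.2
      rw [e1, e2] at h2
      rw [if_neg n1, if_pos rfl, if_neg n1, Fn.add_apply, Fn.sub_apply, Fn.mul_apply, hR, h2]
      linear_combination (1 / 2 : ℝ) * hE (l + 2)
    · have h2 := (frame_einsteinWeyl he hEW b (l + 1)).2.1
      rw [e3, e4] at h2
      rw [if_neg n2, if_neg n3, if_neg n2, Fn.add_apply, Fn.sub_apply, Fn.mul_apply, hR, h2]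
      linear_combination -(1 / 2 : ℝ) * hE (l + 1)
  · rw [asdCurv, S.asdCurv_T hW hD hC hL l m, hνe, hν.d_T]
    split_ifs
    · change r = _
      ring
    · rfl

end SubmersionFrame
end Construction

/-! ### Smooth forms and metrics from their values on smooth fields. -/

section Build
variable {n : ℕ} {M : Type*} [TopologicalSpace M] [ChartedSpace (EuclideanSpace ℝ (Fin n)) M]
  [IsManifold (𝓡 n) ∞ M]

theorem contMDiffAt_clm_of_basis {F G ι : Type*} [NormedAddCommGroup F] [NormedSpace ℝ F]
    [NormedAddCommGroup G] [NormedSpace ℝ G] [Fintype ι] [FiniteDimensional ℝ F]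
    (b : Module.Basis ι ℝ F) {A : M → F →L[ℝ] G} {x : M}
    (h : ∀ i, ContMDiffAt (𝓡 n) 𝓘(ℝ, G) ∞ (fun y => A y (b i)) x) :
    ContMDiffAt (𝓡 n) 𝓘(ℝ, F →L[ℝ] G) ∞ A x := by
  have hA : A = fun y => ∑ i, ContinuousLinearMap.smulRightL ℝ F G
      (LinearMap.toContinuousLinearMap (b.coord i)) (A y (b i)) := by
    funext y
    ext v
    rw [sum_apply]
    conv_lhs => rw [← b.sum_repr v, map_sum]
    simp
  rw [hA]
  exact contMDiffAt_finsetSum fun i _ => (ContinuousLinearMap.contMDiff _).contMDiffAt.comp x (h i)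

/-- The local frame of the tangent trivialization turns the components in coordinates into values on
smooth fields. -/
theorem smoothOneForm_of_apply {α : ∀ x : M, TangentSpace (𝓡 n) x →L[ℝ] ℝ}
    (h : ∀ (x : M) (X : ∀ y : M, TangentSpace (𝓡 n) y), FieldAt X x →
      FunAt (n := n) (fun y => α y (X y)) x) : SmoothOneForm α := by
  intro x
  refine (contMDiffAt_hom_bundle (E₁ := fun x : M => TangentSpace (𝓡 n) x)
    (E₂ := Bundle.Trivial M ℝ) _).2 ⟨contMDiffAt_id, ?_⟩
  set t := trivializationAt (EuclideanSpace ℝ (Fin n)) (TangentSpace (𝓡 n) : M → Type _) x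
  set b := (EuclideanSpace.basisFun (Fin n) ℝ).toBasis
  have hx : x ∈ t.baseSet := FiberBundle.mem_baseSet_trivializationAt _ _ x
  refine contMDiffAt_clm_of_basis b fun i => ?_
  refine (h x _ (contMDiffAt_localFrame_of_mem ∞ t b i hx)).congr_of_eventuallyEq ?_
  filter_upwards [t.open_baseSet.mem_nhds hx] with y hy
  rw [t.localFrame_apply_of_mem_baseSet b hy]
  simp only [ContinuousLinearMap.inCoordinates, Trivial.fiberBundle_trivializationAt',
    Trivial.continuousLinearMapAt_trivialization, ContinuousLinearMap.coe_comp, Function.comp_apply]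
  exact congrArg (α y) (t.symmL_apply hy (b i))

theorem contMDiff_bilin_of_apply {β : ∀ x : M, TangentSpace (𝓡 n) x →L[ℝ] TangentSpace (𝓡 n) x →L[ℝ] ℝ}
    (h : ∀ (x : M) (X Y : ∀ y : M, TangentSpace (𝓡 n) y), FieldAt X x → FieldAt Y x →
      FunAt (n := n) (fun y => β y (X y) (Y y)) x) : 
    ContMDiff (𝓡 n) ((𝓡 n).prod 𝓘(ℝ, EuclideanSpace ℝ (Fin n) →L[ℝ] EuclideanSpace ℝ (Fin n) →L[ℝ] ℝ)) ∞
    (fun x => TotalSpace.mk' (EuclideanSpace ℝ (Fin n) →L[ℝ] EuclideanSpace ℝ (Fin n) →L[ℝ] ℝ)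
      (E := fun x : M => TangentSpace (𝓡 n) x →L[ℝ] TangentSpace (𝓡 n) x →L[ℝ] ℝ) x (β x)) := by
  intro x
  refine (contMDiffAt_hom_bundle (E₁ := fun x : M => TangentSpace (𝓡 n) x)
    (E₂ := fun x : M => TangentSpace (𝓡 n) x →L[ℝ] Bundle.Trivial M ℝ x) _).2 ⟨contMDiffAt_id, ?_⟩
  set t := trivializationAt (EuclideanSpace ℝ (Fin n)) (TangentSpace (𝓡 n) : M → Type _) x
  set b := (EuclideanSpace.basisFun (Fin n) ℝ).toBasis
  have hx : x ∈ t.baseSet := FiberBundle.mem_baseSet_trivializationAt _ _ x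
  refine contMDiffAt_clm_of_basis b fun i => contMDiffAt_clm_of_basis b fun j => ?_
  refine (h x _ _ (contMDiffAt_localFrame_of_mem ∞ t b i hx)
    (contMDiffAt_localFrame_of_mem ∞ t b j hx)).congr_of_eventuallyEq ?_
  filter_upwards [t.open_baseSet.mem_nhds hx] with y hy
  rw [t.localFrame_apply_of_mem_baseSet b hy, t.localFrame_apply_of_mem_baseSet b hy]
  refine (inCoordinates_apply_eq₂ (E₃ := Bundle.Trivial M ℝ) hy hy (Set.mem_univ _)).trans ?_
  simp
  rfl

/-- The quadratic form has a positive minimum c on the compact unit sphere, so its unit ball lies in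
the ball of radius c^(-1/2). Bundled Riemannian metrics carry this boundedness as a field. -/
theorem isVonNBounded_of_pos {E : Type*} [NormedAddCommGroup E] [NormedSpace ℝ E]
    [FiniteDimensional ℝ E] (β : E →L[ℝ] E →L[ℝ] ℝ) (hp : ∀ v, v ≠ 0 → 0 < β v v) :
    Bornology.IsVonNBounded ℝ {v : E | β v v < 1} := by
  have hc : Continuous fun v => β v v := by fun_prop
  obtain ⟨c, hc0, hcv⟩ : ∃ c : ℝ, 0 < c ∧ ∀ v ∈ Metric.sphere (0 : E) 1, c ≤ β v v := by
    -- The sphere is empty in dimension 0, where any positive constant will do.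
    rcases (Metric.sphere (0 : E) 1).eq_empty_or_nonempty with h | h
    · exact ⟨1, one_pos, by simp [h]⟩
    · obtain ⟨w, hw, hmin⟩ := (isCompact_sphere (0 : E) 1).exists_isMinOn h hc.continuousOn
      exact ⟨β w w, hp w (ne_zero_of_mem_unit_sphere ⟨w, hw⟩), fun v hv => hmin hv⟩
  rw [NormedSpace.isVonNBounded_iff]
  refine (Metric.isBounded_closedBall (x := (0 : E)) (r := (√c)⁻¹)).subset fun v hv => ?_
  rw [mem_closedBall_zero_iff]
  rcases eq_or_ne v 0 with rfl | h0
  · simp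
  have hn : 0 < ‖v‖ := norm_pos_iff.2 h0
  have h1 := hcv (‖v‖⁻¹ • v) (by rw [mem_sphere_zero_iff_norm, norm_smul, norm_inv, norm_norm,
    inv_mul_cancel₀ hn.ne'])
  have h2 : β v v < 1 := hv
  rw [map_smul, map_smul, smul_apply, smul_eq_mul, smul_eq_mul] at h1
  have h3 : c * ‖v‖ ^ 2 < 1 := by
    refine lt_of_le_of_lt ?_ h2
    calc c * ‖v‖ ^ 2 ≤ (‖v‖⁻¹ * (‖v‖⁻¹ * β v v)) * ‖v‖ ^ 2 := by gcongr
      _ = β v v := by field_simp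
  have h4 : √c * ‖v‖ < 1 := by
    have := Real.sqrt_lt_sqrt (by positivity) h3
    rwa [Real.sqrt_mul hc0.le, Real.sqrt_sq hn.le, Real.sqrt_one] at this
  rw [← one_div, le_div_iff₀ (Real.sqrt_pos.2 hc0)]
  linarith

/-- The metric with a given positive definite smooth inner product. -/
def metricOf (β : ∀ x : M, TangentSpace (𝓡 n) x →L[ℝ] TangentSpace (𝓡 n) x →L[ℝ] ℝ)
    (hs : ∀ x v w, β x v w = β x w v) (hp : ∀ x v, v ≠ 0 → 0 < β x v v)
    (h : ∀ (x : M) (X Y : ∀ y : M, TangentSpace (𝓡 n) y), FieldAt X x → FieldAt Y x →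
      FunAt (n := n) (fun y => β y (X y) (Y y)) x) : Metric n M where
  inner := β
  symm := hs
  pos := hp
  isVonNBounded x := isVonNBounded_of_pos (E := EuclideanSpace ℝ (Fin n)) (β x) (hp x)
  contMDiff := contMDiff_bilin_of_apply h
end Build

/-! ### Smoothness of the scalar curvature and of the star of the Faraday curvature. -/

section Star
variable {B : Type*} [TopologicalSpace B] [ChartedSpace (EuclideanSpace ℝ (Fin 3)) B]
  [IsManifold (𝓡 3) ∞ B] (W : WeylStructure B)
  {volB : ∀ x : B, AlternatingMap ℝ (TangentSpace (𝓡 3) x) ℝ (Fin 3)}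

theorem WeylStructure.scal_smooth : ContMDiff (𝓡 3) 𝓘(ℝ, ℝ) ∞ W.scal := fun b => by
  obtain ⟨V, hb, e, he⟩ := HitchinLeBrun.exists_frame W.metric b
  have h : ∀ᶠ y in 𝓝 b, W.scal y =
      (-2 * (W.frameR e 0 0 + W.frameR e 1 1 + W.frameR e 2 2)).lift y :=
    (eventually_mem_opens ⟨b, hb⟩).mono fun y hy => by
      rw [W.scal_frame he ⟨y, hy⟩, Fn.lift_apply _ ⟨y, hy⟩]
      rfl
  exact (Fn.lift_smooth _ b hb).congr_of_eventuallyEq h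

theorem WeylStructure.faraday_isBilinear (x : B) : IsBilinearMap ℝ (W.faraday x) :=
  extDerivOne_isBilinear (W.lee_smooth.formAt x) W.metric

theorem WeylStructure.faraday_swap (x : B) (u v : TangentSpace (𝓡 3) x) :
    W.faraday x u v = -W.faraday x v u :=
  extDerivOne_swap (W.lee_smooth.formAt x) u v

variable (volB) in
/-- The star of the Faraday curvature. -/
def WeylStructure.starFaraday (x : B) : TangentSpace (𝓡 3) x →L[ℝ] ℝ :=
  LinearMap.toContinuousLinearMap (IsLinearMap.mk' (star3 W.metric volB x (W.faraday x)) (by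
    obtain ⟨V, hb, e, he⟩ := HitchinLeBrun.exists_frame W.metric x
    exact star3_isLinear (he x hb) volB (W.faraday_isBilinear x)))

theorem WeylStructure.starFaraday_apply (x : B) (u : TangentSpace (𝓡 3) x) :
    W.starFaraday volB x u = star3 W.metric volB x (W.faraday x) u := rfl

variable {W}

theorem WeylStructure.starFaraday_frame {V : TopologicalSpace.Opens B} {e : Fin 3 → Vec 3 V}
    (he : FrameON W.metric e)
    (hev : ∀ y ∈ V, volB y ![(e 0).toFun y, (e 1).toFun y, (e 2).toFun y] = 1) (x : V) (l : Fin 3) :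
    W.starFaraday volB x ((e l).toFun x) = -(W.frameF e l).1 x := by
  rw [starFaraday_apply, star3_apply (he x x.2) volB (hev x x.2) (W.faraday_isBilinear x)
    (W.faraday_swap x), frameF_apply he l x]

theorem WeylStructure.starFaraday_smooth (hv : IsVolumeForm W.metric volB) :
    SmoothOneForm (W.starFaraday volB) := smoothOneForm_of_apply fun b X hX => by
  obtain ⟨V, hb, e, he, hev⟩ := hv.exists_frame b
  have h : ∀ᶠ y in 𝓝 b, W.starFaraday volB y (X y) =
      ∑ l, W.metric.inner y (X y) ((e l).toFun y) * -(W.frameF e l).lift y :=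
    (eventually_mem_opens ⟨b, hb⟩).mono fun y hy => by
      conv_lhs => rw [(he y hy).expand (X y)]
      rw [map_sum]
      refine Finset.sum_congr rfl fun l _ => ?_
      rw [map_smul, smul_eq_mul, W.starFaraday_frame he hev ⟨y, hy⟩ l, Fn.lift_apply _ ⟨y, hy⟩]
  refine ContMDiffAt.congr_of_eventuallyEq (contMDiffAt_finsetSum fun l _ => ?_) h
  exact (hX.inner W.metric ((e l).smooth b hb)).mul (Fn.lift_smooth _ b hb).neg

end Star

/-! ### Metrics on the total space and the conformal infinity. -/

section Total
variable {B : Type*} [TopologicalSpace B] [ChartedSpace (EuclideanSpace ℝ (Fin 3)) B]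
  [IsManifold (𝓡 3) ∞ B]
  {M : Type*} [TopologicalSpace M] [ChartedSpace (EuclideanSpace ℝ (Fin 4)) M]
  [IsManifold (𝓡 4) ∞ M] {pr : M → B}

/-- The metric `a pr^* h + b β²`. -/
theorem exists_metric_of_form (hpr : ContMDiff (𝓡 4) (𝓡 3) ∞ pr) (h : Metric 3 B) {a b : M → ℝ}
    (ha : ContMDiff (𝓡 4) 𝓘(ℝ, ℝ) ∞ a) (hb : ContMDiff (𝓡 4) 𝓘(ℝ, ℝ) ∞ b)
    (ha0 : ∀ x, 0 < a x) (hb0 : ∀ x, 0 < b x) {β : ∀ x : M, TangentSpace (𝓡 4) x →L[ℝ] ℝ}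
    (hβ : ∀ (x : M) (X : ∀ y : M, TangentSpace (𝓡 4) y), FieldAt X x →
      FunAt (n := 4) (fun y => β y (X y)) x)
    (hinj : ∀ (x : M) (u : TangentSpace (𝓡 4) x), mfderiv (𝓡 4) (𝓡 3) pr x u = 0 → β x u = 0 → u = 0) :
    ∃ g : Metric 4 M, ∀ (x : M) (u v : TangentSpace (𝓡 4) x), g.inner x u v =
      a x * h.inner (pr x) (mfderiv (𝓡 4) (𝓡 3) pr x u) (mfderiv (𝓡 4) (𝓡 3) pr x v)
        + b x * (β x u * β x v) := by
  let φ (x : M) : TangentSpace (𝓡 4) x →L[ℝ] TangentSpace (𝓡 4) x →L[ℝ] ℝ :=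
    a x • (ContinuousLinearMap.precomp ℝ (mfderiv (𝓡 4) (𝓡 3) pr x)).comp
      ((h.inner (pr x)).comp (mfderiv (𝓡 4) (𝓡 3) pr x))
      + b x • (β x).smulRight (β x)
  have hφ (x : M) (u v : TangentSpace (𝓡 4) x) : φ x u v =
      a x * h.inner (pr x) (mfderiv (𝓡 4) (𝓡 3) pr x u) (mfderiv (𝓡 4) (𝓡 3) pr x v)
        + b x * (β x u * β x v) := by
    simp [φ]
  refine ⟨metricOf φ (fun x u v => ?_) (fun x u hu => ?_) (fun x X Y hX hY => ?_), hφ⟩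
  · rw [hφ, hφ, h.symm, mul_comm (β x u)]
  · rw [hφ]
    by_cases h0 : mfderiv (𝓡 4) (𝓡 3) pr x u = 0
    · have h1 : β x u ≠ 0 := fun h1 => hu (hinj x u h0 h1)
      have := mul_pos (hb0 x) (mul_self_pos.2 h1)
      rw [h0, map_zero, mul_zero, zero_add]
      exact this
    · have h1 := mul_pos (ha0 x) (h.pos _ _ h0)
      have h2 := mul_nonneg (hb0 x).le (mul_self_nonneg (β x u))
      linarith
  · simp only [hφ]
    exact ((ha x).mul ((hX.push hpr).inner hpr h (hY.push hpr))).add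
      ((hb x).mul ((hβ x X hX).mul (hβ x Y hY)))

variable (W : WeylStructure B)
  (volB : ∀ x : B, AlternatingMap ℝ (TangentSpace (𝓡 3) x) ℝ (Fin 3))

/-- The form `D^B μ_t - (1/2) μ_t² *_B F^B`. -/
def hlScaledForm (pr : M → B) (t : M → ℝ) (x : M) : TangentSpace (𝓡 4) x →L[ℝ] ℝ :=
  mvfderiv (𝓡 4) t x + t x • (W.lee (pr x)).comp (mfderiv (𝓡 4) (𝓡 3) pr x)
    - (1 / 2 * t x ^ 2) • (W.starFaraday volB (pr x)).comp (mfderiv (𝓡 4) (𝓡 3) pr x)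

theorem hlScaledForm_apply (pr : M → B) (t : M → ℝ) (x : M) (u : TangentSpace (𝓡 4) x) :
    hlScaledForm W volB pr t x u = mvfderiv (𝓡 4) t x u
      + t x * W.lee (pr x) (mfderiv (𝓡 4) (𝓡 3) pr x u)
      - 1 / 2 * t x ^ 2 * W.starFaraday volB (pr x) (mfderiv (𝓡 4) (𝓡 3) pr x u) := rfl

/-- Splits off the pole: the scaled form is smooth also where t vanishes and takes the value dt on
vertical vectors. -/
theorem hlOneForm_eq {pr : M → B} {t : M → ℝ} {x : M} (ht : t x ≠ 0) (u : TangentSpace (𝓡 4) x) :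
    hlOneForm W volB pr t x u = (t x)⁻¹ * hlScaledForm W volB pr t x u := by
  rw [hlScaledForm_apply, hlOneForm, WeylStructure.starFaraday_apply]
  field_simp

variable {W volB}

theorem hlScaledForm_smooth (hv : IsVolumeForm W.metric volB) {t : M → ℝ}
    (hpr : ContMDiff (𝓡 4) (𝓡 3) ∞ pr) (ht : ContMDiff (𝓡 4) 𝓘(ℝ, ℝ) ∞ t) (x : M)
    (X : ∀ y : M, TangentSpace (𝓡 4) y) (hX : FieldAt X x) :
    FunAt (n := 4) (fun y => hlScaledForm W volB pr t y (X y)) x := by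
  simp only [hlScaledForm_apply]
  have h1 := hX.push hpr
  exact ((contMDiffAt_mvfderiv_apply (ht x) hX).add
    ((ht x).mul (h1.oneForm hpr W.lee_smooth))).sub
    ((contMDiffAt_const.mul ((ht x).pow 2)).mul
      (h1.oneForm hpr (W.starFaraday_smooth hv)))

theorem hlFactor_smooth {t : M → ℝ} (hpr : ContMDiff (𝓡 4) (𝓡 3) ∞ pr)
    (ht : ContMDiff (𝓡 4) 𝓘(ℝ, ℝ) ∞ t) : ContMDiff (𝓡 4) 𝓘(ℝ, ℝ) ∞ (hlFactor W pr t) :=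
  contMDiff_const.sub ((contMDiff_const.mul (ht.pow 2)).mul (W.scal_smooth.comp hpr))

theorem IsFibreCoordinate.eq_zero {t : M → ℝ} (hF : IsFibreCoordinate pr t) {x : M}
    {u : TangentSpace (𝓡 4) x} (h1 : mfderiv (𝓡 4) (𝓡 3) pr x u = 0)
    (h2 : hlScaledForm W volB pr t x u = 0) : u = 0 := by
  rw [hlScaledForm_apply, h1, map_zero, map_zero, mul_zero, mul_zero, add_zero, sub_zero] at h2
  exact hF.injective x u h1 h2

theorem FunAt.inv {n : ℕ} {M : Type*} [TopologicalSpace M] [ChartedSpace (EuclideanSpace ℝ (Fin n)) M]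
    {f : M → ℝ} {x : M} (hf : FunAt (n := n) f x) (h : f x ≠ 0) :
    FunAt (n := n) (fun y => (f y)⁻¹) x :=
  ContDiffAt.comp_contMDiffAt (f := f) (contDiffAt_inv ℝ h) hf

/-- The conformal infinity of the metric of an Einstein-Weyl structure. -/
theorem exists_conformalInfinity (hv : IsVolumeForm W.metric volB) {t : M → ℝ}
    (hF : IsFibreCoordinate pr t) (hpos : ∀ x, 0 < hlFactor W pr t x) :
    ∃ gbar : Metric 4 M,
      (∀ x, t x ≠ 0 → ∀ u v : TangentSpace (𝓡 4) x,
        gbar.inner x u v = t x ^ 2 * hlForm W volB pr t x u v) ∧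
      (∀ x, t x = 0 → ∀ u v : TangentSpace (𝓡 4) x,
        mvfderiv (𝓡 4) t x u = 0 → mvfderiv (𝓡 4) t x v = 0 →
        gbar.inner x u v = W.metric.inner (pr x)
          (mfderiv (𝓡 4) (𝓡 3) pr x u) (mfderiv (𝓡 4) (𝓡 3) pr x v)) := by
  have hf := hlFactor_smooth (W := W) hF.smooth_proj hF.smooth_coord
  -- With f = `hlFactor` and β the scaled form, t²g is f π^*h + f⁻¹β², which has no pole at t = 0;
  -- there f = 1 and β = dt.
  obtain ⟨g, hg⟩ := exists_metric_of_form hF.smooth_proj W.metric hf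
    (fun x => FunAt.inv (hf x) (hpos x).ne') hpos
    (fun x => inv_pos.2 (hpos x)) (hlScaledForm_smooth hv hF.smooth_proj hF.smooth_coord)
    (fun x u h1 h2 => hF.eq_zero h1 h2)
  refine ⟨g, fun x hx u v => ?_, fun x hx u v hu hv => ?_⟩
  · rw [hg, hlForm, hlOneForm_eq W volB hx, hlOneForm_eq W volB hx]
    field_simp
  · rw [hg, hlScaledForm_apply, hlScaledForm_apply, hu, hv, hx]
    simp [hlFactor, hx]

end Total

/-! ### The vertical unit field. -/

section Vertical
variable {B : Type*} [TopologicalSpace B] [ChartedSpace (EuclideanSpace ℝ (Fin 3)) B]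
  [IsManifold (𝓡 3) ∞ B]
  {M : Type*} [TopologicalSpace M] [ChartedSpace (EuclideanSpace ℝ (Fin 4)) M]
  [IsManifold (𝓡 4) ∞ M] {pr : M → B} {h : Metric 3 B} {g : Metric 4 M}

theorem FunAt.sqrt {n : ℕ} {M : Type*} [TopologicalSpace M] [ChartedSpace (EuclideanSpace ℝ (Fin n)) M]
    {f : M → ℝ} {x : M} (hf : FunAt (n := n) f x) (h : 0 < f x) :
    FunAt (n := n) (fun y => √(f y)) x :=
  ContDiffAt.comp_contMDiffAt (f := f) (Real.contDiffAt_sqrt h.ne') hf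

/-- The vertical unit field of a metric of the form `a pr^* h + b β²`. -/
theorem exists_isConformalSubmersion (hpr : ContMDiff (𝓡 4) (𝓡 3) ∞ pr) {a b : M → ℝ}
    (hb : ContMDiff (𝓡 4) 𝓘(ℝ, ℝ) ∞ b)
    (ha0 : ∀ x, 0 < a x) (hb0 : ∀ x, 0 < b x) {β : ∀ x : M, TangentSpace (𝓡 4) x →L[ℝ] ℝ}
    (hβ : ∀ (x : M) (X : ∀ y : M, TangentSpace (𝓡 4) y), FieldAt X x →
      FunAt (n := 4) (fun y => β y (X y)) x)
    (hinj : ∀ (x : M) (u : TangentSpace (𝓡 4) x), mfderiv (𝓡 4) (𝓡 3) pr x u = 0 → β x u = 0 → u = 0)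
    (hg : ∀ (x : M) (u v : TangentSpace (𝓡 4) x), g.inner x u v =
      a x * h.inner (pr x) (mfderiv (𝓡 4) (𝓡 3) pr x u) (mfderiv (𝓡 4) (𝓡 3) pr x v)
        + b x * (β x u * β x v)) {σ : ℝ} (hσ : σ * σ = 1) :
    ∃ ξ : ∀ x : M, TangentSpace (𝓡 4) x, IsConformalSubmersion g h pr ξ ∧
      ∀ x, 0 < σ * β x (ξ x) := by
  have hsurj (x : M) : Function.Surjective
      ((mfderiv (𝓡 4) (𝓡 3) pr x).toLinearMap.prod (β x).toLinearMap) := by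
    refine (LinearMap.injective_iff_surjective_of_finrank_eq_finrank ?_).1 ?_
    · rw [Module.finrank_prod, finrank_tangentSpace, finrank_tangentSpace, Module.finrank_self]
    · rw [← LinearMap.ker_eq_bot, LinearMap.ker_eq_bot']
      intro u hu
      have hu' := Prod.ext_iff.1 hu
      exact hinj x u hu'.1 hu'.2
  -- The value of β is fixed by unit length, and the sign σ orients the fibre.
  have hv (x : M) : ∃ v : TangentSpace (𝓡 4) x, mfderiv (𝓡 4) (𝓡 3) pr x v = 0 ∧
      β x v = σ * (√(b x))⁻¹ := by
    obtain ⟨v, hv⟩ := hsurj x (0, σ * (√(b x))⁻¹)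
    exact ⟨v, (Prod.ext_iff.1 hv).1, (Prod.ext_iff.1 hv).2⟩
  choose ξ hξ hβξ using hv
  have hs (x : M) : 0 < √(b x) := Real.sqrt_pos.2 (hb0 x)
  have hss (x : M) : √(b x) * √(b x) = b x := Real.mul_self_sqrt (hb0 x).le
  have hσ0 : σ ≠ 0 := fun h0 => by simp [h0] at hσ
  have hgξ (x : M) (u : TangentSpace (𝓡 4) x) : g.inner x (ξ x) u = σ * √(b x) * β x u := by
    rw [hg, hξ, hβξ, map_zero, zero_apply, mul_zero, zero_add]
    nth_rw 1 [← hss x]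
    have := (hs x).ne'
    field_simp
  refine ⟨ξ, ⟨hpr, fun x z => ?_, fun x => ?_, hξ, fun x => ?_, fun x => ?_⟩, fun x => ?_⟩
  · obtain ⟨v, hv⟩ := hsurj x (z, 0)
    exact ⟨v, (Prod.ext_iff.1 hv).1⟩
  · obtain ⟨U, hx, u, hu⟩ := HitchinLeBrun.exists_frame g x
    have h : ∀ᶠ y in 𝓝 x, ξ y = ∑ i, (σ * √(b y) * β y ((u i).toFun y)) • (u i).toFun y :=
      (eventually_mem_opens ⟨x, hx⟩).mono fun y hy => by
        conv_lhs => rw [(hu y hy).expand (ξ y)]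
        exact Finset.sum_congr rfl fun i _ => by rw [hgξ]
    refine FieldAt.congr (FieldAt.sum fun i _ => FieldAt.smul ?_ ((u i).smooth x hx)) h
    exact (contMDiffAt_const.mul (FunAt.sqrt (hb x) (hb0 x))).mul (hβ x _ ((u i).smooth x hx))
  · rw [hgξ, hβξ]
    have := (hs x).ne'
    field_simp
    linear_combination hσ
  · refine ⟨(a x)⁻¹, inv_pos.2 (ha0 x), fun u v hu _ => ?_⟩
    rw [g.symm, hgξ] at hu
    have : β x u = 0 := (mul_eq_zero.1 hu).resolve_left (mul_ne_zero hσ0 (hs x).ne')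
    rw [hg, this, zero_mul, mul_zero, add_zero, inv_mul_cancel_left₀ (ha0 x).ne']
  · rw [hβξ, ← mul_assoc, hσ, one_mul]
    exact inv_pos.2 (hs x)

end Vertical

/-! ### The selfdual Einstein metric of an Einstein-Weyl structure. -/

section Construction
variable {M : Type*} [TopologicalSpace M] [ChartedSpace (EuclideanSpace ℝ (Fin 4)) M]
  [IsManifold (𝓡 4) ∞ M]
  {B : Type*} [TopologicalSpace B] [ChartedSpace (EuclideanSpace ℝ (Fin 3)) B]
  [IsManifold (𝓡 3) ∞ B]
  {g : Metric 4 M} {W : WeylStructure B} {pr : M → B} {ξ : ∀ x : M, TangentSpace (𝓡 4) x}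
  {U : TopologicalSpace.Opens M} {V : TopologicalSpace.Opens B} {S : SubmersionFrame g U}
  {hpr : ContMDiff (𝓡 4) (𝓡 3) ∞ pr} {hUV : ∀ y ∈ U, pr y ∈ V} {e : Fin 3 → Vec 3 V}
  {volB : ∀ x : B, AlternatingMap ℝ (TangentSpace (𝓡 3) x) ℝ (Fin 3)}
open WeylStructure

/-- In a frame adapted to the metric of an Einstein-Weyl structure, the inverse of the coordinate
along the fibres satisfies the equations of the construction. -/
theorem SubmersionFrame.IsAdapted.isHLCoordinate (hA : S.IsAdapted W.metric hpr hUV e ξ)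
    (he : FrameON W.metric e)
    (hev : ∀ y ∈ V, volB y ![(e 0).toFun y, (e 1).toFun y, (e 2).toFun y] = 1)
    (hEW : W.IsEinsteinWeyl) {t : M → ℝ} (ht : ContMDiff (𝓡 4) 𝓘(ℝ, ℝ) ∞ t) (ht0 : ∀ x, t x ≠ 0)
    {ε : ℝ} (hε : ε = 1 ∨ ε = -1) (hpos : ∀ x, 0 < ε * hlFactor W pr t x)
    (hg : ∀ (x : M) (u v : TangentSpace (𝓡 4) x), g.inner x u v =
      ε * hlFactor W pr t x * (t x ^ 2)⁻¹ *
        W.metric.inner (pr x) (mfderiv (𝓡 4) (𝓡 3) pr x u) (mfderiv (𝓡 4) (𝓡 3) pr x v)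
        + (ε * hlFactor W pr t x)⁻¹ * (t x ^ 2)⁻¹ *
          (hlScaledForm W volB pr t x u * hlScaledForm W volB pr t x v))
    (hξ : ∀ x, 0 < ε * hlScaledForm W volB pr t x (ξ x)) :
    S.IsHLCoordinate hpr hUV W e ε (Fn.of (fun y => (t y)⁻¹) fun x _ => FunAt.inv (ht x) (ht0 x)) := by
  have hε2 : ε * ε = 1 := by rcases hε with rfl | rfl <;> norm_num
  set ν : Fn 4 U := Fn.of (fun y => (t y)⁻¹) fun x _ => FunAt.inv (ht x) (ht0 x) with hν
  set τ : Fn 4 U := Fn.of t fun x _ => ht x with hτ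
  have hdν (X : Vec 4 U) (x : U) : (X.d ν).1 x = -(t x ^ 2)⁻¹ * mvfderiv (𝓡 4) t x (X.toFun x) := by
    have h1 : τ * ν = 1 := Fn.ext fun x => mul_inv_cancel₀ (ht0 x)
    have h2 : X.d (τ * ν) = 0 := by rw [h1]; exact X.d.map_one_eq_zero
    rw [Derivation.leibniz, smul_eq_mul, smul_eq_mul] at h2
    have h3 : t x * (X.d ν).1 x + (t x)⁻¹ * (X.d τ).1 x = 0 :=
      congrArg (fun f : Fn 4 U => f.1 x) h2
    have h4 : (X.d τ).1 x = mvfderiv (𝓡 4) t x (X.toFun x) := by rw [hτ, X.d_of]; rfl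
    rw [h4] at h3
    have := ht0 x
    field_simp at h3 ⊢
    linear_combination h3
  set β := hlScaledForm W volB pr t with hβ
  have hβT (x : U) : β x (S.T.toFun x) = mvfderiv (𝓡 4) t x (S.T.toFun x) := by
    rw [hβ, hlScaledForm_apply, hA.proj_T x x.2]
    simp
  have hE (x : U) (i j : Fin 3) : g.inner x ((S.E i).toFun x) ((S.E j).toFun x) =
      if i = j then S.Q.1 x else 0 := by
    rw [← Vec.ip_apply, S.ip_E]
    split_ifs <;> rfl
  have hTT (x : U) : g.inner x (S.T.toFun x) (S.T.toFun x) = S.QInv.1 x :=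
    congrArg (fun f : Fn 4 U => f.1 x) S.ip_T
  have hTE (x : U) (i : Fin 3) : g.inner x (S.T.toFun x) ((S.E i).toFun x) = 0 :=
    congrArg (fun f : Fn 4 U => f.1 x) (S.ip_T_E i)
  have hQQ (x : U) : S.Q.1 x * S.QInv.1 x = 1 := congrArg (fun f : Fn 4 U => f.1 x) S.Q_mul
  -- T points opposite to ξ.
  have hneg (x : U) : ε * β x (S.T.toFun x) < 0 := by
    have h1 := hξ x
    rw [hA.ξ_eq x x.2, S.ξ_toFun, map_smul, smul_eq_mul] at h1
    have h2 := hA.lam_pos x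
    by_contra h3
    nlinarith [mul_nonneg h2.le (not_lt.1 h3)]
  have hgT (x : U) (v : TangentSpace (𝓡 4) (x : M)) : g.inner x (S.T.toFun x) v =
      (ε * hlFactor W pr t x)⁻¹ * (t x ^ 2)⁻¹ * (β x (S.T.toFun x) * β x v) := by
    rw [hg, hA.proj_T x x.2]
    simp
  have hne (x : U) : β x (S.T.toFun x) ≠ 0 := fun h0 => by
    have := hneg x
    rw [h0] at this
    simp at this
  -- Horizontal vectors are those orthogonal to T, that is, those killed by β.
  have hβE (x : U) (i : Fin 3) : β x ((S.E i).toFun x) = 0 := by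
    have h1 := hTE x i
    rw [hgT] at h1
    have h2 : (ε * hlFactor W pr t x)⁻¹ * (t x ^ 2)⁻¹ ≠ 0 :=
      mul_ne_zero (inv_ne_zero (hpos x).ne') (inv_ne_zero (pow_ne_zero 2 (ht0 x)))
    exact (mul_eq_zero.1 ((mul_eq_zero.1 h1).resolve_left h2)).resolve_left (hne x)
  have hQ (x : U) : S.Q.1 x = ε * hlFactor W pr t x * (t x ^ 2)⁻¹ := by
    have h1 := hE x 0 0
    rw [hg, hA.proj_E 0 x x.2, hβE, mul_zero, mul_zero, add_zero, if_pos rfl] at h1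
    have h2 := he (pr x) (hUV x x.2) 0 0
    rw [if_pos rfl] at h2
    dsimp only at h2
    rw [h2, mul_one] at h1
    exact h1.symm
  refine ⟨Fn.ext fun x => ?_, fun l => Fn.ext fun x => ?_, Fn.ext fun x => ?_⟩
  · change (S.T.d ν).1 x = ε
    rw [hdν, ← hβT]
    have h1 := hTT x
    have h2 := hQQ x
    rw [hgT] at h1
    rw [hQ, ← h1] at h2
    have h3 := hneg x
    have h4 := ht0 x
    have h5 := (hpos x).ne'
    -- Here -y = T(1/t). From Q Q⁻¹ = 1 one gets y² = 1, and εy < 0 leaves y = -ε.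
    set y := (t x ^ 2)⁻¹ * β x (S.T.toFun x) with hy
    have h6 : y ^ 2 = 1 := by
      rw [← h2, hy]
      generalize ε * hlFactor W pr t x = F at h5
      field_simp
    have h7 : ε * y < 0 := by
      have : 0 < (t x ^ 2)⁻¹ := by positivity
      rw [hy]
      nlinarith
    rw [neg_mul, ← hy]
    rcases hε with rfl | rfl
    · nlinarith
    · nlinarith
  · have hF := W.starFaraday_frame he hev ⟨pr x, hUV x x.2⟩ l
    have h1 := hβE x l
    rw [hβ, hlScaledForm_apply, hA.proj_E l x x.2] at h1
    have h3 : (2 * (S.E l).d ν).1 x = 2 * ((S.E l).d ν).1 x := rfl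
    have h2 : W.lee (pr x) ((e l).toFun (pr x)) = (Fn.comap hpr hUV (W.frameOm e l)).1 x := rfl
    have h4 : (W.frameF e l).1 ⟨pr x, hUV x x.2⟩ = (Fn.comap hpr hUV (W.frameF e l)).1 x := rfl
    have h5 : (2 * (ν * Fn.comap hpr hUV (W.frameOm e l)) + Fn.comap hpr hUV (W.frameF e l)).1 x =
      2 * ((t x)⁻¹ * (Fn.comap hpr hUV (W.frameOm e l)).1 x)
        + (Fn.comap hpr hUV (W.frameF e l)).1 x := rfl
    dsimp only at hF
    rw [hF, h2, h4] at h1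
    rw [h3, h5, hdν]
    have := ht0 x
    field_simp
    linear_combination -2 * h1
  · have h1 := (frame_einsteinWeyl he hEW ⟨pr x, hUV x x.2⟩ 0).1
    change ε * S.Q.1 x = (t x)⁻¹ ^ 2 + (W.frameR e 0 0).1 ⟨pr x, hUV x x.2⟩
    rw [h1, hQ, hlFactor]
    have := ht0 x
    field_simp
    linear_combination (6 - t x ^ 2 * W.scal (pr x)) * hε2

variable {t : M → ℝ}

/-- The selfdual Einstein metric of an Einstein-Weyl structure. -/
theorem exists_selfdualEinstein (hEW : W.IsEinsteinWeyl) (hv : IsVolumeForm W.metric volB)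
    (hF : IsFibreCoordinate pr t) (ht0 : ∀ x, t x ≠ 0)
    {ε : ℝ} (hε : ε = 1 ∨ ε = -1) (hpos : ∀ x, 0 < ε * hlFactor W pr t x) :
    ∃ (g : Metric 4 M) (D : Connection 4 M) (ξ : ∀ x : M, TangentSpace (𝓡 4) x)
      (volM : ∀ x : M, AlternatingMap ℝ (TangentSpace (𝓡 4) x) ℝ (Fin 4)),
      (∀ (x : M) (u v : TangentSpace (𝓡 4) x),
        g.inner x u v = ε * hlForm W volB pr t x u v) ∧
      IsLeviCivita g D ∧
      (∀ (x : M) (u v : TangentSpace (𝓡 4) x), ricci D x u v = -3 * ε * g.inner x u v) ∧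
      IsConformalSubmersion g W.metric pr ξ ∧
      (∀ x, 0 < ε * mvfderiv (𝓡 4) t x (ξ x)) ∧
      IsInducedVolume g pr ξ volB volM ∧
      IsSelfdualMetric g D volM ∧
      IsSelfdualCongruence g D volM ξ ∧
      IsLegendrian g D volM ξ := by
  have hε2 : ε * ε = 1 := by rcases hε with rfl | rfl <;> norm_num
  have hε0 : ε ≠ 0 := fun h0 => by simp [h0] at hε2
  have hf : ContMDiff (𝓡 4) 𝓘(ℝ, ℝ) ∞ fun x => ε * hlFactor W pr t x :=
    contMDiff_const.mul (hlFactor_smooth (W := W) hF.smooth_proj hF.smooth_coord)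
  have hti : ContMDiff (𝓡 4) 𝓘(ℝ, ℝ) ∞ fun x => (t x ^ 2)⁻¹ := fun x =>
    FunAt.inv ((hF.smooth_coord x).pow 2) (pow_ne_zero 2 (ht0 x))
  have ht2 (x : M) : 0 < (t x ^ 2)⁻¹ := by have := ht0 x; positivity
  have ha : ContMDiff (𝓡 4) 𝓘(ℝ, ℝ) ∞ fun x => ε * hlFactor W pr t x * (t x ^ 2)⁻¹ := hf.mul hti
  have hb : ContMDiff (𝓡 4) 𝓘(ℝ, ℝ) ∞ fun x => (ε * hlFactor W pr t x)⁻¹ * (t x ^ 2)⁻¹ :=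
    ContMDiff.mul (fun x => FunAt.inv (hf x) (hpos x).ne') hti
  have ha0 (x : M) := mul_pos (hpos x) (ht2 x)
  have hb0 (x : M) := mul_pos (inv_pos.2 (hpos x)) (ht2 x)
  have hβ := hlScaledForm_smooth (W := W) hv hF.smooth_proj hF.smooth_coord
  obtain ⟨g, hg⟩ := exists_metric_of_form hF.smooth_proj W.metric ha hb ha0 hb0 hβ
    (fun x u h1 h2 => hF.eq_zero h1 h2)
  obtain ⟨ξ, hS, hξ⟩ := exists_isConformalSubmersion hF.smooth_proj hb ha0 hb0 hβ
    (fun x u h1 h2 => hF.eq_zero h1 h2) hg hε2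
  obtain ⟨D, hW⟩ := exists_isWeylConnection g fun _ => 0
  obtain ⟨volM, hM⟩ := hS.exists_inducedVolume hv
  have hW : IsLeviCivita g D := hW
  have hD := hW.smooth g
  -- All the remaining properties are pointwise, so one adapted frame around each point suffices.
  have key (x : M) : ∃ w : Fin 4 → TangentSpace (𝓡 4) x, IsON g x w ∧
      volM x ![w 0, w 1, w 2, w 3] = 1 ∧ AsdEinstein (-3 * ε) (curvComp g D x w) ∧
      (IsSelfdualForm g volM x fun u v => extDerivOne (minimalForm g D ξ) x u v) ∧
      IsSelfdualForm g volM x fun u v =>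
        ((g.inner x (D ξ x u) v - minimalForm g D ξ x u * g.inner x (ξ x) v)
          - (g.inner x (D ξ x v) u - minimalForm g D ξ x v * g.inner x (ξ x) u)) / 2 := by
    obtain ⟨V, hxV, e, he, hev⟩ := hv.exists_frame (pr x)
    obtain ⟨U, hx, hUV, S, hA⟩ := hS.exists_adapted x hxV he
    have hvol := hA.volume hev hM
    have hν := hA.isHLCoordinate he hev hEW hF.smooth_coord ht0 hε hpos hg hξ
    have hL := hν.legendrian hA he hε0 hEW
    refine ⟨S.wAt ⟨x, hx⟩, S.w_frameON x hx, hvol ⟨x, hx⟩,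
      hν.asdEinstein hA he hε0 hEW hW hD ⟨x, hx⟩, ?_, ?_⟩
    · refine (S.isSelfdual_iff_of_legendrian hW hD hA.ξ_eq hvol hL).2 (fun p => ?_) x hx
      rw [hν.κ_eq hA hε0]
      exact Vec.d_comap_eq_zero hS.smooth hUV hA.proj_T _
    · exact (S.isLegendrian_iff hW hD hA.ξ_eq hvol).2 hL x hx
  refine ⟨g, D, ξ, volM, fun x u v => ?_, hW, fun x u v => ?_, hS, fun x => ?_, hM, fun x y z => ?_,
    fun x => ?_, fun x => ?_⟩
  · rw [hg, hlForm, hlOneForm_eq W volB (ht0 x), hlOneForm_eq W volB (ht0 x)]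
    have h1 : (ε * hlFactor W pr t x)⁻¹ = ε * (hlFactor W pr t x)⁻¹ := by
      rw [mul_inv, inv_eq_of_mul_eq_one_right hε2]
    rw [h1]
    ring
  · obtain ⟨w, hw, -, h, -⟩ := key x
    exact h.isEinstein hW hw u v
  · have h := hξ x
    rw [hlScaledForm_apply, hS.vertical] at h
    simpa using h
  · obtain ⟨w, hw, hvol, h, -⟩ := key x
    exact h.isSelfdual hW hw hvol y z
  · exact (key x).choose_spec.2.2.2.1
  · exact (key x).choose_spec.2.2.2.2

end Construction

/-! ### Local sections and descent of functions to the base. -/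

section Descent
variable {M : Type*} [TopologicalSpace M] [ChartedSpace (EuclideanSpace ℝ (Fin 4)) M]
  [IsManifold (𝓡 4) ∞ M]
  {B : Type*} [TopologicalSpace B] [ChartedSpace (EuclideanSpace ℝ (Fin 3)) B]
  [IsManifold (𝓡 3) ∞ B]
  {g : Metric 4 M} {h : Metric 3 B} {pr : M → B} {ξ : ∀ x : M, TangentSpace (𝓡 4) x}

/-- A conformal submersion is locally a projection. -/
theorem IsConformalSubmersion.exists_straightening (hS : IsConformalSubmersion g h pr ξ) (x : M) :
    ∃ (τ : M → ℝ) (Ψ : EuclideanSpace ℝ (Fin 3) × ℝ → M), ContinuousAt τ x ∧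
      ContMDiffAt 𝓘(ℝ, EuclideanSpace ℝ (Fin 3) × ℝ) (𝓡 4) ∞ Ψ
        (extChartAt (𝓡 3) (pr x) (pr x), τ x) ∧
      (∀ᶠ y in 𝓝 x, Ψ (extChartAt (𝓡 3) (pr x) (pr y), τ y) = y) ∧
      ∀ᶠ q in 𝓝 (extChartAt (𝓡 3) (pr x) (pr x), τ x), extChartAt (𝓡 3) (pr x) (pr (Ψ q)) = q.1 := by
  set φ := extChartAt (𝓡 4) x with hφ
  set ψ := extChartAt (𝓡 3) (pr x) with hψ
  set v : EuclideanSpace ℝ (Fin 4) := ξ x with hv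
  let A : EuclideanSpace ℝ (Fin 4) →L[ℝ] EuclideanSpace ℝ (Fin 3) := mfderiv (𝓡 4) (𝓡 3) pr x
  let P : EuclideanSpace ℝ (Fin 4) → EuclideanSpace ℝ (Fin 3) := ψ ∘ pr ∘ φ.symm
  have hP : ContDiffAt ℝ ∞ P (φ x) := by
    have := (contMDiffAt_iff.1 (hS.smooth.contMDiffAt (x := x))).2
    simpa only [modelWithCornersSelf_coe, Set.range_id, contDiffWithinAt_univ] using this
  have hA : HasFDerivAt P A (φ x) := by
    have h1 : A = fderiv ℝ P (φ x) := by
      have := (hS.smooth.contMDiffAt (x := x)).mdifferentiableAt (by simp) |>.mfderiv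
      simp only [modelWithCornersSelf_coe, Set.range_id, fderivWithin_univ] at this
      exact this
    rw [h1]
    exact (hP.differentiableAt (by simp)).hasFDerivAt
  -- The kernel of the projection's differential is spanned by v, and pairing with v in the model
  -- inner product detects it; so the inverse function theorem applies to `Φ`.
  let L : EuclideanSpace ℝ (Fin 4) →L[ℝ] EuclideanSpace ℝ (Fin 3) × ℝ := A.prod (innerSL ℝ v)
  let Φ : EuclideanSpace ℝ (Fin 4) → EuclideanSpace ℝ (Fin 3) × ℝ := fun u => (P u, innerSL ℝ v u)
  have hΦ : ContDiffAt ℝ ∞ Φ (φ x) := hP.prodMk (innerSL ℝ v).contDiff.contDiffAt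
  have hL : HasFDerivAt Φ L (φ x) := hA.prodMk (innerSL ℝ v).hasFDerivAt
  have hv0 : v ≠ 0 := fun h0 => by
    have h1 := hS.unit x
    rw [show ξ x = 0 from h0, map_zero] at h1
    exact zero_ne_one h1
  have hinj : Function.Injective L := by
    rw [← ContinuousLinearMap.coe_coe, ← LinearMap.ker_eq_bot, LinearMap.ker_eq_bot']
    intro u hu
    have h1 : A u = 0 := (Prod.ext_iff.1 hu).1
    have h2 : inner ℝ v u = 0 := (Prod.ext_iff.1 hu).2
    obtain ⟨k, hk⟩ : ∃ k : ℝ, u = k • v := ⟨_, hS.eq_smul (x := x) (v := u) h1⟩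
    rw [hk, inner_smul_right, mul_eq_zero] at h2
    rcases h2 with h2 | h2
    · rw [hk, h2, zero_smul]
    · exact absurd (inner_self_eq_zero.1 h2) hv0
  have hsurj : Function.Surjective L := by
    refine (LinearMap.injective_iff_surjective_of_finrank_eq_finrank (f := L.toLinearMap) ?_).1 hinj
    rw [Module.finrank_prod, finrank_euclideanSpace, finrank_euclideanSpace, Module.finrank_self]
    rfl
  let e := ContinuousLinearEquiv.ofBijective L (LinearMap.ker_eq_bot.2 hinj)
    (LinearMap.range_eq_top.2 hsurj)
  have he : HasFDerivAt Φ (e : EuclideanSpace ℝ (Fin 4) →L[ℝ] EuclideanSpace ℝ (Fin 3) × ℝ) (φ x) := by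
    rw [ContinuousLinearEquiv.coe_ofBijective]
    exact hL
  have hst := hΦ.hasStrictFDerivAt' he (by simp)
  have hx : φ.symm (φ x) = x := extChartAt_to_inv x
  have hφc : ContinuousAt φ x := continuousAt_extChartAt x
  have hΦx : Φ (φ x) = (ψ (pr x), inner ℝ v (φ x)) := by
    simp only [Φ, P, Function.comp_apply, hx]
    rfl
  refine ⟨fun y => inner ℝ v (φ y), φ.symm ∘ hΦ.localInverse he (by simp), ?_, ?_, ?_, ?_⟩
  · exact ((innerSL ℝ v).continuous.continuousAt).comp hφc
  · rw [← hΦx]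
    have h1 : ContMDiffAt 𝓘(ℝ, EuclideanSpace ℝ (Fin 3) × ℝ) 𝓘(ℝ, EuclideanSpace ℝ (Fin 4)) ∞
        (hΦ.localInverse he (by simp)) (Φ (φ x)) :=
      (hΦ.to_localInverse he (by simp)).contMDiffAt
    have h2 : ContMDiffAt 𝓘(ℝ, EuclideanSpace ℝ (Fin 4)) (𝓡 4) ∞ φ.symm (φ x) := by
      have := contMDiffWithinAt_extChartAt_symm_range (I := 𝓡 4) (n := ∞) x
        (mem_extChartAt_target (I := 𝓡 4) x)
      simpa only [modelWithCornersSelf_coe, Set.range_id, contMDiffWithinAt_univ] using this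
    exact h2.comp_of_eq h1 (hΦ.localInverse_apply_image he _)
  · filter_upwards [hφc.eventually hst.eventually_left_inverse,
      extChartAt_source_mem_nhds (I := 𝓡 4) x] with y hy hys
    have h1 : Φ (φ y) = (ψ (pr y), inner ℝ v (φ y)) := by
      simp only [Φ, P, Function.comp_apply, φ.left_inv hys]
      rfl
    rw [← h1, Function.comp_apply]
    exact (congrArg φ.symm hy).trans (φ.left_inv hys)
  · rw [← hΦx]
    filter_upwards [hst.eventually_right_inverse] with q hq
    exact congrArg Prod.fst hq

/-- Local sections of a conformal submersion, and functions with vanishing vertical derivative. -/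
theorem IsConformalSubmersion.exists_section (hS : IsConformalSubmersion g h pr ξ) (x : M) :
    ∃ σ : B → M, ContMDiffAt (𝓡 3) (𝓡 4) ∞ σ (pr x) ∧ σ (pr x) = x ∧
      (∀ᶠ b in 𝓝 (pr x), pr (σ b) = b) ∧
      ∀ f : M → ℝ, (∀ᶠ y in 𝓝 x, FunAt (n := 4) f y ∧ mvfderiv (𝓡 4) f y (ξ y) = 0) →
        ∀ᶠ y in 𝓝 x, f y = f (σ (pr y)) := by
  obtain ⟨τ, Ψ, hτ, hΨ, hl, hr⟩ := hS.exists_straightening x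
  set ψ := extChartAt (𝓡 3) (pr x) with hψ
  have hx : Ψ (ψ (pr x), τ x) = x := hl.self_of_nhds
  have hpr : ContinuousAt pr x := hS.smooth.continuous.continuousAt
  have hψc : ContinuousAt ψ (pr x) := continuousAt_extChartAt (pr x)
  have hsrc : ∀ᶠ b in 𝓝 (pr x), b ∈ ψ.source := extChartAt_source_mem_nhds (I := 𝓡 3) (pr x)
  have hq : ContMDiffAt (𝓡 3) 𝓘(ℝ, EuclideanSpace ℝ (Fin 3) × ℝ) ∞ (fun b => (ψ b, τ x)) (pr x) :=
    (contMDiffAt_extChartAt (x := pr x)).prodMk_space contMDiffAt_const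
  have hσ : ContMDiffAt (𝓡 3) (𝓡 4) ∞ (fun b => Ψ (ψ b, τ x)) (pr x) :=
    ContMDiffAt.comp (g := Ψ) (pr x) hΨ hq
  have hprΨ : ∀ᶠ q in 𝓝 (ψ (pr x), τ x), pr (Ψ q) ∈ ψ.source := by
    have h1 : ContinuousAt (pr ∘ Ψ) (ψ (pr x), τ x) :=
      ContinuousAt.comp (by rw [hx]; exact hpr) hΨ.continuousAt
    refine h1.eventually ?_
    rw [Function.comp_apply, hx]
    exact hsrc
  refine ⟨fun b => Ψ (ψ b, τ x), hσ, hx, ?_, fun f hf => ?_⟩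
  · filter_upwards [hq.continuousAt.eventually hr, hq.continuousAt.eventually hprΨ, hsrc] with b h1 h2 h3
    exact ψ.injOn h2 h3 h1
  · have hΨ1 : ∀ᶠ q in 𝓝 (ψ (pr x), τ x),
        ContMDiffAt 𝓘(ℝ, EuclideanSpace ℝ (Fin 3) × ℝ) (𝓡 4) 1 Ψ q :=
      (contMDiffAt_iff_contMDiffAt_nhds (by simp)).1 (hΨ.of_le (by simp))
    have hfΨ : ∀ᶠ q in 𝓝 (ψ (pr x), τ x),
        FunAt (n := 4) f (Ψ q) ∧ mvfderiv (𝓡 4) f (Ψ q) (ξ (Ψ q)) = 0 :=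
      hΨ.continuousAt.eventually (by rw [hx]; exact hf)
    obtain ⟨r, hr0, hball⟩ := Metric.eventually_nhds_iff_ball.1
      (hΨ1.and (hfΨ.and (hr.eventually_nhds.and hprΨ.eventually_nhds)))
    -- Along a line in the last coordinate the projection is constant, so the velocity is a multiple
    -- of ξ and f has zero derivative.
    have key (a : EuclideanSpace ℝ (Fin 3)) (ha : a ∈ Metric.ball (ψ (pr x)) r) (s : ℝ)
        (hs : s ∈ Metric.ball (τ x) r) : f (Ψ (a, s)) = f (Ψ (a, τ x)) := by
      have hd (s : ℝ) (hs : s ∈ Metric.ball (τ x) r) : HasDerivAt (fun s => f (Ψ (a, s))) 0 s := by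
        obtain ⟨h1, ⟨h2, h3⟩, h4, h5⟩ := hball (a, s) (by
          rw [← ball_prod_same]; exact ⟨ha, hs⟩)
        have hc : ContMDiffAt 𝓘(ℝ, ℝ) 𝓘(ℝ, EuclideanSpace ℝ (Fin 3) × ℝ) 1 (fun s : ℝ => (a, s)) s :=
          (contDiff_const.prodMk contDiff_id).contDiffAt.contMDiffAt
        have hc1 : MDifferentiableAt 𝓘(ℝ, ℝ) (𝓡 4) (fun s : ℝ => Ψ (a, s)) s :=
          (ContMDiffAt.comp (g := Ψ) s h1 hc).mdifferentiableAt (by simp)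
        have hconst : ∀ᶠ s' in 𝓝 s, pr (Ψ (a, s')) = pr (Ψ (a, s)) := by
          filter_upwards [hc.continuousAt.eventually h4, hc.continuousAt.eventually h5] with s' h6 h7
          exact ψ.injOn h7 h5.self_of_nhds (h6.trans h4.self_of_nhds.symm)
        have hk : mfderiv (𝓡 4) (𝓡 3) pr (Ψ (a, s))
            (mfderiv 𝓘(ℝ, ℝ) (𝓡 4) (fun s : ℝ => Ψ (a, s)) s (1 : ℝ)) = 0 := by
          have h6 := mfderiv_comp_apply (g := pr) (f := fun s : ℝ => Ψ (a, s)) s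
            (hS.smooth.contMDiffAt.mdifferentiableAt (by simp)) hc1 (1 : ℝ)
          rw [← h6]
          have h7 : (pr ∘ fun s : ℝ => Ψ (a, s)) =ᶠ[𝓝 s] fun _ => pr (Ψ (a, s)) := hconst
          have h8 : HasMFDerivAt 𝓘(ℝ, ℝ) (𝓡 3) (pr ∘ fun s : ℝ => Ψ (a, s)) s 0 :=
            (hasMFDerivAt_const (pr (Ψ (a, s))) s).congr_of_eventuallyEq h7
          rw [h8.mfderiv]
          rfl
        have h6 : MDifferentiableAt 𝓘(ℝ, ℝ) 𝓘(ℝ, ℝ) (f ∘ fun s : ℝ => Ψ (a, s)) s :=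
          MDifferentiableAt.comp (g := f) s h2.mdiff hc1
        have h7 : mvfderiv 𝓘(ℝ, ℝ) (f ∘ fun s : ℝ => Ψ (a, s)) s (1 : ℝ) = 0 := by
          refine (mvfderiv_comp_apply s h2.mdiff hc1 (1 : ℝ)).trans ?_
          rw [hS.eq_smul hk, map_smul, h3, smul_zero]
        have h8 : deriv (f ∘ fun s : ℝ => Ψ (a, s)) s = 0 := by
          rw [← h7, ← fderiv_apply_one_eq_deriv]
          simp only [mvfderiv, mfderiv_eq_fderiv]
          rfl
        rw [← h8]
        exact h6.differentiableAt.hasDerivAt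
      refine Metric.isOpen_ball.is_const_of_deriv_eq_zero (convex_ball _ _).isPreconnected
        (fun s hs => (hd s hs).differentiableAt.differentiableWithinAt)
        (fun s hs => (hd s hs).deriv) hs (Metric.mem_ball_self hr0)
    have hn1 : ∀ᶠ y in 𝓝 x, ψ (pr y) ∈ Metric.ball (ψ (pr x)) r :=
      (ContinuousAt.comp (f := pr) hψc hpr).eventually (Metric.ball_mem_nhds _ hr0)
    have hn2 : ∀ᶠ y in 𝓝 x, τ y ∈ Metric.ball (τ x) r := hτ.eventually (Metric.ball_mem_nhds _ hr0)
    filter_upwards [hl, hn1, hn2] with y h1 h2 h3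
    conv_lhs => rw [← h1]
    exact key _ h2 _ h3

/-- Functions with vanishing vertical derivative descend, if the fibres are connected. -/
theorem IsConformalSubmersion.exists_descend (hS : IsConformalSubmersion g h pr ξ)
    (hconn : ∀ b : B, IsConnected (pr ⁻¹' {b})) {V : TopologicalSpace.Opens B} {f : M → ℝ}
    (hf : ∀ x, pr x ∈ V → FunAt (n := 4) f x)
    (hv : ∀ x, pr x ∈ V → mvfderiv (𝓡 4) f x (ξ x) = 0) :
    ∃ F : B → ℝ, (∀ b ∈ V, FunAt (n := 3) F b) ∧ ∀ x, pr x ∈ V → f x = F (pr x) := by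
  have hev (x : M) (hx : pr x ∈ V) :
      ∀ᶠ y in 𝓝 x, FunAt (n := 4) f y ∧ mvfderiv (𝓡 4) f y (ξ y) = 0 := by
    filter_upwards [hS.smooth.continuous.continuousAt.eventually (V.isOpen.mem_nhds hx)] with y hy
    exact ⟨hf y hy, hv y hy⟩
  have hfib (b : B) (hb : b ∈ V) (x y : M) (hx : pr x = b) (hy : pr y = b) : f x = f y := by
    -- On a fibre f is locally constant, hence constant since the fibre is connected.
    refine (hconn b).isPreconnected.induction₂ (fun x y => f x = f y) (fun z hz => ?_)
      (fun _ _ _ _ _ _ h1 h2 => h1.trans h2) (fun _ _ _ _ h => h.symm) hx hy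
    have hz' : pr z = b := hz
    obtain ⟨σ, -, h1, -, h2⟩ := hS.exists_section z
    filter_upwards [nhdsWithin_le_nhds (h2 f (hev z (hz' ▸ hb))), self_mem_nhdsWithin] with y h3 h4
    have h4' : pr y = b := h4
    rw [h3, h4', ← hz', h1]
  -- An arbitrary set-theoretic section, which exists because the fibres are nonempty. Near each
  -- point it may be replaced by a smooth section, because f is constant on fibres.
  choose s hs using fun b => (hconn b).nonempty
  have hs' (b : B) : pr (s b) = b := hs b
  refine ⟨fun b => f (s b), fun b hb => ?_, fun x hx => hfib _ hx x _ rfl (hs' _)⟩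
  obtain ⟨σ, hσ, h1, h2, -⟩ := hS.exists_section (s b)
  rw [hs'] at hσ h1 h2
  have h3 : (fun b => f (s b)) =ᶠ[𝓝 b] f ∘ σ := by
    filter_upwards [h2, V.isOpen.mem_nhds hb] with b' h4 h5
    exact hfib b' h5 _ _ (hs' b') h4
  refine ContMDiffAt.congr_of_eventuallyEq (ContMDiffAt.comp_of_eq (hf (s b) ?_) hσ h1) h3
  rw [hs']
  exact hb

end Descent

/-! ### The dilation, the fibre coordinate and the Lee form as global objects. -/

section Converse
variable {M : Type*} [TopologicalSpace M] [ChartedSpace (EuclideanSpace ℝ (Fin 4)) M]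
  [IsManifold (𝓡 4) ∞ M]
  {B : Type*} [TopologicalSpace B] [ChartedSpace (EuclideanSpace ℝ (Fin 3)) B]
  [IsManifold (𝓡 3) ∞ B]
  {g : Metric 4 M} {h : Metric 3 B} {pr : M → B} {ξ : ∀ x : M, TangentSpace (𝓡 4) x}
  {U : TopologicalSpace.Opens M} {V : TopologicalSpace.Opens B} {S : SubmersionFrame g U}
  {hUV : ∀ y ∈ U, pr y ∈ V} {e : Fin 3 → Vec 3 V} {D : Connection 4 M}
  {volB : ∀ x : B, AlternatingMap ℝ (TangentSpace (𝓡 3) x) ℝ (Fin 3)}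

/-- The factor by which a conformal submersion shrinks horizontal vectors. -/
def IsConformalSubmersion.dilation (hS : IsConformalSubmersion g h pr ξ) (x : M) : ℝ :=
  (√(hS.conformal x).choose)⁻¹

theorem IsConformalSubmersion.exists_horizontal (hS : IsConformalSubmersion g h pr ξ) (x : M)
    (z : TangentSpace (𝓡 3) (pr x)) : ∃ v : TangentSpace (𝓡 4) x,
      mfderiv (𝓡 4) (𝓡 3) pr x v = z ∧ g.inner x v (ξ x) = 0 := by
  obtain ⟨u, hu⟩ := hS.submersion x z
  refine ⟨u - g.inner x u (ξ x) • ξ x, ?_, ?_⟩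
  · rw [map_sub, map_smul, hS.vertical, hu, smul_zero, sub_zero]
  · rw [inner_sub_left, inner_smul_left, hS.unit, mul_one, sub_self]

/-- The horizontal lift of a tangent vector. -/
def IsConformalSubmersion.hlift (hS : IsConformalSubmersion g h pr ξ) (x : M) :
    TangentSpace (𝓡 3) (pr x) →ₗ[ℝ] TangentSpace (𝓡 4) x :=
  IsLinearMap.mk' (fun z => (hS.exists_horizontal x z).choose) (by
    have H (z : TangentSpace (𝓡 3) (pr x)) := (hS.exists_horizontal x z).choose_spec
    refine ⟨fun z z' => hS.eq_of_horizontal (H _).2 ?_ ?_, fun a z => hS.eq_of_horizontal (H _).2 ?_ ?_⟩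
    · rw [inner_add_left, (H z).2, (H z').2, add_zero]
    · rw [map_add, (H _).1, (H z).1, (H z').1]
    · rw [inner_smul_left, (H z).2, mul_zero]
    · rw [map_smul, (H _).1, (H z).1])

theorem IsConformalSubmersion.hlift_spec (hS : IsConformalSubmersion g h pr ξ) (x : M)
    (z : TangentSpace (𝓡 3) (pr x)) :
    mfderiv (𝓡 4) (𝓡 3) pr x (hS.hlift x z) = z ∧ g.inner x (hS.hlift x z) (ξ x) = 0 :=
  (hS.exists_horizontal x z).choose_spec

namespace SubmersionFrame

variable {hpr : ContMDiff (𝓡 4) (𝓡 3) ∞ pr}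

theorem IsAdapted.inner_E_ξ (hA : S.IsAdapted h hpr hUV e ξ) (x : U) (i : Fin 3) :
    g.inner x ((S.E i).toFun x) (ξ x) = 0 := by
  have hTE : g.inner x (S.T.toFun x) ((S.E i).toFun x) = 0 :=
    congrArg (fun f : Fn 4 U => f.1 x) (S.ip_T_E i)
  rw [g.symm, hA.ξ_eq x x.2, S.ξ_toFun, inner_smul_left, hTE, mul_zero]

theorem IsAdapted.hlift_eq (hA : S.IsAdapted h hpr hUV e ξ) (hS : IsConformalSubmersion g h pr ξ)
    (x : U) (i : Fin 3) : hS.hlift x ((e i).toFun (pr x)) = (S.E i).toFun x :=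
  hS.eq_of_horizontal (hS.hlift_spec x _).2 (hA.inner_E_ξ x i)
    (by rw [(hS.hlift_spec x _).1, hA.proj_E i x x.2])

/-- λ does not depend on the frame, so the local functions glue to a global one. -/
theorem IsAdapted.lam_eq (hA : S.IsAdapted h hpr hUV e ξ) (hS : IsConformalSubmersion g h pr ξ)
    (he : FrameON h e) (x : U) : S.lam.1 x = hS.dilation x := by
  obtain ⟨hc, hcon⟩ := (hS.conformal x).choose_spec
  have h1 := hcon _ _ (hA.inner_E_ξ x 0) (hA.inner_E_ξ x 0)
  rw [hA.proj_E 0 x x.2] at h1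
  have h2 := he (pr x) (hUV x x.2) 0 0
  rw [if_pos rfl] at h2
  have h3 : g.inner x ((S.E 0).toFun x) ((S.E 0).toFun x) = S.lam.1 x ^ 2 :=
    congrArg (fun f : Fn 4 U => f.1 x) (S.ip_E 0 0)
  dsimp only at h2
  rw [h2, h3] at h1
  have hl := hA.lam_pos x
  rw [IsConformalSubmersion.dilation]
  set c := (hS.conformal x).choose
  have h4 : c = ((S.lam.1 x)⁻¹) ^ 2 := by
    have := hl.ne'
    field_simp
    linarith
  rw [h4, Real.sqrt_sq (inv_pos.2 hl).le, inv_inv]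

end SubmersionFrame

theorem IsConformalSubmersion.dilation_smooth (hS : IsConformalSubmersion g h pr ξ) :
    ContMDiff (𝓡 4) 𝓘(ℝ, ℝ) ∞ hS.dilation := fun x => by
  obtain ⟨V, hb, e, he⟩ := HitchinLeBrun.exists_frame h (pr x)
  obtain ⟨U, hx, hUV, S, hA⟩ := hS.exists_adapted x hb he
  have h1 : ∀ᶠ y in 𝓝 x, hS.dilation y = S.lam.lift y :=
    (eventually_mem_opens ⟨x, hx⟩).mono fun y hy => by
      rw [Fn.lift_apply _ ⟨y, hy⟩, hA.lam_eq hS he]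
  exact (Fn.lift_smooth _ x hx).congr_of_eventuallyEq h1

/-- The coordinate along the fibres. -/
def IsConformalSubmersion.coord (hS : IsConformalSubmersion g h pr ξ) (x : M) : ℝ :=
  -mvfderiv (𝓡 4) hS.dilation x (ξ x)

theorem IsConformalSubmersion.coord_smooth (hS : IsConformalSubmersion g h pr ξ) :
    ContMDiff (𝓡 4) 𝓘(ℝ, ℝ) ∞ hS.coord := fun x =>
  (contMDiffAt_mvfderiv_apply (hS.dilation_smooth x) (hS.smooth_vertical x)).neg

/-- The horizontal part of the Lee form. -/
def IsConformalSubmersion.horizontalLee (hS : IsConformalSubmersion g h pr ξ) (D : Connection 4 M)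
    (x : M) : TangentSpace (𝓡 4) x →L[ℝ] ℝ :=
  (hS.dilation x)⁻¹ • mvfderiv (𝓡 4) hS.dilation x - g.inner x (D ξ x (ξ x))

namespace SubmersionFrame

variable {hpr : ContMDiff (𝓡 4) (𝓡 3) ∞ pr}

theorem IsAdapted.d_lam (hA : S.IsAdapted h hpr hUV e ξ) (hS : IsConformalSubmersion g h pr ξ)
    (he : FrameON h e) (X : Vec 4 U) (x : U) :
    (X.d S.lam).1 x = mvfderiv (𝓡 4) hS.dilation x (X.toFun x) := by
  have h1 : S.lam = Fn.of hS.dilation fun x _ => hS.dilation_smooth x :=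
    Fn.ext fun x => hA.lam_eq hS he x
  rw [h1, Vec.d_of]
  rfl

/-- ν = λT(λ) = -ξ(λ), an expression without the frame: this is the global fibre coordinate. -/
theorem IsAdapted.ν_apply (hA : S.IsAdapted h hpr hUV e ξ) (hS : IsConformalSubmersion g h pr ξ)
    (he : FrameON h e) (x : U) : S.ν.1 x = hS.coord x := by
  have h1 : S.ν = S.lam * S.T.d S.lam := Fn.two_cancel (by
    rw [S.two_ν, Q, pow_two, Derivation.leibniz, smul_eq_mul]; ring)
  rw [h1, Fn.mul_apply, hA.d_lam hS he, IsConformalSubmersion.coord, hA.ξ_eq x x.2, S.ξ_toFun, map_smul,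
    smul_eq_mul, neg_mul, neg_neg]

/-- Since pp is twice the Lee form on E_i, solving its definition for κ gives κ_i = λ⁻¹E_i(λ) -
g(∇_ξ ξ, E_i), again free of the frame. -/
theorem IsAdapted.κ_apply (hA : S.IsAdapted h hpr hUV e ξ) (hS : IsConformalSubmersion g h pr ξ)
    (he : FrameON h e) (hW : IsLeviCivita g D) (x : U) (i : Fin 3) :
    (S.κ i).1 x = hS.horizontalLee D x ((S.E i).toFun x) := by
  have hD := hW.smooth g
  have h1 := S.two_gam_E hW hD i
  have h2 : S.gam hD (S.E i) = (S.ξ.nab hD S.ξ).ip g (S.E i) := by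
    rw [gam, show S.ξ.ip g (S.E i) = -S.lam * S.T.ip g (S.E i) from Vec.ip_smul_left _ _ _, S.ip_T_E]
    ring
  have h3 : S.κ i = S.lamInv * (S.E i).d S.lam - (S.ξ.nab hD S.ξ).ip g (S.E i) := by
    rw [pp, Q, QInv, pow_two S.lam, Derivation.leibniz, smul_eq_mul, h2] at h1
    refine Fn.two_cancel ?_
    linear_combination h1 + 2 * S.lamInv * (S.E i).d S.lam * S.lam_mul
  have h4 : S.lam.1 x * S.lamInv.1 x = 1 := congrArg (fun f : Fn 4 U => f.1 x) S.lam_mul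
  have h5 : S.lamInv.1 x = (hS.dilation x)⁻¹ := by
    rw [← hA.lam_eq hS he]; exact eq_inv_of_mul_eq_one_right h4
  rw [h3, Fn.sub_apply, Fn.mul_apply, hA.d_lam hS he, Vec.ip_apply, h5,
    IsConformalSubmersion.horizontalLee, sub_apply, smul_apply, smul_eq_mul, S.conn_vertical hW hA.ξ_eq,
    hA.ξ_eq x x.2]
  rfl

end SubmersionFrame

/-- The Lee form of the Weyl derivative on the base. -/
theorem IsConformalSubmersion.exists_lee (hS : IsConformalSubmersion g h pr ξ)
    (hv : IsVolumeForm h volB) (hW : IsLeviCivita g D) (hconn : ∀ b : B, IsConnected (pr ⁻¹' {b}))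
    (hκ : ∀ (V : TopologicalSpace.Opens B) (e : Fin 3 → Vec 3 V), FrameON h e →
      (∀ y ∈ V, volB y ![(e 0).toFun y, (e 1).toFun y, (e 2).toFun y] = 1) →
      ∀ (U : TopologicalSpace.Opens M) (hUV : ∀ y ∈ U, pr y ∈ V) (S : SubmersionFrame g U),
        S.IsAdapted h hS.smooth hUV e ξ → ∀ i, S.T.d (S.κ i) = 0) :
    ∃ lee : ∀ b : B, TangentSpace (𝓡 3) b →L[ℝ] ℝ, SmoothOneForm lee ∧
      ∀ (x : M) (z : TangentSpace (𝓡 3) (pr x)),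
        lee (pr x) z = hS.horizontalLee D x (hS.hlift x z) := by
  have key (b : B) : ∃ V : TopologicalSpace.Opens B, b ∈ V ∧ ∃ e : Fin 3 → Vec 3 V, FrameON h e ∧
      ∃ F : Fin 3 → B → ℝ, (∀ i, ∀ y ∈ V, FunAt (n := 3) (F i) y) ∧ ∀ i x, pr x ∈ V →
        hS.horizontalLee D x (hS.hlift x ((e i).toFun (pr x))) = F i (pr x) := by
    obtain ⟨V, hb, e, he, hev⟩ := hv.exists_frame b
    have hd (i : Fin 3) (x : M) (hx : pr x ∈ V) :
        FunAt (n := 4) (fun x => hS.horizontalLee D x (hS.hlift x ((e i).toFun (pr x)))) x ∧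
        mvfderiv (𝓡 4) (fun x => hS.horizontalLee D x (hS.hlift x ((e i).toFun (pr x)))) x (ξ x) = 0 := by
      obtain ⟨U, hxU, hUV, S, hA⟩ := hS.exists_adapted x hx he
      have h1 : (fun x => hS.horizontalLee D x (hS.hlift x ((e i).toFun (pr x)))) =ᶠ[𝓝 x]
          (S.κ i).lift := (eventually_mem_opens ⟨x, hxU⟩).mono fun y hy => by
        rw [Fn.lift_apply _ ⟨y, hy⟩, hA.κ_apply hS he hW ⟨y, hy⟩, ← hA.hlift_eq hS ⟨y, hy⟩]
      refine ⟨(Fn.lift_smooth _ x hxU).congr_of_eventuallyEq h1, ?_⟩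
      have h2 : (S.T.d (S.κ i)).1 ⟨x, hxU⟩ = 0 := by
        rw [hκ V e he hev U hUV S hA i]; rfl
      rw [Vec.d_apply] at h2
      rw [mvfderiv_congr h1, hA.ξ_eq x hxU, S.ξ_toFun ⟨x, hxU⟩, map_smul]
      exact (congrArg _ h2).trans (smul_zero _)
    choose F hF1 hF2 using fun i => hS.exists_descend hconn (fun x hx => (hd i x hx).1)
      fun x hx => (hd i x hx).2
    exact ⟨V, hb, e, he, F, hF1, hF2⟩
  choose V hb e he F hF1 hF2 using key
  -- The frame varies with `b`; `hlee` shows that the choice does not matter.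
  let lee (b : B) : TangentSpace (𝓡 3) b →L[ℝ] ℝ := ∑ i, F b i b • h.inner b ((e b i).toFun b)
  have hlee (x : M) (z : TangentSpace (𝓡 3) (pr x)) :
      lee (pr x) z = hS.horizontalLee D x (hS.hlift x z) := by
    conv_rhs => rw [(he (pr x) (pr x) (hb _)).expand z, map_sum, map_sum]
    simp only [lee]
    rw [sum_apply]
    refine Finset.sum_congr rfl fun i _ => ?_
    rw [smul_apply, smul_eq_mul, map_smul, map_smul, smul_eq_mul, hF2 (pr x) i x (hb _), h.symm,
      mul_comm]
  refine ⟨lee, smoothOneForm_of_apply fun b X hX => ?_, hlee⟩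
  -- For smoothness near `b` the frame chosen at `b` is kept fixed, with its own descended
  -- coefficients.
  have h1 : ∀ᶠ y in 𝓝 b, lee y (X y) = ∑ i, h.inner y (X y) ((e b i).toFun y) * F b i y :=
    (eventually_mem_opens ⟨b, hb b⟩).mono fun y hy => by
      obtain ⟨x, rfl⟩ := (hconn y).nonempty
      rw [hlee, (he b (pr x) hy).expand (X (pr x)), map_sum, map_sum]
      refine Finset.sum_congr rfl fun i _ => ?_
      rw [map_smul, map_smul, smul_eq_mul, hF2 b i x hy, ← (he b (pr x) hy).expand (X (pr x))]
  refine ContMDiffAt.congr_of_eventuallyEq (contMDiffAt_finsetSum fun i _ => ?_) h1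
  exact (hX.inner h ((e b i).smooth b (hb b))).mul (hF1 b i b (hb b))

end Converse

/-! ### From a selfdual Einstein metric to the Einstein-Weyl structure. -/

section Converse
variable {M : Type*} [TopologicalSpace M] [ChartedSpace (EuclideanSpace ℝ (Fin 4)) M]
  [IsManifold (𝓡 4) ∞ M]
  {B : Type*} [TopologicalSpace B] [ChartedSpace (EuclideanSpace ℝ (Fin 3)) B]
  [IsManifold (𝓡 3) ∞ B]
  {g : Metric 4 M} {W : WeylStructure B} {pr : M → B} {ξ : ∀ x : M, TangentSpace (𝓡 4) x}
  {U : TopologicalSpace.Opens M} {V : TopologicalSpace.Opens B} {S : SubmersionFrame g U}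
  {hpr : ContMDiff (𝓡 4) (𝓡 3) ∞ pr}
  {hUV : ∀ y ∈ U, pr y ∈ V} {e : Fin 3 → Vec 3 V} {D : Connection 4 M}
  {volB : ∀ x : B, AlternatingMap ℝ (TangentSpace (𝓡 3) x) ℝ (Fin 3)}
open WeylStructure

namespace SubmersionFrame

/-- The horizontal part of the curvature equations, read as three equations for column `l` of the
curvature matrix of the base. -/
theorem IsAdapted.asdEinstein_E (hA : S.IsAdapted W.metric hpr hUV e ξ) (he : FrameON W.metric e)
    (hκ : ∀ i, S.κ i = Fn.comap hpr hUV (W.frameOm e i)) (hL : ∀ p, S.Ω p = S.Q * S.pp p)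
    (hW : IsLeviCivita g D) (hD : SmoothConn D) {c : ℝ} (x : U)
    (hE : AsdEinstein c (curvComp g D x (S.wAt x))) (l : Fin 3) :
    (W.frameR e l l).1 ⟨pr x, hUV x x.2⟩ + S.ν.1 x ^ 2 = -(c / 3) * S.Q.1 x ∧
    (W.frameR e (l + 1) l).1 ⟨pr x, hUV x x.2⟩ + (((S.E (l + 2)).d S.ν).1 x
      - S.ν.1 x * (W.frameOm e (l + 2)).1 ⟨pr x, hUV x x.2⟩) = 0 ∧
    (W.frameR e (l + 2) l).1 ⟨pr x, hUV x x.2⟩ + (S.ν.1 x * (W.frameOm e (l + 1)).1 ⟨pr x, hUV x x.2⟩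
      - ((S.E (l + 1)).d S.ν).1 x) = 0 := by
  have hC := hA.isWeylCoeffs he hκ
  have h := ((S.asdEinstein_iff hD x c).1 hE).1 l
  have key (p : Fin 3) := h p
  simp only [asdCurv, S.asdCurv_E hW hD hC hL l, hA.RR_eq] at key
  have n1 : l + 1 ≠ l := by fin_cases l <;> decide
  have n2 : l + 2 ≠ l := by fin_cases l <;> decide
  have n3 : l + 2 ≠ l + 1 := by fin_cases l <;> decide
  refine ⟨?_, ?_, ?_⟩
  · have := key l
    rw [if_pos rfl, if_pos rfl] at this
    exact this
  · have := key (l + 1)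
    rw [if_neg n1, if_pos rfl, if_neg n1] at this
    exact this
  · have := key (l + 2)
    rw [if_neg n2, if_neg n3, if_neg n2] at this
    exact this

/-- The equations of the construction, from those for the curvature. -/
theorem IsAdapted.isHLCoordinate_of_asdEinstein (hA : S.IsAdapted W.metric hpr hUV e ξ)
    (he : FrameON W.metric e)
    (hκ : ∀ i, S.κ i = Fn.comap hpr hUV (W.frameOm e i)) (hL : ∀ p, S.Ω p = S.Q * S.pp p)
    (hW : IsLeviCivita g D) (hD : SmoothConn D) {c : ℝ}
    (hE : ∀ x : U, AsdEinstein c (curvComp g D x (S.wAt x))) :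
    S.IsHLCoordinate hpr hUV W e (-(c / 3)) S.ν := by
  have hC := hA.isWeylCoeffs he hκ
  have key (x : U) := hA.asdEinstein_E he hκ hL hW hD x (hE x)
  refine ⟨Fn.ext fun x => ?_, fun l => Fn.ext fun x => ?_, Fn.ext fun x => ?_⟩
  · have h := ((S.asdEinstein_iff hD x c).1 (hE x)).2 0 0
    rw [asdCurv, S.asdCurv_T hW hD hC hL, if_pos rfl, if_pos rfl] at h
    exact h
  · have e1 : l + 2 + 2 = l + 1 := by fin_cases l <;> rfl
    have e2 : l + 2 + 1 = l := by fin_cases l <;> rfl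
    have e3 : l + 1 + 1 = l + 2 := by fin_cases l <;> rfl
    have e4 : l + 1 + 2 = l := by fin_cases l <;> rfl
    have h1 := (key x (l + 1)).2.1
    have h2 := (key x (l + 2)).2.2
    rw [e3, e4] at h1
    rw [e1, e2] at h2
    -- Two off-diagonal equations express dν - νω on the same vector; their difference is evaluated
    -- by the first Bianchi identity and yields F/2.
    have h3 : (W.frameF e l).1 ⟨pr x, hUV x x.2⟩ = (W.frameR e (l + 1) (l + 2)).1 ⟨pr x, hUV x x.2⟩
        - (W.frameR e (l + 2) (l + 1)).1 ⟨pr x, hUV x x.2⟩ :=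
      congrArg (fun f : Fn 3 V => f.1 ⟨pr x, hUV x x.2⟩) (frame_bianchi he l)
    change 2 * ((S.E l).d S.ν).1 x = 2 * (S.ν.1 x * (W.frameOm e l).1 ⟨pr x, hUV x x.2⟩)
      + (W.frameF e l).1 ⟨pr x, hUV x x.2⟩
    linear_combination h1 - h2 - h3
  · change -(c / 3) * S.Q.1 x = S.ν.1 x ^ 2 + (W.frameR e 0 0).1 ⟨pr x, hUV x x.2⟩
    linear_combination -(key x 0).1

/-- The diagonal entries all equal -(c/3)Q - ν², and transposed off-diagonal entries are opposite
because dν - νω enters them with opposite signs. -/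
theorem IsAdapted.einsteinWeyl_of_asdEinstein (hA : S.IsAdapted W.metric hpr hUV e ξ)
    (he : FrameON W.metric e)
    (hκ : ∀ i, S.κ i = Fn.comap hpr hUV (W.frameOm e i)) (hL : ∀ p, S.Ω p = S.Q * S.pp p)
    (hW : IsLeviCivita g D) (hD : SmoothConn D) {c : ℝ} (x : U)
    (hE : AsdEinstein c (curvComp g D x (S.wAt x))) (u v : TangentSpace (𝓡 3) (pr x)) :
    (ricci W.conn (pr x) u v + ricci W.conn (pr x) v u) / 2 =
      W.scal (pr x) / 3 * W.metric.inner (pr x) u v := by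
  have key := hA.asdEinstein_E he hκ hL hW hD x hE
  refine einsteinWeyl_of_frame he (x := ⟨pr x, hUV x x.2⟩) ⟨?_, ?_⟩ (fun l => ?_) u v
  · linear_combination (key 0).1 - (key 1).1
  · linear_combination (key 1).1 - (key 2).1
  · have e3 : l + 1 + 1 = l + 2 := by fin_cases l <;> rfl
    have e4 : l + 1 + 2 = l := by fin_cases l <;> rfl
    have h2 := (key (l + 1)).2.2
    rw [e3, e4] at h2
    linear_combination (key l).2.1 + h2

end SubmersionFrame

theorem mvfderiv_inv {n : ℕ} {M : Type*} [TopologicalSpace M] [ChartedSpace (EuclideanSpace ℝ (Fin n)) M]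
    [IsManifold (𝓡 n) ∞ M] {f : M → ℝ} {x : M} (hf : FunAt (n := n) f x) (h : f x ≠ 0) (u : TangentSpace (𝓡 n) x) :
    mvfderiv (𝓡 n) (fun y => (f y)⁻¹) x u = -(f x ^ 2)⁻¹ * mvfderiv (𝓡 n) f x u := by
  have h1 : f * (fun y => (f y)⁻¹) =ᶠ[𝓝 x] fun _ => 1 := by
    filter_upwards [hf.continuousAt.eventually_ne h] with y hy
    exact mul_inv_cancel₀ hy
  have h2 := mvfderiv_mul hf.mdiff (FunAt.mdiff (hf.inv h))
  rw [mvfderiv_congr h1, mvfderiv_const] at h2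
  have h3 := congrArg (fun L : TangentSpace (𝓡 n) x →L[ℝ] ℝ => L u) h2
  simp only [zero_apply, add_apply, smul_apply, smul_eq_mul] at h3
  field_simp at h3 ⊢
  linear_combination -h3

namespace SubmersionFrame

/-- The metric, from the equations of the construction. -/
theorem IsHLCoordinate.inner_eq (hA : S.IsAdapted W.metric hpr hUV e ξ) (he : FrameON W.metric e)
    (hev : ∀ y ∈ V, volB y ![(e 0).toFun y, (e 1).toFun y, (e 2).toFun y] = 1)
    (hEW : W.IsEinsteinWeyl) {c : ℝ} (hc : c ≠ 0) {N : M → ℝ} {ν : Fn 4 U}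
    (hν : S.IsHLCoordinate hpr hUV W e (-(c / 3)) ν)
    (hN : ContMDiff (𝓡 4) 𝓘(ℝ, ℝ) ∞ N) (hNν : ∀ x : U, ν.1 x = N x) (x : U) (hx : N x ≠ 0)
    (u v : TangentSpace (𝓡 4) (x : M)) :
    g.inner x u v = -(3 / c) * hlForm W volB pr (fun y => (N y)⁻¹) x u v := by
  set A := mfderiv (𝓡 4) (𝓡 3) pr (x : M) with hAdef
  -- α = dν - νω + ½*F vanishes on the lifts E_l by `IsHLCoordinate`, so it is proportional to the
  -- dual form of ξ, with α(T) = -c/3; and -α/ν is the form `hlOneForm` for t = 1/ν.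
  let α : TangentSpace (𝓡 4) (x : M) →L[ℝ] ℝ := mvfderiv (𝓡 4) N x - N x • (W.lee (pr x)).comp A
    + (1 / 2 : ℝ) • (W.starFaraday volB (pr x)).comp A
  have hα (u : TangentSpace (𝓡 4) (x : M)) : α u = mvfderiv (𝓡 4) N x u - N x * W.lee (pr x) (A u)
      + 1 / 2 * W.starFaraday volB (pr x) (A u) := rfl
  have hνN : ν = Fn.of N fun x _ => hN x := Fn.ext hNν
  have hd (X : Vec 4 U) : (X.d ν).1 x = mvfderiv (𝓡 4) N x (X.toFun x) := by
    rw [hνN, Vec.d_of]; rfl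
  have hαT : α (S.T.toFun x) = -(c / 3) := by
    rw [hα, hAdef, hA.proj_T x x.2, map_zero, map_zero, mul_zero, mul_zero, sub_zero, add_zero, ← hd,
      hν.d_T]
    rfl
  have hαE (l : Fin 3) : α ((S.E l).toFun x) = 0 := by
    have h1 : 2 * ((S.E l).d ν).1 x = 2 * (ν.1 x * W.lee (pr x) ((e l).toFun (pr x)))
        + (W.frameF e l).1 ⟨pr x, hUV x x.2⟩ := congrArg (fun f : Fn 4 U => f.1 x) (hν.d_E l)
    have h2 := W.starFaraday_frame he hev ⟨pr x, hUV x x.2⟩ l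
    dsimp only at h2
    rw [hd, hNν] at h1
    rw [hα, hAdef, hA.proj_E l x x.2, h2]
    linear_combination (1 / 2 : ℝ) * h1
  have hQ : -(c / 3) * S.Q.1 x = N x ^ 2 - W.scal (pr x) / 6 := by
    have h1 := (frame_einsteinWeyl he hEW ⟨pr x, hUV x x.2⟩ 0).1
    have h2 : -(c / 3) * S.Q.1 x = ν.1 x ^ 2 + (W.frameR e 0 0).1 ⟨pr x, hUV x x.2⟩ :=
      congrArg (fun f : Fn 4 U => f.1 x) hν.Q_eq
    rw [h2, h1, hNν]
    ring
  have hll : S.lam.1 x * S.lamInv.1 x = 1 := congrArg (fun f : Fn 4 U => f.1 x) S.lam_mul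
  have hl0 := (hA.lam_pos x).ne'
  have hli : S.lamInv.1 x = (S.lam.1 x)⁻¹ := eq_inv_of_mul_eq_one_right hll
  have hQl : S.Q.1 x = S.lam.1 x ^ 2 := rfl
  -- The factor 1 - scal/(6ν²) equals -(c/3)Qν⁻², so the powers of ν cancel. What remains is visibly
  -- the metric on the adapted orthonormal frame.
  have hform : -(3 / c) * hlForm W volB pr (fun y => (N y)⁻¹) x u v =
      S.lam.1 x ^ 2 * W.metric.inner (pr x) (A u) (A v)
        + (3 / c) ^ 2 * (S.lam.1 x ^ 2)⁻¹ * (α u * α v) := by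
    have h1 (u : TangentSpace (𝓡 4) (x : M)) :
        hlOneForm W volB pr (fun y => (N y)⁻¹) x u = -(N x)⁻¹ * α u := by
      rw [hlOneForm, mvfderiv_inv (hN x) hx, hα, starFaraday_apply]
      field_simp
      ring
    have h2 : hlFactor W pr (fun y => (N y)⁻¹) x = -(c / 3) * S.lam.1 x ^ 2 * (N x ^ 2)⁻¹ := by
      rw [← hQl, hQ, hlFactor]
      field_simp
    rw [hlForm, h1, h1, h2]
    field_simp
    ring
  rw [hform]
  have hw := S.w_frameON x x.2
  refine bilinear_ext hw.basis (β := fun u v => g.inner x u v)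
    (β' := fun u v => S.lam.1 x ^ 2 * W.metric.inner (pr x) (A u) (A v)
        + (3 / c) ^ 2 * (S.lam.1 x ^ 2)⁻¹ * (α u * α v))
    ⟨fun _ _ _ => by rw [inner_add_left], fun _ _ _ => by rw [inner_smul_left, smul_eq_mul],
      fun _ _ _ => by rw [map_add], fun _ _ _ => by rw [map_smul, smul_eq_mul]⟩
    ⟨fun _ _ _ => by simp only [map_add, add_apply]; ring,
      fun _ _ _ => by simp only [map_smul, smul_apply, smul_eq_mul]; ring,
      fun _ _ _ => by simp only [map_add]; ring,
      fun _ _ _ => by simp only [map_smul, smul_eq_mul]; ring⟩ (fun i j => ?_) u v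
  have hAw (i : Fin 3) : A ((S.w i.castSucc).toFun x) = S.lamInv.1 x • (e i).toFun (pr x) :=
    hA.proj_w x i
  have hαw (i : Fin 3) : α ((S.w i.castSucc).toFun x) = 0 := by
    rw [w_castSucc, Vec.smul_at, map_smul, hαE, smul_zero]
  have h3 : (S.w 3).toFun x = (-S.lam.1 x) • S.T.toFun x := S.ξ_toFun x
  have hA3 : A ((S.w (Fin.last 3)).toFun x) = 0 := by
    refine (congrArg A h3).trans ?_
    rw [map_smul, hAdef, hA.proj_T x x.2, smul_zero]
  have hα3 : α ((S.w (Fin.last 3)).toFun x) = S.lam.1 x * (c / 3) := by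
    refine (congrArg α h3).trans ?_
    rw [map_smul, hαT, smul_eq_mul]
    ring
  rw [hw.basis_apply, hw.basis_apply]
  rw [hw i j]
  refine Fin.lastCases ?_ (fun i => ?_) i <;> refine Fin.lastCases ?_ (fun j => ?_) j
  · rw [hA3, hα3, map_zero, if_pos rfl]
    simp only [mul_zero, zero_add]
    field_simp
  · rw [hA3, hαw, map_zero, if_neg (Fin.castSucc_lt_last j).ne']
    simp
  · rw [hA3, hαw, map_zero, if_neg (Fin.castSucc_lt_last i).ne]
    simp
  · rw [hAw, hAw, hαw, inner_smul_left, map_smul, he (pr x) (hUV x x.2) i j, hli, smul_eq_mul]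
    simp only [Fin.castSucc_inj]
    split_ifs
    · field_simp
      simp
    · simp

end SubmersionFrame

variable {h : Metric 3 B} {volM : ∀ x : M, AlternatingMap ℝ (TangentSpace (𝓡 4) x) ℝ (Fin 4)}

/-- Every selfdual Einstein metric with a Legendrian selfdual conformal submersion comes from an
Einstein-Weyl structure. -/
theorem exists_einsteinWeyl (hv : IsVolumeForm h volB) (hW : IsLeviCivita g D) {c : ℝ} (hc : c ≠ 0)
    (hric : ∀ (x : M) (u v : TangentSpace (𝓡 4) x), ricci D x u v = c * g.inner x u v)
    (hS : IsConformalSubmersion g h pr ξ) (hconn : ∀ b : B, IsConnected (pr ⁻¹' {b}))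
    (hM : IsInducedVolume g pr ξ volB volM) (hsd : IsSelfdualMetric g D volM)
    (hsc : IsSelfdualCongruence g D volM ξ) (hL : IsLegendrian g D volM ξ) :
    ∃ W : WeylStructure B, W.metric = h ∧ W.IsEinsteinWeyl ∧
      ∃ ν : M → ℝ, ContMDiff (𝓡 4) 𝓘(ℝ, ℝ) ∞ ν ∧
        (∀ x, 0 < c * mvfderiv (𝓡 4) ν x (ξ x)) ∧
        Dense {x | ν x ≠ 0} ∧
        ∀ x, ν x ≠ 0 → ∀ u v : TangentSpace (𝓡 4) x,
          g.inner x u v = -(3 / c) * hlForm W volB pr (fun y => (ν y)⁻¹) x u v := by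
  have hD := hW.smooth g
  -- The Legendrian and selfduality hypotheses give T(κ) = 0, as the descent of the Lee form
  -- requires.
  obtain ⟨lee, hlee, hleeK⟩ := hS.exists_lee hv hW hconn fun V e he hev U hUV S hA => by
    have hvol := hA.volume hev hM
    exact (S.isSelfdual_iff_of_legendrian hW hD hA.ξ_eq hvol
      ((S.isLegendrian_iff hW hD hA.ξ_eq hvol).1 fun x _ => hL x)).1 fun x _ => hsc x
  obtain ⟨conn, hconn'⟩ := exists_isWeylConnection h lee
  let W : WeylStructure B := ⟨h, lee, hlee, conn, hconn'⟩
  have key (x : M) : ∃ (V : TopologicalSpace.Opens B) (e : Fin 3 → Vec 3 V)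
      (U : TopologicalSpace.Opens M) (hUV : ∀ y ∈ U, pr y ∈ V) (S : SubmersionFrame g U),
      x ∈ U ∧ FrameON W.metric e ∧
      (∀ y ∈ V, volB y ![(e 0).toFun y, (e 1).toFun y, (e 2).toFun y] = 1) ∧
      S.IsAdapted W.metric hS.smooth hUV e ξ ∧
      (∀ i, S.κ i = Fn.comap hS.smooth hUV (W.frameOm e i)) ∧ (∀ p, S.Ω p = S.Q * S.pp p) ∧
      ∀ x : U, AsdEinstein c (curvComp g D x (S.wAt x)) := by
    obtain ⟨V, hxV, e, he, hev⟩ := hv.exists_frame (pr x)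
    obtain ⟨U, hx, hUV, S, hA⟩ := hS.exists_adapted x hxV he
    have hvol := hA.volume hev hM
    refine ⟨V, e, U, hUV, S, hx, he, hev, hA, fun i => Fn.ext fun y => ?_,
      (S.isLegendrian_iff hW hD hA.ξ_eq hvol).1 fun x _ => hL x, fun y =>
      asdEinstein_of_isSelfdual hW (S.w_frameON y y.2) (hvol y) (hric y) fun v w => hsd y v w⟩
    rw [hA.κ_apply hS he hW, ← hA.hlift_eq hS]
    exact (hleeK y _).symm
  have hEW : W.IsEinsteinWeyl := fun b u v => by
    obtain ⟨x, rfl⟩ := (hconn b).nonempty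
    obtain ⟨V, e, U, hUV, S, hx, he, hev, hA, hκ, hL, hE⟩ := key x
    exact hA.einsteinWeyl_of_asdEinstein he hκ hL hW hD ⟨x, hx⟩ (hE _) u v
  -- ξ(ν) = -λT(ν) = λc/3.
  have hpos (x : M) : 0 < c * mvfderiv (𝓡 4) hS.coord x (ξ x) := by
    obtain ⟨V, e, U, hUV, S, hx, he, hev, hA, hκ, hL, hE⟩ := key x
    have hν := hA.isHLCoordinate_of_asdEinstein he hκ hL hW hD hE
    have h1 : S.ν = Fn.of hS.coord fun x _ => hS.coord_smooth x := Fn.ext (hA.ν_apply hS he)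
    have h2 : (S.T.d S.ν).1 ⟨x, hx⟩ = -(c / 3) := by rw [hν.d_T]; rfl
    rw [h1, Vec.d_of] at h2
    have h3 : mvfderiv (𝓡 4) hS.coord x (S.T.toFun x) = -(c / 3) := h2
    have h4 := hA.lam_pos ⟨x, hx⟩
    rw [hA.ξ_eq x hx, S.ξ_toFun ⟨x, hx⟩, map_smul, h3, smul_eq_mul]
    have h5 : 0 < c ^ 2 := by positivity
    nlinarith [mul_pos h4 h5]
  refine ⟨W, rfl, hEW, hS.coord, hS.coord_smooth, hpos, ?_, fun x hx u v => ?_⟩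
  -- If ν vanished on an open set, its derivative along ξ would vanish there too.
  · rw [← Set.compl_ofPred, ← interior_eq_empty_iff_dense_compl, Set.eq_empty_iff_forall_notMem]
    intro x hx
    have h1 : hS.coord =ᶠ[𝓝 x] fun _ => 0 := mem_interior_iff_mem_nhds.1 hx
    have h2 := hpos x
    rw [mvfderiv_congr h1, mvfderiv_const] at h2
    simp at h2
  · obtain ⟨V, e, U, hUV, S, hxU, he, hev, hA, hκ, hL, hE⟩ := key x
    have hν := hA.isHLCoordinate_of_asdEinstein he hκ hL hW hD hE
    exact hν.inner_eq hA he hev hEW hc hS.coord_smooth (hA.ν_apply hS he) ⟨x, hxU⟩ hx u v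

end Converse

end HitchinLeBrun

end

/-- The Einstein constant c is s/4, so -(3/c) is the factor -12/s. Sections of L_B and of its powers
are represented by functions in the gauge given by the metric of the Weyl structure. Nonemptiness of
the fibres, part of `IsConnected`, makes `pr` surjective. -/
theorem theoremX
    {B : Type*} [TopologicalSpace B] [ChartedSpace (EuclideanSpace ℝ (Fin 3)) B]
    [IsManifold (𝓡 3) ∞ B] [T2Space B] [SecondCountableTopology B]
    {M : Type*} [TopologicalSpace M] [ChartedSpace (EuclideanSpace ℝ (Fin 4)) M]
    [IsManifold (𝓡 4) ∞ M] [T2Space M] [SecondCountableTopology M] :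
    -- the metric attached to an Einstein-Weyl structure
    (∀ (W : WeylStructure B)
        (volB : ∀ x : B, AlternatingMap ℝ (TangentSpace (𝓡 3) x) ℝ (Fin 3)),
      W.IsEinsteinWeyl → IsVolumeForm W.metric volB →
      ∀ (pr : M → B) (t : M → ℝ) (ε : ℝ), IsFibreCoordinate pr t → (ε = 1 ∨ ε = -1) →
        (∀ x, t x ≠ 0) → (∀ x, 0 < ε * hlFactor W pr t x) →
        ∃ (g : Metric 4 M) (D : Connection 4 M) (ξ : ∀ x : M, TangentSpace (𝓡 4) x)
          (volM : ∀ x : M, AlternatingMap ℝ (TangentSpace (𝓡 4) x) ℝ (Fin 4)),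
          (∀ (x : M) (u v : TangentSpace (𝓡 4) x),
            g.inner x u v = ε * hlForm W volB pr t x u v) ∧
          IsLeviCivita g D ∧
          (∀ (x : M) (u v : TangentSpace (𝓡 4) x), ricci D x u v = -3 * ε * g.inner x u v) ∧
          IsConformalSubmersion g W.metric pr ξ ∧
          (∀ x, 0 < ε * mvfderiv (𝓡 4) t x (ξ x)) ∧
          IsInducedVolume g pr ξ volB volM ∧
          IsSelfdualMetric g D volM ∧
          IsSelfdualCongruence g D volM ξ ∧
          IsLegendrian g D volM ξ) ∧
    -- the conformal infinity
    (∀ (W : WeylStructure B)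
        (volB : ∀ x : B, AlternatingMap ℝ (TangentSpace (𝓡 3) x) ℝ (Fin 3)),
      W.IsEinsteinWeyl → IsVolumeForm W.metric volB →
      ∀ (pr : M → B) (t : M → ℝ), IsFibreCoordinate pr t → (∀ x, 0 < hlFactor W pr t x) →
        ∃ gbar : Metric 4 M,
          (∀ x, t x ≠ 0 → ∀ u v : TangentSpace (𝓡 4) x,
            gbar.inner x u v = t x ^ 2 * hlForm W volB pr t x u v) ∧
          (∀ x, t x = 0 → ∀ u v : TangentSpace (𝓡 4) x,
            mvfderiv (𝓡 4) t x u = 0 → mvfderiv (𝓡 4) t x v = 0 →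
            gbar.inner x u v = W.metric.inner (pr x)
              (mfderiv (𝓡 4) (𝓡 3) pr x u) (mfderiv (𝓡 4) (𝓡 3) pr x v))) ∧
    -- every such metric arises in this way
    (∀ (h : Metric 3 B) (volB : ∀ x : B, AlternatingMap ℝ (TangentSpace (𝓡 3) x) ℝ (Fin 3))
        (g : Metric 4 M) (D : Connection 4 M) (pr : M → B)
        (ξ : ∀ x : M, TangentSpace (𝓡 4) x)
        (volM : ∀ x : M, AlternatingMap ℝ (TangentSpace (𝓡 4) x) ℝ (Fin 4)) (c : ℝ),
      IsVolumeForm h volB → IsLeviCivita g D → c ≠ 0 →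
      (∀ (x : M) (u v : TangentSpace (𝓡 4) x), ricci D x u v = c * g.inner x u v) →
      IsConformalSubmersion g h pr ξ →
      (∀ b : B, IsConnected (pr ⁻¹' {b})) →
      IsInducedVolume g pr ξ volB volM →
      IsSelfdualMetric g D volM →
      IsSelfdualCongruence g D volM ξ →
      IsLegendrian g D volM ξ →
      ∃ W : WeylStructure B, W.metric = h ∧ W.IsEinsteinWeyl ∧
        ∃ ν : M → ℝ, ContMDiff (𝓡 4) 𝓘(ℝ, ℝ) ∞ ν ∧
          (∀ x, 0 < c * mvfderiv (𝓡 4) ν x (ξ x)) ∧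
          Dense {x | ν x ≠ 0} ∧
          ∀ x, ν x ≠ 0 → ∀ u v : TangentSpace (𝓡 4) x,
            g.inner x u v = -(3 / c) * hlForm W volB pr (fun y => (ν y)⁻¹) x u v) := by
  exact ⟨fun W volB hEW hv pr t ε hF hε ht hpos => exists_selfdualEinstein hEW hv hF ht hε hpos,
    fun W volB _ hv pr t hF hpos => exists_conformalInfinity hv hF hpos,
    fun h volB g D pr ξ volM c hv hW hc hric hS hconn hM hsd hsc hL =>
      exists_einsteinWeyl hv hW hc hric hS hconn hM hsd hsc hL⟩
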